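/- **Setting.** Let $d\ge 1$, $\beta>0$, $\lambda\in\mathbb R$, $\chi\in\mathbb R^d$. Let $\varepsilon:\mathbb T^d=(\mathbb R/2\pi\mathbb Z)^d\to\mathbb R$ extend to an analytic function on a neighbourhood of a strip $\{|\mathrm{Im}\,z|\le\delta\}$, $\delta>0$, and let $\hat\varepsilon(x)=(2\pi)^{-d}\int_{\mathbb T^d}\varepsilon(k)e^{ik\cdot x}\,dk$. Let $\phi\in L^2(\mathbb R^d)$ be a spherically symmetric function. For $L\in 2\mathbb N$, $L\geq 2$, put $\Lambda=\Lambda_L=\mathbb Z^d\cap[-L/2,L/2]^d$, $\bar\Lambda^*=\frac{2\pi}{L}\mathbb Z^d$, $\omega(q)=|q|+\delta_{q,0}$ and $\phi^\Lambda(q)=(2\pi/L)^{d/2}\phi(q)$ for $q\in\bar\Lambda^*$; assume $\phi^\Lambda\in\ell^2(\bar\Lambda^*)$. On the strip $\mathbb H_\beta=\{0\le\mathrm{Im}\,z\le\beta\}$ let $$\hat\psi^\Lambda(z)=\sum_{q\in\bar\Lambda^*}|\phi^\Lambda(q)|^2\Big(\frac{e^{-iz\omega(q)}}{e^{\beta\omega(q)}-1}+\frac{e^{iz\omega(q)}}{1-e^{-\beta\omega(q)}}\Big),\qquad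 \hat\psi(z)=\int_{\mathbb R^d}|\phi(q)|^2\Big(\frac{e^{-iz|q|}}{e^{\beta|q|}-1}+\frac{e^{iz|q|}}{1-e^{-\beta|q|}}\Big)dq .$$ Assume that the integrand of $\hat\psi(z)$ is integrable for every $z\in\mathbb H_\beta$, that $\hat\psi^\Lambda(z)$ and $\hat\psi(z)$ are bounded uniformly in $\Lambda$ and $z\in\mathbb H_\beta$, that $\hat\psi^\Lambda\to\hat\psi$ uniformly on compact subsets of $\mathbb H_\beta$ as $L\to\infty$, that $\sum_{q\in\bar\Lambda^*}\omega(q)^{-1}|\phi^\Lambda(q)|^2$ is finite and bounded uniformly in $\Lambda$, and that $\hat\psi$ is continuous on $\mathbb H_\beta$. In finite volume let $\mathscr H_S^\Lambda=\ell^2(\Lambda)$, and let $\mathscr H_R$ be the bosonic Fock space over $\ell^2(\Lambda\times\bar\Lambda^*)$ (one reservoir at every site $x\in\Lambda$), with annihilation and creation operators $a_{x,q},a^*_{x,q}$. On $\mathscr H_S^\Lambda\otimes\mathscr H_R$ let $$H=T\otimes 1-\lambda^2\chi\cdot X\otimes 1+1\otimes H_R+\lambda\sum_{x\in\Lambda}|x\rangle\langle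 x|\otimes\big(a_x(\phi^\Lambda)+a_x^*(\phi^\Lambda)\big),$$ where $T(x,x')=\hat\varepsilon(x-x')$, $X$ is the position operator, $H_R=\sum_{x,q}\omega(q)a^*_{x,q}a_{x,q}$, $a_x(\phi^\Lambda)=\sum_q\phi^\Lambda(q)a_{x,q}$, and $a_x^*(\phi^\Lambda)$ is its adjoint. Let $\rho_R=e^{-\beta H_R}/\mathrm{Tr}\,e^{-\beta H_R}$, and for an operator $\rho$ on $\ell^2(\Lambda)$ let $$\mathcal Z^\Lambda_{[0,t]}\rho=\mathrm{Tr}_R\big[e^{-itH}(\rho\otimes\rho_R)e^{itH}\big].$$ In infinite volume let $\mathscr H_S=\ell^2(\mathbb Z^d)$, with trace class $\mathscr B_1(\mathscr H_S)$ and trace norm $\|\cdot\|_1$. Operators on $\ell^2(\Lambda)$ are regarded as operators on $\ell^2(\mathbb Z^d)$ by the natural embedding, $1_\Lambda$ is the projection onto $\ell^2(\Lambda)$, and for a density matrix $\rho$ on $\mathscr H_S$ we put $\rho^\Lambda=1_\Lambda\rho 1_\Lambda/\mathrm{Tr}[1_\Lambda\rho 1_\Lambda]$, which is defined for all large $L$.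 Write $(\mathcal T_yO)(x,x')=O(x+y,x'+y)$. An operator $O$ is exponentially localized if $|O(x,x')|\le Ce^{-\nu(|x|+|x'|)}$, and quasi-diagonal if $|O(x,x')|\le Ce^{-\nu|x-x'|}$, for some $C$ and some $\nu>0$; $\mathfrak A$ is the norm closure of the set of quasi-diagonal bounded operators. **Lemma.** For every $L\in 2\mathbb N$, $L\ge2$, the operator $H$ is essentially self-adjoint on the linear span of the occupation number vectors $|x\rangle\otimes|n\rangle$, so that its closure generates a unique unitary group $e^{-itH}$. For every $t\ge0$ there is a linear map $\mathcal Z_{[0,t]}:\mathscr B_1(\mathscr H_S)\to\mathscr B_1(\mathscr H_S)$ such that, as $L\to\infty$, $$\|\mathcal Z^\Lambda_{[0,t]}\rho^\Lambda-\mathcal Z_{[0,t]}\rho\|_1\to0\ \text{ for every density matrix }\rho,\qquad \|\mathcal Z^\Lambda_{[0,t]}(1_\Lambda\rho1_\Lambda)-\mathcal Z_{[0,t]}\rho\|_1\to0\ \text{ for every }\rho\in\mathscr B_1(\mathscr H_S).$$ For $\rho\in\mathscr B_1(\mathscr H_S)$ one has $\mathrm{Tr}\,\mathcal Z_{[0,t]}\rho=\mathrm{Tr}\,\rho$;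 if $\rho\ge0$, then $\mathcal Z_{[0,t]}\rho\ge0$; if $\rho$ is exponentially localized, then so is $\mathcal Z_{[0,t]}\rho$; and $\mathcal T_{-y}\mathcal Z_{[0,t]}\mathcal T_y=\mathcal Z_{[0,t]}$ on $\mathscr B_1(\mathscr H_S)$ for every $y\in\mathbb Z^d$. Consequently, for every exponentially localized $\rho\in\mathscr B_1(\mathscr H_S)$ and every $O$ that either lies in $\mathfrak A$ or is a polynomial in the components of the position operator, the operator $O\,\mathcal Z_{[0,t]}\rho$ is everywhere defined and trace class, so that $\mathrm{Tr}[O\,\mathcal Z_{[0,t]}\rho]$ is well-defined. -/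

import Mathlib

open scoped ENNReal Topology
open Filter MeasureTheory

noncomputable section

/-! ### Operators on `ℓ²(ι)`: kernels, trace, trace norm -/

/-- The Hilbert space `ℓ²(ι)`. -/
abbrev Hl2 (ι : Type*) := lp (fun _ : ι => ℂ) 2

/-- Bounded operators on `ℓ²(ι)`. -/
abbrev Op (ι : Type*) := Hl2 ι →L[ℂ] Hl2 ι

open Classical in
/-- The canonical basis vector `|i⟩ = δ_i`. -/
def ket {ι : Type*} (i : ι) : Hl2 ι := lp.single 2 i (1 : ℂ)

/-- The rank-one operator `|i⟩⟨j|`. -/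
def ketbra {ι : Type*} (i j : ι) : Op ι := InnerProductSpace.rankOne ℂ (ket i) (ket j)

/-- The kernel `A(i,j) = ⟨δ_i, A δ_j⟩`, so that `(A f)(i) = ∑ j, A(i,j) f(j)`. -/
def kern {ι : Type*} (A : Op ι) (i j : ι) : ℂ := A (ket j) i

/-- `|A| = (A* A)^{1/2}` for a bounded operator on a complex Hilbert space. -/
def opAbs {E : Type*} [NormedAddCommGroup E] [InnerProductSpace ℂ E] [CompleteSpace E]
    (A : E →L[ℂ] E) : E →L[ℂ] E := CFC.abs A

/-- The trace norm `‖A‖₁ = Tr |A| ∈ [0,∞]`. -/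
def traceNorm {ι : Type*} (A : Op ι) : ℝ≥0∞ :=
  ∑' i, ENNReal.ofReal (kern (opAbs A) i i).re

/-- `A` belongs to the trace class `𝓑₁(ℓ²(ι))`. -/
def IsTraceClass {ι : Type*} (A : Op ι) : Prop := traceNorm A < ∞

/-- The trace (an absolutely convergent sum for trace class operators). -/
def opTrace {ι : Type*} (A : Op ι) : ℂ := ∑' i, kern A i i

/-- Density matrices: positive trace class operators of trace one. -/
structure IsDensityMatrix {ι : Type*} (ρ : Op ι) : Prop where
  pos : ρ.IsPositive
  traceClass : IsTraceClass ρ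
  trace_one : opTrace ρ = 1

/-! ### Unitary groups generated by a Hamiltonian given by its matrix elements -/

/-- `U` is a strongly continuous one-parameter group of unitary operators on `ℓ²(ι)` whose
(self-adjoint) generator `H`, `U t = e^{-itH}`, has the basis vectors `|i⟩` in its domain and acts
on them by `H|i⟩ = ∑ j, h(j,i) |j⟩`. There is exactly one such `U` if and only if the symmetric
operator with matrix elements `h` is essentially self-adjoint on the linear span of the basis
vectors; then `U t = e^{-itH}`, with `H` the closure of that operator. -/
structure IsEvolution {ι : Type*} (h : ι → ι → ℂ) (U : ℝ → Op ι) : Prop where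
  zero : U 0 = 1
  add : ∀ s t, U (s + t) = U s * U t
  isUnitary : ∀ t, U t ∈ unitary (Op ι)
  strongly_continuous : ∀ v, Continuous fun t => U t v
  generator : ∀ i, ∃ w : Hl2 ι, (∀ j, w j = h j i) ∧
    HasDerivAt (fun t => U t (ket i)) (-(Complex.I • w)) 0

open Classical in
/-- The unitary group `t ↦ e^{-itH}` of the Hamiltonian with matrix elements `h`. -/
def evolution {ι : Type*} (h : ι → ι → ℂ) : ℝ → Op ι :=
  if H : ∃ U, IsEvolution h U then H.choose else fun _ => 1

/-! ### The lattice -/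

/-- The lattice `ℤ^d`. -/
abbrev ZLat (d : ℕ) := Fin d → ℤ

/-- Euclidean length of a lattice vector. -/
def latNorm {d : ℕ} (x : ZLat d) : ℝ := Real.sqrt (∑ i, (x i : ℝ) ^ 2)

/-- The cube `Λ_L = ℤ^d ∩ [-L/2, L/2]^d` with `L = 2N`. -/
def box (d N : ℕ) : Finset (ZLat d) :=
  Fintype.piFinset fun _ => Finset.Icc (-(N : ℤ)) (N : ℤ)

/-- The sites of the cube `Λ_{2N}`, as a type. -/
abbrev Site (d N : ℕ) := {x : ZLat d // x ∈ box d N}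

/-- The shift `(S_y f)(x) = f(x - y)` on `ℓ²(ℤ^d)`; thus `S_y δ_x = δ_{x+y}`. -/
def shift {d : ℕ} (y : ZLat d) : Op (ZLat d) :=
  LinearMap.mkContinuous
    { toFun := fun f => ⟨fun x => f (x - y), by
        have h := (lp.memℓp f).summable (by norm_num)
        refine memℓp_gen ?_
        exact (Equiv.subRight y).summable_iff.mpr h⟩
      map_add' := fun _ _ => rfl
      map_smul' := fun _ _ => rfl } 1 (by
    intro f
    rw [one_mul, lp.norm_eq_tsum_rpow (by norm_num), lp.norm_eq_tsum_rpow (by norm_num)]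
    exact le_of_eq (congrArg (fun r : ℝ => r ^ (1 / (2 : ℝ≥0∞).toReal))
      ((Equiv.subRight y).tsum_eq fun x => ‖f x‖ ^ (2 : ℝ≥0∞).toReal)))

/-- The translation `𝓣_y` of operators on `ℓ²(ℤ^d)`: `(𝓣_y O)(x,x') = O(x+y, x'+y)`. -/
def transl {d : ℕ} (y : ZLat d) (O : Op (ZLat d)) : Op (ZLat d) :=
  shift (-y) * O * shift y

theorem shift_apply {d : ℕ} (y : ZLat d) (f : Hl2 (ZLat d)) (x : ZLat d) :
    shift y f x = f (x - y) := rfl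

theorem shift_ket {d : ℕ} (y x : ZLat d) : shift y (ket x) = ket (x + y) := by
  ext z
  rw [shift_apply]
  simp only [ket, lp.single_apply, Pi.single_apply, sub_eq_iff_eq_add]
  congr

theorem kern_transl {d : ℕ} (y : ZLat d) (O : Op (ZLat d)) (x x' : ZLat d) :
    kern (transl y O) x x' = kern O (x + y) (x' + y) := by
  change (O (shift y (ket x'))) (x - -y) = _
  rw [shift_ket, sub_neg_eq_add]
  rfl

/-- Exponential localization: `|O(x,x')| ≤ C e^{-ν(|x|+|x'|)}` for some `ν > 0`. -/
def ExpLocalized {d : ℕ} (O : Op (ZLat d)) : Prop :=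
  ∃ C : ℝ, ∃ ν > 0, ∀ x x', ‖kern O x x'‖ ≤ C * Real.exp (-ν * (latNorm x + latNorm x'))

/-- Quasi-diagonal operators: `|O(x,x')| ≤ C e^{-ν|x-x'|}` for some `ν > 0`. -/
def QuasiDiagonal {d : ℕ} (O : Op (ZLat d)) : Prop :=
  ∃ C : ℝ, ∃ ν > 0, ∀ x x', ‖kern O x x'‖ ≤ C * Real.exp (-ν * latNorm (x - x'))

/-- The norm closure `𝔄` of the class of quasi-diagonal operators. -/
def quasiDiagonalClosure (d : ℕ) : Set (Op (ZLat d)) := closure {O | QuasiDiagonal O}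

/-! ### The particle -/

/-- The strip `{z : |Im z| ≤ δ}` in `ℂ^d`. -/
def strip (d : ℕ) (δ : ℝ) : Set (Fin d → ℂ) := {z | ∑ i, (z i).im ^ 2 ≤ δ ^ 2}

/-- The dispersion law `ε`, a function on the torus `(ℝ/2πℤ)^d` written as a function on `ℝ^d`,
extends to a (periodic) analytic function on a neighbourhood of a strip of positive width. -/
def AnalyticDispersion {d : ℕ} (ε : (Fin d → ℝ) → ℝ) : Prop :=
  ∃ δ > 0, ∃ f : (Fin d → ℂ) → ℂ, AnalyticOnNhd ℂ f (strip d δ) ∧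
    (∀ z ∈ strip d δ, ∀ i, f (z + Pi.single i (2 * Real.pi : ℂ)) = f z) ∧
    ∀ k : Fin d → ℝ, f (fun i => (k i : ℂ)) = ε k

/-- The Fourier coefficients `ε̂(x) = (2π)^{-d} ∫_{[-π,π]^d} ε(k) e^{ik·x} dk`; the hopping
operator `T` has the kernel `ε̂(x - x')`. -/
def hopping {d : ℕ} (ε : (Fin d → ℝ) → ℝ) (x : ZLat d) : ℂ :=
  ((2 * Real.pi : ℂ) ^ d)⁻¹ *
    ∫ k in Set.Icc (fun _ : Fin d => -Real.pi) (fun _ => Real.pi),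
      (ε k : ℂ) * Complex.exp (Complex.I * ((∑ i, k i * (x i : ℝ) : ℝ) : ℂ))

/-! ### The reservoirs -/

/-- The quasi-momentum `q = (2π/L) k`, `k ∈ ℤ^d`, with `L = 2N`. -/
def quasiMomentum {d : ℕ} (N : ℕ) (k : ZLat d) : EuclideanSpace ℝ (Fin d) :=
  WithLp.toLp 2 fun i => 2 * Real.pi / (2 * N : ℝ) * (k i : ℝ)

open Classical in
/-- The finite-volume boson dispersion `ω(q) = |q| + δ_{q,0}`. -/
def bosonDispersion {d : ℕ} (N : ℕ) (k : ZLat d) : ℝ :=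
  ‖quasiMomentum N k‖ + if k = 0 then 1 else 0

/-- The finite-volume form factor `φ^Λ(q) = (2π/L)^{d/2} φ(q)`, with `L = 2N`. -/
def finForm {d : ℕ} (φ : EuclideanSpace ℝ (Fin d) → ℂ) (N : ℕ) (k : ZLat d) : ℂ :=
  (((2 * Real.pi / (2 * N : ℝ)) ^ ((d : ℝ) / 2) : ℝ) : ℂ) * φ (quasiMomentum N k)

/-- Boson modes: a quasi-momentum for the reservoir at every site of the cube. -/
abbrev Mode (d N : ℕ) := Site d N × ZLat d

/-- Occupation numbers of the modes. The total reservoir space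
`⨂_{x ∈ Λ} Γ_s(L²([-L/2,L/2]^d)) = Γ_s(ℓ²(Λ × (2π/L)ℤ^d))` is `ℓ²(Occ d N)` in the occupation
number basis of the plane waves. -/
abbrev Occ (d N : ℕ) := Mode d N →₀ ℕ

open Classical in
/-- Matrix element `⟨m| a_p |n⟩` of the annihilation operator `a_p |n⟩ = √(n_p) |n - δ_p⟩`. -/
def annihElem {d N : ℕ} (p : Mode d N) (m n : Occ d N) : ℂ :=
  if n = m + Finsupp.single p 1 then (Real.sqrt (n p : ℝ) : ℂ) else 0

open Classical in
/-- Matrix element `⟨m| a*_p |n⟩` of the creation operator `a*_p |n⟩ = √(n_p+1) |n + δ_p⟩`. -/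
def createElem {d N : ℕ} (p : Mode d N) (m n : Occ d N) : ℂ :=
  if m = n + Finsupp.single p 1 then (Real.sqrt ((n p : ℝ) + 1) : ℂ) else 0

/-- Matrix element `⟨m| Ψ_x(φ^Λ) |n⟩` of the field operator `Ψ_x(φ) = a_x(φ) + a*_x(φ)`, where
`a_x(φ) = ∑_q φ(q) a_{x,q}` and `a*_x(φ)` is its adjoint (for given `m, n` at most one summand is
different from zero). -/
def fieldElem {d : ℕ} (φ : EuclideanSpace ℝ (Fin d) → ℂ) (N : ℕ) (x : Site d N)
    (m n : Occ d N) : ℂ :=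
  ∑' k : ZLat d, (finForm φ N k * annihElem (x, k) m n +
    (starRingEnd ℂ) (finForm φ N k) * createElem (x, k) m n)

/-- Eigenvalue of `H_R = ∑_{x,q} ω(q) a*_{x,q} a_{x,q}` on the occupation number state `|n⟩`. -/
def resEnergy {d N : ℕ} (n : Occ d N) : ℝ := n.sum fun p c => (c : ℝ) * bosonDispersion N p.2

/-- Eigenvalue of the Gibbs state `e^{-βH_R} / Tr e^{-βH_R}` on `|n⟩`. -/
def gibbsWeight {d N : ℕ} (β : ℝ) (n : Occ d N) : ℝ :=
  Real.exp (-β * resEnergy n) / ∑' m : Occ d N, Real.exp (-β * resEnergy m)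

/-- `e^{-izω} / (e^{βω} - 1) + e^{izω} / (1 - e^{-βω})`. -/
def thermalFactor (β ω : ℝ) (z : ℂ) : ℂ :=
  Complex.exp (-(Complex.I * z * ω)) / ((Real.exp (β * ω) - 1 : ℝ) : ℂ) +
    Complex.exp (Complex.I * z * ω) / ((1 - Real.exp (-(β * ω)) : ℝ) : ℂ)

/-- The reservoir correlation function `ψ̂^Λ` in finite volume. -/
def finCorr {d : ℕ} (β : ℝ) (φ : EuclideanSpace ℝ (Fin d) → ℂ) (N : ℕ) (z : ℂ) : ℂ :=
  ∑' k : ZLat d, ((‖finForm φ N k‖ ^ 2 : ℝ) : ℂ) * thermalFactor β (bosonDispersion N k) z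

/-- The reservoir correlation function `ψ̂` in infinite volume. -/
def infCorr {d : ℕ} (β : ℝ) (φ : EuclideanSpace ℝ (Fin d) → ℂ) (z : ℂ) : ℂ :=
  ∫ q : EuclideanSpace ℝ (Fin d), ((‖φ q‖ ^ 2 : ℝ) : ℂ) * thermalFactor β ‖q‖ z

/-- The strip `ℍ_β = {z : 0 ≤ Im z ≤ β}`. -/
def kmsStrip (β : ℝ) : Set ℂ := {z | 0 ≤ z.im ∧ z.im ≤ β}

/-- Assumptions on the form factor `φ` (without exponential decay of the correlation function). -/
structure ReservoirAssumption {d : ℕ} (β : ℝ) (φ : EuclideanSpace ℝ (Fin d) → ℂ) : Prop where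
  memLp : MemLp φ 2 volume
  finForm_l2 : ∀ N : ℕ, 0 < N → Summable fun k : ZLat d => ‖finForm φ N k‖ ^ 2
  radial : ∀ q q', ‖q‖ = ‖q'‖ → φ q = φ q'
  integrable : ∀ z ∈ kmsStrip β, Integrable fun q : EuclideanSpace ℝ (Fin d) =>
    ((‖φ q‖ ^ 2 : ℝ) : ℂ) * thermalFactor β ‖q‖ z
  bounded : ∃ C : ℝ, ∀ z ∈ kmsStrip β,
    ‖infCorr β φ z‖ ≤ C ∧ ∀ N : ℕ, 0 < N → ‖finCorr β φ N z‖ ≤ C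
  converges : ∀ K ⊆ kmsStrip β, IsCompact K →
    TendstoUniformlyOn (fun N : ℕ => finCorr β φ N) (infCorr β φ) atTop K
  shift_bounded : ∃ C : ℝ, ∀ N : ℕ, 0 < N →
    Summable (fun k : ZLat d => (bosonDispersion N k)⁻¹ * ‖finForm φ N k‖ ^ 2) ∧
    ∑' k : ZLat d, (bosonDispersion N k)⁻¹ * ‖finForm φ N k‖ ^ 2 ≤ C
  continuous : ContinuousOn (infCorr β φ) (kmsStrip β)

/-! ### The coupled system in finite volume and the reduced dynamics -/

/-- Labels of the basis `|x⟩ ⊗ |n⟩` of the space `ℓ²(Λ) ⊗ 𝓗_R` of the coupled system. -/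
abbrev TotalIdx (d N : ℕ) := Site d N × Occ d N

open Classical in
/-- Matrix elements `⟨x,m| H |y,n⟩` of
`H = T ⊗ 1 - λ² χ·X ⊗ 1 + 1 ⊗ H_R + λ ∑_x |x⟩⟨x| ⊗ Ψ_x(φ)`. -/
def hamiltonian {d : ℕ} (lam : ℝ) (χ : Fin d → ℝ) (ε : (Fin d → ℝ) → ℝ)
    (φ : EuclideanSpace ℝ (Fin d) → ℂ) (N : ℕ) (a b : TotalIdx d N) : ℂ :=
  (if a.2 = b.2 then hopping ε (a.1.1 - b.1.1) else 0) +
  (if a = b then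
    ((-(lam ^ 2 * ∑ i, χ i * (a.1.1 i : ℝ)) + resEnergy a.2 : ℝ) : ℂ) else 0) +
  (if a.1 = b.1 then (lam : ℂ) * fieldElem φ N a.1 a.2 b.2 else 0)

/-- `ρ ⊗ ρ_R = ∑_n p_n ρ ⊗ |n⟩⟨n|`, where `p_n` are the eigenvalues of the Gibbs state `ρ_R`. -/
def tensorGibbs {d N : ℕ} (β : ℝ) (ρ : Matrix (Site d N) (Site d N) ℂ) : Op (TotalIdx d N) :=
  ∑' n : Occ d N, ∑ x, ∑ y, (ρ x y * (gibbsWeight β n : ℂ)) • ketbra (x, n) (y, n)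

/-- The partial trace over the reservoirs. -/
def partialTrace {d N : ℕ} (A : Op (TotalIdx d N)) : Matrix (Site d N) (Site d N) ℂ :=
  fun x y => ∑' n : Occ d N, kern A (x, n) (y, n)

/-- The reduced dynamics `𝓩^Λ_{[0,t]} ρ = Tr_R [e^{-itH} (ρ ⊗ ρ_R) e^{itH}]`; operators on the
finite-dimensional space `ℓ²(Λ)` are written as matrices. -/
def reducedDynamics {d : ℕ} (β lam : ℝ) (χ : Fin d → ℝ) (ε : (Fin d → ℝ) → ℝ)
    (φ : EuclideanSpace ℝ (Fin d) → ℂ) (N : ℕ) (t : ℝ)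
    (ρ : Matrix (Site d N) (Site d N) ℂ) : Matrix (Site d N) (Site d N) ℂ :=
  partialTrace (evolution (hamiltonian lam χ ε φ N) t * tensorGibbs β ρ *
    evolution (hamiltonian lam χ ε φ N) (-t))

/-- The operator `1_Λ ρ 1_Λ` on `ℓ²(Λ)`. -/
def restrictBox {d : ℕ} (N : ℕ) (ρ : Op (ZLat d)) : Matrix (Site d N) (Site d N) ℂ :=
  fun x y => kern ρ x.1 y.1

/-- The finite-volume density matrix `ρ^Λ = 1_Λ ρ 1_Λ / Tr[1_Λ ρ 1_Λ]`. -/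
def finDensity {d : ℕ} (N : ℕ) (ρ : Op (ZLat d)) : Matrix (Site d N) (Site d N) ℂ :=
  (restrictBox N ρ).trace⁻¹ • restrictBox N ρ

/-- The natural embedding of operators on `ℓ²(Λ)` into operators on `ℓ²(ℤ^d)`. -/
def embedBox {d N : ℕ} (M : Matrix (Site d N) (Site d N) ℂ) : Op (ZLat d) :=
  ∑ x, ∑ y, M x y • ketbra x.1 y.1

end

/-!
The dynamics is expanded in the hopping `T`, which is bounded, and not in the coupling `λ`, which
may be large. Without hopping the particle stays at its site, and every reservoir is a family of
oscillators driven by a constant force: coherent vectors stay coherent (`freeEvolution_coherent`).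
A word `|b⟩⟨x₁| U₀(τ₁) |x₁⟩⟨x₂| U₀(τ₂) ⋯ |xₙ⟩⟨a|` of total time zero, with `U₀` the evolution
without hopping, is therefore a displacement operator times a phase, and its expectation in the
Gibbs state is an explicit Gaussian. The exponent depends on the reservoir only through the memory
function `Γ(t) = ∫₀ᵗ (t - u) ψ̂^Λ(u) du` (`thermalElem_wordOp_eq`), and `Γ` converges in the
thermodynamic limit because `ψ̂^Λ` converges uniformly on compact sets.

For the coupled system, Duhamel's formula expresses the thermal matrix elements of a word in the
Heisenberg picture through those of the free evolution and of longer words (`heisWord_duhamel`).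
All matrix elements are at most one and the hopping amplitudes are summable, so after `n` steps the
remainder is `O((2Kt)ⁿ / n!)`, uniformly in the volume. Hence the matrix elements in two volumes, or
at two translated positions, differ by `o(1)` (`tendsto_max_heisDiff`). For the empty word this is
convergence and translation invariance of the propagator `⟨x| 𝓩(|y⟩⟨y'|) |x'⟩`. An analytic
dispersion relation has exponentially decaying hopping amplitudes, and Gronwall's inequality with
the weight `e^{ν|x - y|}` shows that the propagator decays exponentially in `|x - y|` and `|x' - y'|`,
uniformly in the volume (`norm_latHop_fullEvolution_le`).

The step from kernels to the trace norm goes through nuclear representations `∑ₖ |uₖ⟩⟨vₖ|`: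
`IsTraceClass` is equivalent to the existence of one, and the trace norm is the optimal bound
`∑ₖ ‖uₖ‖ ‖vₖ‖` (`IsTraceClass.exists_isNuclearSum`, `NuclearLE`). The Kraus form of the reduced
dynamics (`IsNuclearSum.finDyn`) shows that it does not increase the nuclear norm, and gives
positivity and conservation of the trace. On operators with summable kernel dominated convergence
gives the limit in nuclear norm; these are dense, and the contraction property extends the limit to
the trace class.

The finite-volume Hamiltonian has the form `D + T + R √𝒩 + √𝒩 R*`, where `𝒩` is the boson number,
`D` is diagonal, and `T` and `R` are bounded (`GradedHamiltonian`). As the off-diagonal part grows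
like `√𝒩` and `∑ₙ n^{-1/2}` diverges, Carleman's criterion applies: the weighted norms of the
difference of two weak solutions grow too slowly for mass to escape to infinite boson number
(`eq_of_isWeakSol`). So bounded weak solutions are unique; limits of the solutions with a number
cutoff provide existence, and together they are essential self-adjointness
(`existsUnique_isEvolution`).
-/

noncomputable section

/-! ### The Hilbert space `ℓ²(ι)` and kernels of operators -/

section Kernels

variable {ι : Type*}

theorem ket_apply [DecidableEq ι] (i j : ι) : (ket i : Hl2 ι) j = if j = i then 1 else 0 := by
  simp only [ket, lp.single_apply, Pi.single_apply]
  congr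

theorem inner_ket (i : ι) (f : Hl2 ι) : inner ℂ (ket i) f = f i := by
  classical
  have := lp.inner_single_left (𝕜 := ℂ) (G := fun _ : ι => ℂ) i (1 : ℂ) f
  rw [RCLike.inner_apply, map_one, mul_one] at this
  rw [← this, ket]

theorem inner_ket_right (i : ι) (f : Hl2 ι) : inner ℂ f (ket i) = (starRingEnd ℂ) (f i) := by
  rw [← inner_conj_symm, inner_ket]

/-- The vectors `|i⟩` form a Hilbert basis. -/
def ketBasis (ι : Type*) : HilbertBasis ι ℂ (Hl2 ι) := HilbertBasis.ofRepr (LinearIsometryEquiv.refl _ _)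

theorem ketBasis_apply (i : ι) : ketBasis ι i = ket i := by
  classical
  rw [← HilbertBasis.repr_symm_single]
  simp only [ketBasis, ket]
  congr!

theorem norm_ket (i : ι) : ‖(ket i : Hl2 ι)‖ = 1 := by
  rw [← ketBasis_apply]
  exact (ketBasis ι).orthonormal.1 i

theorem hasSum_ket (f : Hl2 ι) : HasSum (fun i => f i • ket i) f := by
  have := (ketBasis ι).hasSum_repr f
  simp only [ketBasis_apply] at this
  exact this

theorem hasSum_inner (f g : Hl2 ι) :
    HasSum (fun i => (starRingEnd ℂ) (f i) * g i) (inner ℂ f g) := by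
  have := (ketBasis ι).hasSum_inner_mul_inner f g
  simpa only [ketBasis_apply, inner_ket, inner_ket_right] using this

theorem hasSum_norm_sq (f : Hl2 ι) : HasSum (fun i => ‖f i‖ ^ 2) (‖f‖ ^ 2) := by
  have := lp.hasSum_norm (by norm_num) f
  simpa using this

theorem kern_eq_inner (A : Op ι) (i j : ι) : kern A i j = inner ℂ (ket i) (A (ket j)) := by
  rw [inner_ket]; rfl

theorem norm_kern_le (A : Op ι) (i j : ι) : ‖kern A i j‖ ≤ ‖A‖ := by
  rw [kern_eq_inner]
  refine (norm_inner_le_norm _ _).trans ?_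
  rw [norm_ket, one_mul]
  simpa [norm_ket] using A.le_opNorm (ket j)

theorem hasSum_kern_apply (A : Op ι) (f : Hl2 ι) (i : ι) :
    HasSum (fun j => kern A i j * f j) (A f i) := by
  have h := ((hasSum_ket f).mapL A).mapL (innerSL ℂ (ket i))
  simp only [innerSL_apply_apply, map_smul, inner_ket, smul_eq_mul] at h
  simp only [kern, mul_comm (A _ i)]
  exact h

theorem op_ext {A B : Op ι} (h : ∀ i j, kern A i j = kern B i j) : A = B := by
  ext f i
  refine (hasSum_kern_apply A f i).unique ?_
  simp only [h]
  exact hasSum_kern_apply B f i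

theorem hasSum_kern_mul (A B : Op ι) (i j : ι) :
    HasSum (fun k => kern A i k * kern B k j) (kern (A * B) i j) :=
  hasSum_kern_apply A (B (ket j)) i

theorem kern_star (A : Op ι) (i j : ι) : kern (star A) i j = (starRingEnd ℂ) (kern A j i) := by
  rw [kern_eq_inner, kern_eq_inner, ContinuousLinearMap.star_eq_adjoint,
    ContinuousLinearMap.adjoint_inner_right, inner_conj_symm]

@[simp] theorem kern_add (A B : Op ι) (i j : ι) : kern (A + B) i j = kern A i j + kern B i j := rfl
@[simp] theorem kern_sub (A B : Op ι) (i j : ι) : kern (A - B) i j = kern A i j - kern B i j := rfl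
@[simp] theorem kern_smul (c : ℂ) (A : Op ι) (i j : ι) : kern (c • A) i j = c * kern A i j := rfl
@[simp] theorem kern_zero (i j : ι) : kern (0 : Op ι) i j = 0 := rfl

theorem kern_sum {κ : Type*} (s : Finset κ) (A : κ → Op ι) (i j : ι) :
    kern (∑ k ∈ s, A k) i j = ∑ k ∈ s, kern (A k) i j := by
  simp only [kern_eq_inner, _root_.sum_apply, inner_sum]

theorem kern_ketbra [DecidableEq ι] (a b i j : ι) :
    kern (ketbra a b) i j = (if i = a then 1 else 0) * (if j = b then 1 else 0) := by
  simp only [kern, ketbra, InnerProductSpace.rankOne_apply, inner_ket, lp.coeFn_smul,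
    Pi.smul_apply, ket_apply, smul_eq_mul]
  simp only [mul_comm, eq_comm]

theorem tendsto_kern {κ : Type*} {l : Filter κ} {A : κ → Op ι} {B : Op ι}
    (h : Tendsto A l (𝓝 B)) (i j : ι) : Tendsto (fun n => kern (A n) i j) l (𝓝 (kern B i j)) := by
  simp only [kern_eq_inner]
  exact ((innerSL ℂ (ket i)).continuous.tendsto _).comp
    (((ContinuousLinearMap.apply ℂ (Hl2 ι) (ket j)).continuous.tendsto _).comp h)

theorem norm_apply_le (f : Hl2 ι) (i : ι) : ‖f i‖ ≤ ‖f‖ := by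
  rw [← inner_ket]
  simpa [norm_ket] using norm_inner_le_norm (𝕜 := ℂ) (ket i) f

end Kernels

/-! ### Factorizations through the absolute value -/

section Factor

variable {𝒜 : Type*} [CStarAlgebra 𝒜] [PartialOrder 𝒜] [StarOrderedRing 𝒜]

theorem star_mul_cfc_abs_mul_self (A : 𝒜) (h : ℝ → ℝ) (hh : Continuous h) :
    star (A * cfc h (CFC.abs A)) * (A * cfc h (CFC.abs A)) =
      cfc (fun t => (t * h t) * (t * h t)) (CFC.abs A) := by
  have ha : IsSelfAdjoint (CFC.abs A) := (CFC.abs_nonneg A).isSelfAdjoint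
  have hs : star (cfc h (CFC.abs A)) = cfc h (CFC.abs A) := (cfc_predicate h (CFC.abs A)).star_eq
  rw [star_mul, hs, mul_assoc, ← mul_assoc (star A), ← CFC.abs_mul_abs]
  have h2 : cfc (fun t => t * h t) (CFC.abs A) = CFC.abs A * cfc h (CFC.abs A) :=
    (cfc_mul (fun t : ℝ => t) h (CFC.abs A) (by fun_prop) (by fun_prop)).trans (by
      rw [cfc_id' ℝ (CFC.abs A)])
  have h3 : CFC.abs A * cfc h (CFC.abs A) = cfc h (CFC.abs A) * CFC.abs A := by
    rw [← h2, show (fun t => t * h t) = fun t => h t * t from funext fun t => mul_comm _ _]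
    exact (cfc_mul h (fun t : ℝ => t) (CFC.abs A) (by fun_prop) (by fun_prop)).trans (by
      rw [cfc_id' ℝ (CFC.abs A)])
  rw [cfc_mul (fun t => t * h t) (fun t => t * h t) (CFC.abs A) (by fun_prop) (by fun_prop), h2]
  calc _ = (cfc h (CFC.abs A) * CFC.abs A) * (CFC.abs A * cfc h (CFC.abs A)) := by
        simp only [mul_assoc]
    _ = _ := by rw [← h3]

theorem norm_mul_cfc_abs_le (A : 𝒜) (h : ℝ → ℝ) (hh : Continuous h) {c : ℝ} (hc : 0 ≤ c)
    (H : ∀ t, 0 ≤ t → |t * h t| ≤ c) : ‖A * cfc h (CFC.abs A)‖ ≤ c := by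
  have h4 : ‖A * cfc h (CFC.abs A)‖ * ‖A * cfc h (CFC.abs A)‖ ≤ c * c := by
    rw [← CStarRing.norm_star_mul_self, star_mul_cfc_abs_mul_self A h hh]
    refine norm_cfc_le (by positivity) fun t ht => ?_
    have ht0 : 0 ≤ t := spectrum_nonneg_of_nonneg (CFC.abs_nonneg A) ht
    rw [norm_mul, Real.norm_eq_abs]
    exact mul_le_mul (H t ht0) (H t ht0) (abs_nonneg _) hc
  exact abs_le_of_sq_le_sq' (by nlinarith) hc |>.2

theorem abs_sub_mul_inv_sqrt_le {t e : ℝ} (ht : 0 ≤ t) (he : 0 < e) :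
    |t * (√(t + e))⁻¹ - √t| ≤ √e := by
  have h1 : 0 < √(t + e) := Real.sqrt_pos.2 (by positivity)
  have h2 : √t ≤ √(t + e) := Real.sqrt_le_sqrt (by linarith)
  have h3 : √(t + e) ≤ √t + √e := by
    rw [Real.sqrt_le_left (by positivity)]
    nlinarith [Real.sq_sqrt ht, Real.sq_sqrt he.le, mul_nonneg (Real.sqrt_nonneg t) (Real.sqrt_nonneg e)]
  have h0 := Real.sqrt_nonneg t
  have h4 : t * (√(t + e))⁻¹ - √t = -(√t * (√(t + e))⁻¹ * (√(t + e) - √t)) := by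
    have := Real.mul_self_sqrt ht
    field_simp
    linear_combination -this
  rw [h4, abs_neg, abs_of_nonneg (by have := sub_nonneg.2 h2; positivity)]
  have h5 : √t * (√(t + e))⁻¹ ≤ 1 := by
    rw [← div_eq_mul_inv]; exact div_le_one_of_le₀ h2 h1.le
  calc _ ≤ 1 * (√(t + e) - √t) := mul_le_mul_of_nonneg_right h5 (sub_nonneg.2 h2)
    _ ≤ √e := by linarith

theorem tendsto_sqrt_inv_nat : Tendsto (fun n : ℕ => √(1 / ((n : ℝ) + 1))) atTop (𝓝 0) := by
  have := (Real.continuous_sqrt.tendsto 0).comp tendsto_one_div_add_atTop_nhds_zero_nat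
  rw [Real.sqrt_zero] at this
  exact this

/-- Every element `A` factors as `A = C |A|^{1/2}` with `C* C = |A|`; `C` is the norm limit of
`A (|A| + e)^{-1/2}`, so that no polar decomposition is needed. -/
theorem exists_factor_abs (A : 𝒜) :
    ∃ C S : 𝒜, C * S = A ∧ star C * C = CFC.abs A ∧ 0 ≤ S ∧ S * S = CFC.abs A := by
  set e : ℕ → ℝ := fun n => 1 / ((n : ℝ) + 1) with he
  have hepos : ∀ n, 0 < e n := fun n => by positivity
  set f : ℕ → ℝ → ℝ := fun n t => (√(max t 0 + e n))⁻¹ with hf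
  have hfc : ∀ n, Continuous (f n) := fun n =>
    Continuous.inv₀ (by fun_prop) fun t => (Real.sqrt_pos.2 (by have := hepos n; positivity)).ne'
  have hs : IsSelfAdjoint (CFC.abs A) := (CFC.abs_nonneg A).isSelfAdjoint
  set Cn : ℕ → 𝒜 := fun n => A * cfc (f n) (CFC.abs A) with hCn
  have hdiff : ∀ n m, ‖Cn n - Cn m‖ ≤ √(e n) + √(e m) := by
    intro n m
    have : Cn n - Cn m = A * cfc (fun t => f n t - f m t) (CFC.abs A) := by
      rw [cfc_sub (f n) (f m) (CFC.abs A) (hfc n).continuousOn (hfc m).continuousOn, mul_sub]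
    rw [this]
    refine norm_mul_cfc_abs_le A (fun t => f n t - f m t) ((hfc n).sub (hfc m)) (by positivity)
      fun t ht => ?_
    have h1 := abs_sub_mul_inv_sqrt_le ht (hepos n)
    have h2 := abs_sub_mul_inv_sqrt_le ht (hepos m)
    simp only [hf, max_eq_left ht]
    calc _ = |(t * (√(t + e n))⁻¹ - √t) - (t * (√(t + e m))⁻¹ - √t)| := by ring_nf
      _ ≤ _ := (abs_sub _ _).trans (add_le_add h1 h2)
  have hcau : CauchySeq Cn := by
    rw [Metric.cauchySeq_iff']
    intro r hr
    have h0 := tendsto_sqrt_inv_nat.eventually (gt_mem_nhds (half_pos hr))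
    obtain ⟨N, hN⟩ := eventually_atTop.1 h0
    refine ⟨N, fun n hn => ?_⟩
    rw [dist_eq_norm]
    have h1 := hN n hn
    have h2 := hN N le_rfl
    exact (hdiff n N).trans_lt (by simp only [he]; linarith)
  obtain ⟨C, hC⟩ := cauchySeq_tendsto_of_complete hcau
  have hS0 : 0 ≤ CFC.sqrt (CFC.abs A) := CFC.sqrt_nonneg _
  have hSS := CFC.sqrt_mul_sqrt_self (CFC.abs A) (CFC.abs_nonneg A)
  have hScfc : CFC.sqrt (CFC.abs A) = cfc (fun t : ℝ => √t) (CFC.abs A) := by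
    rw [CFC.sqrt_eq_real_sqrt _ (CFC.abs_nonneg A), cfcₙ_eq_cfc]
  refine ⟨C, CFC.sqrt (CFC.abs A), ?_, ?_, hS0, hSS⟩
  · refine tendsto_nhds_unique (hC.mul_const _) ?_
    rw [tendsto_iff_norm_sub_tendsto_zero]
    have hb : ∀ n, ‖Cn n * CFC.sqrt (CFC.abs A) - A‖ ≤ e n := by
      intro n
      have h1 : Cn n * CFC.sqrt (CFC.abs A) - A =
          A * cfc (fun t => f n t * √t - 1) (CFC.abs A) := by
        rw [cfc_sub (fun t => f n t * √t) (fun _ => (1 : ℝ)) (CFC.abs A)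
            ((hfc n).mul Real.continuous_sqrt).continuousOn (by fun_prop),
          cfc_mul (f n) (fun t => √t) (CFC.abs A) (hfc n).continuousOn (by fun_prop),
          cfc_const_one ℝ (CFC.abs A), mul_sub, mul_one, ← hScfc, mul_assoc]
      rw [h1]
      refine norm_mul_cfc_abs_le A (fun t => f n t * √t - 1)
        (((hfc n).mul Real.continuous_sqrt).sub continuous_const) (hepos n).le fun t ht => ?_
      have hp : 0 < √(t + e n) := Real.sqrt_pos.2 (by have := hepos n; positivity)
      have h2 := Real.mul_self_sqrt ht
      have h3 := Real.mul_self_sqrt (add_nonneg ht (hepos n).le)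
      have h4 : √t ≤ √(t + e n) := Real.sqrt_le_sqrt (by linarith [hepos n])
      have h0 := Real.sqrt_nonneg t
      simp only [hf, max_eq_left ht]
      have h5 : t * ((√(t + e n))⁻¹ * √t - 1) = -(t * (√(t + e n) - √t) / √(t + e n)) := by
        field_simp
        ring
      rw [h5, abs_neg, abs_of_nonneg (div_nonneg (mul_nonneg ht (sub_nonneg.2 h4)) hp.le),
        div_le_iff₀ hp]
      calc t * (√(t + e n) - √t) = √t * (√t * (√(t + e n) - √t)) := by rw [← mul_assoc, h2]
        _ ≤ √(t + e n) * ((√(t + e n) + √t) * (√(t + e n) - √t)) := by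
          have h7 := sub_nonneg.2 h4
          gcongr
          linarith
        _ = e n * √(t + e n) := by linear_combination √(t + e n) * (h3 - h2)
    exact squeeze_zero (fun _ => norm_nonneg _) hb tendsto_one_div_add_atTop_nhds_zero_nat
  · have h1 : Tendsto (fun n => star (Cn n) * Cn n) atTop (𝓝 (star C * C)) := hC.star.mul hC
    refine tendsto_nhds_unique h1 ?_
    rw [tendsto_iff_norm_sub_tendsto_zero]
    refine squeeze_zero (fun _ => norm_nonneg _) (fun n => ?_)
      tendsto_one_div_add_atTop_nhds_zero_nat
    have hcont : Continuous fun t => (t * f n t) * (t * f n t) := by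
      have := hfc n
      fun_prop
    have h2 : star (Cn n) * Cn n - CFC.abs A =
        cfc (fun t => (t * f n t) * (t * f n t) - t) (CFC.abs A) := by
      rw [cfc_sub (fun t => (t * f n t) * (t * f n t)) (fun t => t) (CFC.abs A)
        hcont.continuousOn (by fun_prop), cfc_id' ℝ (CFC.abs A),
        star_mul_cfc_abs_mul_self A (f n) (hfc n)]
    rw [h2]
    refine norm_cfc_le (hepos n).le fun t ht => ?_
    have ht0 : 0 ≤ t := spectrum_nonneg_of_nonneg (CFC.abs_nonneg A) ht
    have hp : 0 < t + e n := by have := hepos n; positivity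
    have h3 := Real.mul_self_sqrt hp.le
    simp only [hf, max_eq_left ht0]
    have h4 : t * (√(t + e n))⁻¹ * (t * (√(t + e n))⁻¹) - t = -(t * e n / (t + e n)) := by
      have : t * (√(t + e n))⁻¹ * (t * (√(t + e n))⁻¹) = t * t / (t + e n) := by
        rw [eq_div_iff hp.ne']
        nth_rw 3 [← h3]
        field_simp
      rw [this]; field_simp; ring
    rw [h4, norm_neg, Real.norm_eq_abs, abs_of_nonneg (by have := hepos n; positivity),
      div_le_iff₀ hp]
    nlinarith [hepos n]

/-- `|A|` is the norm limit of `X A` with contractions `X = |A| (A* A + e)^{-1} A*`. -/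
theorem exists_contractions_mul_tendsto_abs (A : 𝒜) :
    ∃ X : ℕ → 𝒜, (∀ n, ‖X n‖ ≤ 1) ∧ Tendsto (fun n => X n * A) atTop (𝓝 (CFC.abs A)) := by
  set e : ℕ → ℝ := fun n => 1 / ((n : ℝ) + 1) with he
  have hepos : ∀ n, 0 < e n := fun n => by positivity
  set f : ℕ → ℝ → ℝ := fun n t => |t| / (t ^ 2 + e n ^ 2) with hf
  have hfc : ∀ n, Continuous (f n) := fun n => by
    refine Continuous.div (by fun_prop) (by fun_prop) fun t => ?_
    have := hepos n
    positivity
  have hsa : ∀ n, star (cfc (f n) (CFC.abs A)) = cfc (f n) (CFC.abs A) :=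
    fun n => (cfc_predicate (f n) (CFC.abs A)).star_eq
  refine ⟨fun n => star (A * cfc (f n) (CFC.abs A)), fun n => ?_, ?_⟩
  · rw [norm_star]
    refine norm_mul_cfc_abs_le A (f n) (hfc n) zero_le_one fun t ht => ?_
    have := hepos n
    simp only [hf]
    rw [abs_of_nonneg ht, abs_of_nonneg (by positivity), ← mul_div_assoc,
      div_le_one (by positivity)]
    nlinarith [sq_nonneg (e n)]
  · rw [tendsto_iff_norm_sub_tendsto_zero]
    refine squeeze_zero (fun _ => norm_nonneg _) (fun n => ?_)
      tendsto_one_div_add_atTop_nhds_zero_nat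
    have hid : CFC.abs A * CFC.abs A = cfc (fun t : ℝ => t * t) (CFC.abs A) := by
      rw [cfc_mul (fun t : ℝ => t) (fun t => t) (CFC.abs A) (by fun_prop) (by fun_prop),
        cfc_id' ℝ (CFC.abs A)]
    have hf' := hfc n
    have h1 : star (A * cfc (f n) (CFC.abs A)) * A - CFC.abs A =
        cfc (fun t => f n t * (t * t) - t) (CFC.abs A) := by
      rw [cfc_sub (fun t => f n t * (t * t)) (fun t => t) (CFC.abs A) (by fun_prop) (by fun_prop),
        cfc_mul (f n) (fun t => t * t) (CFC.abs A) (by fun_prop) (by fun_prop), ← hid,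
        cfc_id' ℝ (CFC.abs A), star_mul, hsa, mul_assoc, CFC.abs_mul_abs]
    rw [h1]
    refine norm_cfc_le (hepos n).le fun t ht => ?_
    have ht0 : 0 ≤ t := spectrum_nonneg_of_nonneg (CFC.abs_nonneg A) ht
    have hp := hepos n
    have hq : 0 < t ^ 2 + e n ^ 2 := by positivity
    have h4 : f n t * (t * t) - t = -(t * e n ^ 2 / (t ^ 2 + e n ^ 2)) := by
      simp only [hf, abs_of_nonneg ht0]
      field_simp
      ring
    rw [h4, norm_neg, Real.norm_eq_abs, abs_of_nonneg (by positivity), div_le_iff₀ hq]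
    have : 0 ≤ e n * ((t - e n) ^ 2 + t * e n) := by positivity
    nlinarith

end Factor

section OpAbs

variable {E : Type*} [NormedAddCommGroup E] [InnerProductSpace ℂ E] [CompleteSpace E]

theorem opAbs_nonneg (A : E →L[ℂ] E) : 0 ≤ opAbs A := CFC.abs_nonneg A

theorem opAbs_of_nonneg {A : E →L[ℂ] E} (hA : 0 ≤ A) : opAbs A = A := CFC.abs_of_nonneg A hA

theorem exists_factor_opAbs (A : E →L[ℂ] E) :
    ∃ C S : E →L[ℂ] E, C * S = A ∧ star C * C = opAbs A ∧ 0 ≤ S ∧ S * S = opAbs A :=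
  exists_factor_abs A

theorem exists_contractions_mul_tendsto_opAbs (A : E →L[ℂ] E) :
    ∃ X : ℕ → E →L[ℂ] E, (∀ n, ‖X n‖ ≤ 1) ∧ Tendsto (fun n => X n * A) atTop (𝓝 (opAbs A)) :=
  exists_contractions_mul_tendsto_abs A

theorem exists_sqrt_of_nonneg {A : E →L[ℂ] E} (hA : 0 ≤ A) : ∃ S : E →L[ℂ] E, 0 ≤ S ∧ S * S = A :=
  ⟨CFC.sqrt A, CFC.sqrt_nonneg A, CFC.sqrt_mul_sqrt_self A hA⟩

end OpAbs

/-! ### Trace class operators as nuclear operators -/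

section Nuclear

variable {ι : Type}

/-- `A = ∑ₖ |u k⟩⟨v k|` (as an identity of kernels) with `∑ₖ ‖u k‖ ‖v k‖ ≤ c`. -/
structure IsNuclearSum {κ : Type} (A : Op ι) (u v : κ → Hl2 ι) (c : ℝ) : Prop where
  summable : Summable fun k => ‖u k‖ * ‖v k‖
  tsum_le : ∑' k, ‖u k‖ * ‖v k‖ ≤ c
  hasSum : ∀ i j, HasSum (fun k => u k i * (starRingEnd ℂ) (v k j)) (kern A i j)

/-- Operators of nuclear norm at most `c`. -/
def NuclearLE (A : Op ι) (c : ℝ) : Prop :=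
  ∃ (κ : Type) (u v : κ → Hl2 ι), IsNuclearSum A u v c

theorem opTrace_partial_le {κ : Type} {A : Op ι} {u v : κ → Hl2 ι} {c : ℝ}
    (h : IsNuclearSum A u v c) (F : Finset ι) : ‖∑ i ∈ F, kern A i i‖ ≤ c := by
  have h1 : HasSum (fun k => ∑ i ∈ F, u k i * (starRingEnd ℂ) (v k i)) (∑ i ∈ F, kern A i i) :=
    hasSum_sum fun i _ => h.hasSum i i
  have hb : ∀ k, ‖∑ i ∈ F, u k i * (starRingEnd ℂ) (v k i)‖ ≤ ‖u k‖ * ‖v k‖ := by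
    intro k
    have hu : ∑ i ∈ F, ‖u k i‖ ^ 2 ≤ ‖u k‖ ^ 2 :=
      sum_le_hasSum F (fun _ _ => by positivity) (hasSum_norm_sq (u k))
    have hv : ∑ i ∈ F, ‖v k i‖ ^ 2 ≤ ‖v k‖ ^ 2 :=
      sum_le_hasSum F (fun _ _ => by positivity) (hasSum_norm_sq (v k))
    calc ‖∑ i ∈ F, u k i * (starRingEnd ℂ) (v k i)‖ ≤ ∑ i ∈ F, ‖u k i‖ * ‖v k i‖ :=
          norm_sum_le_of_le _ fun i _ => by simp
      _ ≤ ‖u k‖ * ‖v k‖ := by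
          refine abs_le_of_sq_le_sq' ?_ (by positivity) |>.2
          calc _ ≤ (∑ i ∈ F, ‖u k i‖ ^ 2) * ∑ i ∈ F, ‖v k i‖ ^ 2 :=
                Finset.sum_mul_sq_le_sq_mul_sq _ _ _
            _ ≤ ‖u k‖ ^ 2 * ‖v k‖ ^ 2 := by gcongr
            _ = _ := by ring
  rw [← h1.tsum_eq]
  exact (tsum_of_norm_bounded h.summable.hasSum hb).trans h.tsum_le

theorem IsNuclearSum.mul_left {κ : Type} {A : Op ι} {u v : κ → Hl2 ι} {c : ℝ}
    (h : IsNuclearSum A u v c) (X : Op ι) :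
    IsNuclearSum (X * A) (fun k => X (u k)) v (‖X‖ * c) := by
  have hb : ∀ k, ‖X (u k)‖ * ‖v k‖ ≤ ‖X‖ * (‖u k‖ * ‖v k‖) := fun k => by
    rw [← mul_assoc]; gcongr; exact X.le_opNorm _
  have hs := h.summable.mul_left ‖X‖
  have hs' := Summable.of_nonneg_of_le (fun k => by positivity) hb hs
  refine ⟨hs', ?_, fun i j => ?_⟩
  · refine (hs'.tsum_le_tsum hb hs).trans ?_
    rw [tsum_mul_left]
    exact mul_le_mul_of_nonneg_left h.tsum_le (norm_nonneg _)
  · -- the vector `A |j⟩` is the norm convergent sum of `conj (v k j) • u k`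
    have hsum : Summable fun k => (starRingEnd ℂ) (v k j) • u k := by
      refine Summable.of_norm_bounded h.summable fun k => ?_
      rw [norm_smul, RCLike.norm_conj, mul_comm]
      gcongr
      exact norm_apply_le _ _
    have hA : A (ket j) = ∑' k, (starRingEnd ℂ) (v k j) • u k := by
      ext i
      have h2 := hsum.hasSum.mapL (innerSL ℂ (ket i))
      simp only [innerSL_apply_apply, inner_smul_right, inner_ket] at h2
      have h3 := h.hasSum i j
      simp only [mul_comm (u _ i)] at h3
      exact h3.unique h2
    have h2 := (hsum.hasSum.mapL X).mapL (innerSL ℂ (ket i))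
    rw [← hA] at h2
    simp only [innerSL_apply_apply, inner_ket, map_smul, smul_eq_mul] at h2
    simp only [mul_comm _ ((starRingEnd ℂ) _)]
    exact h2

theorem NuclearLE.mul_left {A : Op ι} {c : ℝ} (h : NuclearLE A c) (X : Op ι) :
    NuclearLE (X * A) (‖X‖ * c) :=
  let ⟨κ, _, v, hh⟩ := h
  ⟨κ, _, v, hh.mul_left X⟩

theorem NuclearLE.nonneg {A : Op ι} {c : ℝ} (h : NuclearLE A c) : 0 ≤ c := by
  obtain ⟨κ, u, v, hh⟩ := h
  exact (tsum_nonneg fun k => by positivity).trans hh.tsum_le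

theorem NuclearLE.mono {A : Op ι} {c c' : ℝ} (h : NuclearLE A c) (hc : c ≤ c') :
    NuclearLE A c' := by
  obtain ⟨κ, u, v, hh⟩ := h
  exact ⟨κ, u, v, hh.summable, hh.tsum_le.trans hc, hh.hasSum⟩

theorem NuclearLE.add {A B : Op ι} {a b : ℝ} (hA : NuclearLE A a) (hB : NuclearLE B b) :
    NuclearLE (A + B) (a + b) := by
  obtain ⟨κ, u, v, h⟩ := hA
  obtain ⟨κ', u', v', h'⟩ := hB
  have hs : HasSum (fun k : κ ⊕ κ' => ‖(Sum.elim u u' k : Hl2 ι)‖ * ‖(Sum.elim v v' k : Hl2 ι)‖)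
      (_ + _) := HasSum.sum h.summable.hasSum h'.summable.hasSum
  refine ⟨κ ⊕ κ', Sum.elim u u', Sum.elim v v', hs.summable, ?_, fun i j => ?_⟩
  · rw [hs.tsum_eq]
    exact add_le_add h.tsum_le h'.tsum_le
  · exact HasSum.sum (f := fun k : κ ⊕ κ' => (Sum.elim u u' k : Hl2 ι) i *
      (starRingEnd ℂ) ((Sum.elim v v' k : Hl2 ι) j)) (h.hasSum i j) (h'.hasSum i j)

theorem NuclearLE.smul {A : Op ι} {a : ℝ} (hA : NuclearLE A a) (c : ℂ) :
    NuclearLE (c • A) (‖c‖ * a) := by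
  obtain ⟨κ, u, v, h⟩ := hA
  have hn : ∀ k, ‖c • u k‖ * ‖v k‖ = ‖c‖ * (‖u k‖ * ‖v k‖) := fun k => by
    rw [norm_smul, mul_assoc]
  refine ⟨κ, fun k => c • u k, v, ?_, ?_, fun i j => ?_⟩
  · simp only [hn]; exact h.summable.mul_left _
  · simp only [hn, tsum_mul_left]; exact mul_le_mul_of_nonneg_left h.tsum_le (norm_nonneg _)
  · simpa [mul_assoc] using (h.hasSum i j).mul_left c

theorem NuclearLE.sub {A B : Op ι} {a b : ℝ} (hA : NuclearLE A a) (hB : NuclearLE B b) :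
    NuclearLE (A - B) (a + b) := by
  have := hA.add (hB.smul (-1))
  simpa [sub_eq_add_neg] using this

/-- The trace norm is the supremum of the partial traces of `X A` over all contractions `X`. -/
theorem traceNorm_le_of_partial_traces {A : Op ι} {c : ℝ}
    (h : ∀ X : Op ι, ‖X‖ ≤ 1 → ∀ F : Finset ι, ‖∑ i ∈ F, kern (X * A) i i‖ ≤ c) :
    traceNorm A ≤ ENNReal.ofReal c := by
  obtain ⟨X, hX, hlim⟩ := exists_contractions_mul_tendsto_opAbs A
  have hpos : ∀ i, 0 ≤ (kern (opAbs A) i i).re := by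
    intro i
    have h0 : (opAbs A).IsPositive :=
      (ContinuousLinearMap.nonneg_iff_isPositive _).1 (opAbs_nonneg A)
    have := h0.inner_nonneg_right (ket i)
    rw [← kern_eq_inner] at this
    exact (RCLike.nonneg_iff.1 this).1
  rw [traceNorm, ENNReal.tsum_eq_iSup_sum]
  refine iSup_le fun F => ?_
  rw [← ENNReal.ofReal_sum_of_nonneg fun i _ => hpos i]
  refine ENNReal.ofReal_le_ofReal ?_
  have h1 : Tendsto (fun n => ∑ i ∈ F, kern (X n * A) i i) atTop
      (𝓝 (∑ i ∈ F, kern (opAbs A) i i)) :=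
    tendsto_finsetSum F fun i _ => tendsto_kern hlim i i
  rw [← Complex.re_sum]
  exact (Complex.re_le_norm _).trans (le_of_tendsto h1.norm (Eventually.of_forall fun n => h _ (hX n) F))

theorem NuclearLE.traceNorm_le {A : Op ι} {c : ℝ} (h : NuclearLE A c) :
    traceNorm A ≤ ENNReal.ofReal c := by
  refine traceNorm_le_of_partial_traces fun X hX F => ?_
  obtain ⟨κ, u, v, hh⟩ := h
  refine (opTrace_partial_le (hh.mul_left X) F).trans ?_
  have := (tsum_nonneg fun k => by positivity).trans hh.tsum_le
  nlinarith

theorem NuclearLE.isTraceClass {A : Op ι} {c : ℝ} (h : NuclearLE A c) : IsTraceClass A :=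
  h.traceNorm_le.trans_lt ENNReal.ofReal_lt_top

/-- The canonical rank-one expansion of a trace class operator, `u k = C |k⟩`, `v k = |A|^{1/2}|k⟩`
with `A = C |A|^{1/2}`; for positive `A` one can take `u = v`. -/
theorem isNuclearSum_of_factor {A C S : Op ι} (hCS : C * S = A) (hC : star C * C = opAbs A)
    (hS : 0 ≤ S) (hSS : S * S = opAbs A) (hA : IsTraceClass A) :
    IsNuclearSum A (fun k => C (ket k)) (fun k => S (ket k)) (traceNorm A).toReal := by
  have hSs : star S = S := hS.isSelfAdjoint.star_eq
  have hn : ∀ B : Op ι, star B * B = opAbs A → ∀ k, ‖B (ket k)‖ ^ 2 = (kern (opAbs A) k k).re := by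
    intro B hB k
    rw [← hB, kern_eq_inner, mul_apply_eq_comp, ContinuousLinearMap.star_eq_adjoint,
      ContinuousLinearMap.adjoint_inner_right, inner_self_eq_norm_sq_to_K]
    norm_cast
  have h1 := hn C hC
  have h2 := hn S (by rw [hSs, hSS])
  have h3 : ∀ k, ‖C (ket k)‖ * ‖S (ket k)‖ = (kern (opAbs A) k k).re := fun k => by
    have : ‖C (ket k)‖ = ‖S (ket k)‖ := by
      rw [← sq_eq_sq₀ (norm_nonneg _) (norm_nonneg _), h1, h2]
    rw [this, ← sq, h2]
  have hpos : ∀ k, 0 ≤ (kern (opAbs A) k k).re := fun k => by rw [← h3]; positivity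
  have hs : HasSum (fun k => (kern (opAbs A) k k).re) (traceNorm A).toReal := by
    have := ENNReal.hasSum_toReal (f := fun k => ENNReal.ofReal (kern (opAbs A) k k).re)
      (ne_of_lt hA)
    simp only [ENNReal.toReal_ofReal (hpos _)] at this
    rw [traceNorm, ENNReal.tsum_toReal_eq fun _ => ENNReal.ofReal_ne_top]
    simpa only [ENNReal.toReal_ofReal (hpos _)] using this
  refine ⟨by simpa only [h3] using hs.summable, by simp only [h3]; exact hs.tsum_eq.le,
    fun i j => ?_⟩
  rw [← hCS]
  convert hasSum_kern_mul C S i j using 2 with k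
  rw [← hSs, kern_star, hSs]
  rfl

theorem IsTraceClass.exists_isNuclearSum {A : Op ι} (hA : IsTraceClass A) :
    ∃ u v : ι → Hl2 ι, IsNuclearSum A u v (traceNorm A).toReal := by
  obtain ⟨C, S, h1, h2, h3, h4⟩ := exists_factor_opAbs A
  exact ⟨_, _, isNuclearSum_of_factor h1 h2 h3 h4 hA⟩

theorem IsTraceClass.nuclearLE {A : Op ι} (hA : IsTraceClass A) :
    NuclearLE A (traceNorm A).toReal :=
  let ⟨u, v, h⟩ := hA.exists_isNuclearSum
  ⟨ι, u, v, h⟩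

theorem IsTraceClass.exists_isNuclearSum_of_isPositive {A : Op ι} (hA : IsTraceClass A)
    (hp : A.IsPositive) : ∃ u : ι → Hl2 ι, IsNuclearSum A u u (traceNorm A).toReal := by
  have h0 : 0 ≤ A := (ContinuousLinearMap.nonneg_iff_isPositive _).2 hp
  have habs := opAbs_of_nonneg h0
  obtain ⟨S, hS, hSS⟩ := exists_sqrt_of_nonneg h0
  refine ⟨_, isNuclearSum_of_factor hSS ?_ hS (hSS.trans habs.symm) hA⟩
  rw [hS.isSelfAdjoint.star_eq, hSS, habs]

theorem IsNuclearSum.hasSum_apply {κ : Type} {A : Op ι} {u v : κ → Hl2 ι} {c : ℝ}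
    (h : IsNuclearSum A u v c) (y : Hl2 ι) : HasSum (fun k => inner ℂ (v k) y • u k) (A y) := by
  have hb1 : ∀ (y : Hl2 ι) k, ‖inner ℂ (v k) y • u k‖ ≤ ‖u k‖ * ‖v k‖ * ‖y‖ := by
    intro y k
    rw [norm_smul]
    calc _ ≤ ‖v k‖ * ‖y‖ * ‖u k‖ := by gcongr; exact norm_inner_le_norm _ _
      _ = _ := by ring
  have h1 : ∀ y : Hl2 ι, Summable fun k => inner ℂ (v k) y • u k := fun y =>
    Summable.of_norm_bounded (h.summable.mul_right ‖y‖) (hb1 y)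
  -- both sides are continuous in `y` and agree on the basis
  let B : Op ι := LinearMap.mkContinuous
    { toFun := fun y => ∑' k, inner ℂ (v k) y • u k
      map_add' := fun y z => by
        simp only [inner_add_right, add_smul]
        exact (h1 y).tsum_add (h1 z)
      map_smul' := fun a y => by
        simp only [inner_smul_right, mul_smul, RingHom.id_apply]
        exact (h1 y).tsum_const_smul a } (∑' k, ‖u k‖ * ‖v k‖) fun y => by
      rw [← tsum_mul_right]
      exact tsum_of_norm_bounded (h.summable.mul_right ‖y‖).hasSum (hb1 y)
  have hAB : A = B := by
    refine op_ext fun i j => ?_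
    have h2 := ((h1 (ket j)).hasSum).mapL (innerSL ℂ (ket i))
    simp only [innerSL_apply_apply, inner_smul_right, inner_ket, inner_ket_right] at h2
    have h3 := h.hasSum i j
    simp only [mul_comm (u _ i)] at h3
    have h4 : kern B i j = (∑' k, (starRingEnd ℂ) (v k j) • u k : Hl2 ι) i := by
      simp only [← inner_ket_right]
      rfl
    rw [h4]
    exact h3.unique h2
  have h4 : A y = ∑' k, inner ℂ (v k) y • u k := by
    conv_lhs => rw [hAB]
    rfl
  rw [h4]
  exact (h1 y).hasSum

theorem norm_le_of_nuclearLE {A : Op ι} {c : ℝ} (h : NuclearLE A c) : ‖A‖ ≤ c := by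
  obtain ⟨κ, u, v, hh⟩ := h
  refine A.opNorm_le_bound ((tsum_nonneg fun k => by positivity).trans hh.tsum_le) fun y => ?_
  have h1 := hh.hasSum_apply y
  rw [← h1.tsum_eq]
  calc _ ≤ (∑' k, ‖u k‖ * ‖v k‖) * ‖y‖ := by
        rw [← tsum_mul_right]
        refine tsum_of_norm_bounded (hh.summable.mul_right ‖y‖).hasSum fun k => ?_
        rw [norm_smul]
        calc _ ≤ ‖v k‖ * ‖y‖ * ‖u k‖ := by gcongr; exact norm_inner_le_norm _ _
          _ = _ := by ring
    _ ≤ _ := by gcongr; exact hh.tsum_le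

theorem isPositive_of_hasSum {κ : Type} {A : Op ι} {u : κ → Hl2 ι} {c : ℝ}
    (h : IsNuclearSum A u u c) : A.IsPositive := by
  have key : ∀ x, HasSum (fun k => ((‖inner ℂ (u k) x‖ ^ 2 : ℝ) : ℂ)) (inner ℂ x (A x)) := by
    intro x
    have h2 := (h.hasSum_apply x).mapL (innerSL ℂ x)
    simp only [innerSL_apply_apply, inner_smul_right] at h2
    have e : ∀ k, ((‖inner ℂ (u k) x‖ ^ 2 : ℝ) : ℂ) = inner ℂ (u k) x * inner ℂ x (u k) := by
      intro k
      rw [← inner_conj_symm x (u k), Complex.mul_conj, Complex.normSq_eq_norm_sq]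
    simp only [e]
    exact h2
  rw [ContinuousLinearMap.isPositive_iff_complex]
  intro x
  have h1 := key x
  have h3 : ∃ r : ℝ, 0 ≤ r ∧ inner ℂ x (A x) = (r : ℂ) := by
    refine ⟨∑' k, ‖inner ℂ (u k) x‖ ^ 2, tsum_nonneg fun k => by positivity, ?_⟩
    rw [← h1.tsum_eq, Complex.ofReal_tsum]
  obtain ⟨r, hr, h4⟩ := h3
  have h5 : inner ℂ (A x) x = (r : ℂ) := by rw [← inner_conj_symm, h4, Complex.conj_ofReal]
  rw [h5]
  exact ⟨by simp, by simpa using hr⟩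

theorem traceNorm_add_le {A B : Op ι} (hA : IsTraceClass A) (hB : IsTraceClass B) :
    traceNorm (A + B) ≤ traceNorm A + traceNorm B := by
  refine (hA.nuclearLE.add hB.nuclearLE).traceNorm_le.trans ?_
  rw [ENNReal.ofReal_add ENNReal.toReal_nonneg ENNReal.toReal_nonneg,
    ENNReal.ofReal_toReal hA.ne, ENNReal.ofReal_toReal hB.ne]

/-- Lower semicontinuity of the trace norm under norm convergence. -/
theorem traceNorm_le_of_tendsto {A : ℕ → Op ι} {B : Op ι} {c : ℝ}
    (hlim : Tendsto A atTop (𝓝 B)) (h : ∀ᶠ n in atTop, NuclearLE (A n) c) :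
    traceNorm B ≤ ENNReal.ofReal c := by
  refine traceNorm_le_of_partial_traces fun X hX F => ?_
  have h1 : Tendsto (fun n => ∑ i ∈ F, kern (X * A n) i i) atTop
      (𝓝 (∑ i ∈ F, kern (X * B) i i)) :=
    tendsto_finsetSum F fun i _ => tendsto_kern (hlim.const_mul X) i i
  refine le_of_tendsto h1.norm (h.mono fun n hn => ?_)
  have hc := hn.nonneg
  obtain ⟨κ, u, v, hh⟩ := hn
  refine (opTrace_partial_le (hh.mul_left X) F).trans ?_
  nlinarith

/-- The diagonal of a nuclear operator is absolutely summable. -/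
theorem NuclearLE.hasSum_opTrace {A : Op ι} {c : ℝ} (h : NuclearLE A c) :
    HasSum (fun i => kern A i i) (opTrace A) ∧ ‖opTrace A‖ ≤ c := by
  obtain ⟨κ, u, v, hh⟩ := h
  have h1 : ∀ k, Summable fun i => ‖u k i * (starRingEnd ℂ) (v k i)‖ := fun k => by
    have := (hasSum_inner (v k) (u k)).summable.norm
    simpa only [mul_comm] using this
  have h2 : ∀ k, ∑' i, ‖u k i * (starRingEnd ℂ) (v k i)‖ ≤ ‖u k‖ * ‖v k‖ := by
    intro k
    have hu := hasSum_norm_sq (u k)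
    have hv := hasSum_norm_sq (v k)
    refine Real.tsum_le_of_sum_le (fun _ => norm_nonneg _) fun F => ?_
    simp only [norm_mul, RCLike.norm_conj]
    refine abs_le_of_sq_le_sq' ?_ (by positivity) |>.2
    calc _ ≤ (∑ i ∈ F, ‖u k i‖ ^ 2) * ∑ i ∈ F, ‖v k i‖ ^ 2 :=
          Finset.sum_mul_sq_le_sq_mul_sq _ _ _
      _ ≤ ‖u k‖ ^ 2 * ‖v k‖ ^ 2 := by
          gcongr
          · exact sum_le_hasSum F (fun _ _ => by positivity) hu
          · exact sum_le_hasSum F (fun _ _ => by positivity) hv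
      _ = _ := by ring
  have h3 : Summable fun p : κ × ι => ‖u p.1 p.2 * (starRingEnd ℂ) (v p.1 p.2)‖ := by
    rw [summable_prod_of_nonneg fun _ => norm_nonneg _]
    exact ⟨h1, Summable.of_nonneg_of_le (fun k => tsum_nonneg fun _ => norm_nonneg _) h2 hh.summable⟩
  have h4 : Summable fun p : ι × κ => u p.2 p.1 * (starRingEnd ℂ) (v p.2 p.1) :=
    (Summable.of_norm h3).prod_symm
  have h5 : ∀ i, HasSum (fun k => u k i * (starRingEnd ℂ) (v k i)) (kern A i i) :=
    fun i => hh.hasSum i i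
  have h6 : HasSum (fun i => kern A i i) (∑' p : ι × κ, u p.2 p.1 * (starRingEnd ℂ) (v p.2 p.1)) :=
    h4.hasSum.prod_fiberwise h5
  have h7 : HasSum (fun i => kern A i i) (opTrace A) := by
    rw [opTrace]; exact h6.summable.hasSum
  refine ⟨h7, le_of_tendsto h7.norm (Eventually.of_forall fun F => ?_)⟩
  exact opTrace_partial_le hh F

/-- An operator with absolutely summable kernel is nuclear. -/
theorem nuclearLE_of_summable_kern {A : Op ι} (h : Summable fun p : ι × ι => ‖kern A p.1 p.2‖) :
    NuclearLE A (∑' p : ι × ι, ‖kern A p.1 p.2‖) := by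
  classical
  refine ⟨ι × ι, fun p => kern A p.1 p.2 • ket p.1, fun p => ket p.2, ?_⟩
  have hn : ∀ p : ι × ι, ‖kern A p.1 p.2 • (ket p.1 : Hl2 ι)‖ * ‖(ket p.2 : Hl2 ι)‖ =
      ‖kern A p.1 p.2‖ := fun p => by rw [norm_smul, norm_ket, norm_ket, mul_one, mul_one]
  refine ⟨by simpa only [hn] using h, by simp only [hn]; exact le_rfl, fun i j => ?_⟩
  convert hasSum_single (i, j) ?_ using 1
  · simp [ket_apply]
  · rintro ⟨a, b⟩ hab
    simp only [lp.coeFn_smul, Pi.smul_apply, ket_apply, smul_eq_mul]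
    by_cases h1 : i = a
    · by_cases h2 : j = b
      · exact absurd (by rw [h1, h2]) hab
      · simp [h2]
    · simp [h1]

/-- A summable family of matrix elements is the kernel of a nuclear operator. -/
theorem exists_op_of_summable {a : ι → ι → ℂ} (h : Summable fun p : ι × ι => ‖a p.1 p.2‖) :
    ∃ A : Op ι, (∀ i j, kern A i j = a i j) ∧ NuclearLE A (∑' p : ι × ι, ‖a p.1 p.2‖) := by
  classical
  have hs : Summable fun p : ι × ι => a p.1 p.2 • (ketbra p.1 p.2 : Op ι) := by
    refine Summable.of_norm_bounded h fun p => ?_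
    rw [norm_smul, ketbra, InnerProductSpace.norm_rankOne, norm_ket, norm_ket, mul_one, mul_one]
  have hk : ∀ i j, kern (∑' p : ι × ι, a p.1 p.2 • (ketbra p.1 p.2 : Op ι)) i j = a i j := by
    intro i j
    have h1 := tendsto_kern hs.hasSum i j
    simp only [kern_sum, kern_smul, kern_ketbra] at h1
    refine HasSum.unique (f := fun p : ι × ι =>
      a p.1 p.2 * ((if i = p.1 then 1 else 0) * if j = p.2 then 1 else 0)) h1 ?_
    convert hasSum_single (i, j) ?_ using 1
    · simp
    · rintro ⟨x, y⟩ hab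
      by_cases h1 : i = x
      · by_cases h2 : j = y
        · exact absurd (by rw [h1, h2]) hab
        · simp [h2]
      · simp [h1]
  refine ⟨_, hk, ?_⟩
  have := nuclearLE_of_summable_kern (A := ∑' p : ι × ι, a p.1 p.2 • (ketbra p.1 p.2 : Op ι))
    (by simpa only [hk] using h)
  simpa only [hk] using this

end Nuclear

/-! ### Linear evolution equations in `ℓ²(ι)` -/

section LinearODE

variable {E : Type*} [NormedAddCommGroup E] [NormedSpace ℂ E]

theorem continuous_apply_of_strong {X : Type*} [TopologicalSpace X] {C : X → E →L[ℂ] E} {K : ℝ}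
    (hC : ∀ v, Continuous fun t => C t v) (hK : ∀ t, ‖C t‖ ≤ K) {y : X → E} (hy : Continuous y) :
    Continuous fun t => C t (y t) := by
  rw [continuous_iff_continuousAt]
  intro t
  have h1 : Tendsto (fun s => C s (y s - y t)) (𝓝 t) (𝓝 0) := by
    rw [tendsto_zero_iff_norm_tendsto_zero]
    have h2 : Tendsto (fun s => K * ‖y s - y t‖) (𝓝 t) (𝓝 0) := by
      have := ((hy.tendsto t).sub_const (y t)).norm.const_mul K
      simpa using this
    refine squeeze_zero (fun _ => norm_nonneg _) (fun s => ?_) h2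
    exact (C s).le_of_opNorm_le (hK s) _
  have h3 := h1.add ((hC (y t)).tendsto t)
  simpa [ContinuousAt] using h3

/-- A linear equation `y' = C(t) y` with bounded, strongly continuous coefficient is solvable for
all times, by the Dyson series. -/
theorem exists_linear_ode [CompleteSpace E] {C : ℝ → E →L[ℂ] E} {K : ℝ}
    (hC : ∀ v, Continuous fun t => C t v) (hK : ∀ t, ‖C t‖ ≤ K) (v : E) :
    ∃ y : ℝ → E, y 0 = v ∧ ∀ t, HasDerivAt y (C t (y t)) t := by
  have hK0 : 0 ≤ K := (norm_nonneg _).trans (hK 0)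
  let y : ℕ → ℝ → E := fun n => Nat.rec (fun _ => v) (fun _ f t => ∫ s in (0 : ℝ)..t, C s (f s)) n
  have y0 : ∀ t, y 0 t = v := fun t => rfl
  have ys : ∀ n t, y (n + 1) t = ∫ s in (0 : ℝ)..t, C s (y n s) := fun n t => rfl
  have hcont : ∀ n, Continuous (y n) := by
    intro n
    induction n with
    | zero => exact continuous_const
    | succ n ih =>
      have := continuous_apply_of_strong hC hK ih
      simp only [funext (ys n)]
      exact intervalIntegral.continuous_primitive (fun a b => this.intervalIntegrable a b) 0
  have hder : ∀ n t, HasDerivAt (y (n + 1)) (C t (y n t)) t := by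
    intro n t
    have := continuous_apply_of_strong hC hK (hcont n)
    exact intervalIntegral.integral_hasDerivAt_right (this.intervalIntegrable _ _)
      this.aestronglyMeasurable.stronglyMeasurableAtFilter this.continuousAt
  have hbound : ∀ n t, ‖y n t‖ ≤ (K * |t|) ^ n / n.factorial * ‖v‖ := by
    intro n
    induction n with
    | zero => intro t; simp [y0]
    | succ n ih =>
      intro t
      have hb : ∀ s, ‖C s (y n s)‖ ≤ K ^ (n + 1) * ‖v‖ / n.factorial * |s| ^ n := fun s => by
        calc _ ≤ K * ((K * |s|) ^ n / n.factorial * ‖v‖) :=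
              (C s).le_of_opNorm_le_of_le (hK s) (ih s)
          _ = _ := by ring
      rw [ys]
      have hpow : ∀ r : ℝ, 0 ≤ r → ∫ s in (0 : ℝ)..r, s ^ n = r ^ (n + 1) / (n + 1) := by
        intro r _; rw [integral_pow]; simp
      rcases le_total 0 t with ht | ht
      · calc _ ≤ ∫ s in (0 : ℝ)..t, K ^ (n + 1) * ‖v‖ / n.factorial * s ^ n := by
              refine intervalIntegral.norm_integral_le_of_norm_le ht ?_
                (Continuous.intervalIntegrable (by fun_prop) _ _)
              refine Eventually.of_forall fun s hs => ?_
              have := hb s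
              rwa [abs_of_nonneg hs.1.le] at this
          _ = _ := by
              rw [intervalIntegral.integral_const_mul, hpow t ht, abs_of_nonneg ht,
                Nat.factorial_succ]
              push_cast
              field_simp
              ring
      · have h1 : ∫ s in (0 : ℝ)..t, C s (y n s) = -∫ s in (0 : ℝ)..(-t), C (-s) (y n (-s)) := by
          rw [intervalIntegral.integral_comp_neg fun s => C s (y n s), neg_neg, neg_zero,
            intervalIntegral.integral_symm]
        rw [h1, norm_neg]
        calc _ ≤ ∫ s in (0 : ℝ)..(-t), K ^ (n + 1) * ‖v‖ / n.factorial * s ^ n := by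
              refine intervalIntegral.norm_integral_le_of_norm_le (by linarith) ?_
                (Continuous.intervalIntegrable (by fun_prop) _ _)
              refine Eventually.of_forall fun s hs => ?_
              have := hb (-s)
              rwa [abs_neg, abs_of_nonneg hs.1.le] at this
          _ = _ := by
              rw [intervalIntegral.integral_const_mul, hpow _ (by linarith), abs_of_nonpos ht,
                Nat.factorial_succ]
              push_cast
              field_simp
              ring
  refine ⟨fun t => ∑' n, y n t, ?_, fun t => ?_⟩
  · change ∑' n, y n 0 = v
    rw [tsum_eq_single 0, y0]
    intro n hn
    obtain ⟨m, rfl⟩ := Nat.exists_eq_succ_of_ne_zero hn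
    rw [Nat.succ_eq_add_one, ys, intervalIntegral.integral_same]
  · have hsum : ∀ s, Summable fun n => y n s := fun s =>
      Summable.of_norm_bounded ((Real.summable_pow_div_factorial (K * |s|)).mul_right ‖v‖)
        (hbound · s)
    have hsum1 : ∀ s, Summable fun n => y (n + 1) s := fun s =>
      (summable_nat_add_iff 1).2 (hsum s)
    have hd : HasDerivAt (fun s => ∑' n, y (n + 1) s) (∑' n, C t (y n t)) t := by
      refine hasDerivAt_tsum_of_isPreconnected (t := Metric.ball 0 (|t| + 1)) (y₀ := 0)
        (u := fun n => K * ((K * (|t| + 1)) ^ n / n.factorial * ‖v‖)) ?_ Metric.isOpen_ball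
        (convex_ball _ _).isPreconnected (fun n s _ => hder n s) (fun n s hs => ?_) ?_ (hsum1 0) ?_
      · exact ((Real.summable_pow_div_factorial _).mul_right _).mul_left _
      · rw [mem_ball_zero_iff, Real.norm_eq_abs] at hs
        refine ((C s).le_of_opNorm_le_of_le (hK s) (hbound n s)).trans ?_
        gcongr
      · exact Metric.mem_ball_self (by positivity)
      · rw [mem_ball_zero_iff, Real.norm_eq_abs]; linarith
    have h1 : (fun s => ∑' n, y n s) = fun s => v + ∑' n, y (n + 1) s := by
      funext s
      rw [(hsum s).tsum_eq_zero_add, y0]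
    have h2 := hd.const_add v
    rwa [← (C t).map_tsum (hsum t), ← h1] at h2

end LinearODE

section DiagonalOperators

variable {ι : Type*}

/-- The operator of multiplication by a bounded function. -/
def diagOp (f : ι → ℂ) {C : ℝ} (hf : ∀ i, ‖f i‖ ≤ C) : Op ι :=
  LinearMap.mkContinuous
    { toFun := fun v => ⟨fun i => f i * v i, by
        refine memℓp_gen ?_
        have h := ((lp.memℓp v).summable (by norm_num)).mul_left (C ^ (2 : ℝ))
        refine Summable.of_nonneg_of_le (fun i => by positivity) (fun i => ?_) h
        have : 0 ≤ C := (norm_nonneg _).trans (hf i)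
        rw [norm_mul, Real.mul_rpow (norm_nonneg _) (norm_nonneg _)]
        simp only [ENNReal.toReal_ofNat]
        gcongr
        exact hf i⟩
      map_add' := fun v w => by ext i; exact mul_add _ _ _
      map_smul' := fun a v => by ext i; exact mul_left_comm _ _ _ } |C| (by
    intro v
    refine abs_le_of_sq_le_sq' ?_ (by positivity) |>.2
    rw [mul_pow]
    refine hasSum_le (fun i => ?_) (hasSum_norm_sq _) ((hasSum_norm_sq v).mul_left (|C| ^ 2))
    change ‖f i * v i‖ ^ 2 ≤ _
    rw [norm_mul, mul_pow]
    gcongr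
    exact (hf i).trans (le_abs_self C))

theorem diagOp_apply (f : ι → ℂ) {C : ℝ} (hf : ∀ i, ‖f i‖ ≤ C) (v : Hl2 ι) (i : ι) :
    diagOp f hf v i = f i * v i := rfl

theorem norm_diagOp_le (f : ι → ℂ) {C : ℝ} (hC : 0 ≤ C) (hf : ∀ i, ‖f i‖ ≤ C) :
    ‖diagOp f hf‖ ≤ C :=
  (LinearMap.mkContinuous_norm_le _ (abs_nonneg C) _).trans (abs_of_nonneg hC).le

theorem inner_diagOp_right (f : ι → ℂ) {C : ℝ} (hf : ∀ i, ‖f i‖ ≤ C) (v w : Hl2 ι) :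
    HasSum (fun i => f i * ((starRingEnd ℂ) (v i) * w i)) (inner ℂ v (diagOp f hf w)) := by
  have := hasSum_inner v (diagOp f hf w)
  simp only [diagOp_apply] at this
  simpa only [mul_left_comm] using this

theorem diagOp_ket (f : ι → ℂ) {C : ℝ} (hf : ∀ i, ‖f i‖ ≤ C) (j : ι) :
    diagOp f hf (ket j) = f j • ket j := by
  classical
  ext k
  simp only [diagOp_apply, lp.coeFn_smul, Pi.smul_apply, ket_apply, smul_eq_mul]
  split_ifs with h
  · rw [h]
  · simp

theorem kern_diagOp_mul (f : ι → ℂ) {C : ℝ} (hf : ∀ i, ‖f i‖ ≤ C) (A : Op ι) (i j : ι) :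
    kern (diagOp f hf * A) i j = f i * kern A i j := rfl

theorem kern_mul_diagOp (f : ι → ℂ) {C : ℝ} (hf : ∀ i, ‖f i‖ ≤ C) (A : Op ι) (i j : ι) :
    kern (A * diagOp f hf) i j = f j * kern A i j := by
  change A (diagOp f hf (ket j)) i = _
  rw [diagOp_ket, map_smul]
  rfl

theorem star_diagOp (f : ι → ℝ) {C : ℝ} (hf : ∀ i, ‖(f i : ℂ)‖ ≤ C) :
    star (diagOp (fun i => (f i : ℂ)) hf) = diagOp (fun i => (f i : ℂ)) hf := by
  classical
  refine op_ext fun i j => ?_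
  rw [kern_star, kern, kern, diagOp_ket, diagOp_ket]
  simp only [lp.coeFn_smul, Pi.smul_apply, ket_apply, smul_eq_mul, map_mul, Complex.conj_ofReal]
  by_cases h : i = j
  · subst h; simp
  · simp [h, Ne.symm h]

theorem inner_mul_star (A : Op ι) (v : Hl2 ι) :
    inner ℂ v (star A v) = (starRingEnd ℂ) (inner ℂ v (A v)) := by
  rw [ContinuousLinearMap.star_eq_adjoint, ContinuousLinearMap.adjoint_inner_right,
    inner_conj_symm]

theorem im_inner_of_star_eq {A : Op ι} (hA : star A = A) (v : Hl2 ι) :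
    (inner ℂ v (A v)).im = 0 := by
  have h := inner_mul_star A v
  rw [hA] at h
  exact Complex.conj_eq_iff_im.1 h.symm

end DiagonalOperators

section WeakConvergence

variable {ι : Type*}

/-- Bounded sequences converging in every coordinate converge weakly. -/
theorem tendsto_inner_of_coord {κ : Type*} {l : Filter κ} {u : κ → Hl2 ι} {v : Hl2 ι} {M : ℝ}
    (hu : ∀ k, ‖u k‖ ≤ M) (h : ∀ j, Tendsto (fun k => u k j) l (𝓝 (v j))) (b : Hl2 ι) :
    Tendsto (fun k => inner ℂ b (u k)) l (𝓝 (inner ℂ b v)) := by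
  rw [Metric.tendsto_nhds]
  intro r hr
  set B := |M| + ‖v‖ + 1 with hB
  have hBpos : 0 < B := by positivity
  have h1 := (hasSum_ket b).eventually (Metric.ball_mem_nhds b (ε := r / (2 * B)) (by positivity))
  obtain ⟨F, hF⟩ := h1.exists
  rw [dist_eq_norm] at hF
  have h2 : Tendsto (fun k => inner ℂ (∑ j ∈ F, b j • ket j) (u k)) l
      (𝓝 (inner ℂ (∑ j ∈ F, b j • ket j) v)) := by
    simp only [sum_inner, inner_smul_left, inner_ket]
    exact tendsto_finsetSum F fun j _ => (h j).const_mul _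
  filter_upwards [(Metric.tendsto_nhds.1 h2) (r / 2) (by positivity)] with k hk
  rw [dist_eq_norm] at hk ⊢
  have h3 : inner ℂ b (u k) - inner ℂ b v = (inner ℂ (∑ j ∈ F, b j • ket j) (u k) -
      inner ℂ (∑ j ∈ F, b j • ket j) v) - inner ℂ (∑ j ∈ F, b j • ket j - b) (u k - v) := by
    simp only [inner_sub_left, inner_sub_right]; ring
  have h4 : ‖inner ℂ (∑ j ∈ F, b j • ket j - b) (u k - v)‖ ≤ r / 2 := by
    refine (norm_inner_le_norm _ _).trans ?_
    have h5 : ‖u k - v‖ ≤ B := by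
      have := norm_sub_le (u k) v
      have := (hu k).trans (le_abs_self M)
      linarith
    calc _ ≤ r / (2 * B) * B := by gcongr
      _ = r / 2 := by field_simp
  rw [h3]
  calc _ ≤ _ := norm_sub_le _ _
    _ < r / 2 + r / 2 := by linarith
    _ = r := by ring

theorem continuous_inner_of_coord {X : Type*} [TopologicalSpace X] {u : X → Hl2 ι} {M : ℝ}
    (hu : ∀ t, ‖u t‖ ≤ M) (h : ∀ j, Continuous fun t => u t j) (b : Hl2 ι) :
    Continuous fun t => inner ℂ b (u t) :=
  continuous_iff_continuousAt.2 fun t => tendsto_inner_of_coord hu (fun j => (h j).tendsto t) b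

theorem continuous_of_coord_of_norm {X : Type*} [TopologicalSpace X] {u : X → Hl2 ι} {M : ℝ}
    (hu : ∀ t, ‖u t‖ = M) (h : ∀ j, Continuous fun t => u t j) : Continuous u := by
  rw [continuous_iff_continuousAt]
  intro t
  have h1 := tendsto_inner_of_coord (fun s => (hu s).le) (fun j => (h j).tendsto t) (u t)
  have h2 : ∀ s, ‖u s - u t‖ ^ 2 = M ^ 2 + M ^ 2 - 2 * (inner ℂ (u t) (u s)).re := by
    intro s
    rw [@norm_sub_sq ℂ, hu, hu, ← inner_conj_symm]
    simp only [RCLike.re_to_complex, Complex.conj_re]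
    ring
  have h3 : Tendsto (fun s => ‖u s - u t‖ ^ 2) (𝓝 t) (𝓝 0) := by
    simp only [h2]
    have h4 := ((Complex.continuous_re.tendsto _).comp h1).const_mul 2 |>.const_sub (M ^ 2 + M ^ 2)
    have h5 : (inner ℂ (u t) (u t)).re = M ^ 2 := by
      have := inner_self_eq_norm_sq (𝕜 := ℂ) (u t)
      rw [hu] at this
      exact this
    rw [h5, show M ^ 2 + M ^ 2 - 2 * M ^ 2 = 0 by ring] at h4
    exact h4
  rw [ContinuousAt, tendsto_iff_norm_sub_tendsto_zero]
  have h5 := (Real.continuous_sqrt.tendsto 0).comp h3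
  simpa [Function.comp_def, Real.sqrt_sq (norm_nonneg _)] using h5

end WeakConvergence

/-! ### Weak solutions of the Schrödinger equation and Carleman's criterion -/

section WeakSolutions

variable {ι : Type*}

/-- `u` solves `u' = -i H u` in the coordinates from `s`, where `r j = H |j⟩`. -/
def IsWeakSol (r : ι → Hl2 ι) (s : Set ι) (u : ℝ → Hl2 ι) : Prop :=
  ∀ j ∈ s, ∀ t, HasDerivAt (fun t => u t j) (-(Complex.I * inner ℂ (r j) (u t))) t

theorem IsWeakSol.sub {r : ι → Hl2 ι} {s : Set ι} {u v : ℝ → Hl2 ι} (hu : IsWeakSol r s u)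
    (hv : IsWeakSol r s v) : IsWeakSol r s fun t => u t - v t := by
  intro j hj t
  refine ((hu j hj t).sub (hv j hj t)).congr_deriv ?_
  rw [inner_sub_right]; ring

theorem IsWeakSol.add {r : ι → Hl2 ι} {s : Set ι} {u v : ℝ → Hl2 ι} (hu : IsWeakSol r s u)
    (hv : IsWeakSol r s v) : IsWeakSol r s fun t => u t + v t := by
  intro j hj t
  refine ((hu j hj t).add (hv j hj t)).congr_deriv ?_
  rw [inner_add_right]; ring

theorem IsWeakSol.smul {r : ι → Hl2 ι} {s : Set ι} {u : ℝ → Hl2 ι} (hu : IsWeakSol r s u)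
    (c : ℂ) : IsWeakSol r s fun t => c • u t := by
  intro j hj t
  refine ((hu j hj t).const_mul c).congr_deriv ?_
  rw [inner_smul_right]; ring

theorem IsWeakSol.comp_add {r : ι → Hl2 ι} {s : Set ι} {u : ℝ → Hl2 ι} (hu : IsWeakSol r s u)
    (a : ℝ) : IsWeakSol r s fun t => u (t + a) :=
  fun j hj t => (hu j hj (t + a)).comp_add_const t a

theorem IsWeakSol.mono {r : ι → Hl2 ι} {s s' : Set ι} {u : ℝ → Hl2 ι} (hu : IsWeakSol r s u)
    (h : s' ⊆ s) : IsWeakSol r s' u := fun j hj => hu j (h hj)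

theorem IsWeakSol.congr {r r' : ι → Hl2 ι} {s : Set ι} {u : ℝ → Hl2 ι} (hu : IsWeakSol r s u)
    (h : ∀ j ∈ s, ∀ v, inner ℂ (r j) v = inner ℂ (r' j) v) : IsWeakSol r' s u := by
  intro j hj t
  rw [← h j hj]
  exact hu j hj t

end WeakSolutions

/-- A Hamiltonian `D + T + R √𝒩 + √𝒩 R*` on `ℓ²(ι)`, where `𝒩` is a grading operator (a particle
number), `D` is real and diagonal, `T` is bounded and preserves the grade, and `R` is bounded and
lowers the grade by one. -/
structure GradedHamiltonian (ι : Type*) where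
  /-- the particle number -/
  grade : ι → ℕ
  /-- the diagonal part -/
  D : ι → ℝ
  /-- the bounded, number preserving part -/
  T : Op ι
  /-- the normalized annihilation part -/
  R : Op ι
  star_T : star T = T
  T_grade : ∀ i j, kern T i j ≠ 0 → grade i = grade j
  R_grade : ∀ i j, kern R i j ≠ 0 → grade j = grade i + 1

namespace GradedHamiltonian

variable {ι : Type*} (H : GradedHamiltonian ι)

/-- The vector `H |j⟩`. -/
def row (j : ι) : Hl2 ι :=
  (H.D j : ℂ) • ket j + H.T (ket j) + ((√(H.grade j + 1 : ℝ) : ℝ) : ℂ) • star H.R (ket j) +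
    ((√(H.grade j : ℝ) : ℝ) : ℂ) • H.R (ket j)

theorem inner_star_ket (A : Op ι) (j : ι) (v : Hl2 ι) : inner ℂ (star A (ket j)) v = A v j := by
  rw [ContinuousLinearMap.star_eq_adjoint, ContinuousLinearMap.adjoint_inner_left, inner_ket]

theorem inner_row (j : ι) (v : Hl2 ι) : inner ℂ (H.row j) v =
    H.D j * v j + H.T v j + (√(H.grade j + 1 : ℝ) : ℝ) * H.R v j +
      (√(H.grade j : ℝ) : ℝ) * star H.R v j := by
  have h1 : inner ℂ (H.T (ket j)) v = H.T v j := by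
    conv_lhs => rw [← H.star_T]
    exact inner_star_ket _ _ _
  have h2 : inner ℂ (H.R (ket j)) v = star H.R v j := by
    conv_lhs => rw [← star_star H.R]
    exact inner_star_ket _ _ _
  simp only [row, inner_add_left, inner_smul_left, inner_star_ket, Complex.conj_ofReal, h1, h2,
    inner_ket]

/-- `∑_{m ≤ k < N} (k + 1)^{-1/2}`, the weights in Carleman's criterion. -/
def weight (N m : ℕ) : ℝ := ∑ k ∈ Finset.Ico m N, (√(k + 1 : ℝ))⁻¹

theorem weight_nonneg (N m : ℕ) : 0 ≤ weight N m := Finset.sum_nonneg fun _ _ => by positivity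

theorem weight_of_le {N m : ℕ} (h : N ≤ m) : weight N m = 0 := by
  rw [weight, Finset.Ico_eq_empty_of_le h, Finset.sum_empty]

theorem weight_sub {N m : ℕ} (h : m < N) : weight N m - weight N (m + 1) = (√(m + 1 : ℝ))⁻¹ := by
  rw [weight, weight, Finset.sum_eq_sum_Ico_succ_bot h]
  ring

theorem weight_anti (N : ℕ) : Antitone (weight N) := fun _ _ h =>
  Finset.sum_le_sum_of_subset_of_nonneg (Finset.Ico_subset_Ico_left h) fun _ _ _ => by positivity

theorem weight_le (N m : ℕ) : weight N m ≤ N := by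
  calc weight N m ≤ ∑ k ∈ Finset.Ico m N, (1 : ℝ) := by
        refine Finset.sum_le_sum fun k _ => inv_le_one_of_one_le₀ ?_
        rw [Real.one_le_sqrt]; linarith [(Nat.cast_nonneg k : (0 : ℝ) ≤ k)]
    _ ≤ N := by simp

theorem tendsto_weight (m : ℕ) : Tendsto (fun N => weight N m) atTop atTop := by
  have h1 : ¬ Summable fun k : ℕ => (√(k + 1 : ℝ))⁻¹ := by
    intro h
    have h2 : Summable fun k : ℕ => 1 / ((k + 1 : ℕ) : ℝ) ^ (1 / 2 : ℝ) := by
      convert h using 2 with k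
      rw [← Real.sqrt_eq_rpow, one_div]; push_cast; rfl
    have h3 := (summable_nat_add_iff (f := fun k : ℕ => 1 / (k : ℝ) ^ (1 / 2 : ℝ)) 1).1 h2
    rw [Real.summable_one_div_nat_rpow] at h3
    norm_num at h3
  have h2 := (not_summable_iff_tendsto_nat_atTop_of_nonneg (fun k => by positivity)).1 h1
  have h3 := tendsto_atTop_add_const_right atTop (-∑ k ∈ Finset.range m, (√(k + 1 : ℝ))⁻¹) h2
  refine h3.congr' ?_
  filter_upwards [eventually_ge_atTop m] with N hN
  rw [weight, Finset.sum_Ico_eq_sub _ hN, sub_eq_add_neg]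

theorem weight_mul_im_eq (N : ℕ) (v : Hl2 ι) (j : ι) :
    weight N (H.grade j) * ((starRingEnd ℂ) (v j) * inner ℂ (H.row j) v).im =
      (((weight N (H.grade j) : ℝ) : ℂ) * ((starRingEnd ℂ) (v j) * H.T v j) +
        ((weight N (H.grade j) * √((H.grade j : ℝ) + 1) : ℝ) : ℂ) *
          ((starRingEnd ℂ) (v j) * H.R v j) +
        ((weight N (H.grade j) * √(H.grade j : ℝ) : ℝ) : ℂ) *
          ((starRingEnd ℂ) (v j) * star H.R v j)).im := by
  have h : (starRingEnd ℂ) (v j) * v j = ((Complex.normSq (v j) : ℝ) : ℂ) := by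
    rw [mul_comm, Complex.mul_conj]
  rw [← Complex.im_ofReal_mul, inner_row]
  have e : ((weight N (H.grade j) : ℝ) : ℂ) * ((starRingEnd ℂ) (v j) *
      (H.D j * v j + H.T v j + (√(H.grade j + 1 : ℝ) : ℝ) * H.R v j +
      (√(H.grade j : ℝ) : ℝ) * star H.R v j)) =
      ((weight N (H.grade j) * H.D j * Complex.normSq (v j) : ℝ) : ℂ) + (
      ((weight N (H.grade j) : ℝ) : ℂ) * ((starRingEnd ℂ) (v j) * H.T v j) +
        ((weight N (H.grade j) * √((H.grade j : ℝ) + 1) : ℝ) : ℂ) *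
          ((starRingEnd ℂ) (v j) * H.R v j) +
        ((weight N (H.grade j) * √(H.grade j : ℝ) : ℝ) : ℂ) *
          ((starRingEnd ℂ) (v j) * star H.R v j)) := by
    push_cast
    rw [← h]
    ring
  rw [e, Complex.add_im, Complex.ofReal_im, zero_add]

theorem norm_weight_le (N : ℕ) (j : ι) : ‖((weight N (H.grade j) : ℝ) : ℂ)‖ ≤ N := by
  rw [Complex.norm_real, Real.norm_eq_abs, abs_of_nonneg (weight_nonneg _ _)]
  exact weight_le _ _

theorem norm_weight_mul_sqrt_le (N : ℕ) (j : ι) (x : ℝ) (hx : x ≤ (H.grade j : ℝ) + 1) :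
    ‖((weight N (H.grade j) * √x : ℝ) : ℂ)‖ ≤ N * √(N : ℝ) := by
  rw [Complex.norm_real, Real.norm_eq_abs,
    abs_of_nonneg (mul_nonneg (weight_nonneg _ _) (Real.sqrt_nonneg _))]
  rcases lt_or_ge (H.grade j) N with h | h
  · have : (H.grade j : ℝ) + 1 ≤ N := by exact_mod_cast h
    have := hx.trans this
    have := weight_le N (H.grade j)
    gcongr
  · rw [weight_of_le h, zero_mul]; positivity

theorem norm_sum_mul_inner_le (F : Finset ι) (f : ι → ℂ) {C : ℝ} (hf : ∀ i, ‖f i‖ ≤ C)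
    (v w : Hl2 ι) :
    ‖∑ j ∈ F, f j * ((starRingEnd ℂ) (v j) * w j)‖ ≤ |C| * (‖v‖ * ‖w‖) := by
  calc _ ≤ ∑ j ∈ F, |C| * (‖v j‖ * ‖w j‖) := norm_sum_le_of_le _ fun j _ => by
        rw [norm_mul, norm_mul, RCLike.norm_conj]
        gcongr
        exact (hf j).trans (le_abs_self C)
    _ ≤ _ := by
        rw [← Finset.mul_sum]
        gcongr
        refine abs_le_of_sq_le_sq' ?_ (by positivity) |>.2
        calc _ ≤ (∑ i ∈ F, ‖v i‖ ^ 2) * ∑ i ∈ F, ‖w i‖ ^ 2 :=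
              Finset.sum_mul_sq_le_sq_mul_sq _ _ _
          _ ≤ ‖v‖ ^ 2 * ‖w‖ ^ 2 := by
              gcongr
              · exact sum_le_hasSum F (fun _ _ => by positivity) (hasSum_norm_sq v)
              · exact sum_le_hasSum F (fun _ _ => by positivity) (hasSum_norm_sq w)
          _ = _ := by ring

theorem exists_bound_partial_commutator (N : ℕ) : ∃ K : ℝ, ∀ (v : Hl2 ι) (F : Finset ι),
    |∑ j ∈ F, weight N (H.grade j) * ((starRingEnd ℂ) (v j) * inner ℂ (H.row j) v).im| ≤
      K * ‖v‖ ^ 2 := by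
  refine ⟨|(N : ℝ)| * ‖H.T‖ + |N * √(N : ℝ)| * ‖H.R‖ + |N * √(N : ℝ)| * ‖star H.R‖, fun v F => ?_⟩
  simp only [weight_mul_im_eq]
  rw [← Complex.im_sum, Finset.sum_add_distrib, Finset.sum_add_distrib]
  refine (Complex.abs_im_le_norm _).trans ((norm_add₃_le).trans ?_)
  have h1 := norm_sum_mul_inner_le F _ (H.norm_weight_le N) v (H.T v)
  have h2 := norm_sum_mul_inner_le F _ (fun j => H.norm_weight_mul_sqrt_le N j _
    (le_refl ((H.grade j : ℝ) + 1))) v (H.R v)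
  have h3 := norm_sum_mul_inner_le F _ (fun j => H.norm_weight_mul_sqrt_le N j (H.grade j : ℝ)
    (by linarith)) v (star H.R v)
  have g : ∀ (A : Op ι) (C : ℝ), |C| * (‖v‖ * ‖A v‖) ≤ |C| * ‖A‖ * ‖v‖ ^ 2 := fun A C => by
    calc _ ≤ |C| * (‖v‖ * (‖A‖ * ‖v‖)) := by gcongr; exact A.le_opNorm v
      _ = _ := by ring
  have := g H.T N
  have := g H.R (N * √(N : ℝ))
  have := g (star H.R) (N * √(N : ℝ))
  rw [add_mul, add_mul]
  linarith

/-- The commutator of the weights with the Hamiltonian is bounded uniformly in the cutoff: the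
weights telescope, and their increments cancel the growth of the matrix elements. -/
theorem exists_hasSum_commutator (N : ℕ) (v : Hl2 ι) :
    ∃ b : ℝ, |b| ≤ ‖H.R‖ * ‖v‖ ^ 2 ∧
      HasSum (fun j => weight N (H.grade j) *
        ((starRingEnd ℂ) (v j) * inner ℂ (H.row j) v).im) b := by
  have ha := H.norm_weight_le N
  have hb := fun j => H.norm_weight_mul_sqrt_le N j _ (le_refl ((H.grade j : ℝ) + 1))
  have hc := fun j => H.norm_weight_mul_sqrt_le N j (H.grade j : ℝ) (by linarith)
  have hd : ∀ j, ‖(if H.grade j < N then (1 : ℂ) else 0)‖ ≤ 1 := fun j => by split_ifs <;> simp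
  -- the three parts of the commutator
  have s1 := inner_diagOp_right _ ha v (H.T v)
  have s2 := inner_diagOp_right _ hb v (H.R v)
  have s3 := inner_diagOp_right _ hc v (star H.R v)
  -- `T` commutes with the weights, so its part is real
  have hT : (inner ℂ v (diagOp _ ha (H.T v))).im = 0 := by
    refine im_inner_of_star_eq (A := diagOp _ ha * H.T) ?_ v
    rw [star_mul, H.star_T, star_diagOp (fun j => weight N (H.grade j)) ha]
    refine op_ext fun i j => ?_
    rw [kern_mul_diagOp, kern_diagOp_mul]
    by_cases h : kern H.T i j = 0
    · rw [h, mul_zero, mul_zero]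
    · rw [H.T_grade i j h]
  -- `w(n) √(n+1) - w(n+1) √(n+1)` is `1` below the cutoff and `0` above
  have hR : diagOp _ hb * H.R = diagOp _ hd * H.R + H.R * diagOp _ hc := by
    refine op_ext fun i j => ?_
    rw [kern_add, kern_mul_diagOp, kern_diagOp_mul, kern_diagOp_mul, ← add_mul]
    by_cases h : kern H.R i j = 0
    · rw [h, mul_zero, mul_zero]
    · rw [H.R_grade i j h]
      congr 1
      push_cast
      rw [← sub_eq_iff_eq_add, ← sub_mul]
      split_ifs with h1
      · norm_cast
        rw [Nat.cast_add, Nat.cast_one, weight_sub h1,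
          inv_mul_cancel₀ (Real.sqrt_pos.2 (by positivity)).ne']
      · rw [weight_of_le (by omega), weight_of_le (by omega)]
        simp
  have h3 : inner ℂ v (diagOp _ hc (star H.R v)) =
      (starRingEnd ℂ) (inner ℂ v ((H.R * diagOp _ hc) v)) := by
    rw [← inner_mul_star, star_mul,
      star_diagOp (fun j => weight N (H.grade j) * √(H.grade j : ℝ)) hc]
    rfl
  have h2 : inner ℂ v (diagOp _ hb (H.R v)) =
      inner ℂ v (diagOp _ hd (H.R v)) + inner ℂ v ((H.R * diagOp _ hc) v) := by
    rw [← inner_add_right]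
    exact congrArg (fun A : Op ι => inner ℂ v (A v)) hR
  have hsum := Complex.hasSum_im ((s1.add s2).add s3)
  refine ⟨_, ?_, hsum.congr_fun ?_⟩
  · rw [Complex.add_im, Complex.add_im, hT, h2, h3, Complex.add_im, Complex.conj_im]
    have h4 : ‖inner ℂ v (diagOp _ hd (H.R v))‖ ≤ ‖H.R‖ * ‖v‖ ^ 2 := by
      refine (norm_inner_le_norm _ _).trans ?_
      calc _ ≤ ‖v‖ * (1 * (‖H.R‖ * ‖v‖)) := by
            gcongr
            exact (diagOp _ hd).le_of_opNorm_le_of_le (norm_diagOp_le _ zero_le_one hd)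
              (H.R.le_opNorm v)
        _ = _ := by ring
    refine le_trans ?_ ((Complex.abs_im_le_norm _).trans h4)
    exact le_of_eq (congrArg _ (by ring))
  · intro j
    exact H.weight_mul_im_eq N v j

/-- Carleman's estimate: the weighted norm of a bounded solution grows at most linearly, at a rate
which does not depend on the cutoff `N`. -/
theorem abs_sub_weighted_le [Countable ι] (N : ℕ) {u : ℝ → Hl2 ι} {M : ℝ}
    (hu : IsWeakSol H.row {j | H.grade j < N} u) (hM : ∀ t, ‖u t‖ ≤ M) (t : ℝ) :
    |(∑' j, weight N (H.grade j) * ‖u t j‖ ^ 2) - ∑' j, weight N (H.grade j) * ‖u 0 j‖ ^ 2| ≤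
      2 * (‖H.R‖ * M ^ 2) * |t| := by
  have hM0 : 0 ≤ M := (norm_nonneg _).trans (hM 0)
  set G : ι → ℝ → ℝ := fun j s =>
    2 * (weight N (H.grade j) * ((starRingEnd ℂ) (u s j) * inner ℂ (H.row j) (u s)).im) with hG
  have hder : ∀ j s, HasDerivAt (fun s => weight N (H.grade j) * ‖u s j‖ ^ 2) (G j s) s := by
    intro j s
    rcases lt_or_ge (H.grade j) N with h | h
    · have h1 := (hu j h s).norm_sq.const_mul (weight N (H.grade j))
      refine h1.congr_deriv ?_
      have : inner ℝ (u s j) (-(Complex.I * inner ℂ (H.row j) (u s))) =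
          ((starRingEnd ℂ) (u s j) * inner ℂ (H.row j) (u s)).im := by
        rw [Complex.inner]
        simp only [mul_neg, neg_mul, Complex.neg_re, Complex.mul_re, Complex.mul_im,
          Complex.I_re, Complex.I_im, Complex.conj_re, Complex.conj_im]
        ring
      rw [this, hG]
      ring
    · simp only [hG, weight_of_le h, zero_mul, mul_zero]
      exact hasDerivAt_const _ _
  obtain ⟨K, hK⟩ := H.exists_bound_partial_commutator N
  have hK' : ∀ (F : Finset ι) s, |∑ j ∈ F, G j s| ≤ 2 * (|K| * M ^ 2) := by
    intro F s
    simp only [hG, ← Finset.mul_sum]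
    rw [abs_mul, abs_two]
    have := hK (u s) F
    have h2 : K * ‖u s‖ ^ 2 ≤ |K| * M ^ 2 := by
      have := hM s
      have := le_abs_self K
      gcongr
    linarith
  have hmeas : ∀ j, Measurable (G j) := fun j => by
    rw [show G j = deriv fun s => weight N (H.grade j) * ‖u s j‖ ^ 2 from
      funext fun s => (hder j s).deriv.symm]
    exact measurable_deriv _
  have hmeasF : ∀ F : Finset ι, Measurable fun s => ∑ j ∈ F, G j s := fun F =>
    Finset.measurable_fun_sum _ fun j _ => hmeas j
  have hint : ∀ F : Finset ι, IntervalIntegrable (fun s => ∑ j ∈ F, G j s) volume 0 t := fun F =>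
    (intervalIntegrable_const (c := 2 * (|K| * M ^ 2))).mono_fun'
      (hmeasF F).aestronglyMeasurable (Eventually.of_forall fun s => hK' F s)
  have hftc : ∀ F : Finset ι, ∫ s in (0 : ℝ)..t, ∑ j ∈ F, G j s =
      (∑ j ∈ F, weight N (H.grade j) * ‖u t j‖ ^ 2) -
        ∑ j ∈ F, weight N (H.grade j) * ‖u 0 j‖ ^ 2 := fun F =>
    intervalIntegral.integral_eq_sub_of_hasDerivAt
      (f := fun s => ∑ j ∈ F, weight N (H.grade j) * ‖u s j‖ ^ 2)
      (fun s _ => HasDerivAt.fun_sum fun j _ => hder j s) (hint F)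
  choose b hb1 hb2 using fun s => H.exists_hasSum_commutator N (u s)
  have hlim1 : Tendsto (fun F : Finset ι => ∫ s in (0 : ℝ)..t, ∑ j ∈ F, G j s) atTop
      (𝓝 (∫ s in (0 : ℝ)..t, 2 * b s)) := by
    refine intervalIntegral.tendsto_integral_filter_of_dominated_convergence
      (fun _ => 2 * (|K| * M ^ 2)) (Eventually.of_forall fun F => (hmeasF F).aestronglyMeasurable)
      (Eventually.of_forall fun F => Eventually.of_forall fun s _ => hK' F s)
      intervalIntegrable_const (Eventually.of_forall fun s _ => (hb2 s).mul_left 2)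
  have hsum : ∀ s, Summable fun j => weight N (H.grade j) * ‖u s j‖ ^ 2 := fun s =>
    Summable.of_nonneg_of_le (fun j => mul_nonneg (weight_nonneg _ _) (by positivity))
      (fun j => mul_le_mul_of_nonneg_right (weight_le N _) (by positivity))
      ((hasSum_norm_sq (u s)).summable.mul_left (N : ℝ))
  have hlim2 := (hsum t).hasSum.sub (hsum 0).hasSum
  have h3 : Tendsto (fun F : Finset ι => ∫ s in (0 : ℝ)..t, ∑ j ∈ F, G j s) atTop
      (𝓝 ((∑' j, weight N (H.grade j) * ‖u t j‖ ^ 2) -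
        ∑' j, weight N (H.grade j) * ‖u 0 j‖ ^ 2)) := by
    simp only [hftc, ← Finset.sum_sub_distrib]
    exact hlim2
  rw [← tendsto_nhds_unique hlim1 h3]
  have h4 := intervalIntegral.norm_integral_le_of_norm_le_const (a := 0) (b := t)
    (f := fun s => 2 * b s) (C := 2 * (‖H.R‖ * M ^ 2)) fun s _ => by
      rw [Real.norm_eq_abs, abs_mul, abs_two]
      have := hb1 s
      have h5 : ‖H.R‖ * ‖u s‖ ^ 2 ≤ ‖H.R‖ * M ^ 2 := by
        have := hM s
        gcongr
      linarith
  simpa using h4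

theorem coord_sq_mul_weight_le [Countable ι] (N : ℕ) {u : ℝ → Hl2 ι} {M : ℝ}
    (hu : IsWeakSol H.row {j | H.grade j < N} u) (hM : ∀ t, ‖u t‖ ≤ M) (h0 : u 0 = 0) (t : ℝ)
    (j : ι) : weight N (H.grade j) * ‖u t j‖ ^ 2 ≤ 2 * (‖H.R‖ * M ^ 2) * |t| := by
  have h1 := H.abs_sub_weighted_le N hu hM t
  have hsum : Summable fun j => weight N (H.grade j) * ‖u t j‖ ^ 2 :=
    Summable.of_nonneg_of_le (fun j => mul_nonneg (weight_nonneg _ _) (by positivity))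
      (fun j => mul_le_mul_of_nonneg_right (weight_le N _) (by positivity))
      ((hasSum_norm_sq (u t)).summable.mul_left (N : ℝ))
  have h2 : weight N (H.grade j) * ‖u t j‖ ^ 2 ≤ ∑' j, weight N (H.grade j) * ‖u t j‖ ^ 2 :=
    hsum.le_tsum j fun k _ => mul_nonneg (weight_nonneg _ _) (by positivity)
  have h3 : ∑' j, weight N (H.grade j) * ‖u 0 j‖ ^ 2 = 0 := by
    simp [h0]
  rw [h3, sub_zero] at h1
  exact h2.trans ((le_abs_self _).trans h1)

/-- A bounded weak solution is determined by its initial value. -/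
theorem eq_of_isWeakSol [Countable ι] {u v : ℝ → Hl2 ι} {M : ℝ}
    (hu : IsWeakSol H.row Set.univ u) (hv : IsWeakSol H.row Set.univ v) (hM : ∀ t, ‖u t‖ ≤ M)
    (hM' : ∀ t, ‖v t‖ ≤ M) (h0 : u 0 = v 0) (t : ℝ) : u t = v t := by
  have h1 := hu.sub hv
  have h2 : ∀ s, ‖u s - v s‖ ≤ M + M := fun s =>
    (norm_sub_le _ _).trans (add_le_add (hM s) (hM' s))
  rw [← sub_eq_zero]
  ext j
  by_contra hne
  have hpos : 0 < ‖(u t - v t) j‖ ^ 2 := by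
    have : (u t - v t) j ≠ 0 := hne
    positivity
  have h3 := (tendsto_weight (H.grade j)).atTop_mul_const hpos
  obtain ⟨N, hN⟩ := (h3.eventually_gt_atTop (2 * (‖H.R‖ * (M + M) ^ 2) * |t|)).exists
  exact absurd (H.coord_sq_mul_weight_le N (h1.mono (Set.subset_univ _)) h2
    (by simp [h0]) t j) (not_le.2 hN)

/-- Bounded weak solutions have constant norm. -/
theorem norm_eq_of_isWeakSol [Countable ι] {u : ℝ → Hl2 ι} {M : ℝ}
    (hu : IsWeakSol H.row Set.univ u) (hM : ∀ t, ‖u t‖ ≤ M) (t : ℝ) : ‖u t‖ = ‖u 0‖ := by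
  have hlim : ∀ s, Tendsto (fun N => (weight N 0)⁻¹ * ∑' j, weight N (H.grade j) * ‖u s j‖ ^ 2)
      atTop (𝓝 (‖u s‖ ^ 2)) := by
    intro s
    have h1 : ∀ m, Tendsto (fun N => (weight N 0)⁻¹ * weight N m) atTop (𝓝 1) := by
      intro m
      have h2 : ∀ᶠ N in atTop, 1 - (weight N 0)⁻¹ * weight m 0 = (weight N 0)⁻¹ * weight N m := by
        filter_upwards [eventually_ge_atTop m, (tendsto_weight 0).eventually_gt_atTop 0] with N h h'
        have : weight N 0 = weight m 0 + weight N m := by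
          rw [weight, weight, weight, Finset.sum_Ico_consecutive _ (Nat.zero_le m) h]
        rw [eq_inv_mul_iff_mul_eq₀ h'.ne', mul_sub, mul_inv_cancel_left₀ h'.ne', this]
        ring
      refine Tendsto.congr' h2 ?_
      have := ((tendsto_inv_atTop_zero.comp (tendsto_weight 0)).mul_const (weight m 0)).const_sub 1
      simpa using this
    simp only [← tsum_mul_left, ← mul_assoc]
    rw [← (hasSum_norm_sq (u s)).tsum_eq]
    refine tendsto_tsum_of_dominated_convergence (hasSum_norm_sq (u s)).summable (fun j => ?_)
      (Eventually.of_forall fun N j => ?_)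
    · simpa using (h1 (H.grade j)).mul_const (‖u s j‖ ^ 2)
    · rw [norm_mul, norm_mul, norm_inv, Real.norm_of_nonneg (weight_nonneg _ _),
        Real.norm_of_nonneg (weight_nonneg _ _), Real.norm_of_nonneg (sq_nonneg ‖u s j‖)]
      refine mul_le_of_le_one_left (sq_nonneg _) ?_
      rw [← div_eq_inv_mul]
      exact div_le_one_of_le₀ (weight_anti N (Nat.zero_le _)) (weight_nonneg _ _)
  have h1 := ((hlim t).sub (hlim 0)).abs
  have h2 : Tendsto (fun N => (weight N 0)⁻¹ * (2 * (‖H.R‖ * M ^ 2) * |t|)) atTop (𝓝 0) := by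
    have := (tendsto_inv_atTop_zero.comp (tendsto_weight 0)).mul_const (2 * (‖H.R‖ * M ^ 2) * |t|)
    simpa using this
  have h3 : |‖u t‖ ^ 2 - ‖u 0‖ ^ 2| ≤ 0 := by
    refine le_of_tendsto_of_tendsto' h1 h2 fun N => ?_
    rw [← mul_sub, abs_mul, abs_of_nonneg (inv_nonneg.2 (weight_nonneg N 0))]
    exact mul_le_mul_of_nonneg_left (H.abs_sub_weighted_le N (hu.mono (Set.subset_univ _)) hM t)
      (inv_nonneg.2 (weight_nonneg N 0))
  have h4 := abs_nonpos_iff.1 h3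
  rw [sub_eq_zero, sq_eq_sq₀ (norm_nonneg _) (norm_nonneg _)] at h4
  exact h4

end GradedHamiltonian

/-! ### Existence and uniqueness of the unitary group -/

/-- A strongly continuous one-parameter group of unitary operators. -/
structure IsUnitaryGroup {ι : Type*} (U : ℝ → Op ι) : Prop where
  zero : U 0 = 1
  add : ∀ s t, U (s + t) = U s * U t
  isUnitary : ∀ t, U t ∈ unitary (Op ι)
  strongly_continuous : ∀ v, Continuous fun t => U t v

theorem IsEvolution.isUnitaryGroup {ι : Type*} {h : ι → ι → ℂ} {U : ℝ → Op ι}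
    (hU : IsEvolution h U) : IsUnitaryGroup U :=
  ⟨hU.zero, hU.add, hU.isUnitary, hU.strongly_continuous⟩

namespace IsUnitaryGroup

variable {ι : Type*} {U : ℝ → Op ι}

theorem mul_neg_self (hU : IsUnitaryGroup U) (t : ℝ) : U t * U (-t) = 1 := by
  rw [← hU.add, add_neg_cancel, hU.zero]

theorem neg_mul_self (hU : IsUnitaryGroup U) (t : ℝ) : U (-t) * U t = 1 := by
  rw [← hU.add, neg_add_cancel, hU.zero]

theorem neg_apply_apply (hU : IsUnitaryGroup U) (t : ℝ) (v : Hl2 ι) : U (-t) (U t v) = v :=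
  congrArg (fun A : Op ι => A v) (hU.neg_mul_self t)

theorem star_eq (hU : IsUnitaryGroup U) (t : ℝ) : star (U t) = U (-t) := by
  have h := Unitary.star_mul_self_of_mem (hU.isUnitary t)
  calc star (U t) = star (U t) * (U t * U (-t)) := by rw [hU.mul_neg_self, mul_one]
    _ = U (-t) := by rw [← mul_assoc, h, one_mul]

theorem inner_left (hU : IsUnitaryGroup U) (t : ℝ) (v w : Hl2 ι) :
    inner ℂ (U t v) w = inner ℂ v (U (-t) w) := by
  rw [← hU.star_eq, ContinuousLinearMap.star_eq_adjoint, ContinuousLinearMap.adjoint_inner_right]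

theorem inner_map (hU : IsUnitaryGroup U) (t : ℝ) (v w : Hl2 ι) : inner ℂ (U t v) (U t w) = inner ℂ v w := by
  rw [hU.inner_left, hU.neg_apply_apply]

theorem norm_apply (hU : IsUnitaryGroup U) (t : ℝ) (v : Hl2 ι) : ‖U t v‖ = ‖v‖ := by
  rw [← sq_eq_sq₀ (norm_nonneg _) (norm_nonneg _), ← inner_self_eq_norm_sq (𝕜 := ℂ),
    ← inner_self_eq_norm_sq (𝕜 := ℂ), hU.inner_map]

theorem norm_le_one (hU : IsUnitaryGroup U) (t : ℝ) : ‖U t‖ ≤ 1 :=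
  (U t).opNorm_le_bound zero_le_one fun v => by rw [hU.norm_apply, one_mul]

/-- Bounded perturbation: `u t = U t (y t)`, where `y` solves the equation
`y' = -i U(-t) B U(t) y` of the interaction picture. -/
theorem exists_perturbation (hU : IsUnitaryGroup U) {r : ι → Hl2 ι}
    (hgen : ∀ j t, HasDerivAt (fun t => U (-t) (ket j)) (Complex.I • U (-t) (r j)) t)
    {B : Op ι} (hB : star B = B) (v : Hl2 ι) :
    ∃ u y : ℝ → Hl2 ι, y 0 = v ∧ u 0 = v ∧ (∀ t, u t = U t (y t)) ∧ (∀ t, ‖u t‖ = ‖v‖) ∧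
      (∀ t, HasDerivAt y (-(Complex.I • U (-t) (B (u t)))) t) ∧
      IsWeakSol (fun j => r j + B (ket j)) Set.univ u := by
  set C : ℝ → Op ι := fun t => -(Complex.I • (U (-t) * B * U t)) with hCdef
  have hCapp : ∀ t w, C t w = -(Complex.I • U (-t) (B (U t w))) := fun t w => rfl
  have hUneg : ∀ v, Continuous fun t => U (-t) v := fun v =>
    (hU.strongly_continuous v).comp continuous_neg
  have hC : ∀ v, Continuous fun t => C t v := by
    intro v
    simp only [hCapp]
    exact ((continuous_apply_of_strong hUneg (fun t => hU.norm_le_one (-t))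
      (B.continuous.comp (hU.strongly_continuous v))).const_smul Complex.I).neg
  have hK : ∀ t, ‖C t‖ ≤ ‖B‖ := by
    intro t
    refine (C t).opNorm_le_bound (norm_nonneg _) fun w => ?_
    rw [hCapp, norm_neg, norm_smul, Complex.norm_I, one_mul, hU.norm_apply]
    simpa [hU.norm_apply] using B.le_opNorm (U t w)
  obtain ⟨y, hy0, hy⟩ := exists_linear_ode hC hK v
  have hy' : ∀ t, HasDerivAt y (-(Complex.I • U (-t) (B (U t (y t))))) t := hy
  refine ⟨fun t => U t (y t), y, hy0, by simp only [hy0, hU.zero]; rfl, fun t => rfl, fun t => ?_,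
    hy', ?_⟩
  · rw [hU.norm_apply]
    have h1 : ∀ s, HasDerivAt (fun s => (inner ℂ (y s) (y s))) 0 s := by
      intro s
      refine ((hy' s).inner ℂ (hy' s)).congr_deriv ?_
      have h2 := im_inner_of_star_eq hB (U s (y s))
      have h3 : (starRingEnd ℂ) (inner ℂ (U s (y s)) (B (U s (y s)))) =
          inner ℂ (U s (y s)) (B (U s (y s))) := Complex.conj_eq_iff_im.2 h2
      rw [inner_neg_right, inner_neg_left, inner_smul_right, inner_smul_left, Complex.conj_I,
        ← inner_conj_symm (U (-s) _) (y s), ← hU.inner_left, h3]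
      ring
    have h2 := is_const_of_deriv_eq_zero (fun s => (h1 s).differentiableAt)
      (fun s => (h1 s).deriv) t 0
    rw [hy0] at h2
    rw [← sq_eq_sq₀ (norm_nonneg _) (norm_nonneg _), ← inner_self_eq_norm_sq (𝕜 := ℂ),
      ← inner_self_eq_norm_sq (𝕜 := ℂ), h2]
  · intro j _ t
    have h1 : ∀ s, U s (y s) j = inner ℂ (U (-s) (ket j)) (y s) := fun s => by
      rw [hU.inner_left, neg_neg, inner_ket]
    simp only [h1]
    refine ((hgen j t).inner ℂ (hy' t)).congr_deriv ?_
    rw [inner_neg_right, inner_smul_right, inner_smul_left, Complex.conj_I, hU.inner_map,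
      inner_add_left, hU.inner_left, neg_neg, inner_ket,
      ← GradedHamiltonian.inner_star_ket, hB]
    ring

end IsUnitaryGroup

section Diagonal

variable {ι : Type*} (D : ι → ℝ)

theorem norm_exp_diag (t : ℝ) (i : ι) : ‖Complex.exp (-(Complex.I * t * D i))‖ ≤ 1 := by
  rw [Complex.norm_exp]
  simp

/-- The group `e^{-itD}` of a diagonal operator. -/
def diagGroup (t : ℝ) : Op ι := diagOp _ (norm_exp_diag D t)

theorem diagGroup_apply (t : ℝ) (v : Hl2 ι) (i : ι) :
    diagGroup D t v i = Complex.exp (-(Complex.I * t * D i)) * v i := rfl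

theorem diagGroup_isUnitaryGroup : IsUnitaryGroup (diagGroup D) := by
  have hadd : ∀ s t, diagGroup D (s + t) = diagGroup D s * diagGroup D t := by
    intro s t
    ext v i
    change diagGroup D (s + t) v i = diagGroup D s (diagGroup D t v) i
    rw [diagGroup_apply, diagGroup_apply, diagGroup_apply, ← mul_assoc, ← Complex.exp_add]
    congr 2; push_cast; ring
  have hzero : diagGroup D 0 = 1 := by
    ext v i
    change diagGroup D 0 v i = v i
    simp [diagGroup_apply]
  have hstar : ∀ t, star (diagGroup D t) = diagGroup D (-t) := by
    classical
    intro t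
    refine op_ext fun i j => ?_
    rw [kern_star, kern, kern, diagGroup_apply, diagGroup_apply, ket_apply, ket_apply]
    by_cases h : i = j
    · subst h
      simp [← Complex.exp_conj]
    · simp [h, Ne.symm h]
  have hnorm : ∀ t (v : Hl2 ι), ‖diagGroup D t v‖ = ‖v‖ := by
    intro t v
    rw [← sq_eq_sq₀ (norm_nonneg _) (norm_nonneg _), ← (hasSum_norm_sq _).tsum_eq,
      ← (hasSum_norm_sq v).tsum_eq]
    refine tsum_congr fun i => ?_
    rw [diagGroup_apply, norm_mul, Complex.norm_exp]
    simp
  refine ⟨hzero, hadd, fun t => ?_, fun v => ?_⟩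
  · rw [Unitary.mem_iff, hstar, ← hadd, ← hadd]
    simp [hzero]
  · refine continuous_of_coord_of_norm (fun t => hnorm t v) fun j => ?_
    simp only [diagGroup_apply]
    fun_prop

theorem hasDerivAt_diagGroup_neg (j : ι) (t : ℝ) : HasDerivAt (fun t => diagGroup D (-t) (ket j))
    (Complex.I • diagGroup D (-t) ((D j : ℂ) • ket j)) t := by
  have h1 : ∀ t, diagGroup D (-t) (ket j) = Complex.exp (Complex.I * t * D j) • ket j := by
    intro t
    rw [diagGroup, diagOp_ket]
    congr 2; push_cast; ring
  rw [map_smul, h1]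
  simp only [h1, smul_smul]
  have h2 : HasDerivAt (fun s : ℝ => Complex.exp (Complex.I * s * D j))
      (Complex.exp (Complex.I * t * D j) * (Complex.I * D j)) t := by
    have h3 : HasDerivAt (fun s : ℝ => Complex.I * s * D j) (Complex.I * 1 * D j) t :=
      ((hasDerivAt_id t).ofReal_comp.const_mul Complex.I).mul_const _
    simpa using h3.cexp
  refine (h2.smul_const (ket j : Hl2 ι)).congr_deriv ?_
  congr 1
  ring

end Diagonal

namespace GradedHamiltonian

variable {ι : Type*} (H : GradedHamiltonian ι)

theorem norm_cutoff_le (N : ℕ) (j : ι) :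
    ‖((if H.grade j < N then √(H.grade j + 1 : ℝ) else 0 : ℝ) : ℂ)‖ ≤ √(N : ℝ) := by
  rw [Complex.norm_real, Real.norm_eq_abs]
  split_ifs with h
  · rw [abs_of_nonneg (Real.sqrt_nonneg _)]
    refine Real.sqrt_le_sqrt ?_
    exact_mod_cast h
  · simp

/-- The bounded number cutoff of the Hamiltonian without its diagonal part. -/
def cutoff (N : ℕ) : Op ι :=
  H.T + diagOp _ (H.norm_cutoff_le N) * H.R + star H.R * diagOp _ (H.norm_cutoff_le N)

theorem star_cutoff (N : ℕ) : star (H.cutoff N) = H.cutoff N := by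
  rw [cutoff, star_add, star_add, star_mul, star_mul, star_star, H.star_T,
    star_diagOp (fun j => if H.grade j < N then √(H.grade j + 1 : ℝ) else 0)]
  abel

theorem inner_row_cutoff (N : ℕ) (j : ι) (hj : H.grade j < N) (v : Hl2 ι) :
    inner ℂ ((H.D j : ℂ) • ket j + H.cutoff N (ket j)) v = inner ℂ (H.row j) v := by
  rw [inner_row, inner_add_left, inner_smul_left, Complex.conj_ofReal, inner_ket]
  conv_lhs => rw [← H.star_cutoff N]
  rw [inner_star_ket, add_assoc, add_assoc]
  congr 1
  have h1 : (diagOp _ (H.norm_cutoff_le N) * H.R) v j = (√(H.grade j + 1 : ℝ) : ℝ) * H.R v j := by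
    change ((if H.grade j < N then √(H.grade j + 1 : ℝ) else 0 : ℝ) : ℂ) * H.R v j = _
    rw [if_pos hj]
  have h2 : (star H.R * diagOp _ (H.norm_cutoff_le N)) v j =
      (√(H.grade j : ℝ) : ℝ) * star H.R v j := by
    have e1 := hasSum_kern_apply (star H.R * diagOp _ (H.norm_cutoff_le N)) v j
    have e2 := (hasSum_kern_apply (star H.R) v j).mul_left ((√(H.grade j : ℝ) : ℝ) : ℂ)
    refine e1.unique ?_
    refine e2.congr_fun fun k => ?_
    rw [kern_mul_diagOp, ← mul_assoc]
    congr 1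
    by_cases h : kern H.R k j = 0
    · rw [kern_star, h, map_zero, mul_zero, mul_zero]
    · have hk := H.R_grade k j h
      rw [if_pos (by omega), hk]
      push_cast
      rfl
  have h3 : H.cutoff N v j = H.T v j + ((diagOp _ (H.norm_cutoff_le N) * H.R) v j +
      (star H.R * diagOp _ (H.norm_cutoff_le N)) v j) := by
    rw [← add_assoc]; rfl
  rw [h3, h1, h2]

theorem exists_cutoff_sol (N : ℕ) (v : Hl2 ι) : ∃ u : ℝ → Hl2 ι, u 0 = v ∧ (∀ t, ‖u t‖ = ‖v‖) ∧
    IsWeakSol H.row {j | H.grade j < N} u := by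
  obtain ⟨u, y, -, h0, -, hn, -, hw⟩ := (diagGroup_isUnitaryGroup H.D).exists_perturbation
    (hasDerivAt_diagGroup_neg H.D) (H.star_cutoff N) v
  exact ⟨u, h0, hn, (hw.mono (Set.subset_univ _)).congr fun j hj => H.inner_row_cutoff N j hj⟩

/-- Every vector is the initial value of a weak solution of constant norm: the solutions of the
number cutoff equations converge by Carleman's estimate. -/
theorem exists_isWeakSol [Countable ι] (v : Hl2 ι) : ∃ u : ℝ → Hl2 ι, u 0 = v ∧
    (∀ t, ‖u t‖ = ‖v‖) ∧ IsWeakSol H.row Set.univ u := by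
  choose w hw0 hwn hw using fun N => H.exists_cutoff_sol N v
  have hcau : ∀ t j, CauchySeq fun N => w N t j := by
    intro t j
    rw [Metric.cauchySeq_iff']
    intro r hr
    have h1 := (tendsto_weight (H.grade j)).atTop_mul_const (sq_pos_of_pos hr)
    obtain ⟨N, hN⟩ :=
      (h1.eventually_gt_atTop (2 * (‖H.R‖ * (‖v‖ + ‖v‖) ^ 2) * |t|)).exists
    refine ⟨N, fun n hn => ?_⟩
    have h2 : IsWeakSol H.row {j | H.grade j < N} fun t => w n t - w N t :=
      ((hw n).mono fun k (hk : H.grade k < N) => lt_of_lt_of_le hk hn).sub (hw N)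
    have h3 := H.coord_sq_mul_weight_le N h2 (M := ‖v‖ + ‖v‖)
      (fun s => (norm_sub_le _ _).trans (by rw [hwn, hwn])) (by simp [hw0]) t j
    rw [dist_eq_norm]
    have h4 := lt_of_le_of_lt h3 hN
    exact lt_of_pow_lt_pow_left₀ 2 hr.le (lt_of_mul_lt_mul_left h4 (weight_nonneg _ _))
  choose f hf using fun t j => cauchySeq_tendsto_of_complete (hcau t j)
  have hbdd : ∀ t, Bornology.IsBounded (Set.range fun N => w N t) := by
    intro t
    refine (Metric.isBounded_iff_subset_closedBall 0).2 ⟨‖v‖, ?_⟩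
    rintro _ ⟨N, rfl⟩
    simp [hwn]
  have hmem : ∀ t, Memℓp (f t) 2 := fun t =>
    lp.memℓp_of_tendsto (hbdd t) (tendsto_pi_nhds.2 fun j => hf t j)
  set u : ℝ → Hl2 ι := fun t => ⟨f t, hmem t⟩ with hu
  have hlim : ∀ t j, Tendsto (fun N => w N t j) atTop (𝓝 (u t j)) := hf
  have hle : ∀ t, ‖u t‖ ≤ ‖v‖ := fun t =>
    lp.norm_le_of_tendsto (l := atTop) (F := fun N => w N t)
      (Eventually.of_forall fun N => (hwn N t).le) (tendsto_pi_nhds.2 fun j => hf t j)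
  have h0 : u 0 = v := by
    ext j
    refine tendsto_nhds_unique (hlim 0 j) ?_
    simp [hw0]
  have hweak : ∀ t b, Tendsto (fun N => inner ℂ b (w N t)) atTop (𝓝 (inner ℂ b (u t))) :=
    fun t b => tendsto_inner_of_coord (fun N => (hwn N t).le) (hlim t) b
  -- the coordinates satisfy the integrated equation
  have hmeas : ∀ N j, H.grade j < N → Measurable fun s => -(Complex.I * inner ℂ (H.row j) (w N s)) := by
    intro N j hj
    rw [show (fun s => -(Complex.I * inner ℂ (H.row j) (w N s))) = deriv fun s => w N s j from
      funext fun s => (hw N j hj s).deriv.symm]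
    exact measurable_deriv _
  have hbnd : ∀ N j s, ‖-(Complex.I * inner ℂ (H.row j) (w N s))‖ ≤ ‖H.row j‖ * ‖v‖ := by
    intro N j s
    rw [norm_neg, norm_mul, Complex.norm_I, one_mul, ← hwn N s]
    exact norm_inner_le_norm _ _
  have hint : ∀ j a t, u t j - u a j = ∫ s in a..t, -(Complex.I * inner ℂ (H.row j) (u s)) := by
    intro j a t
    have h1 : ∀ᶠ N in atTop, ∫ s in a..t, -(Complex.I * inner ℂ (H.row j) (w N s)) =
        w N t j - w N a j := by
      filter_upwards [eventually_gt_atTop (H.grade j)] with N hN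
      refine intervalIntegral.integral_eq_sub_of_hasDerivAt (f := fun s => w N s j)
        (fun s _ => hw N j hN s) ?_
      exact (intervalIntegrable_const (c := ‖H.row j‖ * ‖v‖)).mono_fun'
        (hmeas N j hN).aestronglyMeasurable (Eventually.of_forall fun s => hbnd N j s)
    have h2 : Tendsto (fun N => ∫ s in a..t, -(Complex.I * inner ℂ (H.row j) (w N s))) atTop
        (𝓝 (∫ s in a..t, -(Complex.I * inner ℂ (H.row j) (u s)))) := by
      refine intervalIntegral.tendsto_integral_filter_of_dominated_convergence
        (fun _ => ‖H.row j‖ * ‖v‖) ?_ (Eventually.of_forall fun N =>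
          Eventually.of_forall fun s _ => hbnd N j s) intervalIntegrable_const
        (Eventually.of_forall fun s _ => ((hweak s _).const_mul _).neg)
      filter_upwards [eventually_gt_atTop (H.grade j)] with N hN
      exact (hmeas N j hN).aestronglyMeasurable
    exact tendsto_nhds_unique (((hlim t j).sub (hlim a j)).congr' (h1.mono fun N hN => hN.symm)) h2
  have hcont : ∀ j, Continuous fun t => u t j := by
    intro j
    have hlip : LipschitzWith (‖H.row j‖₊ * ‖v‖₊) fun t => u t j := by
      refine LipschitzWith.of_dist_le_mul fun t a => ?_
      rw [dist_eq_norm, hint j a t, Real.dist_eq]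
      refine intervalIntegral.norm_integral_le_of_norm_le_const fun s _ => ?_
      rw [norm_neg, norm_mul, Complex.norm_I, one_mul]
      exact (norm_inner_le_norm _ _).trans (mul_le_mul_of_nonneg_left (hle s) (norm_nonneg _))
    exact hlip.continuous
  have hsol : IsWeakSol H.row Set.univ u := by
    intro j _ t
    have h1 : Continuous fun s => -(Complex.I * inner ℂ (H.row j) (u s)) :=
      ((continuous_inner_of_coord hle hcont (H.row j)).const_mul _).neg
    have h2 := intervalIntegral.integral_hasDerivAt_right (h1.intervalIntegrable 0 t)
      h1.aestronglyMeasurable.stronglyMeasurableAtFilter h1.continuousAt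
    have h3 := h2.const_add (u 0 j)
    refine h3.congr_of_eventuallyEq (Eventually.of_forall fun s => ?_)
    change u s j = u 0 j + _
    rw [← hint j 0 s]
    ring
  exact ⟨u, h0, fun t => by rw [H.norm_eq_of_isWeakSol hsol hle t, h0], hsol⟩

end GradedHamiltonian

section Evolution

variable {ι : Type*}

theorem IsEvolution.hasDerivAt_neg {r : ι → Hl2 ι} {U : ℝ → Op ι}
    (hU : IsEvolution (fun j i => r i j) U) (j : ι) (t : ℝ) :
    HasDerivAt (fun t => U (-t) (ket j)) (Complex.I • U (-t) (r j)) t := by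
  obtain ⟨w, hw, hd⟩ := hU.generator j
  have hwr : w = r j := by ext k; exact hw k
  rw [hwr] at hd
  have h1 : HasDerivAt (fun s : ℝ => t - s) (-1) t := by
    simpa using (hasDerivAt_id t).const_sub t
  have h2 : HasDerivAt (fun s : ℝ => U (t - s) (ket j)) ((-1 : ℝ) • -(Complex.I • r j)) t := by
    refine HasDerivAt.scomp t (g₁ := fun s => U s (ket j)) ?_ h1
    rw [sub_self]
    exact hd
  have h3 := ((U (-t)).hasFDerivAt (x := U (t - t) (ket j))).restrictScalars ℝ |>.comp_hasDerivAt t h2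
  refine (h3.congr_deriv ?_).congr_of_eventuallyEq (Eventually.of_forall fun s => ?_)
  · simp
  · change U (-s) (ket j) = U (-t) (U (t - s) (ket j))
    rw [show -s = -t + (t - s) by ring, hU.add]
    rfl

theorem IsEvolution.isWeakSol {r : ι → Hl2 ι} {U : ℝ → Op ι}
    (hU : IsEvolution (fun j i => r i j) U) (v : Hl2 ι) :
    IsWeakSol r Set.univ fun t => U t v := by
  intro j _ t
  have hg := hU.isUnitaryGroup
  have h1 : ∀ s, U s v j = inner ℂ (U (-s) (ket j)) v := fun s => by
    rw [hg.inner_left, neg_neg, inner_ket]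
  simp only [h1]
  refine ((hU.hasDerivAt_neg j t).inner ℂ (hasDerivAt_const t v)).congr_deriv ?_
  rw [inner_zero_right, zero_add, inner_smul_left, Complex.conj_I, hg.inner_left, neg_neg]
  ring

namespace GradedHamiltonian

variable (H : GradedHamiltonian ι)

/-- A graded Hamiltonian is essentially self-adjoint on the span of the basis vectors. -/
theorem existsUnique_isEvolution [Countable ι] :
    ∃! U, IsEvolution (fun j i => H.row i j) U := by
  choose u hu0 hun hu using fun v => H.exists_isWeakSol v
  have huniq : ∀ (w : ℝ → Hl2 ι) (M : ℝ), IsWeakSol H.row Set.univ w → (∀ t, ‖w t‖ ≤ M) →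
      ∀ t, w t = u (w 0) t := fun w M hw hM t =>
    H.eq_of_isWeakSol hw (hu (w 0)) (M := max M ‖w 0‖) (fun s => (hM s).trans (le_max_left _ _))
      (fun s => (hun _ s).le.trans (le_max_right _ _)) (hu0 _).symm t
  have hadd : ∀ v w t, u (v + w) t = u v t + u w t := by
    intro v w t
    have := huniq (fun t => u v t + u w t) (‖v‖ + ‖w‖) ((hu v).add (hu w)) (fun s =>
      (norm_add_le _ _).trans (by rw [hun, hun])) t
    simp only [hu0] at this
    exact this.symm
  have hsmul : ∀ (c : ℂ) v t, u (c • v) t = c • u v t := by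
    intro c v t
    have := huniq (fun t => c • u v t) (‖c‖ * ‖v‖) ((hu v).smul c) (fun s => by
      rw [norm_smul, hun]) t
    simp only [hu0] at this
    exact this.symm
  let U : ℝ → Op ι := fun t => LinearMap.mkContinuous
    { toFun := fun v => u v t
      map_add' := fun v w => hadd v w t
      map_smul' := fun c v => hsmul c v t } 1 fun v => by
      rw [one_mul]; exact (hun v t).le
  have hUapp : ∀ t v, U t v = u v t := fun t v => rfl
  have hUzero : U 0 = 1 := by ext1 v; exact hu0 v
  have hUadd : ∀ s t, U (s + t) = U s * U t := by
    intro s t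
    ext1 v
    change u v (s + t) = u (u v t) s
    have := huniq (fun s => u v (s + t)) ‖v‖ ((hu v).comp_add t) (fun s => (hun _ _).le) s
    simpa only [zero_add] using this
  have hcoord : ∀ v j, Continuous fun t => u v t j := fun v j =>
    continuous_iff_continuousAt.2 fun t => (hu v j (Set.mem_univ _) t).continuousAt
  have hiso : ∀ t, star (U t) * U t = 1 := by
    intro t
    rw [ContinuousLinearMap.star_eq_adjoint]
    exact (ContinuousLinearMap.norm_map_iff_adjoint_comp_self (U t)).1 fun v => hun v t
  have hinv : ∀ t, U t * U (-t) = 1 := fun t => by rw [← hUadd, add_neg_cancel, hUzero]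
  have hstar : ∀ t, star (U t) = U (-t) := fun t => by
    calc star (U t) = star (U t) * (U t * U (-t)) := by rw [hinv, mul_one]
      _ = U (-t) := by rw [← mul_assoc, hiso, one_mul]
  have hgroup : IsUnitaryGroup U := by
    refine ⟨hUzero, hUadd, fun t => ?_, fun v => ?_⟩
    · rw [Unitary.mem_iff]
      refine ⟨hiso t, ?_⟩
      rw [hstar, hinv]
    · exact continuous_of_coord_of_norm (fun t => hun v t) (hcoord v)
  have hev : IsEvolution (fun j i => H.row i j) U := by
    refine ⟨hgroup.zero, hgroup.add, hgroup.isUnitary, hgroup.strongly_continuous, fun i =>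
      ⟨H.row i, fun j => rfl, ?_⟩⟩
    have hc : Continuous fun s => -(Complex.I • U s (H.row i)) :=
      ((hgroup.strongly_continuous (H.row i)).const_smul Complex.I).neg
    set Y : ℝ → Hl2 ι := fun t => ket i + ∫ s in (0 : ℝ)..t, -(Complex.I • U s (H.row i)) with hY
    have hYd : ∀ t, HasDerivAt Y (-(Complex.I • U t (H.row i))) t := fun t =>
      (intervalIntegral.integral_hasDerivAt_right (hc.intervalIntegrable 0 t)
        hc.aestronglyMeasurable.stronglyMeasurableAtFilter hc.continuousAt).const_add _
    have hYU : ∀ t, U t (ket i) = Y t := by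
      intro t
      ext j
      have h1 : ∀ s, HasDerivAt (fun s => U s (ket i) j)
          (-(Complex.I * inner ℂ (ket j) (U s (H.row i)))) s := by
        intro s
        have e1 : ∀ s, U s (ket i) j = (starRingEnd ℂ) (u (ket j) (-s) i) := fun s => by
          rw [← inner_ket, ← inner_ket, inner_conj_symm, ← hUapp, hgroup.inner_left, neg_neg]
        simp only [e1]
        have h2 : HasDerivAt (fun s => u (ket j) (-s) i)
            (-(-(Complex.I * inner ℂ (H.row i) (u (ket j) (-s))))) s :=
          HasDerivAt.scomp s (hu (ket j) i (Set.mem_univ _) (-s)) (hasDerivAt_neg s) |>.congr_deriv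
            (by simp)
        have h3 := h2.star
        refine h3.congr_deriv ?_
        change (starRingEnd ℂ) _ = _
        rw [neg_neg, map_mul, Complex.conj_I, inner_conj_symm, ← hUapp, hgroup.inner_left, neg_neg]
        ring
      have h2 : ∀ s, HasDerivAt (fun s => Y s j)
          (-(Complex.I * inner ℂ (ket j) (U s (H.row i)))) s := by
        intro s
        have h3 := (hasDerivAt_const s (ket j : Hl2 ι)).inner ℂ (hYd s)
        simp only [inner_ket] at h3
        refine h3.congr_deriv ?_
        rw [inner_zero_left, add_zero, inner_ket]
        rfl
      have h3 := is_const_of_deriv_eq_zero (f := fun s => U s (ket i) j - Y s j)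
        (fun s => ((h1 s).sub (h2 s)).differentiableAt)
        (fun s => (((h1 s).sub (h2 s)).deriv).trans (sub_self _)) t 0
      have h4 : Y 0 = ket i := by simp [hY]
      simp only [h4, hUzero] at h3
      rw [← sub_eq_zero, h3]
      exact sub_self _
    have h0 := hYd 0
    simp only [hUzero] at h0
    exact h0.congr_of_eventuallyEq (Eventually.of_forall hYU)
  refine ⟨U, hev, fun V hV => ?_⟩
  funext t
  ext1 v
  have h1 := huniq (fun t => V t v) ‖v‖ (hV.isWeakSol v)
    (fun s => (hV.isUnitaryGroup.norm_apply s v).le) t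
  simp only [hV.zero] at h1
  exact h1

/-- Duhamel's formula in differential form, for a bounded perturbation `B` of the generator of
`U₀`. -/
theorem hasDerivAt_interaction [Countable ι] {r : ι → Hl2 ι} {U₀ U : ℝ → Op ι} {B : Op ι}
    (hU₀ : IsEvolution (fun j i => r i j) U₀) (hU : IsEvolution (fun j i => H.row i j) U)
    (hB : star B = B) (hrow : ∀ j, H.row j = r j + B (ket j)) (v : Hl2 ι) (t : ℝ) :
    HasDerivAt (fun t => U₀ (-t) (U t v)) (-(Complex.I • U₀ (-t) (B (U t v)))) t := by
  have hg := hU₀.isUnitaryGroup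
  obtain ⟨u, y, hy0, hu0, huy, hn, hy, hw⟩ := hg.exists_perturbation hU₀.hasDerivAt_neg hB v
  rw [show (fun j => r j + B (ket j)) = H.row from funext fun j => (hrow j).symm] at hw
  have h1 : ∀ t, U t v = u t := fun t =>
    H.eq_of_isWeakSol (hU.isWeakSol v) hw (fun s => (hU.isUnitaryGroup.norm_apply s v).le)
      (fun s => (hn s).le) (by rw [hU.zero, hu0]; rfl) t
  have h2 : ∀ t, U₀ (-t) (U t v) = y t := fun t => by
    rw [h1, huy, hg.neg_apply_apply]
  simp only [h2]
  rw [h1]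
  exact hy t

end GradedHamiltonian

end Evolution

/-! ### The finite-volume Hamiltonian -/

section SchurTest

variable {ι : Type*}

/-- A Schur test: a kernel `b c` with `ℓ²`-bounded rows of `b` and columns of `c` is bounded. -/
theorem exists_op_of_rows_cols {b c : ι → ι → ℂ} {B : ℝ}
    (hb : ∀ i, ∃ s ≤ B, HasSum (fun j => ‖b i j‖ ^ 2) s)
    (hc : ∀ j (F : Finset ι), ∑ i ∈ F, ‖c i j‖ ^ 2 ≤ 1) :
    ∃ A : Op ι, ∀ i j, kern A i j = b i j * c i j := by
  have hc1 : ∀ i j, ‖c i j‖ ^ 2 ≤ 1 := fun i j => by simpa using hc j {i}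
  have hcv : ∀ (v : Hl2 ι) i, Summable fun j => ‖c i j‖ ^ 2 * ‖v j‖ ^ 2 := fun v i =>
    Summable.of_nonneg_of_le (fun j => by positivity)
      (fun j => mul_le_of_le_one_left (by positivity) (hc1 i j)) (hasSum_norm_sq v).summable
  have hcs : ∀ (v : Hl2 ι) i, Summable (fun j => b i j * c i j * v j) ∧
      ‖∑' j, b i j * c i j * v j‖ ^ 2 ≤ B * ∑' j, ‖c i j‖ ^ 2 * ‖v j‖ ^ 2 := by
    intro v i
    obtain ⟨s, hs, hsum⟩ := hb i
    have h0 : 0 ≤ s := hsum.nonneg fun j => by positivity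
    have h1 : ∀ F : Finset ι, ∑ j ∈ F, ‖b i j * c i j * v j‖ ≤
        √(B * ∑' j, ‖c i j‖ ^ 2 * ‖v j‖ ^ 2) := by
      intro F
      refine Real.le_sqrt_of_sq_le ?_
      simp only [norm_mul, mul_assoc]
      refine (Finset.sum_mul_sq_le_sq_mul_sq _ _ _).trans ?_
      simp only [mul_pow]
      have e1 := sum_le_hasSum F (fun _ _ => by positivity) hsum
      have e2 := (hcv v i).sum_le_tsum F (fun _ _ => by positivity)
      have e3 : 0 ≤ ∑ j ∈ F, ‖b i j‖ ^ 2 := Finset.sum_nonneg fun _ _ => by positivity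
      have e4 : 0 ≤ ∑ j ∈ F, ‖c i j‖ ^ 2 * ‖v j‖ ^ 2 := Finset.sum_nonneg fun _ _ => by positivity
      exact mul_le_mul (e1.trans hs) e2 e4 (h0.trans hs)
    have h2 : Summable fun j => ‖b i j * c i j * v j‖ :=
      summable_of_sum_le (fun _ => norm_nonneg _) h1
    refine ⟨h2.of_norm, ?_⟩
    have h3 : ‖∑' j, b i j * c i j * v j‖ ≤ √(B * ∑' j, ‖c i j‖ ^ 2 * ‖v j‖ ^ 2) :=
      (norm_tsum_le_tsum_norm h2).trans (Real.tsum_le_of_sum_le (fun _ => norm_nonneg _) h1)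
    have h4 : 0 ≤ B * ∑' j, ‖c i j‖ ^ 2 * ‖v j‖ ^ 2 :=
      mul_nonneg (h0.trans hs) (tsum_nonneg fun _ => by positivity)
    calc _ ≤ √(B * ∑' j, ‖c i j‖ ^ 2 * ‖v j‖ ^ 2) ^ 2 := by gcongr
      _ = _ := Real.sq_sqrt h4
  have hF : ∀ (v : Hl2 ι) (F : Finset ι),
      ∑ i ∈ F, ‖∑' j, b i j * c i j * v j‖ ^ 2 ≤ |B| * ‖v‖ ^ 2 := by
    intro v F
    have e1 : ∑ i ∈ F, ∑' j, ‖c i j‖ ^ 2 * ‖v j‖ ^ 2 ≤ ‖v‖ ^ 2 := by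
      rw [← (Summable.tsum_finsetSum fun i _ => hcv v i), ← (hasSum_norm_sq v).tsum_eq]
      refine (summable_sum fun i _ => hcv v i).tsum_le_tsum (fun j => ?_)
        (hasSum_norm_sq v).summable
      rw [← Finset.sum_mul]
      exact mul_le_of_le_one_left (by positivity) (hc j F)
    calc _ ≤ ∑ i ∈ F, |B| * ∑' j, ‖c i j‖ ^ 2 * ‖v j‖ ^ 2 :=
          Finset.sum_le_sum fun i _ => (hcs v i).2.trans
            (mul_le_mul_of_nonneg_right (le_abs_self B) (tsum_nonneg fun _ => by positivity))
      _ ≤ _ := by rw [← Finset.mul_sum]; gcongr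
  have hmem : ∀ v : Hl2 ι, Memℓp (fun i => ∑' j, b i j * c i j * v j) 2 := fun v => by
    refine memℓp_gen ?_
    simp only [ENNReal.toReal_ofNat, Real.rpow_two]
    exact summable_of_sum_le (fun _ => by positivity) (hF v)
  let A : Op ι := LinearMap.mkContinuous
    { toFun := fun v => ⟨_, hmem v⟩
      map_add' := fun v w => by
        ext i
        change ∑' j, b i j * c i j * (v j + w j) = (∑' j, b i j * c i j * v j) + _
        simp only [mul_add]
        exact (hcs v i).1.tsum_add (hcs w i).1
      map_smul' := fun a v => by
        ext i
        change ∑' j, b i j * c i j * (a * v j) = a * ∑' j, b i j * c i j * v j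
        rw [← tsum_mul_left]
        exact tsum_congr fun j => by ring } (√|B|) fun v => by
      refine abs_le_of_sq_le_sq' ?_ (by positivity) |>.2
      rw [mul_pow, Real.sq_sqrt (abs_nonneg B), ← (hasSum_norm_sq _).tsum_eq]
      exact Real.tsum_le_of_sum_le (fun _ => by positivity) (hF v)
  classical
  refine ⟨A, fun i j => ?_⟩
  change ∑' k, b i k * c i k * (ket j : Hl2 ι) k = _
  rw [tsum_eq_single j]
  · simp [ket_apply]
  · intro k hk
    simp [ket_apply, hk]

end SchurTest

section Hopping

variable {α β : Type*}

open Classical in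
theorem exists_hopOp (x z : α) : ∃ A : Op (α × β), ∀ a b,
    kern A a b = if a.1 = x ∧ b.1 = z ∧ a.2 = b.2 then 1 else 0 := by
  have h : ∀ a b : α × β, (if a.1 = x ∧ b.1 = z ∧ a.2 = b.2 then (1 : ℂ) else 0) =
      (if b = (z, a.2) then 1 else 0) * (if a = (x, b.2) then 1 else 0) := by
    rintro ⟨a, m⟩ ⟨b, n⟩
    by_cases h1 : a = x <;> by_cases h2 : b = z <;> by_cases h3 : m = n <;>
      simp [h1, h2, h3]
  simp only [h]
  refine exists_op_of_rows_cols (B := 1) (fun i => ⟨1, le_rfl, ?_⟩) fun j F => ?_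
  · convert hasSum_ite_eq (z, i.2) (1 : ℝ) using 2 with j
    split_ifs <;> simp
  · have : ∀ i ∈ F, ‖(if i = (x, j.2) then (1 : ℂ) else 0)‖ ^ 2 =
        if i = (x, j.2) then 1 else 0 := fun i _ => by split_ifs <;> simp
    rw [Finset.sum_congr rfl this, Finset.sum_ite_eq']
    split_ifs <;> simp

/-- The hopping operator `|x⟩⟨z| ⊗ 1` on `ℓ²(α) ⊗ ℓ²(β)`. -/
def hopOp (x z : α) : Op (α × β) := (exists_hopOp x z).choose

open Classical in
theorem kern_hopOp (x z : α) (a b : α × β) :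
    kern (hopOp x z) a b = if a.1 = x ∧ b.1 = z ∧ a.2 = b.2 then 1 else 0 :=
  (exists_hopOp x z).choose_spec a b

open Classical in
theorem hopOp_apply (x z : α) (v : Hl2 (α × β)) (a : α × β) :
    hopOp x z v a = if a.1 = x then v (z, a.2) else 0 := by
  refine (hasSum_kern_apply (hopOp x z) v a).unique ?_
  convert hasSum_single (z, a.2) ?_ using 1
  · rw [kern_hopOp]
    by_cases h : a.1 = x <;> simp [h]
  · rintro ⟨y, m⟩ h
    rw [kern_hopOp, if_neg, zero_mul]
    rintro ⟨-, h2, h3⟩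
    exact h (Prod.ext h2 h3.symm)

theorem hopOp_mul_same (x z y : α) : (hopOp x z * hopOp z y : Op (α × β)) = hopOp x y := by
  classical
  ext v a
  change hopOp x z (hopOp z y v) a = _
  simp only [hopOp_apply, if_true]

theorem hopOp_mul_of_ne {z z' : α} (h : z ≠ z') (x y : α) :
    (hopOp x z * hopOp z' y : Op (α × β)) = 0 := by
  classical
  ext v a
  change hopOp x z (hopOp z' y v) a = 0
  simp only [hopOp_apply, if_neg h, ite_self]

theorem star_hopOp (x z : α) : star (hopOp x z : Op (α × β)) = hopOp z x := by
  classical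
  refine op_ext fun a b => ?_
  rw [kern_star, kern_hopOp, kern_hopOp]
  by_cases h : b.1 = x ∧ a.1 = z ∧ b.2 = a.2
  · rw [if_pos h, if_pos ⟨h.2.1, h.1, h.2.2.symm⟩, map_one]
  · rw [if_neg h, if_neg fun h' => h ⟨h'.2.1, h'.1, h'.2.2.symm⟩, map_zero]

theorem norm_hopOp_le (x z : α) : ‖(hopOp x z : Op (α × β))‖ ≤ 1 := by
  have h1 : ∀ y : α, ‖(hopOp y y : Op (α × β))‖ ≤ 1 := fun y => by
    have h := CStarRing.norm_star_mul_self (x := (hopOp y y : Op (α × β)))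
    rw [star_hopOp, hopOp_mul_same] at h
    by_contra hc
    nlinarith
  have h := CStarRing.norm_star_mul_self (x := (hopOp x z : Op (α × β)))
  rw [star_hopOp, hopOp_mul_same] at h
  nlinarith [h1 z, norm_nonneg (hopOp x z : Op (α × β))]

theorem sum_hopOp_self [Fintype α] : ∑ x, (hopOp x x : Op (α × β)) = 1 := by
  classical
  refine op_ext fun a b => ?_
  simp only [kern_sum, kern_hopOp]
  change _ = (ket b : Hl2 (α × β)) a
  rw [ket_apply]
  by_cases h : a = b
  · subst h; simp
  · rw [if_neg h]
    refine Finset.sum_eq_zero fun x _ => if_neg ?_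
    rintro ⟨h1, h2, h3⟩
    exact h (Prod.ext (h1.trans h2.symm) h3)

/-- The operator `M ⊗ 1` for a matrix `M`. -/
def siteOp [Fintype α] (M : α → α → ℂ) : Op (α × β) := ∑ x, ∑ z, M x z • hopOp x z

open Classical in
theorem kern_siteOp [Fintype α] (M : α → α → ℂ) (a b : α × β) :
    kern (siteOp M) a b = if a.2 = b.2 then M a.1 b.1 else 0 := by
  simp only [siteOp, kern_sum, kern_smul, kern_hopOp]
  rw [Finset.sum_eq_single a.1, Finset.sum_eq_single b.1]
  · by_cases h : a.2 = b.2 <;> simp [h]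
  · intro z _ hz
    rw [if_neg fun h => hz h.2.1.symm, mul_zero]
  · simp
  · intro x _ hx
    refine Finset.sum_eq_zero fun z _ => ?_
    rw [if_neg fun h => hx h.1.symm, mul_zero]
  · simp

theorem star_siteOp [Fintype α] {M : α → α → ℂ} (hM : ∀ x z, (starRingEnd ℂ) (M z x) = M x z) :
    star (siteOp M : Op (α × β)) = siteOp M := by
  classical
  refine op_ext fun a b => ?_
  rw [kern_star, kern_siteOp, kern_siteOp]
  by_cases h : a.2 = b.2
  · rw [if_pos h, if_pos h.symm, hM]
  · rw [if_neg h, if_neg (Ne.symm h), map_zero]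

end Hopping

section Hamiltonian

variable {d N : ℕ}

/-- The number of bosons. -/
def bosonNumber (n : Occ d N) : ℕ := n.sum fun _ c => c

theorem bosonNumber_add_single (n : Occ d N) (p : Mode d N) :
    bosonNumber (n + Finsupp.single p 1) = bosonNumber n + 1 := by
  classical
  rw [bosonNumber, Finsupp.sum_add_index' (fun _ => rfl) (fun _ _ _ => rfl),
    Finsupp.sum_single_index rfl]
  rfl

theorem sum_le_bosonNumber (n : Occ d N) (K : Finset (Mode d N)) : ∑ p ∈ K, n p ≤ bosonNumber n := by
  classical
  rw [bosonNumber, Finsupp.sum]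
  calc ∑ p ∈ K, n p = ∑ p ∈ K ∩ n.support, n p := by
        refine (Finset.sum_subset Finset.inter_subset_left fun p hp hp' => ?_).symm
        by_contra h
        exact hp' (Finset.mem_inter.2 ⟨hp, Finsupp.mem_support_iff.2 h⟩)
    _ ≤ _ := Finset.sum_le_sum_of_subset Finset.inter_subset_right

/-- Addition of a boson to the reservoir at the site of the particle. -/
def addBoson (a : TotalIdx d N) (k : ZLat d) : TotalIdx d N :=
  (a.1, a.2 + Finsupp.single (a.1, k) 1)

theorem addBoson_injective (a : TotalIdx d N) : Function.Injective (addBoson a) := by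
  classical
  intro k k' h
  have h1 := congrArg Prod.snd h
  simp only [addBoson, add_right_inj] at h1
  have h2 := (Finsupp.single_left_inj one_ne_zero).1 h1
  exact congrArg Prod.snd h2

theorem addBoson_injective_left (k : ZLat d) :
    Function.Injective fun a : TotalIdx d N => addBoson a k := by
  rintro ⟨x, m⟩ ⟨y, n⟩ h
  simp only [addBoson, Prod.mk.injEq] at h
  obtain ⟨rfl, h⟩ := h
  rw [add_left_inj] at h
  rw [h]

theorem exists_annihilation {φ : EuclideanSpace ℝ (Fin d) → ℂ}
    (hφ : Summable fun k : ZLat d => ‖finForm φ N k‖ ^ 2) :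
    ∃ R : Op (TotalIdx d N), ∀ a b, kern R a b =
      Function.extend (addBoson a) (finForm φ N) 0 b *
      Function.extend (addBoson a) (fun k => ((√((a.2 (a.1, k) : ℝ) + 1) /
        √((bosonNumber a.2 : ℝ) + 1) : ℝ) : ℂ)) 0 b := by
  classical
  refine exists_op_of_rows_cols (B := ∑' k, ‖finForm φ N k‖ ^ 2) (fun a => ⟨_, le_rfl, ?_⟩)
    fun b F => ?_
  · have h := (hasSum_extend_zero (addBoson_injective a)).2 hφ.hasSum
    refine h.congr_fun fun b => ?_
    by_cases hb : ∃ k, addBoson a k = b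
    · obtain ⟨k, rfl⟩ := hb
      rw [(addBoson_injective a).extend_apply, (addBoson_injective a).extend_apply]
    · rw [Function.extend_apply' _ _ _ hb, Function.extend_apply' _ _ _ hb]
      simp
  · -- each `a` contributes the fraction `n_k / |n|` of the bosons in the mode `k` added to `a`
    have h1 : ∀ a ∈ F, ‖Function.extend (addBoson a) (fun k => ((√((a.2 (a.1, k) : ℝ) + 1) /
        √((bosonNumber a.2 : ℝ) + 1) : ℝ) : ℂ)) 0 b‖ ^ 2 ≤
        ∑ p ∈ b.2.support, if addBoson a p.2 = b ∧ p.1 = b.1 then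
          (b.2 p : ℝ) / bosonNumber b.2 else 0 := by
      intro a _
      by_cases hb : ∃ k, addBoson a k = b
      · obtain ⟨k, rfl⟩ := hb
        rw [(addBoson_injective a).extend_apply, Complex.norm_real, Real.norm_eq_abs, sq_abs,
          div_pow, Real.sq_sqrt (by positivity), Real.sq_sqrt (by positivity)]
        have hmem : ((a.1, k) : Mode d N) ∈ (addBoson a k).2.support := by
          simp [addBoson]
        refine le_trans (le_of_eq ?_)
          (Finset.single_le_sum (fun p _ => ?_) hmem)
        · rw [if_pos ⟨rfl, rfl⟩]
          simp [addBoson, bosonNumber_add_single]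
        · split_ifs <;> positivity
      · rw [Function.extend_apply' _ _ _ hb]
        simp only [Pi.zero_apply, norm_zero, ne_eq, OfNat.ofNat_ne_zero, not_false_eq_true,
          zero_pow]
        exact Finset.sum_nonneg fun p _ => by split_ifs <;> positivity
    refine (Finset.sum_le_sum h1).trans ?_
    rw [Finset.sum_comm]
    have h2 : ∀ p ∈ b.2.support, (∑ a ∈ F, if addBoson a p.2 = b ∧ p.1 = b.1 then
        (b.2 p : ℝ) / bosonNumber b.2 else 0) ≤ (b.2 p : ℝ) / bosonNumber b.2 := by
      intro p _
      rw [← Finset.sum_filter, Finset.sum_const, nsmul_eq_mul]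
      refine mul_le_of_le_one_left (by positivity) ?_
      norm_cast
      refine Finset.card_le_one.2 fun a ha a' ha' => ?_
      rw [Finset.mem_filter] at ha ha'
      exact addBoson_injective_left p.2 (ha.2.1.trans ha'.2.1.symm)
    refine (Finset.sum_le_sum h2).trans ?_
    rw [← Finset.sum_div]
    refine div_le_one_of_le₀ ?_ (by positivity)
    exact_mod_cast sum_le_bosonNumber b.2 _

/-- The normalized annihilation operator `∑ₓ |x⟩⟨x| ⊗ aₓ(φ) 𝒩^{-1/2}`. -/
def annihilation {φ : EuclideanSpace ℝ (Fin d) → ℂ}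
    (hφ : Summable fun k : ZLat d => ‖finForm φ N k‖ ^ 2) : Op (TotalIdx d N) :=
  (exists_annihilation hφ).choose

theorem kern_annihilation_addBoson {φ : EuclideanSpace ℝ (Fin d) → ℂ}
    (hφ : Summable fun k : ZLat d => ‖finForm φ N k‖ ^ 2) (a : TotalIdx d N) (k : ZLat d) :
    kern (annihilation hφ) a (addBoson a k) =
      finForm φ N k * ((√((a.2 (a.1, k) : ℝ) + 1) / √((bosonNumber a.2 : ℝ) + 1) : ℝ) : ℂ) := by
  rw [annihilation, (exists_annihilation hφ).choose_spec, (addBoson_injective a).extend_apply,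
    (addBoson_injective a).extend_apply]

theorem kern_annihilation_eq_zero {φ : EuclideanSpace ℝ (Fin d) → ℂ}
    (hφ : Summable fun k : ZLat d => ‖finForm φ N k‖ ^ 2) {a b : TotalIdx d N}
    (h : ¬ ∃ k, addBoson a k = b) : kern (annihilation hφ) a b = 0 := by
  rw [annihilation, (exists_annihilation hφ).choose_spec, Function.extend_apply' _ _ _ h]
  simp

theorem conj_hopping {d : ℕ} (ε : (Fin d → ℝ) → ℝ) (x : ZLat d) :
    (starRingEnd ℂ) (hopping ε x) = hopping ε (-x) := by
  rw [hopping, hopping, map_mul, ← integral_conj]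
  congr 1
  · rw [map_inv₀, map_pow, map_mul, Complex.conj_ofReal, Complex.conj_ofNat]
  · congr 1
    funext k
    rw [map_mul, ← Complex.exp_conj, map_mul, Complex.conj_I, Complex.conj_ofReal,
      Complex.conj_ofReal]
    congr 2
    simp

/-- The hopping operator `T ⊗ 1` in finite volume. -/
def boxHopping (ε : (Fin d → ℝ) → ℝ) : Op (TotalIdx d N) :=
  siteOp fun x z : Site d N => hopping ε (x.1 - z.1)

theorem star_boxHopping (ε : (Fin d → ℝ) → ℝ) :
    star (boxHopping ε : Op (TotalIdx d N)) = boxHopping ε :=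
  star_siteOp fun x z => by rw [conj_hopping, neg_sub]

/-- The finite-volume Hamiltonian, graded by the boson number. -/
def gradedHamiltonian (lam : ℝ) (χ : Fin d → ℝ) (ε : (Fin d → ℝ) → ℝ)
    {φ : EuclideanSpace ℝ (Fin d) → ℂ} (hφ : Summable fun k : ZLat d => ‖finForm φ N k‖ ^ 2) :
    GradedHamiltonian (TotalIdx d N) where
  grade a := bosonNumber a.2
  D a := -(lam ^ 2 * ∑ i, χ i * (a.1.1 i : ℝ)) + resEnergy a.2
  T := boxHopping ε
  R := (lam : ℂ) • annihilation hφ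
  star_T := star_boxHopping ε
  T_grade a b h := by
    classical
    rw [boxHopping, kern_siteOp] at h
    by_contra h'
    exact h (if_neg fun e => h' (by rw [e]))
  R_grade a b h := by
    rw [kern_smul] at h
    by_cases h' : ∃ k, addBoson a k = b
    · obtain ⟨k, rfl⟩ := h'
      exact bosonNumber_add_single _ _
    · rw [kern_annihilation_eq_zero hφ h', mul_zero] at h
      exact absurd rfl h

theorem hasSum_annihElem {φ : EuclideanSpace ℝ (Fin d) → ℂ}
    (hφ : Summable fun k : ZLat d => ‖finForm φ N k‖ ^ 2) (x : Site d N) (m n : Occ d N) :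
    HasSum (fun k => finForm φ N k * annihElem (x, k) m n)
      (√(bosonNumber n : ℝ) * kern (annihilation hφ) (x, m) (x, n)) := by
  classical
  by_cases h : ∃ k, addBoson (x, m) k = (x, n)
  · obtain ⟨k, hk⟩ := h
    have hn : n = m + Finsupp.single (x, k) 1 := (congrArg Prod.snd hk).symm
    rw [← hk, kern_annihilation_addBoson]
    convert hasSum_single k ?_ using 1
    · rw [annihElem, if_pos hn, hn, bosonNumber_add_single]
      have h0 : √((bosonNumber m : ℝ) + 1) ≠ 0 := (Real.sqrt_pos.2 (by positivity)).ne'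
      have h0' : ((√((bosonNumber m : ℝ) + 1) : ℝ) : ℂ) ≠ 0 := by exact_mod_cast h0
      simp only [Finsupp.add_apply, Finsupp.single_eq_same]
      push_cast
      field_simp
    · intro k' hk'
      rw [annihElem, if_neg, mul_zero]
      intro h'
      exact hk' (addBoson_injective (x, m) (by rw [hk, addBoson, ← h']))
  · rw [kern_annihilation_eq_zero hφ h, mul_zero]
    convert hasSum_zero with k
    rw [annihElem, if_neg, mul_zero]
    intro h'
    exact h ⟨k, by rw [addBoson, h']⟩

theorem createElem_eq (p : Mode d N) (m n : Occ d N) : createElem p m n = annihElem p n m := by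
  classical
  rw [createElem, annihElem]
  split_ifs with h
  · simp [h]
  · rfl

theorem conj_annihElem (p : Mode d N) (m n : Occ d N) :
    (starRingEnd ℂ) (annihElem p m n) = annihElem p m n := by
  classical
  rw [annihElem]
  split_ifs <;> simp

theorem fieldElem_eq {φ : EuclideanSpace ℝ (Fin d) → ℂ}
    (hφ : Summable fun k : ZLat d => ‖finForm φ N k‖ ^ 2) (x : Site d N) (m n : Occ d N) :
    fieldElem φ N x m n = √(bosonNumber n : ℝ) * kern (annihilation hφ) (x, m) (x, n) +
      √(bosonNumber m : ℝ) * (starRingEnd ℂ) (kern (annihilation hφ) (x, n) (x, m)) := by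
  have h1 := hasSum_annihElem hφ x m n
  have h2 := (hasSum_annihElem hφ x n m).star
  have h3 := h1.add h2
  rw [fieldElem]
  convert h3.tsum_eq using 1
  · refine tsum_congr fun k => ?_
    change _ = _ + (starRingEnd ℂ) _
    rw [map_mul, conj_annihElem, createElem_eq]
  · congr 1
    change _ = (starRingEnd ℂ) _
    rw [map_mul, Complex.conj_ofReal]

theorem gradedHamiltonian_row (lam : ℝ) (χ : Fin d → ℝ) (ε : (Fin d → ℝ) → ℝ)
    {φ : EuclideanSpace ℝ (Fin d) → ℂ} (hφ : Summable fun k : ZLat d => ‖finForm φ N k‖ ^ 2)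
    (a b : TotalIdx d N) :
    (gradedHamiltonian lam χ ε hφ).row b a = hamiltonian lam χ ε φ N a b := by
  classical
  have h1 : (gradedHamiltonian lam χ ε hφ).row b a =
      ((-(lam ^ 2 * ∑ i, χ i * (b.1.1 i : ℝ)) + resEnergy b.2 : ℝ) : ℂ) * (ket b : Hl2 _) a +
      kern (boxHopping ε) a b +
      ((√((bosonNumber b.2 : ℝ) + 1) : ℝ) : ℂ) * kern (star ((lam : ℂ) • annihilation hφ)) a b +
      ((√(bosonNumber b.2 : ℝ) : ℝ) : ℂ) * kern ((lam : ℂ) • annihilation hφ) a b := rfl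
  rw [h1, kern_star, kern_smul, kern_smul, map_mul, Complex.conj_ofReal, boxHopping, kern_siteOp,
    ket_apply, hamiltonian]
  obtain ⟨x, m⟩ := a
  obtain ⟨y, n⟩ := b
  have h2 : ((if ((x, m) : TotalIdx d N) = (y, n) then
      ((-(lam ^ 2 * ∑ i, χ i * (x.1 i : ℝ)) + resEnergy m : ℝ) : ℂ) else 0)) =
      ((-(lam ^ 2 * ∑ i, χ i * (y.1 i : ℝ)) + resEnergy n : ℝ) : ℂ) *
        (if ((x, m) : TotalIdx d N) = (y, n) then 1 else 0) := by
    split_ifs with h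
    · rw [Prod.mk.injEq] at h
      rw [h.1, h.2, mul_one]
    · rw [mul_zero]
  have h3 : (if x = y then (lam : ℂ) * fieldElem φ N x m n else 0) =
      ((√((bosonNumber n : ℝ) + 1) : ℝ) : ℂ) *
        (lam * (starRingEnd ℂ) (kern (annihilation hφ) (y, n) (x, m))) +
      ((√(bosonNumber n : ℝ) : ℝ) : ℂ) * (lam * kern (annihilation hφ) (x, m) (y, n)) := by
    split_ifs with h
    · subst h
      rw [fieldElem_eq hφ]
      by_cases h' : ∃ k, addBoson (x, n) k = (x, m)
      · obtain ⟨k, hk⟩ := h'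
        have hm : m = n + Finsupp.single (x, k) 1 := (congrArg Prod.snd hk).symm
        have hb : (bosonNumber m : ℝ) = bosonNumber n + 1 := by
          rw [hm, bosonNumber_add_single]; push_cast; rfl
        rw [hb]
        ring
      · rw [kern_annihilation_eq_zero hφ h', map_zero]
        ring
    · rw [kern_annihilation_eq_zero, kern_annihilation_eq_zero]
      · simp
      · rintro ⟨k, hk⟩
        exact h (congrArg Prod.fst hk)
      · rintro ⟨k, hk⟩
        exact h (congrArg Prod.fst hk).symm
  simp only [h2, h3]
  ring

theorem hamiltonian_eq_row (lam : ℝ) (χ : Fin d → ℝ) (ε : (Fin d → ℝ) → ℝ)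
    {φ : EuclideanSpace ℝ (Fin d) → ℂ} (hφ : Summable fun k : ZLat d => ‖finForm φ N k‖ ^ 2) :
    hamiltonian lam χ ε φ N = fun a b => (gradedHamiltonian lam χ ε hφ).row b a := by
  funext a b
  exact (gradedHamiltonian_row lam χ ε hφ a b).symm

theorem existsUnique_evolution (lam : ℝ) (χ : Fin d → ℝ) (ε : (Fin d → ℝ) → ℝ)
    {φ : EuclideanSpace ℝ (Fin d) → ℂ} (hφ : Summable fun k : ZLat d => ‖finForm φ N k‖ ^ 2) :
    ∃! U, IsEvolution (hamiltonian lam χ ε φ N) U := by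
  rw [hamiltonian_eq_row lam χ ε hφ]
  exact (gradedHamiltonian lam χ ε hφ).existsUnique_isEvolution

theorem isEvolution_evolution (lam : ℝ) (χ : Fin d → ℝ) (ε : (Fin d → ℝ) → ℝ)
    {φ : EuclideanSpace ℝ (Fin d) → ℂ} (hφ : Summable fun k : ZLat d => ‖finForm φ N k‖ ^ 2) :
    IsEvolution (hamiltonian lam χ ε φ N) (evolution (hamiltonian lam χ ε φ N)) := by
  have h := (existsUnique_evolution lam χ ε hφ).exists
  rw [evolution, dif_pos h]
  exact h.choose_spec

end Hamiltonian

/-! ### Exponential decay of the hopping amplitudes -/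

section Lattice

variable {d : ℕ}

theorem latNorm_nonneg (x : ZLat d) : 0 ≤ latNorm x := Real.sqrt_nonneg _

theorem latNorm_eq_norm (x : ZLat d) :
    latNorm x = ‖(WithLp.toLp 2 fun i => (x i : ℝ) : EuclideanSpace ℝ (Fin d))‖ := by
  rw [EuclideanSpace.norm_eq, latNorm]
  simp

theorem latNorm_add_le (x y : ZLat d) : latNorm (x + y) ≤ latNorm x + latNorm y := by
  rw [latNorm_eq_norm, latNorm_eq_norm, latNorm_eq_norm]
  refine le_trans (le_of_eq ?_) (norm_add_le _ _)
  congr 1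
  ext i
  simp

theorem latNorm_le_add_sub (x y : ZLat d) : latNorm x ≤ latNorm y + latNorm (x - y) := by
  simpa using latNorm_add_le y (x - y)

theorem abs_le_latNorm (x : ZLat d) (i : Fin d) : |(x i : ℝ)| ≤ latNorm x := by
  refine Real.abs_le_sqrt ?_
  exact Finset.single_le_sum (f := fun i => (x i : ℝ) ^ 2) (fun _ _ => sq_nonneg _)
    (Finset.mem_univ i)

theorem latNorm_le_sum (x : ZLat d) : latNorm x ≤ ∑ i, |(x i : ℝ)| := by
  refine Real.sqrt_le_iff.2 ⟨Finset.sum_nonneg fun _ _ => abs_nonneg _, ?_⟩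
  refine le_trans (le_of_eq ?_) (Finset.sum_sq_le_sq_sum_of_nonneg fun i _ => abs_nonneg (x i : ℝ))
  simp

theorem summable_exp_neg_abs {ν : ℝ} (hν : 0 < ν) : Summable fun n : ℤ => Real.exp (-ν * |(n : ℝ)|) := by
  have h : Summable fun n : ℕ => Real.exp (-ν * (n : ℝ)) := by
    have := Real.summable_exp_nat_mul_iff.2 (neg_lt_zero.2 hν)
    simpa [mul_comm] using this
  refine Summable.of_nat_of_neg ?_ ?_
  · simpa using h
  · simpa using h

theorem summable_exp_latNorm (d : ℕ) {ν : ℝ} (hν : 0 < ν) :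
    Summable fun x : ZLat d => Real.exp (-ν * latNorm x) := by
  have hμ : 0 < ν / (d + 1) := by positivity
  set μ := ν / (d + 1) with hμdef
  have h1 : ∀ x : ZLat d, Real.exp (-ν * latNorm x) ≤ ∏ i, Real.exp (-μ * |(x i : ℝ)|) := by
    intro x
    rw [← Real.exp_sum, Real.exp_le_exp, ← Finset.mul_sum]
    have h2 : ∑ i, |(x i : ℝ)| ≤ d * latNorm x := by
      calc ∑ i, |(x i : ℝ)| ≤ ∑ _i : Fin d, latNorm x := Finset.sum_le_sum fun i _ => abs_le_latNorm x i
        _ = _ := by simp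
    have h3 : ν = μ * (d + 1) := by rw [hμdef]; field_simp
    have h4 := latNorm_nonneg x
    rw [h3]
    nlinarith [mul_nonneg hμ.le h4, mul_le_mul_of_nonneg_left h2 hμ.le]
  refine Summable.of_nonneg_of_le (fun _ => (Real.exp_pos _).le) h1 ?_
  have hs := summable_exp_neg_abs hμ
  refine summable_of_sum_le (c := ∏ _i : Fin d, ∑' n : ℤ, Real.exp (-μ * |(n : ℝ)|))
    (fun x => Finset.prod_nonneg fun _ _ => (Real.exp_pos _).le) fun F => ?_
  classical
  have hF : F ⊆ Fintype.piFinset fun i => F.image fun x => x i := by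
    intro x hx
    exact Fintype.mem_piFinset.2 fun i => Finset.mem_image_of_mem _ hx
  refine (Finset.sum_le_sum_of_subset_of_nonneg hF fun x _ _ =>
    Finset.prod_nonneg fun _ _ => (Real.exp_pos _).le).trans ?_
  rw [← Finset.prod_univ_sum (fun i => F.image fun x => x i) fun _ n => Real.exp (-μ * |((n : ℤ) : ℝ)|)]
  exact Finset.prod_le_prod (fun i _ => Finset.sum_nonneg fun _ _ => (Real.exp_pos _).le)
    fun i _ => hs.sum_le_tsum _ fun _ _ => (Real.exp_pos _).le

end Lattice

section HoppingDecay

/-- Shift of the contour of integration over a period. -/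
theorem integral_shift_of_periodic {g : ℂ → ℂ} {a b σ : ℝ}
    (hg : DifferentiableOn ℂ g {z | |z.im| ≤ |σ|})
    (hper : ∀ z : ℂ, |z.im| ≤ |σ| → z.re = a → g (z + ((b - a : ℝ) : ℂ)) = g z) :
    ∫ t in a..b, g t = ∫ t in a..b, g (t + σ * Complex.I) := by
  have h := Complex.integral_boundary_rect_eq_zero_of_differentiableOn g (a : ℂ) (b + σ * Complex.I)
    (hg.mono fun z hz => by
      have h2 : z.im ∈ Set.uIcc 0 σ := by simpa using hz.2
      rw [Set.mem_ofPred_eq]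
      rw [Set.mem_uIcc] at h2
      rcases h2 with h2 | h2
      · rw [abs_of_nonneg h2.1]; exact h2.2.trans (le_abs_self σ)
      · rw [abs_of_nonpos h2.2]; exact (neg_le_neg h2.1).trans (neg_le_abs σ))
  simp only [Complex.ofReal_re, Complex.ofReal_im, Complex.add_re, Complex.mul_re, Complex.I_re,
    Complex.add_im, Complex.mul_im, Complex.I_im, mul_zero, mul_one, zero_mul, add_zero, zero_add,
    sub_zero, Complex.ofReal_zero] at h
  have h3 : ∫ y in (0 : ℝ)..σ, g (b + y * Complex.I) = ∫ y in (0 : ℝ)..σ, g (a + y * Complex.I) := by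
    refine intervalIntegral.integral_congr fun y hy => ?_
    have hy' : |y| ≤ |σ| := by
      rw [Set.mem_uIcc] at hy
      rcases hy with h2 | h2
      · rw [abs_of_nonneg h2.1]; exact h2.2.trans (le_abs_self σ)
      · rw [abs_of_nonpos h2.2]; exact (neg_le_neg h2.1).trans (neg_le_abs σ)
    have := hper (a + y * Complex.I) (by simpa using hy') (by simp)
    simp only [← this]
    congr 1
    push_cast
    ring
  rw [h3] at h
  have h4 : (∫ t in a..b, g t) - ∫ t in a..b, g (t + σ * Complex.I) = 0 := by
    rw [← h]; ring
  exact sub_eq_zero.1 h4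

theorem setIntegral_Icc_insertNth {n : ℕ} (i : Fin (n + 1)) {F : (Fin (n + 1) → ℝ) → ℂ}
    {a b : ℝ} (hab : a ≤ b) (hF : IntegrableOn F (Set.Icc (fun _ => a) fun _ => b)) :
    ∫ k in Set.Icc (fun _ : Fin (n + 1) => a) (fun _ => b), F k =
      ∫ k in Set.Icc (fun _ : Fin n => a) (fun _ => b), ∫ t in a..b, F (i.insertNth t k) := by
  have hmp := volume_preserving_piFinSuccAbove (fun _ : Fin (n + 1) => ℝ) i
  set e := MeasurableEquiv.piFinSuccAbove (fun _ : Fin (n + 1) => ℝ) i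
  have hpre : Set.Icc (fun _ : Fin (n + 1) => a) (fun _ => b) =
      e ⁻¹' (Set.Icc a b ×ˢ Set.Icc (fun _ : Fin n => a) (fun _ => b)) := by
    ext k
    simp only [Set.mem_Icc, Pi.le_def, Set.mem_preimage, Set.mem_prod]
    constructor
    · rintro ⟨h1, h2⟩
      exact ⟨⟨h1 _, h2 _⟩, fun j => h1 _, fun j => h2 _⟩
    · rintro ⟨h1, h2, h3⟩
      constructor
      · intro j
        rcases Fin.eq_self_or_eq_succAbove i j with rfl | ⟨j, rfl⟩
        exacts [h1.1, h2 j]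
      · intro j
        rcases Fin.eq_self_or_eq_succAbove i j with rfl | ⟨j, rfl⟩
        exacts [h1.2, h3 j]
  have hF' : IntegrableOn (fun p : ℝ × (Fin n → ℝ) => F (i.insertNth p.1 p.2))
      (Set.Icc a b ×ˢ Set.Icc (fun _ : Fin n => a) (fun _ => b)) := by
    rw [← hmp.integrableOn_comp_preimage e.measurableEmbedding, ← hpre]
    refine hF.congr_fun (fun k _ => ?_) measurableSet_Icc
    exact congrArg F (e.symm_apply_apply k).symm
  have h1 := hmp.setIntegral_preimage_emb e.measurableEmbedding
    (fun p : ℝ × (Fin n → ℝ) => F (i.insertNth p.1 p.2))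
    (Set.Icc a b ×ˢ Set.Icc (fun _ : Fin n => a) (fun _ => b))
  rw [← hpre] at h1
  calc _ = _ := setIntegral_congr_fun measurableSet_Icc
        fun k _ => congrArg F (e.symm_apply_apply k).symm
    _ = _ := h1
    _ = _ := by
      rw [Measure.volume_eq_prod] at hF' ⊢
      rw [← setIntegral_prod_swap, setIntegral_prod]
      · refine setIntegral_congr_fun measurableSet_Icc fun k _ => ?_
        rw [intervalIntegral.integral_of_le hab, integral_Icc_eq_integral_Ioc]
        rfl
      · exact hF'.swap

/-- A point of the box, complexified and shifted by `iσ` in the direction `i`. -/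
def shiftedPoint {d : ℕ} (i : Fin d) (σ : ℝ) (k : Fin d → ℝ) : Fin d → ℂ :=
  fun j => (k j : ℂ) + (Pi.single i (σ * Complex.I) : Fin d → ℂ) j

theorem continuous_shiftedPoint {d : ℕ} (i : Fin d) (σ : ℝ) : Continuous (shiftedPoint i σ) := by
  unfold shiftedPoint
  fun_prop

theorem shiftedPoint_mem_strip {d : ℕ} (i : Fin d) {σ δ : ℝ} (hσ : |σ| ≤ |δ|) (k : Fin d → ℝ) :
    shiftedPoint i σ k ∈ strip d δ := by
  change ∑ j, (shiftedPoint i σ k j).im ^ 2 ≤ δ ^ 2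
  rw [Finset.sum_eq_single i]
  · simpa [shiftedPoint] using sq_le_sq.2 hσ
  · intro j _ hj
    simp [shiftedPoint, hj]
  · simp

theorem norm_hopping_le_exp_mul {d : ℕ} {ε : (Fin d → ℝ) → ℝ} {δ : ℝ} {f : (Fin d → ℂ) → ℂ}
    (hf : AnalyticOnNhd ℂ f (strip d δ))
    (hper : ∀ z ∈ strip d δ, ∀ i, f (z + Pi.single i (2 * Real.pi : ℂ)) = f z)
    (hfε : ∀ k : Fin d → ℝ, f (fun i => (k i : ℂ)) = ε k) (i : Fin d) {σ : ℝ} (hσ : |σ| ≤ |δ|) :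
    ∃ M, ∀ x : ZLat d, ‖hopping ε x‖ ≤ M * Real.exp (-(σ * x i)) := by
  cases d with
  | zero => exact i.elim0
  | succ n =>
  have hcont : ∀ σ' : ℝ, |σ'| ≤ |δ| → Continuous fun k => f (shiftedPoint i σ' k) := fun σ' h =>
    continuousOn_univ.1 (hf.continuousOn.comp (continuous_shiftedPoint i σ').continuousOn
      fun k _ => shiftedPoint_mem_strip i h k)
  obtain ⟨M, hM⟩ := (isCompact_Icc (a := fun _ : Fin (n + 1) => -Real.pi)
    (b := fun _ => Real.pi)).exists_bound_of_continuousOn (hcont σ hσ).continuousOn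
  have hpi : -Real.pi ≤ Real.pi := by linarith [Real.pi_pos]
  have hreal : ∀ k : Fin (n + 1) → ℝ, shiftedPoint i 0 k = fun j => (k j : ℂ) := by
    intro k; funext j; simp [shiftedPoint]
  set B := Set.Icc (fun _ : Fin n => -Real.pi) fun _ => Real.pi with hB
  refine ⟨‖((2 * Real.pi : ℂ) ^ (n + 1))⁻¹‖ * (M * (2 * Real.pi) * volume.real B), fun x => ?_⟩
  -- the integrand, as a function on the strip
  set Φ : (Fin (n + 1) → ℂ) → ℂ := fun z => f z * Complex.exp (Complex.I * ∑ j, z j * (x j : ℂ))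
    with hΦ
  have hΦc : Continuous fun k : Fin (n + 1) → ℝ => Φ fun j => (k j : ℂ) := by
    have h0 := hcont 0 (by simp)
    simp only [hreal] at h0
    refine h0.mul (Complex.continuous_exp.comp ?_)
    fun_prop
  have h1 : hopping ε x = ((2 * Real.pi : ℂ) ^ (n + 1))⁻¹ *
      ∫ k in B, ∫ t in -Real.pi..Real.pi, Φ fun j => ((i.insertNth t k : Fin (n + 1) → ℝ) j : ℂ) := by
    rw [hopping, ← setIntegral_Icc_insertNth i hpi (hΦc.continuousOn.integrableOn_compact isCompact_Icc)]
    congr 2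
    funext k
    rw [hΦ]
    simp only [hfε]
    congr 3
    push_cast
    rfl
  have hins : ∀ (z : ℂ) (k : Fin n → ℝ), |z.im| ≤ |δ| →
      (i.insertNth z (fun j => (k j : ℂ)) : Fin (n + 1) → ℂ) ∈ strip (n + 1) δ := by
    intro z k hz
    change ∑ j, ((i.insertNth z (fun j => (k j : ℂ)) : Fin (n + 1) → ℂ) j).im ^ 2 ≤ δ ^ 2
    rw [Fin.sum_univ_succAbove _ i]
    simpa using sq_le_sq.2 hz
  have h2 : ∀ k ∈ B, ‖∫ t in -Real.pi..Real.pi,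
      Φ fun j => ((i.insertNth t k : Fin (n + 1) → ℝ) j : ℂ)‖ ≤
        M * (2 * Real.pi) * Real.exp (-(σ * x i)) := by
    intro k hk
    set g : ℂ → ℂ := fun z => Φ (i.insertNth z fun j => (k j : ℂ)) with hg
    have hgt : ∀ t : ℝ, Φ (fun j => ((i.insertNth t k : Fin (n + 1) → ℝ) j : ℂ)) = g t := by
      intro t
      rw [hg]
      congr 1
      funext j
      refine Fin.succAboveCases i ?_ (fun j => ?_) j <;> simp
    simp only [hgt]
    rw [integral_shift_of_periodic (σ := σ)]
    · refine (intervalIntegral.norm_integral_le_of_norm_le_const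
        (C := M * Real.exp (-(σ * x i))) fun t ht => ?_).trans (le_of_eq ?_)
      · rw [Set.uIoc_of_le hpi] at ht
        have hpt : (i.insertNth ((t : ℂ) + σ * Complex.I) fun j => (k j : ℂ) : Fin (n + 1) → ℂ) =
            shiftedPoint i σ (i.insertNth t k) := by
          funext j
          refine Fin.succAboveCases i ?_ (fun j => ?_) j <;> simp [shiftedPoint]
        rw [hg]
        simp only [hpt, hΦ]
        rw [norm_mul]
        refine mul_le_mul (hM _ ?_) (le_of_eq ?_) (norm_nonneg _) ?_
        · constructor
          · intro j
            refine Fin.succAboveCases i ?_ (fun j => ?_) j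
            · simpa using ht.1.le
            · simpa using hk.1 j
          · intro j
            refine Fin.succAboveCases i ?_ (fun j => ?_) j
            · simpa using ht.2
            · simpa using hk.2 j
        · rw [Complex.norm_exp]
          congr 1
          simp only [Complex.mul_re, Complex.I_re, zero_mul, Complex.I_im, one_mul, zero_sub,
            Complex.im_sum, Complex.mul_im, Complex.intCast_im, mul_zero, Complex.intCast_re,
            zero_add]
          rw [Finset.sum_eq_single i]
          · simp [shiftedPoint]
          · intro j _ hj
            simp [shiftedPoint, hj]
          · simp
        · exact (norm_nonneg _).trans (hM 0 ⟨fun _ => by simpa using Real.pi_pos.le, fun _ => Real.pi_pos.le⟩)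
      · rw [sub_neg_eq_add, abs_of_nonneg (by positivity)]
        ring
    · intro z hz
      refine DifferentiableAt.differentiableWithinAt ?_
      have hz' : |z.im| ≤ |δ| := le_trans hz hσ
      have h4 : DifferentiableAt ℂ (fun z : ℂ => (i.insertNth z fun j => (k j : ℂ) :
          Fin (n + 1) → ℂ)) z := by
        rw [differentiableAt_pi]
        intro j
        refine Fin.succAboveCases i ?_ (fun j => ?_) j <;> simp
      refine DifferentiableAt.mul ?_ ?_
      · exact (hf _ (hins z k hz')).differentiableAt.comp z h4
      · refine DifferentiableAt.cexp ?_
        rw [differentiableAt_pi] at h4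
        refine DifferentiableAt.const_mul ?_ _
        exact DifferentiableAt.fun_sum fun j _ => (h4 j).mul_const _
    · intro z hz _
      have hz' : |z.im| ≤ |δ| := le_trans hz hσ
      have hpt : (i.insertNth (z + ((Real.pi - -Real.pi : ℝ) : ℂ)) fun j => (k j : ℂ) :
          Fin (n + 1) → ℂ) = (i.insertNth z fun j => (k j : ℂ) : Fin (n + 1) → ℂ) +
            Pi.single i (2 * Real.pi : ℂ) := by
        funext j
        refine Fin.succAboveCases i ?_ (fun j => ?_) j
        · simp [two_mul]
        · simp
      rw [hg]
      simp only [hpt, hΦ]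
      rw [hper _ (hins z k hz')]
      congr 1
      have hsum : ∑ j, ((i.insertNth z fun j => (k j : ℂ) : Fin (n + 1) → ℂ) +
          (Pi.single i (2 * Real.pi : ℂ) : Fin (n + 1) → ℂ)) j * (x j : ℂ) =
          ∑ j, (i.insertNth z (fun j => (k j : ℂ)) : Fin (n + 1) → ℂ) j * (x j : ℂ) +
            2 * Real.pi * x i := by
        simp only [Pi.add_apply, add_mul, Finset.sum_add_distrib]
        congr 1
        rw [Finset.sum_eq_single i]
        · simp
        · intro j _ hj
          simp [hj]
        · simp
      rw [hsum, mul_add, Complex.exp_add]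
      have h5 : Complex.exp (Complex.I * (2 * Real.pi * x i)) = 1 := by
        rw [Complex.exp_eq_one_iff]
        exact ⟨x i, by ring⟩
      rw [h5, mul_one]
  rw [h1, norm_mul, mul_assoc]
  refine mul_le_mul_of_nonneg_left ?_ (norm_nonneg _)
  refine (norm_setIntegral_le_of_norm_le_const (isCompact_Icc.measure_lt_top) h2).trans
    (le_of_eq ?_)
  ring

/-- The hopping amplitudes decay exponentially (Paley-Wiener). -/
theorem exists_norm_hopping_le {d : ℕ} (hd : 1 ≤ d) {ε : (Fin d → ℝ) → ℝ}
    (hε : AnalyticDispersion ε) :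
    ∃ C, ∃ μ > 0, ∀ x : ZLat d, ‖hopping ε x‖ ≤ C * Real.exp (-μ * latNorm x) := by
  obtain ⟨δ, hδ, f, hf, hper, hfε⟩ := hε
  choose M hM using fun i => norm_hopping_le_exp_mul hf hper hfε i (σ := δ) le_rfl
  choose M' hM' using fun i => norm_hopping_le_exp_mul hf hper hfε i (σ := -δ) (by rw [abs_neg])
  have hd' : (0 : ℝ) < d := by exact_mod_cast hd
  refine ⟨∑ i, (|M i| + |M' i|), δ / d, by positivity, fun x => ?_⟩
  have : Nonempty (Fin d) := ⟨⟨0, hd⟩⟩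
  obtain ⟨i, -, hi⟩ := Finset.exists_max_image Finset.univ (fun i => |(x i : ℝ)|)
    Finset.univ_nonempty
  have h1 : latNorm x ≤ d * |(x i : ℝ)| := by
    refine (latNorm_le_sum x).trans ((Finset.sum_le_sum fun j _ => hi j (Finset.mem_univ j)).trans ?_)
    simp
  have h2 : ‖hopping ε x‖ ≤ (|M i| + |M' i|) * Real.exp (-(δ * |(x i : ℝ)|)) := by
    rcases le_total 0 (x i : ℝ) with h | h
    · rw [abs_of_nonneg h]
      exact (hM i x).trans (mul_le_mul_of_nonneg_right
        ((le_abs_self _).trans (le_add_of_nonneg_right (abs_nonneg _))) (Real.exp_pos _).le)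
    · rw [abs_of_nonpos h, mul_neg, ← neg_mul]
      exact (hM' i x).trans (mul_le_mul_of_nonneg_right
        ((le_abs_self _).trans (le_add_of_nonneg_left (abs_nonneg _))) (Real.exp_pos _).le)
  refine h2.trans (mul_le_mul ?_ ?_ (Real.exp_pos _).le (Finset.sum_nonneg fun _ _ => by positivity))
  · exact Finset.single_le_sum (f := fun i => |M i| + |M' i|) (fun _ _ => by positivity)
      (Finset.mem_univ i)
  · rw [Real.exp_le_exp, neg_mul, neg_le_neg_iff, div_mul_eq_mul_div, div_le_iff₀ hd']
    calc δ * latNorm x ≤ δ * (d * |(x i : ℝ)|) := mul_le_mul_of_nonneg_left h1 hδ.le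
      _ = _ := by ring

end HoppingDecay

/-! ### Sums of products over occupation numbers -/

section FinsuppProd

variable {P : Type*} {𝕜 : Type*} [NormedField 𝕜]

theorem norm_finsupp_prod (g : P → ℕ → 𝕜) (n : P →₀ ℕ) :
    ‖n.prod g‖ = n.prod fun p k => ‖g p k‖ := by
  rw [Finsupp.prod, Finsupp.prod, norm_prod]

theorem hasSum_finsupp_prod_of_support_subset [CompleteSpace 𝕜] {g : P → ℕ → 𝕜} (h0 : ∀ p, g p 0 = 1)
    (hs : ∀ p, Summable fun k => ‖g p k‖) (K : Finset P) :
    (Summable fun n : {n : P →₀ ℕ // n.support ⊆ K} => ‖n.1.prod g‖) ∧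
      HasSum (fun n : {n : P →₀ ℕ // n.support ⊆ K} => n.1.prod g) (∏ p ∈ K, ∑' k, g p k) := by
  classical
  induction K using Finset.induction_on with
  | empty =>
    let _ : Unique {n : P →₀ ℕ // n.support ⊆ ∅} :=
      ⟨⟨⟨0, by simp⟩⟩, fun n => Subtype.ext (by simpa using n.2)⟩
    refine ⟨(hasSum_fintype _).summable, ?_⟩
    convert hasSum_fintype _
    rw [Fintype.sum_unique, Finset.prod_empty]
    have : (default : {n : P →₀ ℕ // n.support ⊆ ∅}).1 = 0 := by
      simpa using (default : {n : P →₀ ℕ // n.support ⊆ ∅}).2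
    rw [this, Finsupp.prod_zero_index]
  | insert p K hp ih =>
    have hnp : ∀ n : {n : P →₀ ℕ // n.support ⊆ K}, n.1 p = 0 := fun n =>
      Finsupp.notMem_support_iff.1 fun h => hp (n.2 h)
    obtain ⟨e, he⟩ : ∃ e : {n : P →₀ ℕ // n.support ⊆ K} × ℕ ≃
        {n : P →₀ ℕ // n.support ⊆ insert p K}, ∀ q, (e q).1.prod g = q.1.1.prod g * g p q.2 := by
      let e : {n : P →₀ ℕ // n.support ⊆ K} × ℕ ≃ {n : P →₀ ℕ // n.support ⊆ insert p K} :=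
        { toFun := fun q => ⟨q.1.1 + Finsupp.single p q.2, fun r hr => by
            by_cases hrp : r = p
            · rw [hrp]; exact Finset.mem_insert_self _ _
            · refine Finset.mem_insert_of_mem (q.1.2 ?_)
              simpa [Finsupp.single_apply, Ne.symm hrp] using hr⟩
          invFun := fun m => (⟨m.1.erase p, fun r hr => by
            rw [Finsupp.support_erase, Finset.mem_erase] at hr
            exact (Finset.mem_insert.1 (m.2 hr.2)).resolve_left hr.1⟩, m.1 p)
          left_inv := fun q => by
            refine Prod.ext (Subtype.ext ?_) ?_
            · ext r
              by_cases hrp : r = p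
              · rw [hrp]; simp [hnp q.1]
              · simp [Finsupp.erase_ne hrp]
            · simp [hnp q.1]
          right_inv := fun m => Subtype.ext (Finsupp.erase_add_single p m.1) }
      refine ⟨e, fun q => ?_⟩
      change (q.1.1 + Finsupp.single p q.2).prod g = _
      rw [Finsupp.prod_add_index_of_disjoint, Finsupp.prod_single_index (h0 p)]
      refine Finset.disjoint_of_subset_left q.1.2 (Finset.disjoint_of_subset_right
        Finsupp.support_single_subset (Finset.disjoint_singleton_right.2 hp))
    have h1 : Summable fun q : {n : P →₀ ℕ // n.support ⊆ K} × ℕ => ‖q.1.1.prod g * g p q.2‖ :=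
      Summable.mul_norm (f := fun n : {n : P →₀ ℕ // n.support ⊆ K} => n.1.prod g) (g := g p)
        ih.1 (hs p)
    have h2 := ih.2.mul (hs p).of_norm.hasSum h1.of_norm
    rw [Finset.prod_insert hp, mul_comm]
    refine ⟨e.summable_iff.1 ?_, e.hasSum_iff.1 ?_⟩
    · simpa only [Function.comp_def, he] using h1
    · simpa only [Function.comp_def, he] using h2

theorem summable_finsupp_prod {g : P → ℕ → 𝕜} (h0 : ∀ p, g p 0 = 1) {c : P → ℝ}
    (hs : ∀ p, Summable fun k => ‖g p k‖) (hle : ∀ p, ∑' k, ‖g p k‖ ≤ Real.exp (c p))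
    (hc0 : ∀ p, 0 ≤ c p) (hc : Summable c) :
    (Summable fun n : P →₀ ℕ => ‖n.prod g‖) ∧ ∑' n : P →₀ ℕ, ‖n.prod g‖ ≤ Real.exp (∑' p, c p) := by
  classical
  have hF : ∀ F : Finset (P →₀ ℕ), ∑ n ∈ F, ‖n.prod g‖ ≤ Real.exp (∑' p, c p) := by
    intro F
    set K := F.biUnion fun n => n.support
    have h1 := hasSum_finsupp_prod_of_support_subset (g := fun p k => ‖g p k‖)
      (fun p => by rw [h0, norm_one]) (fun p => by simpa using hs p) K
    have h2 : ∑ n ∈ F, ‖n.prod g‖ ≤ ∏ p ∈ K, ∑' k, ‖g p k‖ := by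
      rw [← h1.2.tsum_eq, ← Finset.sum_subtype_of_mem
        (f := fun n : P →₀ ℕ => ‖n.prod g‖) (p := fun n => n.support ⊆ K)
        (fun n hn => Finset.subset_biUnion_of_mem (fun n : P →₀ ℕ => n.support) hn)]
      simp only [norm_finsupp_prod]
      exact h1.2.summable.sum_le_tsum _ fun n _ => Finset.prod_nonneg fun _ _ => norm_nonneg _
    refine h2.trans ((Finset.prod_le_prod (fun p _ => tsum_nonneg fun _ => norm_nonneg _)
      fun p _ => hle p).trans ?_)
    rw [← Real.exp_sum, Real.exp_le_exp]
    exact hc.sum_le_tsum _ fun p _ => hc0 p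
  exact ⟨summable_of_sum_le (fun _ => norm_nonneg _) hF,
    Real.tsum_le_of_sum_le (fun _ => norm_nonneg _) hF⟩

theorem tendsto_prod_tsum [CompleteSpace 𝕜] {g : P → ℕ → 𝕜} (h0 : ∀ p, g p 0 = 1)
    (hs : ∀ p, Summable fun k => ‖g p k‖) (hg : Summable fun n : P →₀ ℕ => ‖n.prod g‖) :
    Tendsto (fun K : Finset P => ∏ p ∈ K, ∑' k, g p k) atTop (𝓝 (∑' n : P →₀ ℕ, n.prod g)) := by
  classical
  have h1 : ∀ K : Finset P, ∏ p ∈ K, ∑' k, g p k =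
      ∑' n : P →₀ ℕ, Set.indicator {n | n.support ⊆ K} (fun n => n.prod g) n := by
    intro K
    rw [← (hasSum_finsupp_prod_of_support_subset h0 hs K).2.tsum_eq]
    exact tsum_subtype {n : P →₀ ℕ | n.support ⊆ K} fun n => n.prod g
  simp only [h1]
  refine tendsto_tsum_of_dominated_convergence hg (fun n => ?_) (Eventually.of_forall fun K n => ?_)
  · refine tendsto_const_nhds.congr' ?_
    filter_upwards [eventually_ge_atTop n.support] with K hK
    rw [Set.indicator_of_mem]
    exact hK
  · exact norm_indicator_le_norm_self _ _

end FinsuppProd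

/-! ### Matrix elements of displacement operators -/

section Circle

theorem integral_conj_pow_mul_pow (m n : ℕ) :
    ∫ θ : UnitAddCircle, (starRingEnd ℂ) (fourier 1 θ) ^ m * (fourier 1 θ : ℂ) ^ n =
      if m = n then 1 else 0 := by
  have h := orthonormal_iff_ite.mp (orthonormal_fourier (T := 1)) (m : ℤ) n
  rw [fourierLp, fourierLp, ContinuousMap.inner_toLp] at h
  rw [AddCircle.volume_eq_smul_haarAddCircle, ENNReal.ofReal_one, one_smul]
  simp only [Nat.cast_inj] at h
  rw [← h]
  congr 1
  funext θ
  rw [mul_comm]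
  simp only [fourier_apply, one_smul, natCast_zsmul, AddCircle.toCircle_nsmul, Circle.coe_pow,
    map_pow]

/-- The Laguerre polynomial `ℓ_n(y) = ∑_k (n choose k) (-y)^k / k!`. -/
def laguerre (n : ℕ) (y : ℝ) : ℝ := ∑ k ∈ Finset.range (n + 1), (n.choose k : ℝ) * (-y) ^ k / k.factorial

/-- The diagonal matrix elements of a displacement operator of one mode. -/
theorem integral_circle_displacement (n : ℕ) (b : ℂ) :
    ∫ θ : UnitAddCircle, (starRingEnd ℂ) (fourier 1 θ) ^ n *
      (Complex.exp (-((starRingEnd ℂ) b * fourier 1 θ)) * (fourier 1 θ + b) ^ n) =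
      (laguerre n (‖b‖ ^ 2) : ℂ) := by
  set z : UnitAddCircle → ℂ := fun θ => fourier 1 θ with hz
  have hzn : ∀ θ, ‖z θ‖ = 1 := fun θ => by
    rw [hz]; simp only [fourier_apply]; exact Circle.norm_coe _
  have hzc : Continuous z := (fourier 1).continuous
  set F : ℕ → UnitAddCircle → ℂ := fun k θ => (-(starRingEnd ℂ) b) ^ k / k.factorial *
    ((starRingEnd ℂ) (z θ) ^ n * (z θ ^ k * (z θ + b) ^ n)) with hF
  have hFc : ∀ k, Continuous (F k) := fun k =>
    continuous_const.mul (((Complex.continuous_conj.comp hzc).pow n).mul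
      ((hzc.pow k).mul ((hzc.add continuous_const).pow n)))
  have hFb : ∀ k θ, ‖F k θ‖ ≤ ‖b‖ ^ k / k.factorial * (1 + ‖b‖) ^ n := by
    intro k θ
    rw [hF]
    simp only [norm_mul, norm_div, norm_pow, norm_neg, RCLike.norm_conj, hzn, one_pow, one_mul,
      Complex.norm_natCast]
    refine mul_le_mul_of_nonneg_left (pow_le_pow_left₀ (norm_nonneg _) ?_ _) (by positivity)
    exact (norm_add_le _ _).trans (by rw [hzn])
  have hFi : ∀ k, Integrable (F k) := fun k =>
    (hFc k).integrable_of_hasCompactSupport (HasCompactSupport.of_compactSpace _)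
  have hint : ∀ k, ∫ θ, F k θ = if k ≤ n then
      (-(starRingEnd ℂ) b) ^ k / k.factorial * (b ^ k * n.choose k) else 0 := by
    intro k
    have h1 : ∀ θ, F k θ = ∑ j ∈ Finset.range (n + 1), (-(starRingEnd ℂ) b) ^ k / k.factorial *
        (b ^ (n - j) * n.choose j) * ((starRingEnd ℂ) (z θ) ^ n * z θ ^ (k + j)) := by
      intro θ
      rw [hF]
      simp only [add_pow, Finset.mul_sum]
      refine Finset.sum_congr rfl fun j _ => ?_
      rw [pow_add]; ring
    simp only [h1]
    rw [integral_finsetSum]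
    · simp only [integral_const_mul, hz, integral_conj_pow_mul_pow]
      split_ifs with hk
      · rw [Finset.sum_eq_single (n - k)]
        · rw [if_pos (by omega), mul_one, Nat.choose_symm hk]
          congr 3; omega
        · intro j hj hj'
          rw [if_neg, mul_zero]
          rw [Finset.mem_range] at hj
          omega
        · intro h; rw [Finset.mem_range] at h; omega
      · refine Finset.sum_eq_zero fun j hj => ?_
        rw [if_neg (by omega), mul_zero]
    · intro j _
      refine Integrable.const_mul ?_ _
      exact (((Complex.continuous_conj.comp hzc).pow n).mul (hzc.pow _)).integrable_of_hasCompactSupport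
        (HasCompactSupport.of_compactSpace _)
  have hsum : Summable fun k => ∫ θ, ‖F k θ‖ := by
    refine Summable.of_nonneg_of_le (fun k => integral_nonneg fun _ => norm_nonneg _) (fun k => ?_)
      ((Real.summable_pow_div_factorial ‖b‖).mul_right ((1 + ‖b‖) ^ n))
    refine (integral_mono (hFi k).norm (integrable_const _) (hFb k)).trans ?_
    have h1 : volume.real (Set.univ : Set UnitAddCircle) = 1 := by
      rw [Measure.real, UnitAddCircle.measure_univ, ENNReal.toReal_one]
    rw [integral_const, h1, one_smul]
  have h2 := hasSum_integral_of_summable_integral_norm hFi hsum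
  have h3 : ∀ θ, ∑' k, F k θ = (starRingEnd ℂ) (z θ) ^ n *
      (Complex.exp (-((starRingEnd ℂ) b * z θ)) * (z θ + b) ^ n) := by
    intro θ
    have h4 := (NormedSpace.expSeries_div_hasSum_exp (-((starRingEnd ℂ) b * z θ))).mul_left
      ((starRingEnd ℂ) (z θ) ^ n * (z θ + b) ^ n)
    rw [← Complex.exp_eq_exp_ℂ] at h4
    rw [mul_comm (Complex.exp _), ← mul_assoc, ← h4.tsum_eq]
    refine tsum_congr fun k => ?_
    rw [hF]
    simp only [← neg_mul, mul_pow]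
    ring
  simp only [h3] at h2
  rw [← h2.tsum_eq, tsum_eq_sum (s := Finset.range (n + 1))]
  · rw [laguerre]
    push_cast
    refine Finset.sum_congr rfl fun k hk => ?_
    rw [hint, if_pos (by rw [Finset.mem_range] at hk; omega)]
    have h5 : (-((‖b‖ : ℂ) ^ 2)) ^ k = (-(starRingEnd ℂ) b) ^ k * b ^ k := by
      rw [← mul_pow, neg_mul, Complex.conj_mul']
    rw [h5]; ring
  · intro k hk
    rw [hint, if_neg (by rw [Finset.mem_range] at hk; omega)]

theorem abs_laguerre_le (n : ℕ) {y : ℝ} (hy : 0 ≤ y) : |laguerre n y| ≤ laguerre n (-y) := by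
  rw [laguerre, laguerre]
  refine (Finset.abs_sum_le_sum_abs _ _).trans (Finset.sum_le_sum fun k _ => ?_)
  rw [abs_div, abs_mul, abs_pow, abs_neg, abs_of_nonneg hy, neg_neg, Nat.abs_cast, Nat.abs_cast]

/-- The generating function of the Laguerre polynomials. -/
theorem hasSum_laguerre {x : ℝ} (hx : 0 ≤ x) (hx1 : x < 1) (y : ℝ) :
    HasSum (fun n => x ^ n * laguerre n y) ((1 - x)⁻¹ * Real.exp (-(y * (x / (1 - x))))) := by
  have hx' : 0 < 1 - x := by linarith
  have h1 : ∀ k : ℕ, HasSum (fun n : ℕ => (n.choose k : ℝ) * x ^ n) (x ^ k / (1 - x) ^ (k + 1)) := by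
    intro k
    have h := (hasSum_choose_mul_geometric_of_norm_lt_one k (r := x)
      (by rwa [Real.norm_of_nonneg hx])).mul_left (x ^ k)
    rw [← (add_left_injective k).hasSum_iff]
    · rw [div_eq_mul_one_div]
      refine h.congr_fun fun n => ?_
      simp only [Function.comp_apply, pow_add]; ring
    · intro n hn
      have : n < k := by
        by_contra h'
        exact hn ⟨n - k, by simp only; omega⟩
      rw [Nat.choose_eq_zero_of_lt this]; simp
  have h2 : ∀ y : ℝ, HasSum (fun k : ℕ => y ^ k / k.factorial * (x ^ k / (1 - x) ^ (k + 1)))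
      ((1 - x)⁻¹ * Real.exp (y * (x / (1 - x)))) := by
    intro y
    have h := (NormedSpace.expSeries_div_hasSum_exp (y * (x / (1 - x)))).mul_left (1 - x)⁻¹
    rw [← Real.exp_eq_exp_ℝ] at h
    refine h.congr_fun fun k => ?_
    rw [mul_pow, div_pow, pow_succ]
    field_simp
  have h3 : Summable fun p : ℕ × ℕ => (-y) ^ p.1 / p.1.factorial * ((p.2.choose p.1 : ℝ) * x ^ p.2) := by
    refine Summable.of_norm ?_
    rw [summable_prod_of_nonneg fun _ => norm_nonneg _]
    constructor
    · intro k
      simpa using ((h1 k).summable.mul_left ((-y) ^ k / k.factorial : ℝ)).norm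
    · have h4 := (h2 |y|).summable
      refine h4.congr fun k => ?_
      rw [← (h1 k).tsum_eq, ← tsum_mul_left]
      refine tsum_congr fun n => ?_
      simp only [norm_mul, norm_div, norm_pow, norm_neg, Real.norm_eq_abs, Nat.abs_cast,
        abs_of_nonneg hx]
  have h4 : HasSum (fun p : ℕ × ℕ => (-y) ^ p.1 / p.1.factorial * ((p.2.choose p.1 : ℝ) * x ^ p.2))
      ((1 - x)⁻¹ * Real.exp (-(y * (x / (1 - x))))) := by
    have h5 := h3.hasSum
    have h6 := h5.prod_fiberwise fun k => (h1 k).mul_left ((-y) ^ k / k.factorial : ℝ)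
    have h7 := h6.unique (h2 (-y))
    rw [h7, neg_mul] at h5
    exact h5
  have h5 := (Equiv.prodComm ℕ ℕ).hasSum_iff.2 h4
  have h6 := h5.prod_fiberwise (g := fun n => x ^ n * laguerre n y) fun n => by
    rw [laguerre, Finset.mul_sum]
    have := hasSum_sum_of_ne_finset_zero (L := .unconditional ℕ) (s := Finset.range (n + 1))
      (f := fun k : ℕ => (-y) ^ k / k.factorial * ((n.choose k : ℝ) * x ^ n)) fun k hk => by
        rw [Nat.choose_eq_zero_of_lt (by rw [Finset.mem_range] at hk; omega)]; simp
    have h7 : ∑ k ∈ Finset.range (n + 1), x ^ n * ((n.choose k : ℝ) * (-y) ^ k / k.factorial) =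
        ∑ k ∈ Finset.range (n + 1), (-y) ^ k / k.factorial * ((n.choose k : ℝ) * x ^ n) :=
      Finset.sum_congr rfl fun k _ => by ring
    rw [h7]
    exact this
  exact h6

section Displacement

variable {P : Type*}

/-- Amplitudes `α^n / √(n!)` of a coherent state, one factor for every mode. -/
def coherentFactor (α : P → ℂ) (p : P) (k : ℕ) : ℂ := α p ^ k / (√(k.factorial : ℝ) : ℝ)

theorem coherentFactor_zero (α : P → ℂ) (p : P) : coherentFactor α p 0 = 1 := by
  simp [coherentFactor]

/-- A vector `w` is determined by its inner products with coherent vectors: the coefficient of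
`α^n`, for `α` in the torus over the support of `n`, is a Fourier coefficient. -/
theorem eq_prod_laguerre_of_hasSum [Countable P] {w : (P →₀ ℕ) → ℂ} (n : P →₀ ℕ) (c : ℂ) (B : P → ℂ)
    {M : (P →₀ ℕ) → ℝ} (hM : Summable M)
    (hb : ∀ α : P → ℂ, (∀ p, ‖α p‖ ≤ 1) → (∀ p ∉ n.support, α p = 0) →
      ∀ m, ‖w m * m.prod (coherentFactor α)‖ ≤ M m)
    (h : ∀ α : P → ℂ, (∀ p ∉ n.support, α p = 0) →
      HasSum (fun m => w m * m.prod (coherentFactor α))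
      (c * (Complex.exp (-∑ p ∈ n.support, (starRingEnd ℂ) (B p) * α p) *
        n.prod (coherentFactor fun p => α p + B p)))) :
    w n = c * n.prod fun p k => (laguerre k (‖B p‖ ^ 2) : ℂ) := by
  classical
  set S := n.support with hS
  set z : UnitAddCircle → ℂ := fun θ => fourier 1 θ with hz
  have hzn : ∀ θ, ‖z θ‖ = 1 := fun θ => by
    rw [hz]; simp only [fourier_apply]; exact Circle.norm_coe _
  have hzc : Continuous z := (fourier 1).continuous
  -- the points of the torus, extended by zero
  set α : (S → UnitAddCircle) → P → ℂ := fun θ p => if hp : p ∈ S then z (θ ⟨p, hp⟩) else 0 with hα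
  have hαS : ∀ θ (p : S), α θ p = z (θ p) := fun θ p => by simp [hα]
  have hα0 : ∀ θ, ∀ p ∉ S, α θ p = 0 := fun θ p hp => by simp [hα, hp]
  have hα1 : ∀ θ p, ‖α θ p‖ ≤ 1 := fun θ p => by
    simp only [hα]; split_ifs
    · rw [hzn]
    · simp
  have hαc : ∀ p, Continuous fun θ => α θ p := fun p => by
    by_cases hp : p ∈ S
    · simp only [hα, hp, dite_true]; exact hzc.comp (continuous_apply _)
    · simp only [hα, hp, dite_false]; exact continuous_const
  set χ : (S → UnitAddCircle) → ℂ := fun θ => ∏ p : S, (starRingEnd ℂ) (z (θ p)) ^ n p with hχ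
  have hχc : Continuous χ := continuous_finsetProd _ fun p _ =>
    (Complex.continuous_conj.comp (hzc.comp (continuous_apply p))).pow _
  have hχn : ∀ θ, ‖χ θ‖ = 1 := fun θ => by simp [hχ, norm_prod, hzn]
  set F : (P →₀ ℕ) → (S → UnitAddCircle) → ℂ :=
    fun m θ => χ θ * (w m * m.prod (coherentFactor (α θ))) with hF
  have hFc : ∀ m, Continuous (F m) := fun m => hχc.mul (continuous_const.mul
    (continuous_finsetProd _ fun p _ => ((hαc p).pow _).div_const _))
  have hFi : ∀ m, Integrable (F m) := fun m =>
    (hFc m).integrable_of_hasCompactSupport (HasCompactSupport.of_compactSpace _)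
  have hvol : volume.real (Set.univ : Set (S → UnitAddCircle)) = 1 := by
    rw [Measure.real, volume_pi, Measure.pi_univ]
    simp
  have hsum : Summable fun m => ∫ θ, ‖F m θ‖ := by
    refine Summable.of_nonneg_of_le (fun k => integral_nonneg fun _ => norm_nonneg _) (fun m => ?_) hM
    refine (integral_mono (hFi m).norm (integrable_const (M m)) fun θ => ?_).trans ?_
    · rw [hF]
      simp only
      rw [norm_mul, hχn, one_mul]
      exact hb _ (hα1 θ) (hα0 θ) m
    · rw [integral_const, hvol, one_smul]
  have h1 := hasSum_integral_of_summable_integral_norm hFi hsum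
  -- only the term `m = n` survives
  have h2 : ∀ m, m ≠ n → ∫ θ, F m θ = 0 := by
    intro m hm
    by_cases hmS : m.support ⊆ S
    · have h3 : ∀ θ, F m θ = w m * ∏ p : S, ((starRingEnd ℂ) (z (θ p)) ^ n p * z (θ p) ^ m p *
          ((√((m p).factorial : ℝ) : ℝ) : ℂ)⁻¹) := by
        intro θ
        rw [hF]
        simp only
        rw [Finsupp.prod_of_support_subset m hmS _ fun p _ => coherentFactor_zero _ p,
          ← Finset.prod_coe_sort, hχ, mul_left_comm, ← Finset.prod_mul_distrib]
        congr 1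
        refine Finset.prod_congr rfl fun p _ => ?_
        rw [coherentFactor, hαS]
        ring
      simp only [h3]
      rw [integral_const_mul, integral_fintype_prod_volume_eq_prod (fun (p : S) (θ : UnitAddCircle) =>
        (starRingEnd ℂ) (z θ) ^ n p * z θ ^ m p * ((√((m p).factorial : ℝ) : ℝ) : ℂ)⁻¹)]
      obtain ⟨p, hp⟩ : ∃ p : S, n p ≠ m p := by
        by_contra! h'
        refine hm (Finsupp.ext fun p => ?_)
        by_cases hp : p ∈ S
        · exact (h' ⟨p, hp⟩).symm
        · rw [Finsupp.notMem_support_iff.1 hp, Finsupp.notMem_support_iff.1 fun h'' => hp (hmS h'')]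
      rw [Finset.prod_eq_zero (Finset.mem_univ p), mul_zero]
      rw [integral_mul_const, hz, integral_conj_pow_mul_pow, if_neg hp, zero_mul]
    · obtain ⟨p, hp, hpS⟩ := Finset.not_subset.1 hmS
      have h3 : ∀ θ, F m θ = 0 := by
        intro θ
        rw [hF]
        simp only
        rw [Finsupp.prod, Finset.prod_eq_zero hp, mul_zero, mul_zero]
        rw [coherentFactor, hα0 θ p hpS, zero_pow (Finsupp.mem_support_iff.1 hp), zero_div]
      simp [h3]
  have h3 : ∫ θ, F n θ = w n * ∏ p ∈ S, ((√((n p).factorial : ℝ) : ℝ) : ℂ)⁻¹ := by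
    have h4 : ∀ θ, F n θ = w n * ∏ p ∈ S, ((√((n p).factorial : ℝ) : ℝ) : ℂ)⁻¹ := by
      intro θ
      rw [hF]
      simp only
      rw [Finsupp.prod, ← hS, ← Finset.prod_coe_sort S, ← Finset.prod_coe_sort S, hχ, mul_left_comm,
        ← Finset.prod_mul_distrib]
      congr 1
      refine Finset.prod_congr rfl fun p _ => ?_
      rw [coherentFactor, hαS, div_eq_mul_inv, ← mul_assoc, ← mul_pow, Complex.conj_mul', hzn]
      simp
    simp only [h4]
    rw [integral_const, hvol, one_smul]
  have h4 := h1.unique (hasSum_single n h2)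
  -- the generating function factorizes over the modes
  have h5 : ∀ θ, ∑' m, F m θ = c * ∏ p : S, ((starRingEnd ℂ) (z (θ p)) ^ n p *
      (Complex.exp (-((starRingEnd ℂ) (B p) * z (θ p))) * (z (θ p) + B p) ^ n p) *
      ((√((n p).factorial : ℝ) : ℝ) : ℂ)⁻¹) := by
    intro θ
    rw [((h (α θ) (hα0 θ)).mul_left (χ θ)).tsum_eq, hχ, Finsupp.prod, ← hS,
      ← Finset.prod_coe_sort S, ← Finset.sum_neg_distrib, Complex.exp_sum, ← Finset.prod_coe_sort S,
      mul_left_comm, ← Finset.prod_mul_distrib, ← Finset.prod_mul_distrib]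
    congr 1
    refine Finset.prod_congr rfl fun p _ => ?_
    rw [coherentFactor, hαS]
    ring
  simp only [h5] at h4
  rw [integral_const_mul, integral_fintype_prod_volume_eq_prod (fun (p : S) (θ : UnitAddCircle) =>
      (starRingEnd ℂ) (z θ) ^ n p *
      (Complex.exp (-((starRingEnd ℂ) (B p) * z θ)) * (z θ + B p) ^ n p) *
      ((√((n p).factorial : ℝ) : ℝ) : ℂ)⁻¹), h3] at h4
  simp only [integral_mul_const, hz, integral_circle_displacement] at h4
  rw [Finset.prod_mul_distrib, ← mul_assoc, Finset.prod_coe_sort S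
    (fun p => ((√((n p).factorial : ℝ) : ℝ) : ℂ)⁻¹), Finset.prod_coe_sort S
    (fun p => (laguerre (n p) (‖B p‖ ^ 2) : ℂ))] at h4
  have h6 : ∏ p ∈ S, ((√((n p).factorial : ℝ) : ℝ) : ℂ)⁻¹ ≠ 0 := by
    refine Finset.prod_ne_zero_iff.2 fun p _ => inv_ne_zero ?_
    have := (Real.sqrt_pos.2 (Nat.cast_pos.2 (n p).factorial_pos)).ne'
    exact_mod_cast this
  exact (mul_right_cancel₀ h6 h4).symm

end Displacement

end Circle

/-! ### Coherent states and the free evolution -/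

section Coherent

variable {d N : ℕ}

theorem inv_bosonDispersion_le (k : ZLat d) : (bosonDispersion N k)⁻¹ ≤ (N : ℝ) + 1 := by
  classical
  by_cases hk : k = 0
  · rw [bosonDispersion, if_pos hk, hk]
    have : quasiMomentum N (0 : ZLat d) = 0 := by ext i; simp [quasiMomentum]
    rw [this]
    simp
  · rcases Nat.eq_zero_or_pos N with rfl | hN
    · have : quasiMomentum 0 k = 0 := by ext i; simp [quasiMomentum]
      rw [bosonDispersion, if_neg hk, this]
      simp
    · have hN' : (0 : ℝ) < N := by exact_mod_cast hN
      obtain ⟨i, hi⟩ : ∃ i, k i ≠ 0 := by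
        by_contra! h
        exact hk (funext h)
      have h1 : (1 : ℝ) ≤ |(k i : ℝ)| := by
        exact_mod_cast Int.one_le_abs hi
      have h2 : Real.pi / N ≤ ‖quasiMomentum N k‖ := by
        refine le_trans ?_ (PiLp.norm_apply_le _ i)
        change _ ≤ ‖2 * Real.pi / (2 * N : ℝ) * (k i : ℝ)‖
        rw [norm_mul, Real.norm_eq_abs, Real.norm_eq_abs, abs_of_pos (by positivity),
          mul_div_mul_left _ _ two_ne_zero]
        exact le_mul_of_one_le_right (by positivity) h1
      rw [bosonDispersion, if_neg hk, add_zero]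
      refine inv_le_of_inv_le₀ (by positivity) (le_trans ?_ h2)
      rw [← one_div, div_le_div_iff₀ (by positivity) hN']
      nlinarith [Real.pi_gt_three]

theorem bosonDispersion_nonneg (k : ZLat d) : 0 ≤ bosonDispersion N k := by
  rw [bosonDispersion]
  split_ifs <;> positivity

theorem bosonDispersion_pos (hN : 0 < N) (k : ZLat d) : 0 < bosonDispersion N k := by
  classical
  rw [bosonDispersion]
  split_ifs with hk
  · positivity
  · rw [add_zero, norm_pos_iff]
    intro h
    refine hk (funext fun i => ?_)
    have h1 : 2 * Real.pi / (2 * N : ℝ) * (k i : ℝ) = 0 :=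
      congrArg (fun v : EuclideanSpace ℝ (Fin d) => v i) h
    have hN' : (0 : ℝ) < N := by exact_mod_cast hN
    rcases mul_eq_zero.1 h1 with h2 | h2
    · exact absurd h2 (by positivity)
    · exact_mod_cast h2

/-- The energy of a boson mode. -/
def modeEnergy (p : Mode d N) : ℝ := bosonDispersion N p.2

/-- The amplitudes of the coherent vector `e(α) = exp(∑ α_p a*_p) |0⟩`. -/
def coherentAmp (α : Mode d N → ℂ) (n : Occ d N) : ℂ := n.prod (coherentFactor α)

theorem norm_coherentFactor_sq (α : Mode d N → ℂ) (p : Mode d N) (k : ℕ) :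
    ‖coherentFactor α p k‖ ^ 2 = (‖α p‖ ^ 2) ^ k / k.factorial := by
  rw [coherentFactor, norm_div, norm_pow, Complex.norm_real, div_pow, Real.norm_eq_abs, sq_abs,
    Real.sq_sqrt (by positivity), ← pow_mul, ← pow_mul, mul_comm]

theorem coherentAmp_summable {α : Mode d N → ℂ} (hα : Summable fun p => ‖α p‖ ^ 2) :
    (Summable fun n => ‖coherentAmp α n‖ ^ 2) ∧
      ∑' n, ‖coherentAmp α n‖ ^ 2 ≤ Real.exp (∑' p, ‖α p‖ ^ 2) := by
  have h1 : ∀ n : Occ d N, ‖coherentAmp α n‖ ^ 2 =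
      ‖n.prod fun p k => ((‖α p‖ ^ 2) ^ k / k.factorial : ℝ)‖ := by
    intro n
    rw [coherentAmp, norm_finsupp_prod, Finsupp.prod, Finsupp.prod, ← Finset.prod_pow,
      Real.norm_of_nonneg (Finset.prod_nonneg fun _ _ => by positivity)]
    exact Finset.prod_congr rfl fun p _ => norm_coherentFactor_sq α p _
  simp only [h1]
  have hn : ∀ p k, ‖((‖α p‖ ^ 2) ^ k / k.factorial : ℝ)‖ = (‖α p‖ ^ 2) ^ k / k.factorial :=
    fun p k => Real.norm_of_nonneg (by positivity)
  refine summable_finsupp_prod (fun p => by simp) (fun p => ?_) (fun p => ?_)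
    (fun p => by positivity) hα
  · simp only [hn]
    exact Real.summable_pow_div_factorial _
  · simp only [hn]
    rw [Real.exp_eq_exp_ℝ, NormedSpace.exp_eq_tsum_div]

theorem summable_norm_sq (f : Hl2 (Mode d N)) : Summable fun p => ‖f p‖ ^ 2 := (hasSum_norm_sq f).summable

open Classical in
theorem coherent_summable (x : ZLat d) (α : Hl2 (Mode d N)) :
    (Summable fun a : TotalIdx d N => ‖if a.1.1 = x then coherentAmp α a.2 else 0‖ ^ 2) ∧
      ∑' a : TotalIdx d N, ‖if a.1.1 = x then coherentAmp α a.2 else 0‖ ^ 2 ≤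
        Fintype.card (Site d N) * Real.exp (‖α‖ ^ 2) := by
  have h := coherentAmp_summable (summable_norm_sq α)
  rw [(hasSum_norm_sq α).tsum_eq] at h
  have h1 : ∀ y : Site d N, Summable fun n => ‖if y.1 = x then coherentAmp α n else 0‖ ^ 2 := by
    intro y
    by_cases hy : y.1 = x
    · simpa [hy] using h.1
    · simp [hy, summable_zero]
  have h2 : Summable fun a : TotalIdx d N => ‖if a.1.1 = x then coherentAmp α a.2 else 0‖ ^ 2 :=
    (summable_prod_of_nonneg fun _ => by positivity).2 ⟨h1, (hasSum_fintype _).summable⟩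
  refine ⟨h2, ?_⟩
  rw [h2.tsum_prod' h1, tsum_fintype, ← nsmul_eq_mul, ← Finset.card_univ]
  refine Finset.sum_le_card_nsmul _ _ _ fun y _ => ?_
  by_cases hy : y.1 = x
  · simpa [hy] using h.2
  · simp [hy, (Real.exp_pos _).le]

open Classical in
/-- The vector `|x⟩ ⊗ e(α)`. -/
def coherent (x : ZLat d) (α : Hl2 (Mode d N)) : Hl2 (TotalIdx d N) :=
  ⟨fun a => if a.1.1 = x then coherentAmp α a.2 else 0,
    memℓp_gen (by simpa using (coherent_summable x α).1)⟩

open Classical in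
theorem coherent_apply (x : ZLat d) (α : Hl2 (Mode d N)) (a : TotalIdx d N) :
    coherent x α a = if a.1.1 = x then coherentAmp α a.2 else 0 := rfl

theorem norm_coherent_sq_le (x : ZLat d) (α : Hl2 (Mode d N)) :
    ‖coherent x α‖ ^ 2 ≤ Fintype.card (Site d N) * Real.exp (‖α‖ ^ 2) := by
  classical
  rw [← (hasSum_norm_sq _).tsum_eq]
  simp only [coherent_apply]
  exact (coherent_summable x α).2

theorem mul_coherentAmp_erase (α : Mode d N → ℂ) (n : Occ d N) (p : Mode d N) :
    coherentFactor α p (n p) * (n.erase p).prod (coherentFactor α) = coherentAmp α n :=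
  Finsupp.mul_prod_erase' n p _ fun p => coherentFactor_zero α p

theorem coherentFactor_succ (α : Mode d N → ℂ) (p : Mode d N) (k : ℕ) :
    ((√((k : ℝ) + 1) : ℝ) : ℂ) * coherentFactor α p (k + 1) = α p * coherentFactor α p k := by
  have h1 : (√((k : ℝ) + 1) : ℝ) ≠ 0 := (Real.sqrt_pos.2 (by positivity)).ne'
  have h2 : (√(k.factorial : ℝ) : ℝ) ≠ 0 := (Real.sqrt_pos.2 (by positivity)).ne'
  have h1' : ((√((k : ℝ) + 1) : ℝ) : ℂ) ≠ 0 := by exact_mod_cast h1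
  have h2' : ((√(k.factorial : ℝ) : ℝ) : ℂ) ≠ 0 := by exact_mod_cast h2
  rw [coherentFactor, coherentFactor, Nat.factorial_succ, Nat.cast_mul, Real.sqrt_mul (by positivity)]
  push_cast
  field_simp
  ring

theorem coherentAmp_add_single (α : Mode d N → ℂ) (n : Occ d N) (p : Mode d N) :
    ((√((n p : ℝ) + 1) : ℝ) : ℂ) * coherentAmp α (n + Finsupp.single p 1) =
      α p * coherentAmp α n := by
  rw [← mul_coherentAmp_erase α _ p, ← mul_coherentAmp_erase α n p]
  have h1 : (n + Finsupp.single p 1).erase p = n.erase p := by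
    rw [Finsupp.erase_add, Finsupp.erase_single, add_zero]
  rw [h1, Finsupp.add_apply, Finsupp.single_eq_same, ← mul_assoc, coherentFactor_succ, mul_assoc]

/-- The amplitude `√(n_p) e(α)_{n - δ_p}` of `a*_p e(α)`. -/
def createdAmp (α : Mode d N → ℂ) (n : Occ d N) (p : Mode d N) : ℂ :=
  ((√(n p : ℝ) : ℝ) : ℂ) * coherentAmp α (n - Finsupp.single p 1)

theorem mul_createdAmp (α : Mode d N → ℂ) (n : Occ d N) {p : Mode d N} (hp : p ∈ n.support) :
    α p * createdAmp α n p = n p * coherentAmp α n := by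
  have h0 : 1 ≤ n p := Nat.one_le_iff_ne_zero.2 (Finsupp.mem_support_iff.1 hp)
  have h1 : n = (n - Finsupp.single p 1) + Finsupp.single p 1 :=
    (tsub_add_cancel_of_le (Finsupp.single_le_iff.2 h0)).symm
  set m := n - Finsupp.single p 1 with hm
  have h2 : (n p : ℝ) = (m p : ℝ) + 1 := by rw [h1]; simp
  have h3 := coherentAmp_add_single α m p
  rw [← h1] at h3
  rw [createdAmp, ← hm, h2, mul_left_comm, ← h3, ← mul_assoc, ← Complex.ofReal_mul,
    Real.mul_self_sqrt (by positivity), ← h2]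
  simp

theorem hasDerivAt_coherentAmp {α : ℝ → Mode d N → ℂ} {α' : Mode d N → ℂ} {t : ℝ}
    (h : ∀ p, HasDerivAt (fun t => α t p) (α' p) t) (n : Occ d N) :
    HasDerivAt (fun t => coherentAmp (α t) n) (∑ p ∈ n.support, α' p * createdAmp (α t) n p) t := by
  classical
  have h1 := HasDerivAt.fun_finsetProd (u := n.support) (f := fun p t => coherentFactor (α t) p (n p))
    (f' := fun p => (n p : ℂ) * α t p ^ (n p - 1) * α' p / ((√((n p).factorial : ℝ) : ℝ) : ℂ))
    (x := t) fun p _ => (((h p).pow (n p)).div_const _)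
  refine h1.congr_deriv (Finset.sum_congr rfl fun p hp => ?_)
  have h0 : 1 ≤ n p := Nat.one_le_iff_ne_zero.2 (Finsupp.mem_support_iff.1 hp)
  have h2 : (n - Finsupp.single p 1).erase p = n.erase p := by
    ext q
    by_cases hq : q = p
    · rw [hq]; simp
    · simp [Finsupp.erase_ne hq, hq]
  have h3 : (n.erase p).prod (coherentFactor (α t)) =
      ∏ q ∈ n.support.erase p, coherentFactor (α t) q (n q) := by
    rw [Finsupp.prod, Finsupp.support_erase]
    exact Finset.prod_congr rfl fun q hq => by rw [Finsupp.erase_ne (Finset.ne_of_mem_erase hq)]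
  rw [createdAmp, ← mul_coherentAmp_erase (α t) _ p, h2, h3, smul_eq_mul]
  have h4 : (n - Finsupp.single p 1 : Occ d N) p = n p - 1 := by simp
  rw [h4]
  obtain ⟨k, hk⟩ : ∃ k, n p = k + 1 := ⟨n p - 1, by omega⟩
  rw [hk, Nat.add_sub_cancel, coherentFactor, Nat.factorial_succ, Nat.cast_mul,
    Real.sqrt_mul (by positivity)]
  have h5 : (√((k : ℝ) + 1) : ℝ) ≠ 0 := (Real.sqrt_pos.2 (by positivity)).ne'
  have h6 : (√(k.factorial : ℝ) : ℝ) ≠ 0 := (Real.sqrt_pos.2 (by positivity)).ne'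
  have h5' : ((√((k : ℝ) + 1) : ℝ) : ℂ) ≠ 0 := by exact_mod_cast h5
  have h6' : ((√(k.factorial : ℝ) : ℝ) : ℂ) ≠ 0 := by exact_mod_cast h6
  have h7 : ((k + 1 : ℕ) : ℂ) = ((√((k : ℝ) + 1) : ℝ) : ℂ) * ((√((k : ℝ) + 1) : ℝ) : ℂ) := by
    rw [← Complex.ofReal_mul, Real.mul_self_sqrt (by positivity)]; push_cast; rfl
  rw [h7]
  push_cast
  field_simp

section FreeEvolution

variable {φ : EuclideanSpace ℝ (Fin d) → ℂ} (hφ : Summable fun k : ZLat d => ‖finForm φ N k‖ ^ 2)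

theorem mode_injective (y : Site d N) : Function.Injective fun k : ZLat d => ((y, k) : Mode d N) :=
  fun _ _ h => congrArg Prod.snd h

open Classical in
theorem formVec_summable (hφ : Summable fun k : ZLat d => ‖finForm φ N k‖ ^ 2) (x : ZLat d) :
    Summable fun p : Mode d N =>
      ‖if p.1.1 = x then (starRingEnd ℂ) (finForm φ N p.2) else 0‖ ^ 2 := by
  refine (summable_prod_of_nonneg fun _ => by positivity).2 ⟨fun y => ?_, (hasSum_fintype _).summable⟩
  by_cases hy : y.1 = x
  · simpa [hy] using hφ
  · simp [hy, summable_zero]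

open Classical in
/-- The form factor of the reservoir at the site `x`, as a vector `∑_q conj φ(q) δ_{x,q}`. -/
def formVec (x : ZLat d) : Hl2 (Mode d N) :=
  ⟨fun p => if p.1.1 = x then (starRingEnd ℂ) (finForm φ N p.2) else 0,
    memℓp_gen (by simpa using formVec_summable hφ x)⟩

open Classical in
theorem formVec_apply (x : ZLat d) (p : Mode d N) :
    formVec hφ x p = if p.1.1 = x then (starRingEnd ℂ) (finForm φ N p.2) else 0 := rfl

theorem hasSum_inner_formVec (y : Site d N) (α : Hl2 (Mode d N)) :
    HasSum (fun k => finForm φ N k * α (y, k)) (inner ℂ (formVec hφ y.1) α) := by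
  classical
  have h := hasSum_inner (formVec hφ y.1) α
  rw [← (mode_injective y).hasSum_iff] at h
  · refine h.congr_fun fun k => ?_
    simp [formVec_apply]
  · rintro ⟨z, k⟩ hz
    rw [formVec_apply, if_neg, map_zero, zero_mul]
    intro h'
    exact hz ⟨k, by rw [Prod.mk.injEq]; exact ⟨(Subtype.ext h').symm, rfl⟩⟩

theorem annihilation_coherent (x : ZLat d) (α : Hl2 (Mode d N)) (a : TotalIdx d N) :
    ((√((bosonNumber a.2 : ℝ) + 1) : ℝ) : ℂ) * annihilation hφ (coherent x α) a =
      inner ℂ (formVec hφ x) α * coherent x α a := by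
  classical
  have h := hasSum_kern_apply (annihilation hφ) (coherent x α) a
  rw [← (addBoson_injective a).hasSum_iff fun b hb => by
    rw [kern_annihilation_eq_zero hφ (fun h => hb h), zero_mul]] at h
  rw [coherent_apply]
  by_cases hx : a.1.1 = x
  · rw [if_pos hx]
    have h1 := (hasSum_inner_formVec hφ a.1 α).mul_right (coherentAmp α a.2)
    rw [hx] at h1
    have h3 := h.mul_left ((√((bosonNumber a.2 : ℝ) + 1) : ℝ) : ℂ)
    refine h3.unique (h1.congr_fun fun k => ?_)
    rw [Function.comp_apply, kern_annihilation_addBoson, coherent_apply,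
      if_pos (show (addBoson a k).1.1 = x from hx)]
    have h2 := coherentAmp_add_single α a.2 (a.1, k)
    have h0 : (√((bosonNumber a.2 : ℝ) + 1) : ℝ) ≠ 0 := (Real.sqrt_pos.2 (by positivity)).ne'
    have h0' : ((√((bosonNumber a.2 : ℝ) + 1) : ℝ) : ℂ) ≠ 0 := by exact_mod_cast h0
    refine Eq.trans ?_ (mul_assoc _ _ _).symm
    rw [← h2]
    change _ * (_ * coherentAmp α (a.2 + Finsupp.single (a.1, k) 1)) = _
    push_cast
    field_simp
  · rw [if_neg hx, mul_zero]
    have h1 : HasSum (fun k => kern (annihilation hφ) a (addBoson a k) *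
        coherent x α (addBoson a k)) 0 := by
      convert hasSum_zero with k
      rw [coherent_apply, if_neg (show ¬ (addBoson a k).1.1 = x from hx), mul_zero]
    rw [h.unique h1, mul_zero]

theorem star_annihilation_coherent (x : ZLat d) (α : Hl2 (Mode d N)) (a : TotalIdx d N)
    (hx : a.1.1 = x) :
    ((√(bosonNumber a.2 : ℝ) : ℝ) : ℂ) * star (annihilation hφ) (coherent x α) a =
      ∑ p ∈ a.2.support, formVec hφ x p * createdAmp α a.2 p := by
  classical
  obtain ⟨y, n⟩ := a
  simp only at hx ⊢
  have h := hasSum_kern_apply (star (annihilation hφ)) (coherent x α) (y, n)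
  set S := n.support.filter fun p => p.1 = y with hS
  have hSn : ∀ p ∈ S, n = (n - Finsupp.single p 1) + Finsupp.single p 1 := fun p hp =>
    (tsub_add_cancel_of_le (Finsupp.single_le_iff.2 (Nat.one_le_iff_ne_zero.2
      (Finsupp.mem_support_iff.1 (Finset.mem_filter.1 hp).1)))).symm
  have hadd : ∀ p ∈ S, addBoson ((y, n - Finsupp.single p 1) : TotalIdx d N) p.2 = (y, n) := by
    intro p hp
    have hp1 : ((y, p.2) : Mode d N) = p := by rw [← (Finset.mem_filter.1 hp).2]
    simp only [addBoson, hp1]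
    rw [← hSn p hp]
  have hinj : Set.InjOn (fun p : Mode d N => ((y, n - Finsupp.single p 1) : TotalIdx d N)) S := by
    intro p hp q hq hpq
    have h1 := congrArg Prod.snd hpq
    simp only at h1
    have h2 := hSn p hp
    rw [h1] at h2
    have h3 := h2.symm.trans (hSn q hq)
    rw [add_right_inj] at h3
    exact (Finsupp.single_left_inj one_ne_zero).1 h3
  have h1 := hasSum_sum_of_ne_finset_zero (L := .unconditional _)
    (s := S.image fun p : Mode d N => ((y, n - Finsupp.single p 1) : TotalIdx d N))
    (f := fun b => kern (star (annihilation hφ)) (y, n) b * coherent x α b) fun b hb => by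
      rw [kern_star, kern_annihilation_eq_zero, map_zero, zero_mul]
      rintro ⟨k, hk⟩
      have hb1 : b.1 = y := congrArg Prod.fst hk
      have hb2 : b.2 + Finsupp.single (y, k) 1 = n := by
        rw [← hb1]; exact congrArg Prod.snd hk
      refine hb (Finset.mem_image.2 ⟨(y, k), Finset.mem_filter.2 ⟨?_, rfl⟩, ?_⟩)
      · rw [← hb2]; simp
      · rw [← hb2, add_tsub_cancel_right, ← hb1]
  rw [h.unique h1, Finset.sum_image hinj, Finset.mul_sum]
  have h2 : ∑ p ∈ n.support, formVec hφ x p * createdAmp α n p =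
      ∑ p ∈ S, formVec hφ x p * createdAmp α n p := by
    rw [hS, Finset.sum_filter]
    refine Finset.sum_congr rfl fun p _ => ?_
    split_ifs with hp
    · rfl
    · rw [formVec_apply, if_neg, zero_mul]
      intro h'
      exact hp (Subtype.ext (h'.trans hx.symm))
  rw [h2]
  refine Finset.sum_congr rfl fun p hp => ?_
  have hp1 : p.1 = y := (Finset.mem_filter.1 hp).2
  have h3 := kern_annihilation_addBoson hφ ((y, n - Finsupp.single p 1) : TotalIdx d N) p.2
  rw [hadd p hp] at h3
  have hp2 : ((y, p.2) : Mode d N) = p := by rw [← hp1]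
  have hn1 : ((n - Finsupp.single p 1 : Occ d N) p : ℝ) + 1 = n p := by
    conv_rhs => rw [hSn p hp]
    simp
  have hn2 : (bosonNumber (n - Finsupp.single p 1) : ℝ) + 1 = bosonNumber n := by
    conv_rhs => rw [hSn p hp, bosonNumber_add_single]
    push_cast; rfl
  simp only [hp2, hn1, hn2] at h3
  rw [kern_star, h3, coherent_apply, if_pos hx, formVec_apply, hp1, if_pos hx, createdAmp, map_mul,
    Complex.conj_ofReal]
  have h0 : (√(bosonNumber n : ℝ) : ℝ) ≠ 0 := (Real.sqrt_pos.2 (by rw [← hn2]; positivity)).ne'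
  have h0' : ((√(bosonNumber n : ℝ) : ℝ) : ℂ) ≠ 0 := by exact_mod_cast h0
  push_cast
  field_simp

end FreeEvolution

end Coherent

section FreeEvolution

variable {d N : ℕ} {φ : EuclideanSpace ℝ (Fin d) → ℂ} (lam : ℝ) (χ : Fin d → ℝ)
  (hφ : Summable fun k : ZLat d => ‖finForm φ N k‖ ^ 2)

theorem hopping_zero (x : ZLat d) : hopping (fun _ => 0) x = 0 := by
  simp [hopping]

theorem boxHopping_zero : (boxHopping (fun _ => 0) : Op (TotalIdx d N)) = 0 := by
  simp [boxHopping, siteOp, hopping_zero]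

/-- The potential energy of the particle. -/
def siteEnergy (x : ZLat d) : ℝ := -(lam ^ 2 * ∑ i, χ i * (x i : ℝ))

theorem star_annihilation_coherent_of_ne (x : ZLat d) (α : Hl2 (Mode d N)) (a : TotalIdx d N)
    (hx : a.1.1 ≠ x) : star (annihilation hφ) (coherent x α) a = 0 := by
  classical
  refine (hasSum_kern_apply (star (annihilation hφ)) (coherent x α) a).unique ?_
  convert hasSum_zero with b
  rw [coherent_apply]
  split_ifs with hb
  · rw [kern_star, kern_annihilation_eq_zero, map_zero, zero_mul]
    rintro ⟨k, hk⟩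
    have h1 : b.1 = a.1 := (congrArg Prod.fst hk : (addBoson b k).1 = a.1)
    exact hx (by rw [← h1, hb])
  · rw [mul_zero]

theorem resEnergy_mul_coherentAmp (α : Mode d N → ℂ) (n : Occ d N) :
    (resEnergy n : ℂ) * coherentAmp α n =
      ∑ p ∈ n.support, (modeEnergy p : ℂ) * (α p * createdAmp α n p) := by
  rw [resEnergy, Finsupp.sum, Complex.ofReal_sum, Finset.sum_mul]
  refine Finset.sum_congr rfl fun p hp => ?_
  rw [mul_createdAmp α n hp, modeEnergy]
  push_cast
  ring

theorem inner_row_coherent (x : ZLat d) (α : Hl2 (Mode d N)) (a : TotalIdx d N) (hx : a.1.1 = x) :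
    inner ℂ ((gradedHamiltonian lam χ (fun _ => 0) hφ).row a) (coherent x α) =
      (siteEnergy lam χ x + lam * inner ℂ (formVec hφ x) α) * coherentAmp α a.2 +
      ∑ p ∈ a.2.support, (modeEnergy p * α p + lam * formVec hφ x p) * createdAmp α a.2 p := by
  classical
  rw [GradedHamiltonian.inner_row]
  have hT : (gradedHamiltonian lam χ (fun _ => 0) hφ).T = 0 := boxHopping_zero
  have hR : (gradedHamiltonian lam χ (fun _ => 0) hφ).R = (lam : ℂ) • annihilation hφ := rfl
  have hD : (gradedHamiltonian lam χ (fun _ => 0) hφ).D a = siteEnergy lam χ x + resEnergy a.2 := by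
    rw [← hx]; rfl
  have hg : (gradedHamiltonian lam χ (fun _ => 0) hφ).grade a = bosonNumber a.2 := rfl
  have h1 := annihilation_coherent hφ x α a
  have h2 := star_annihilation_coherent hφ x α a hx
  have h3 := resEnergy_mul_coherentAmp α a.2
  have h4 : coherent x α a = coherentAmp α a.2 := by rw [coherent_apply, if_pos hx]
  rw [h4] at h1
  have h5 : ((lam : ℂ) • annihilation hφ) (coherent x α) a =
      lam * annihilation hφ (coherent x α) a := rfl
  have h6 : star ((lam : ℂ) • annihilation hφ) (coherent x α) a =
      lam * star (annihilation hφ) (coherent x α) a := by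
    rw [star_smul]
    change (starRingEnd ℂ) (lam : ℂ) * _ = _
    rw [Complex.conj_ofReal]
    rfl
  rw [hT, hR, hD, hg, h4, h5, h6]
  have h7 : ∑ p ∈ a.2.support, (modeEnergy p * α p + lam * formVec hφ x p) * createdAmp α a.2 p =
      ∑ p ∈ a.2.support, (modeEnergy p : ℂ) * (α p * createdAmp α a.2 p) +
        lam * ∑ p ∈ a.2.support, formVec hφ x p * createdAmp α a.2 p := by
    rw [Finset.mul_sum, ← Finset.sum_add_distrib]
    exact Finset.sum_congr rfl fun p _ => by ring
  rw [h7, ← h3, ← h2]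
  have h8 : (0 : Op (TotalIdx d N)) (coherent x α) a = 0 := rfl
  rw [h8]
  push_cast
  linear_combination (lam : ℂ) * h1

theorem inner_row_coherent_of_ne (x : ZLat d) (α : Hl2 (Mode d N)) (a : TotalIdx d N)
    (hx : a.1.1 ≠ x) :
    inner ℂ ((gradedHamiltonian lam χ (fun _ => 0) hφ).row a) (coherent x α) = 0 := by
  classical
  rw [GradedHamiltonian.inner_row]
  have hT : (gradedHamiltonian lam χ (fun _ => 0) hφ).T = 0 := boxHopping_zero
  have hR : (gradedHamiltonian lam χ (fun _ => 0) hφ).R = (lam : ℂ) • annihilation hφ := rfl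
  have h1 := annihilation_coherent hφ x α a
  have h4 : coherent x α a = 0 := by rw [coherent_apply, if_neg hx]
  have h0 : ((√((bosonNumber a.2 : ℝ) + 1) : ℝ) : ℂ) ≠ 0 := by
    have : (√((bosonNumber a.2 : ℝ) + 1) : ℝ) ≠ 0 := (Real.sqrt_pos.2 (by positivity)).ne'
    exact_mod_cast this
  rw [h4, mul_zero, mul_eq_zero] at h1
  have h7 := h1.resolve_left h0
  have h5 : ((lam : ℂ) • annihilation hφ) (coherent x α) a =
      lam * annihilation hφ (coherent x α) a := rfl
  have h6 : star ((lam : ℂ) • annihilation hφ) (coherent x α) a =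
      lam * star (annihilation hφ) (coherent x α) a := by
    rw [star_smul]
    change (starRingEnd ℂ) (lam : ℂ) * _ = _
    rw [Complex.conj_ofReal]
    rfl
  rw [hT, hR, h4, h5, h6, h7, star_annihilation_coherent_of_ne hφ x α a hx]
  simp

theorem norm_inv_modeEnergy_le (p : Mode d N) : ‖(((modeEnergy p)⁻¹ : ℝ) : ℂ)‖ ≤ (N : ℝ) + 1 := by
  rw [Complex.norm_real, modeEnergy, Real.norm_of_nonneg (inv_nonneg.2 (bosonDispersion_nonneg _))]
  exact inv_bosonDispersion_le _

/-- The displacement `h = λ ω⁻¹ conj φ` of the reservoir modes by a particle at rest at the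
site `x`. -/
def displacement (x : ZLat d) : Hl2 (Mode d N) :=
  (lam : ℂ) • diagOp _ norm_inv_modeEnergy_le (formVec hφ x)

theorem modeEnergy_mul_displacement (hN : 0 < N) (x : ZLat d) (p : Mode d N) :
    (modeEnergy p : ℂ) * displacement lam hφ x p = lam * formVec hφ x p := by
  change (modeEnergy p : ℂ) * (lam * ((((modeEnergy p)⁻¹ : ℝ) : ℂ) * formVec hφ x p)) = _
  have h : (modeEnergy p : ℂ) ≠ 0 := by
    have := (bosonDispersion_pos hN p.2).ne'
    exact_mod_cast this
  push_cast
  field_simp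

/-- The lowering `λ² ∑_q |φ(q)|² / ω(q)` of the energy of a particle at rest by its coupling to
the reservoir. -/
def energyShift (x : ZLat d) : ℝ := (lam * inner ℂ (formVec hφ x) (displacement lam hφ x)).re

theorem ofReal_energyShift (x : ZLat d) :
    (energyShift lam hφ x : ℂ) = lam * inner ℂ (formVec hφ x) (displacement lam hφ x) := by
  refine Complex.ext rfl ?_
  rw [displacement, inner_smul_right, ← mul_assoc, ← Complex.ofReal_mul, Complex.im_ofReal_mul,
    im_inner_of_star_eq, mul_zero]
  · rfl
  · exact star_diagOp (fun p : Mode d N => (modeEnergy p)⁻¹) norm_inv_modeEnergy_le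

/-- The rotation `e^{-iωt}` of the modes. -/
def modeRotation (t : ℝ) : Op (Mode d N) := diagGroup modeEnergy t

theorem modeRotation_isUnitaryGroup : IsUnitaryGroup (modeRotation : ℝ → Op (Mode d N)) :=
  diagGroup_isUnitaryGroup _

theorem hasDerivAt_modeRotation_apply (v : Hl2 (Mode d N)) (p : Mode d N) (t : ℝ) :
    HasDerivAt (fun t => modeRotation t v p) (-(Complex.I * modeEnergy p) * modeRotation t v p) t := by
  have h : HasDerivAt (fun s : ℝ => -(Complex.I * s * modeEnergy p)) (-(Complex.I * 1 * modeEnergy p)) t :=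
    (((hasDerivAt_id t).ofReal_comp.const_mul Complex.I).mul_const _).neg
  have h2 := (h.cexp).mul_const (v p)
  refine h2.congr_deriv ?_
  change _ = _ * (Complex.exp (-(Complex.I * t * modeEnergy p)) * v p)
  ring

theorem hasDerivAt_inner_modeRotation (hN : 0 < N) (x : ZLat d) (v : Hl2 (Mode d N)) (t : ℝ) :
    HasDerivAt (fun t => inner ℂ (displacement lam hφ x) (modeRotation t v))
      (-(Complex.I * (lam * inner ℂ (formVec hφ x) (modeRotation t v)))) t := by
  have h1 : ∀ t, inner ℂ (displacement lam hφ x) (modeRotation t v) =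
      ∑' p, (starRingEnd ℂ) (displacement lam hφ x p) * modeRotation t v p :=
    fun t => (hasSum_inner _ _).tsum_eq.symm
  have hn : ∀ t p, ‖modeRotation t v p‖ = ‖v p‖ := by
    intro t p
    change ‖Complex.exp (-(Complex.I * t * modeEnergy p)) * v p‖ = _
    rw [norm_mul, Complex.norm_exp]
    simp
  have hg : ∀ p t, (starRingEnd ℂ) (displacement lam hφ x p) *
      (-(Complex.I * modeEnergy p) * modeRotation t v p) = -(Complex.I * (lam *
        ((starRingEnd ℂ) (formVec hφ x p) * modeRotation t v p))) := by
    intro p t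
    have h2 := congrArg (starRingEnd ℂ) (modeEnergy_mul_displacement lam hφ hN x p)
    rw [map_mul, map_mul, Complex.conj_ofReal, Complex.conj_ofReal] at h2
    calc _ = -(Complex.I * ((modeEnergy p * (starRingEnd ℂ) (displacement lam hφ x p)) *
          modeRotation t v p)) := by ring
      _ = _ := by rw [h2]; ring
  have hsum : Summable fun p => |lam| * (‖formVec hφ x p‖ * ‖v p‖) := by
    refine Summable.mul_left _ ?_
    refine Summable.of_nonneg_of_le (fun p => by positivity) (fun p => ?_)
      ((hasSum_norm_sq (formVec hφ x)).summable.add (hasSum_norm_sq v).summable)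
    nlinarith [sq_nonneg (‖formVec hφ x p‖ - ‖v p‖), sq_nonneg ‖formVec hφ x p‖, sq_nonneg ‖v p‖]
  simp only [h1]
  have h3 := hasDerivAt_tsum (y₀ := 0) hsum
    (fun p t => (hasDerivAt_modeRotation_apply v p t).const_mul
      ((starRingEnd ℂ) (displacement lam hφ x p)))
    (fun p t => by
      rw [hg, norm_neg, norm_mul, norm_mul, norm_mul, Complex.norm_I, one_mul, Complex.norm_real,
        RCLike.norm_conj, hn, Real.norm_eq_abs])
    (hasSum_inner _ (modeRotation 0 v)).summable t
  refine h3.congr_deriv ?_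
  simp only [hg]
  exact (((hasSum_inner (formVec hφ x) (modeRotation t v)).mul_left (lam : ℂ)).mul_left
    Complex.I).neg.tsum_eq

/-- The logarithm of the factor acquired by `|x⟩ ⊗ e(α)`, `v = α + h`, in the free evolution. -/
def freePhase (x : ZLat d) (v : Hl2 (Mode d N)) (t : ℝ) : ℂ :=
  -(Complex.I * t * (siteEnergy lam χ x - energyShift lam hφ x : ℝ)) +
    (inner ℂ (displacement lam hφ x) (modeRotation t v) - inner ℂ (displacement lam hφ x) v)

/-- The unitary group of the system without hopping. -/
def freeEvolution (lam : ℝ) (χ : Fin d → ℝ) (φ : EuclideanSpace ℝ (Fin d) → ℂ) (N : ℕ) :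
    ℝ → Op (TotalIdx d N) := evolution (hamiltonian lam χ (fun _ => 0) φ N)

theorem isEvolution_freeEvolution : IsEvolution
    (fun b a => (gradedHamiltonian lam χ (fun _ => 0) hφ).row a b) (freeEvolution lam χ φ N) := by
  have h := isEvolution_evolution lam χ (fun _ => 0) hφ
  rw [freeEvolution]
  convert h using 1
  exact (hamiltonian_eq_row lam χ _ hφ).symm

/-- Without hopping the particle stays at its site, and the reservoir modes there are driven
harmonic oscillators: coherent vectors stay coherent. -/
theorem freeEvolution_coherent (hN : 0 < N) (x : ZLat d) (α : Hl2 (Mode d N)) (t : ℝ) :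
    freeEvolution lam χ φ N t (coherent x α) =
      Complex.exp (freePhase lam χ hφ x (α + displacement lam hφ x) t) •
        coherent x (modeRotation t (α + displacement lam hφ x) - displacement lam hφ x) := by
  classical
  set h := displacement lam hφ x with hh
  set v := α + h with hv
  set u : ℝ → Hl2 (TotalIdx d N) := fun t => Complex.exp (freePhase lam χ hφ x v t) •
    coherent x (modeRotation t v - h) with hu
  have hrot := modeRotation_isUnitaryGroup (d := d) (N := N)
  have hev := isEvolution_freeEvolution lam χ hφ
  have hphase : ∀ t, HasDerivAt (freePhase lam χ hφ x v)
      (-(Complex.I * (siteEnergy lam χ x + lam * inner ℂ (formVec hφ x) (modeRotation t v - h)))) t := by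
    intro t
    have h1 : HasDerivAt (fun t : ℝ => -(Complex.I * t *
        ((siteEnergy lam χ x - energyShift lam hφ x : ℝ) : ℂ)))
        (-(Complex.I * 1 * ((siteEnergy lam χ x - energyShift lam hφ x : ℝ) : ℂ))) t :=
      (((hasDerivAt_id t).ofReal_comp.const_mul Complex.I).mul_const _).neg
    have h2 := h1.add ((hasDerivAt_inner_modeRotation lam hφ hN x v t).sub_const
      (inner ℂ (displacement lam hφ x) v))
    refine h2.congr_deriv ?_
    rw [inner_sub_right, Complex.ofReal_sub, ofReal_energyShift]
    ring
  have hsol : IsWeakSol (gradedHamiltonian lam χ (fun _ => 0) hφ).row Set.univ u := by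
    intro a _ t
    by_cases hx : a.1.1 = x
    · have h1 : ∀ t, u t a = Complex.exp (freePhase lam χ hφ x v t) *
          coherentAmp (modeRotation t v - h : Hl2 (Mode d N)) a.2 := by
        intro t
        change _ * coherent x (modeRotation t v - h) a = _
        rw [coherent_apply, if_pos hx]
      simp only [h1]
      have h2 : ∀ p, HasDerivAt (fun t => (modeRotation t v - h : Hl2 (Mode d N)) p)
          (-(Complex.I * modeEnergy p) * modeRotation t v p) t := fun p =>
        (hasDerivAt_modeRotation_apply v p t).sub_const (h p)
      refine ((hphase t).cexp.mul (hasDerivAt_coherentAmp h2 a.2)).congr_deriv ?_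
      rw [hu]
      simp only
      rw [inner_smul_right, inner_row_coherent lam χ hφ x _ a hx]
      have h3 : ∀ p, (modeEnergy p : ℂ) * (modeRotation t v - h : Hl2 (Mode d N)) p +
          lam * formVec hφ x p = modeEnergy p * modeRotation t v p := by
        intro p
        rw [← modeEnergy_mul_displacement lam hφ hN]
        change (modeEnergy p : ℂ) * (modeRotation t v p - h p) + _ = _
        rw [hh]; ring
      simp only [h3]
      have h4 : ∑ p ∈ a.2.support, -(Complex.I * modeEnergy p) * modeRotation t v p *
          createdAmp (modeRotation t v - h : Hl2 (Mode d N)) a.2 p = -(Complex.I *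
          ∑ p ∈ a.2.support, modeEnergy p * modeRotation t v p *
          createdAmp (modeRotation t v - h : Hl2 (Mode d N)) a.2 p) := by
        rw [Finset.mul_sum, ← Finset.sum_neg_distrib]
        exact Finset.sum_congr rfl fun p _ => by ring
      rw [h4]
      ring
    · have h1 : ∀ t, u t a = 0 := by
        intro t
        change _ * coherent x (modeRotation t v - h) a = _
        rw [coherent_apply, if_neg hx, mul_zero]
      simp only [h1]
      refine (hasDerivAt_const t (0 : ℂ)).congr_deriv ?_
      rw [hu]
      simp only
      rw [inner_smul_right, inner_row_coherent_of_ne lam χ hφ x _ a hx, mul_zero, mul_zero, neg_zero]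
  have hnv : ∀ t, ‖modeRotation t v - h‖ ≤ ‖v‖ + ‖h‖ := fun t =>
    (norm_sub_le _ _).trans (by rw [hrot.norm_apply])
  have hbound : ∀ t, ‖u t‖ ≤ Real.exp (‖h‖ * ‖v‖ + ‖h‖ * ‖v‖) *
      √(Fintype.card (Site d N) * Real.exp ((‖v‖ + ‖h‖) ^ 2)) := by
    intro t
    rw [hu]
    simp only
    rw [norm_smul, Complex.norm_exp]
    refine mul_le_mul (Real.exp_le_exp.2 ?_) ?_ (norm_nonneg _) (Real.exp_pos _).le
    · have h1 : (freePhase lam χ hφ x v t).re =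
          (inner ℂ h (modeRotation t v)).re - (inner ℂ h v).re := by
        rw [freePhase]
        simp
        rfl
      rw [h1, sub_eq_add_neg]
      refine add_le_add ?_ ?_
      · refine (Complex.re_le_norm _).trans ((norm_inner_le_norm _ _).trans ?_)
        rw [hrot.norm_apply]
      · exact (neg_le_abs _).trans ((Complex.abs_re_le_norm _).trans (norm_inner_le_norm _ _))
    · refine Real.le_sqrt_of_sq_le ((norm_coherent_sq_le x _).trans ?_)
      have := hnv t
      gcongr
  have h0 : u 0 = coherent x α := by
    rw [hu]
    simp only
    rw [freePhase, hrot.zero]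
    have : (1 : Op (Mode d N)) v = v := rfl
    rw [this, sub_self]
    simp [hv]
  set M := max (Real.exp (‖h‖ * ‖v‖ + ‖h‖ * ‖v‖) *
      √(Fintype.card (Site d N) * Real.exp ((‖v‖ + ‖h‖) ^ 2))) ‖coherent x α‖
  refine (gradedHamiltonian lam χ (fun _ => 0) hφ).eq_of_isWeakSol (M := M)
    (hev.isWeakSol (coherent x α)) hsol (fun t => ?_) (fun t => (hbound t).trans (le_max_left _ _)) ?_ t
  · rw [hev.isUnitaryGroup.norm_apply]
    exact le_max_right _ _
  · rw [h0, hev.zero]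
    rfl

end FreeEvolution

/-! ### Words of free evolutions and jumps -/

section LatticeHops

variable {d N : ℕ}

/-- The jump `|x⟩⟨z| ⊗ 1`; it vanishes unless `x` and `z` belong to the cube. -/
def latHop (x z : ZLat d) : Op (TotalIdx d N) :=
  if h : x ∈ box d N ∧ z ∈ box d N then hopOp ⟨x, h.1⟩ ⟨z, h.2⟩ else 0

open Classical in
theorem kern_latHop (x z : ZLat d) (a b : TotalIdx d N) :
    kern (latHop x z) a b = if a.1.1 = x ∧ b.1.1 = z ∧ a.2 = b.2 then 1 else 0 := by
  rw [latHop]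
  split_ifs with h h' h'
  · rw [kern_hopOp, if_pos ⟨Subtype.ext h'.1, Subtype.ext h'.2.1, h'.2.2⟩]
  · rw [kern_hopOp, if_neg fun h'' => h' ⟨congrArg Subtype.val h''.1, congrArg Subtype.val h''.2.1,
      h''.2.2⟩]
  · exact absurd ⟨h'.1 ▸ a.1.2, h'.2.1 ▸ b.1.2⟩ h
  · rfl

theorem latHop_of_notMem_left {x : ZLat d} (hx : x ∉ box d N) (z : ZLat d) :
    (latHop x z : Op (TotalIdx d N)) = 0 := dif_neg fun h => hx h.1

theorem latHop_of_notMem_right {z : ZLat d} (hz : z ∉ box d N) (x : ZLat d) :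
    (latHop x z : Op (TotalIdx d N)) = 0 := dif_neg fun h => hz h.2

theorem latHop_coe (x z : Site d N) : (latHop x.1 z.1 : Op (TotalIdx d N)) = hopOp x z :=
  dif_pos ⟨x.2, z.2⟩

theorem latHop_mul_same (x : ZLat d) {z : ZLat d} (hz : z ∈ box d N) (y : ZLat d) :
    (latHop x z * latHop z y : Op (TotalIdx d N)) = latHop x y := by
  by_cases hx : x ∈ box d N
  · by_cases hy : y ∈ box d N
    · rw [latHop, latHop, latHop, dif_pos ⟨hx, hz⟩, dif_pos ⟨hz, hy⟩, dif_pos ⟨hx, hy⟩,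
        hopOp_mul_same]
    · rw [latHop_of_notMem_right hy, latHop_of_notMem_right hy, mul_zero]
  · rw [latHop_of_notMem_left hx, latHop_of_notMem_left hx, zero_mul]

theorem star_latHop (x z : ZLat d) : star (latHop x z : Op (TotalIdx d N)) = latHop z x := by
  rw [latHop, latHop]
  split_ifs with h h' h'
  · exact star_hopOp _ _
  · exact absurd h.symm h'
  · exact absurd h'.symm h
  · exact star_zero _

theorem norm_latHop_le (x z : ZLat d) : ‖(latHop x z : Op (TotalIdx d N))‖ ≤ 1 := by
  rw [latHop]
  split_ifs
  · exact norm_hopOp_le _ _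
  · rw [norm_zero]; exact zero_le_one

open Classical in
theorem latHop_apply (x z : ZLat d) (v : Hl2 (TotalIdx d N)) (a : TotalIdx d N) :
    latHop x z v a = if h : a.1.1 = x ∧ z ∈ box d N then v (⟨z, h.2⟩, a.2) else 0 := by
  by_cases hz : z ∈ box d N
  · refine (hasSum_kern_apply (latHop x z) v a).unique ?_
    convert hasSum_single ((⟨z, hz⟩, a.2) : TotalIdx d N) ?_ using 1
    · rw [kern_latHop]
      by_cases hx : a.1.1 = x
      · rw [dif_pos ⟨hx, hz⟩, if_pos ⟨hx, rfl, rfl⟩, one_mul]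
      · rw [dif_neg fun h => hx h.1, if_neg fun h => hx h.1, zero_mul]
    · rintro ⟨y, n⟩ hb
      rw [kern_latHop, if_neg, zero_mul]
      rintro ⟨-, h2, h3⟩
      exact hb (Prod.ext (Subtype.ext h2) h3.symm)
  · rw [latHop_of_notMem_right hz, dif_neg fun h => hz h.2]
    rfl

open Classical in
theorem latHop_self_apply (x : ZLat d) (v : Hl2 (TotalIdx d N)) (a : TotalIdx d N) :
    latHop x x v a = if a.1.1 = x then v a else 0 := by
  rw [latHop_apply]
  by_cases hx : a.1.1 = x
  · rw [dif_pos ⟨hx, hx ▸ a.1.2⟩, if_pos hx]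
    exact congrArg (fun b => v b) (Prod.ext (Subtype.ext hx.symm) rfl : ((⟨x, _⟩, a.2) : TotalIdx d N) = a)
  · rw [dif_neg fun h => hx h.1, if_neg hx]

theorem latHop_coherent (x : ZLat d) {z : ZLat d} (hz : z ∈ box d N) (α : Hl2 (Mode d N)) :
    latHop x z (coherent z α) = coherent x α := by
  classical
  ext a
  rw [latHop_apply, coherent_apply]
  by_cases hx : a.1.1 = x
  · rw [dif_pos ⟨hx, hz⟩, if_pos hx, coherent_apply, if_pos rfl]
  · rw [dif_neg fun h => hx h.1, if_neg hx]

variable {φ : EuclideanSpace ℝ (Fin d) → ℂ} (lam : ℝ) (χ : Fin d → ℝ)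
  (hφ : Summable fun k : ZLat d => ‖finForm φ N k‖ ^ 2)

theorem row_eq_zero_of_ne (a b : TotalIdx d N) (h : b.1 ≠ a.1) :
    (gradedHamiltonian lam χ (fun _ => 0) hφ).row a b = 0 := by
  classical
  rw [gradedHamiltonian_row, hamiltonian, hopping_zero, ite_self, if_neg fun h' => h (by rw [h']),
    if_neg h]
  simp

theorem latHop_mul_freeEvolution (hφ : Summable fun k : ZLat d => ‖finForm φ N k‖ ^ 2)
    (x : ZLat d) (t : ℝ) :
    latHop x x * freeEvolution lam χ φ N t = freeEvolution lam χ φ N t * latHop x x := by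
  classical
  have hev := isEvolution_freeEvolution lam χ hφ
  have hnorm : ∀ v, ‖latHop x x v‖ ≤ ‖(v : Hl2 (TotalIdx d N))‖ := fun v =>
    ((latHop x x).le_opNorm v).trans (mul_le_of_le_one_left (norm_nonneg _) (norm_latHop_le x x))
  ext1 v
  have hrow : ∀ (a : TotalIdx d N) (w : Hl2 (TotalIdx d N)),
      inner ℂ ((gradedHamiltonian lam χ (fun _ => 0) hφ).row a) (latHop x x w) =
        if a.1.1 = x then inner ℂ ((gradedHamiltonian lam χ (fun _ => 0) hφ).row a) w else 0 := by
    intro a w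
    refine (hasSum_inner _ _).unique ?_
    have h1 := (hasSum_inner ((gradedHamiltonian lam χ (fun _ => 0) hφ).row a) w).mul_left
      (if a.1.1 = x then 1 else 0)
    rw [ite_mul, one_mul, zero_mul] at h1
    refine h1.congr_fun fun b => ?_
    by_cases hb : b.1 = a.1
    · rw [latHop_self_apply, hb]
      split_ifs <;> simp
    · rw [row_eq_zero_of_ne lam χ hφ a b hb]
      simp
  refine (gradedHamiltonian lam χ (fun _ => 0) hφ).eq_of_isWeakSol (M := ‖v‖)
    (u := fun t => latHop x x (freeEvolution lam χ φ N t v))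
    (v := fun t => freeEvolution lam χ φ N t (latHop x x v)) ?_ (hev.isWeakSol _) (fun t => ?_)
    (fun t => ?_) ?_ t
  · intro a _ t
    simp only [hrow, latHop_self_apply]
    by_cases ha : a.1.1 = x
    · simpa only [if_pos ha] using hev.isWeakSol v a (Set.mem_univ _) t
    · simpa only [if_neg ha, mul_zero, neg_zero] using hasDerivAt_const t (0 : ℂ)
  · refine (hnorm _).trans ?_
    rw [hev.isUnitaryGroup.norm_apply]
  · rw [hev.isUnitaryGroup.norm_apply]
    exact hnorm v
  · simp only [hev.zero]
    rfl

end LatticeHops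

section Words

variable {d N : ℕ}

/-- The word `|b⟩⟨x₁| U(τ₁) |x₁⟩⟨x₂| U(τ₂) ⋯ U(τₙ) |xₙ⟩⟨a|` of free evolutions at the sites
`xᵢ` for the (signed) times `τᵢ`. -/
def wordOp (U : ℝ → Op (TotalIdx d N)) : List (ZLat d × ℝ) → ZLat d → ZLat d → Op (TotalIdx d N)
  | [], b, a => latHop b a
  | p :: c, b, a => latHop b p.1 * U p.2 * wordOp U c p.1 a

/-- The total time of a word. -/
def wordTime (c : List (ZLat d × ℝ)) : ℝ := (c.map Prod.snd).sum

theorem wordOp_of_notMem_left (U : ℝ → Op (TotalIdx d N)) (c : List (ZLat d × ℝ)) {b : ZLat d}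
    (hb : b ∉ box d N) (a : ZLat d) : wordOp U c b a = 0 := by
  cases c with
  | nil => exact latHop_of_notMem_left hb a
  | cons p c => rw [wordOp, latHop_of_notMem_left hb, zero_mul, zero_mul]

theorem wordOp_of_notMem_right (U : ℝ → Op (TotalIdx d N)) (c : List (ZLat d × ℝ)) (b : ZLat d)
    {a : ZLat d} (ha : a ∉ box d N) : wordOp U c b a = 0 := by
  induction c generalizing b with
  | nil => exact latHop_of_notMem_right ha b
  | cons p c ih => rw [wordOp, ih, mul_zero]

theorem latHop_mul_wordOp (U : ℝ → Op (TotalIdx d N)) (c : List (ZLat d × ℝ)) (x : ZLat d)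
    {b : ZLat d} (hb : b ∈ box d N) (a : ZLat d) :
    latHop x b * wordOp U c b a = wordOp U c x a := by
  cases c with
  | nil => exact latHop_mul_same x hb a
  | cons p c => rw [wordOp, wordOp, ← mul_assoc, ← mul_assoc, latHop_mul_same x hb]

theorem wordOp_mul_latHop (U : ℝ → Op (TotalIdx d N)) (c : List (ZLat d × ℝ)) (b : ZLat d)
    {a : ZLat d} (ha : a ∈ box d N) (z : ZLat d) :
    wordOp U c b a * latHop a z = wordOp U c b z := by
  induction c generalizing b with
  | nil => exact latHop_mul_same b ha z
  | cons p c ih => rw [wordOp, wordOp, mul_assoc, ih]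

theorem norm_wordOp_le {U : ℝ → Op (TotalIdx d N)} (hU : IsUnitaryGroup U) (c : List (ZLat d × ℝ))
    (b a : ZLat d) : ‖wordOp U c b a‖ ≤ 1 := by
  induction c generalizing b with
  | nil => exact norm_latHop_le b a
  | cons p c ih =>
    rw [wordOp]
    refine (norm_mul_le _ _).trans (mul_le_one₀ ?_ (norm_nonneg _) (ih _))
    exact (norm_mul_le _ _).trans (mul_le_one₀ (norm_latHop_le _ _) (norm_nonneg _)
      (hU.norm_le_one _))

variable {φ : EuclideanSpace ℝ (Fin d) → ℂ} (lam : ℝ) (χ : Fin d → ℝ)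
  (hφ : Summable fun k : ZLat d => ‖finForm φ N k‖ ^ 2)

theorem freeEvolution_mul_wordOp (hφ : Summable fun k : ZLat d => ‖finForm φ N k‖ ^ 2)
    (c : List (ZLat d × ℝ)) (b a : ZLat d) (τ : ℝ) :
    freeEvolution lam χ φ N τ * wordOp (freeEvolution lam χ φ N) c b a =
      wordOp (freeEvolution lam χ φ N) ((b, τ) :: c) b a := by
  rw [wordOp, latHop_mul_freeEvolution lam χ hφ, mul_assoc]
  by_cases hb : b ∈ box d N
  · rw [latHop_mul_wordOp _ _ _ hb]
  · rw [wordOp_of_notMem_left _ _ hb, mul_zero, mul_zero, mul_zero]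

theorem wordOp_mul_freeEvolution (hφ : Summable fun k : ZLat d => ‖finForm φ N k‖ ^ 2)
    (c : List (ZLat d × ℝ)) (b a : ZLat d) (τ : ℝ) :
    wordOp (freeEvolution lam χ φ N) c b a * freeEvolution lam χ φ N τ =
      wordOp (freeEvolution lam χ φ N) (c ++ [(a, τ)]) b a := by
  induction c generalizing b with
  | nil =>
    rw [List.nil_append, wordOp, wordOp, wordOp, mul_assoc, ← latHop_mul_freeEvolution lam χ hφ,
      ← mul_assoc]
    by_cases ha : a ∈ box d N
    · rw [latHop_mul_same _ ha]
    · rw [latHop_of_notMem_right ha, zero_mul, zero_mul, zero_mul]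
  | cons p c ih => rw [List.cons_append, wordOp, wordOp, mul_assoc, ih]

/-- The displacement by a free evolution at the site `x` between the times `s` and `s'`, in the
interaction picture. -/
def segmentDisp (x : ZLat d) (s s' : ℝ) : Hl2 (Mode d N) :=
  modeRotation (-s) (displacement lam hφ x) - modeRotation (-s') (displacement lam hφ x)

/-- The displacement of the reservoir modes by a word. -/
def wordDisp : List (ZLat d × ℝ) → Hl2 (Mode d N)
  | [] => 0
  | p :: c => wordDisp c + segmentDisp lam hφ p.1 (wordTime c) (wordTime c + p.2)

/-- The logarithm of the factor acquired by coherent vectors under a word. -/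
def wordPhase : List (ZLat d × ℝ) → ℂ
  | [] => 0
  | p :: c => wordPhase c + freePhase lam χ hφ p.1 (displacement lam hφ p.1) p.2 -
      inner ℂ (segmentDisp lam hφ p.1 (wordTime c) (wordTime c + p.2)) (wordDisp lam hφ c)

/-- Words act on coherent vectors by a displacement and a rotation of the modes. -/
theorem wordOp_coherent (hN : 0 < N) (c : List (ZLat d × ℝ)) (hc : ∀ p ∈ c, p.1 ∈ box d N)
    (b : ZLat d) {a : ZLat d} (ha : a ∈ box d N) (α : Hl2 (Mode d N)) :
    wordOp (freeEvolution lam χ φ N) c b a (coherent a α) =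
      Complex.exp (wordPhase lam χ hφ c - inner ℂ (wordDisp lam hφ c) α) •
        coherent b (modeRotation (wordTime c) (α + wordDisp lam hφ c)) := by
  have hrot := modeRotation_isUnitaryGroup (d := d) (N := N)
  induction c generalizing b with
  | nil =>
    rw [wordOp, latHop_coherent b ha, wordPhase, wordDisp, wordTime, inner_zero_left, sub_zero,
      Complex.exp_zero, one_smul, add_zero, List.map_nil, List.sum_nil, hrot.zero]
    rfl
  | cons p c ih =>
    obtain ⟨x, τ⟩ := p
    have hx : x ∈ box d N := hc (x, τ) List.mem_cons_self
    have hT : wordTime ((x, τ) :: c) = wordTime c + τ := by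
      rw [wordTime, List.map_cons, List.sum_cons, add_comm]; rfl
    set T := wordTime c with hTdef
    set h := displacement lam hφ x with hh
    set B := wordDisp lam hφ c with hB
    set D := segmentDisp lam hφ x T (T + τ) with hD
    set γ := modeRotation T (α + B) with hγ
    have hrr : ∀ s t v, modeRotation s (modeRotation t v) =
        (modeRotation (s + t) v : Hl2 (Mode d N)) := by
      intro s t v
      rw [hrot.add]; rfl
    have e1 : wordOp (freeEvolution lam χ φ N) ((x, τ) :: c) b a (coherent a α) =
        latHop b x (freeEvolution lam χ φ N τ
          (wordOp (freeEvolution lam χ φ N) c x a (coherent a α))) := rfl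
    have e2 : modeRotation τ (γ + h) - h = modeRotation (T + τ) (α + (B + D)) := by
      rw [hD, segmentDisp, hγ]
      simp only [map_add, map_sub, hrr]
      rw [show T + τ + -T = τ by ring, show T + τ + -(T + τ) = 0 by ring,
        show τ + T = T + τ by ring, hrot.zero]
      change _ + _ - h = _ + (_ + (_ - h))
      abel
    have e3 : freePhase lam χ hφ x (γ + h) τ = freePhase lam χ hφ x h τ - inner ℂ D (α + B) := by
      rw [freePhase, freePhase, hD, segmentDisp, inner_sub_left, hrot.inner_left, hrot.inner_left,
        neg_neg, neg_neg, map_add, inner_add_right, inner_add_right, hγ, hrr, add_comm T τ]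
      ring
    rw [e1, ih (fun q hq => hc q (List.mem_cons_of_mem _ hq)) x, map_smul, map_smul,
      freeEvolution_coherent lam χ hφ hN, map_smul, latHop_coherent b hx, smul_smul,
      ← Complex.exp_add, e2, e3, hT, wordDisp, wordPhase, inner_add_left, inner_add_right]
    congr 2
    ring

/-- The diagonal matrix elements of a word of total time zero, which is a displacement operator. -/
theorem kern_wordOp_self (hN : 0 < N) (c : List (ZLat d × ℝ)) (hc : ∀ p ∈ c, p.1 ∈ box d N)
    (hc0 : wordTime c = 0) (b a : Site d N) (n : Occ d N) :
    kern (wordOp (freeEvolution lam χ φ N) c b.1 a.1) (b, n) (a, n) =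
      Complex.exp (wordPhase lam χ hφ c) *
        n.prod fun p k => (laguerre k (‖wordDisp lam hφ c p‖ ^ 2) : ℂ) := by
  classical
  set W := wordOp (freeEvolution lam χ φ N) c b.1 a.1 with hW
  set B := wordDisp lam hφ c with hB
  have hrot := modeRotation_isUnitaryGroup (d := d) (N := N)
  -- finitely supported amplitudes
  have hfin : ∀ α : Mode d N → ℂ, (∀ p ∉ n.support, α p = 0) → Memℓp α 2 := fun α hα =>
    memℓp_gen (summable_of_ne_finset_zero (s := n.support) fun p hp => by simp [hα p hp])
  have hrowsum : ∀ v : Hl2 (TotalIdx d N), Summable fun m => ‖kern W (b, n) (a, m) * v (a, m)‖ := by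
    intro v
    have h1 := (hasSum_kern_apply W v (b, n)).summable.norm
    exact h1.comp_injective (i := fun m : Occ d N => ((a, m) : TotalIdx d N))
      fun m m' h => congrArg Prod.snd h
  set I : Mode d N → ℂ := fun p => if p ∈ n.support then 1 else 0 with hI
  have hI0 : ∀ p ∉ n.support, I p = 0 := fun p hp => by rw [hI]; simp only [if_neg hp]
  refine eq_prod_laguerre_of_hasSum (w := fun m => kern W (b, n) (a, m)) n _ (B : Mode d N → ℂ)
    (M := fun m => ‖kern W (b, n) (a, m) * coherent a.1 (⟨I, hfin I hI0⟩ : Hl2 (Mode d N)) (a, m)‖)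
    (hrowsum _) ?_ ?_
  · intro α hα1 hα0 m
    rw [norm_mul, norm_mul, coherent_apply, if_pos rfl]
    refine mul_le_mul_of_nonneg_left ?_ (norm_nonneg _)
    change _ ≤ ‖m.prod (coherentFactor I)‖
    rw [norm_finsupp_prod, norm_finsupp_prod, Finsupp.prod, Finsupp.prod]
    refine Finset.prod_le_prod (fun _ _ => norm_nonneg _) fun p _ => ?_
    rw [coherentFactor, coherentFactor, norm_div, norm_div, norm_pow, norm_pow]
    refine div_le_div_of_nonneg_right (pow_le_pow_left₀ (norm_nonneg _) ?_ _) (norm_nonneg _)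
    by_cases hp : p ∈ n.support
    · simpa [hI, Finsupp.mem_support_iff.1 hp] using hα1 p
    · rw [hα0 p hp, hI0 p hp]
  · intro α hα0
    set α' : Hl2 (Mode d N) := ⟨α, hfin α hα0⟩ with hα'
    have h1 := hasSum_kern_apply W (coherent a.1 α') (b, n)
    rw [← (show Function.Injective fun m : Occ d N => ((a, m) : TotalIdx d N) from
      fun m m' h => congrArg Prod.snd h).hasSum_iff] at h1
    · have h2 := wordOp_coherent lam χ hφ hN c hc b.1 a.2 α'
      rw [← hW] at h2
      rw [h2, hc0, hrot.zero] at h1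
      have h3 : inner ℂ B α' = ∑ p ∈ n.support, (starRingEnd ℂ) (B p) * α p := by
        refine (hasSum_inner B α').unique ?_
        refine hasSum_sum_of_ne_finset_zero fun p hp => ?_
        change _ * α p = 0
        rw [hα0 p hp, mul_zero]
      have h4 : (Complex.exp (wordPhase lam χ hφ c - inner ℂ (wordDisp lam hφ c) α') •
          coherent b.1 ((1 : Op (Mode d N)) (α' + wordDisp lam hφ c))) (b, n) =
          Complex.exp (wordPhase lam χ hφ c) *
            (Complex.exp (-∑ p ∈ n.support, (starRingEnd ℂ) (B p) * α p) *
            n.prod (coherentFactor fun p => α p + B p)) := by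
        change _ * coherent b.1 (α' + B) (b, n) = _
        rw [coherent_apply, if_pos rfl, ← hB, h3, sub_eq_add_neg, Complex.exp_add, mul_assoc]
        rfl
      rw [h4] at h1
      refine h1.congr_fun fun m => ?_
      rw [Function.comp_apply, coherent_apply, if_pos rfl]
      rfl
    · rintro ⟨y, m⟩ hy
      rw [coherent_apply, if_neg, mul_zero]
      intro h
      exact hy ⟨m, by rw [Prod.mk.injEq]; exact ⟨(Subtype.ext h).symm, rfl⟩⟩

end Words

/-! ### Thermal expectations of words -/

section Thermal

variable {d N : ℕ}

/-- The thermal occupation number `1 / (e^{βω} - 1)` of a mode. -/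
def thermalOcc (β : ℝ) (p : Mode d N) : ℝ := (Real.exp (β * modeEnergy p) - 1)⁻¹

theorem modeEnergy_pos (hN : 0 < N) (p : Mode d N) : 0 < modeEnergy p := bosonDispersion_pos hN p.2

theorem thermalOcc_nonneg {β : ℝ} (hβ : 0 < β) (hN : 0 < N) (p : Mode d N) : 0 ≤ thermalOcc β p :=
  inv_nonneg.2 (sub_nonneg.2 (Real.one_le_exp (mul_nonneg hβ.le (modeEnergy_pos hN p).le)))

theorem exp_neg_lt_one {β : ℝ} (hβ : 0 < β) (hN : 0 < N) (p : Mode d N) :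
    Real.exp (-(β * modeEnergy p)) < 1 :=
  Real.exp_lt_one_iff.2 (neg_lt_zero.2 (mul_pos hβ (modeEnergy_pos hN p)))

theorem thermalOcc_eq (β : ℝ) (p : Mode d N) : thermalOcc β p =
    Real.exp (-(β * modeEnergy p)) / (1 - Real.exp (-(β * modeEnergy p))) := by
  have h := (Real.exp_pos (β * modeEnergy p)).ne'
  have h1 : 1 - (Real.exp (β * modeEnergy p))⁻¹ =
      (Real.exp (β * modeEnergy p) - 1) * (Real.exp (β * modeEnergy p))⁻¹ := by field_simp
  rw [thermalOcc, Real.exp_neg, h1, div_mul_eq_div_div_swap, div_self (inv_ne_zero h), one_div]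

theorem one_div_one_sub_exp_neg {β : ℝ} (hβ : 0 < β) (hN : 0 < N) (p : Mode d N) :
    (1 - Real.exp (-(β * modeEnergy p)))⁻¹ = 1 + thermalOcc β p := by
  have h := exp_neg_lt_one hβ hN p
  have h' : 1 - Real.exp (-(β * modeEnergy p)) ≠ 0 := by linarith
  rw [thermalOcc_eq]
  field_simp
  ring

theorem exists_thermalOcc_le {β : ℝ} (hβ : 0 < β) (hN : 0 < N) :
    ∃ C, 0 ≤ C ∧ ∀ p : Mode d N, thermalOcc β p ≤ C * Real.exp (-(β * modeEnergy p)) := by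
  set x := Real.exp (-(β * ((N : ℝ) + 1)⁻¹)) with hx
  have hx1 : x < 1 := Real.exp_lt_one_iff.2 (neg_lt_zero.2 (by positivity))
  refine ⟨(1 - x)⁻¹, inv_nonneg.2 (by linarith), fun p => ?_⟩
  have h1 : Real.exp (-(β * modeEnergy p)) ≤ x := by
    rw [hx, Real.exp_le_exp, neg_le_neg_iff]
    refine mul_le_mul_of_nonneg_left ?_ hβ.le
    have := inv_bosonDispersion_le (N := N) p.2
    exact inv_le_of_inv_le₀ (bosonDispersion_pos hN p.2) this
  rw [thermalOcc_eq, div_eq_inv_mul]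
  refine mul_le_mul_of_nonneg_right ?_ (Real.exp_pos _).le
  exact inv_anti₀ (by linarith) (by linarith)

theorem norm_quasiMomentum (N : ℕ) (k : ZLat d) :
    ‖quasiMomentum N k‖ = 2 * Real.pi / (2 * N : ℝ) * latNorm k := by
  have h : quasiMomentum N k = (2 * Real.pi / (2 * N : ℝ)) •
      (WithLp.toLp 2 fun i => (k i : ℝ) : EuclideanSpace ℝ (Fin d)) := by
    ext i; simp [quasiMomentum]
  rw [h, norm_smul, latNorm_eq_norm, Real.norm_of_nonneg (by positivity)]

theorem summable_exp_neg_modeEnergy {β : ℝ} (hβ : 0 < β) (hN : 0 < N) :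
    Summable fun p : Mode d N => Real.exp (-(β * modeEnergy p)) := by
  have hN' : (0 : ℝ) < N := by exact_mod_cast hN
  refine (summable_prod_of_nonneg fun _ => (Real.exp_pos _).le).2
    ⟨fun y => ?_, (hasSum_fintype _).summable⟩
  refine Summable.of_nonneg_of_le (fun _ => (Real.exp_pos _).le) (fun k => ?_)
    (summable_exp_latNorm d (ν := β * (2 * Real.pi / (2 * N : ℝ))) (by positivity))
  rw [Real.exp_le_exp, neg_mul, neg_le_neg_iff, mul_assoc, ← norm_quasiMomentum]
  refine mul_le_mul_of_nonneg_left ?_ hβ.le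
  rw [modeEnergy, bosonDispersion]
  split_ifs <;> simp

theorem summable_thermalOcc {β : ℝ} (hβ : 0 < β) (hN : 0 < N) :
    Summable fun p : Mode d N => thermalOcc β p := by
  obtain ⟨C, -, hC⟩ := exists_thermalOcc_le (d := d) hβ hN
  exact Summable.of_nonneg_of_le (thermalOcc_nonneg hβ hN) hC
    ((summable_exp_neg_modeEnergy hβ hN).mul_left C)

theorem exists_norm_thermalOcc_le {β : ℝ} (hβ : 0 < β) (hN : 0 < N) :
    ∃ C, 0 ≤ C ∧ ∀ p : Mode d N, ‖(thermalOcc β p : ℂ)‖ ≤ C := by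
  obtain ⟨C, hC0, hC⟩ := exists_thermalOcc_le (d := d) hβ hN
  refine ⟨C, hC0, fun p => ?_⟩
  rw [Complex.norm_real, Real.norm_of_nonneg (thermalOcc_nonneg hβ hN p)]
  exact (hC p).trans (mul_le_of_le_one_right hC0 (exp_neg_lt_one hβ hN p).le)

theorem exp_neg_resEnergy (β : ℝ) (n : Occ d N) :
    Real.exp (-β * resEnergy n) = n.prod fun p k => Real.exp (-(β * modeEnergy p)) ^ k := by
  rw [resEnergy, Finsupp.sum, Finset.mul_sum, Real.exp_sum, Finsupp.prod]
  refine Finset.prod_congr rfl fun p _ => ?_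
  rw [← Real.exp_nat_mul, modeEnergy]
  congr 1
  ring

theorem tsum_exp_pow {β : ℝ} (hβ : 0 < β) (hN : 0 < N) (p : Mode d N) :
    HasSum (fun k : ℕ => Real.exp (-(β * modeEnergy p)) ^ k) (1 + thermalOcc β p) := by
  rw [← one_div_one_sub_exp_neg hβ hN]
  exact hasSum_geometric_of_lt_one (Real.exp_pos _).le (exp_neg_lt_one hβ hN p)

theorem summable_exp_neg_resEnergy {β : ℝ} (hβ : 0 < β) (hN : 0 < N) :
    Summable fun n : Occ d N => Real.exp (-β * resEnergy n) := by
  have h := (summable_finsupp_prod (P := Mode d N)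
    (g := fun p k => Real.exp (-(β * modeEnergy p)) ^ k) (fun p => pow_zero _)
    (c := thermalOcc β) (fun p => ?_) (fun p => ?_) (thermalOcc_nonneg hβ hN)
    (summable_thermalOcc hβ hN)).1
  · refine h.congr fun n => ?_
    rw [← exp_neg_resEnergy, Real.norm_of_nonneg (Real.exp_pos _).le]
  · simpa using (tsum_exp_pow hβ hN p).summable
  · simp only [norm_pow, Real.norm_of_nonneg (Real.exp_pos _).le]
    rw [(tsum_exp_pow hβ hN p).tsum_eq, add_comm]
    exact Real.add_one_le_exp _

theorem partition_pos {β : ℝ} (hβ : 0 < β) (hN : 0 < N) :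
    0 < ∑' n : Occ d N, Real.exp (-β * resEnergy n) :=
  (summable_exp_neg_resEnergy hβ hN).tsum_pos (fun _ => (Real.exp_pos _).le) 0 (Real.exp_pos _)

theorem gibbsWeight_nonneg (β : ℝ) (n : Occ d N) : 0 ≤ gibbsWeight β n :=
  div_nonneg (Real.exp_pos _).le (tsum_nonneg fun _ => (Real.exp_pos _).le)

theorem hasSum_gibbsWeight {β : ℝ} (hβ : 0 < β) (hN : 0 < N) :
    HasSum (fun n : Occ d N => gibbsWeight β n) 1 := by
  have h := (summable_exp_neg_resEnergy (d := d) hβ hN).hasSum.div_const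
    (∑' n : Occ d N, Real.exp (-β * resEnergy n))
  rwa [div_self (partition_pos hβ hN).ne'] at h

/-- The thermal expectation of a displacement operator. -/
theorem tsum_gibbsWeight_mul_laguerre {β : ℝ} (hβ : 0 < β) (hN : 0 < N) (B : Hl2 (Mode d N)) :
    ∑' n : Occ d N, gibbsWeight β n * n.prod (fun p k => laguerre k (‖B p‖ ^ 2)) =
      Real.exp (-∑' p, ‖B p‖ ^ 2 * thermalOcc β p) := by
  set x : Mode d N → ℝ := fun p => Real.exp (-(β * modeEnergy p)) with hx
  have hx0 : ∀ p, 0 ≤ x p := fun p => (Real.exp_pos _).le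
  have hx1 : ∀ p, x p < 1 := exp_neg_lt_one hβ hN
  have hy0 : ∀ p, 0 ≤ ‖B p‖ ^ 2 := fun p => by positivity
  have hlag : ∀ p y, HasSum (fun k => x p ^ k * laguerre k y)
      ((1 + thermalOcc β p) * Real.exp (-(y * thermalOcc β p))) := by
    intro p y
    have h := hasSum_laguerre (hx0 p) (hx1 p) y
    rwa [hx, one_div_one_sub_exp_neg hβ hN, ← thermalOcc_eq] at h
  set g : Mode d N → ℕ → ℝ := fun p k => x p ^ k * laguerre k (‖B p‖ ^ 2) with hg
  have hg0 : ∀ p, g p 0 = 1 := fun p => by simp [hg, laguerre]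
  have hgn : ∀ p k, ‖g p k‖ ≤ x p ^ k * laguerre k (-‖B p‖ ^ 2) := by
    intro p k
    rw [hg, norm_mul, norm_pow, Real.norm_of_nonneg (hx0 p)]
    exact mul_le_mul_of_nonneg_left (abs_laguerre_le k (hy0 p)) (pow_nonneg (hx0 p) _)
  have hgs : ∀ p, Summable fun k => ‖g p k‖ := fun p =>
    Summable.of_nonneg_of_le (fun _ => norm_nonneg _) (hgn p) (hlag p _).summable
  obtain ⟨C, hC0, hC⟩ := exists_norm_thermalOcc_le (d := d) hβ hN
  have hC' : ∀ p : Mode d N, thermalOcc β p ≤ C := fun p => by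
    refine le_trans ?_ (hC p)
    rw [Complex.norm_real]
    exact le_abs_self _
  have hBN : Summable fun p => ‖B p‖ ^ 2 * thermalOcc β p := by
    refine Summable.of_nonneg_of_le (fun p => mul_nonneg (hy0 p) (thermalOcc_nonneg hβ hN p))
      (fun p => mul_le_mul_of_nonneg_left (hC' p) (hy0 p)) ((summable_norm_sq B).mul_right C)
  have hsum := (summable_finsupp_prod (g := g) hg0 hgs
    (c := fun p => thermalOcc β p + ‖B p‖ ^ 2 * thermalOcc β p) (fun p => by
      refine ((hgs p).tsum_le_tsum (hgn p) (hlag p _).summable).trans ?_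
      rw [(hlag p _).tsum_eq, neg_mul, neg_neg, Real.exp_add]
      refine mul_le_mul_of_nonneg_right ?_ (Real.exp_pos _).le
      rw [add_comm]
      exact Real.add_one_le_exp _)
    (fun p => add_nonneg (thermalOcc_nonneg hβ hN p)
      (mul_nonneg (hy0 p) (thermalOcc_nonneg hβ hN p)))
    ((summable_thermalOcc hβ hN).add hBN)).1
  have h1 := tendsto_prod_tsum hg0 hgs hsum
  have hp0 : ∀ p : Mode d N, (fun k : ℕ => x p ^ k) 0 = 1 := fun p => pow_zero _
  have h2 := tendsto_prod_tsum (g := fun p k => x p ^ k) hp0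
    (fun p => (tsum_exp_pow hβ hN p).summable.norm)
    (by
      refine (summable_exp_neg_resEnergy (d := d) hβ hN).congr fun n => ?_
      rw [exp_neg_resEnergy, Real.norm_of_nonneg]
      exact Finset.prod_nonneg fun p _ => pow_nonneg (hx0 p) _)
  have h3 : Tendsto (fun K : Finset (Mode d N) =>
      Real.exp (-∑ p ∈ K, ‖B p‖ ^ 2 * thermalOcc β p)) atTop
      (𝓝 (Real.exp (-∑' p, ‖B p‖ ^ 2 * thermalOcc β p))) :=
    (Real.continuous_exp.tendsto _).comp (Tendsto.neg hBN.hasSum)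
  have h4 := tendsto_nhds_unique (h1.congr fun K => by
    rw [← Finset.sum_neg_distrib, Real.exp_sum, ← Finset.prod_mul_distrib]
    refine Finset.prod_congr rfl fun p _ => ?_
    rw [(hlag p _).tsum_eq, (tsum_exp_pow hβ hN p).tsum_eq]) (h2.mul h3)
  have h5 : ∀ n : Occ d N, n.prod g =
      Real.exp (-β * resEnergy n) * n.prod (fun p k => laguerre k (‖B p‖ ^ 2)) := by
    intro n
    rw [exp_neg_resEnergy, ← Finsupp.prod_mul]
  have h6 : ∀ n : Occ d N, gibbsWeight β n * n.prod (fun p k => laguerre k (‖B p‖ ^ 2)) =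
      (∑' n : Occ d N, Real.exp (-β * resEnergy n))⁻¹ * n.prod g := by
    intro n
    rw [h5, gibbsWeight, div_eq_mul_inv]
    ring
  simp only [h6]
  rw [tsum_mul_left, h4]
  have h7 : ∑' n : Occ d N, n.prod (fun p k => x p ^ k) =
      ∑' n : Occ d N, Real.exp (-β * resEnergy n) :=
    tsum_congr fun n => (exp_neg_resEnergy β n).symm
  rw [h7, inv_mul_cancel_left₀ (partition_pos hβ hN).ne']

/-- The average `∑_n p_n ⟨y',n| A |y,n⟩` over the reservoirs in the Gibbs state. -/
def thermalElem (β : ℝ) (A : Op (TotalIdx d N)) (y' y : Site d N) : ℂ :=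
  ∑' n : Occ d N, (gibbsWeight β n : ℂ) * kern A (y', n) (y, n)

theorem summable_thermalElem {β : ℝ} (hβ : 0 < β) (hN : 0 < N) (A : Op (TotalIdx d N))
    (y' y : Site d N) : Summable fun n : Occ d N => (gibbsWeight β n : ℂ) * kern A (y', n) (y, n) := by
  refine Summable.of_norm (Summable.of_nonneg_of_le (fun _ => norm_nonneg _) (fun n => ?_)
    ((hasSum_gibbsWeight (d := d) hβ hN).summable.mul_right ‖A‖))
  rw [norm_mul, Complex.norm_real, Real.norm_of_nonneg (gibbsWeight_nonneg β n)]
  exact mul_le_mul_of_nonneg_left (norm_kern_le A _ _) (gibbsWeight_nonneg β n)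

theorem norm_thermalElem_le_of_kern {β : ℝ} (hβ : 0 < β) (hN : 0 < N) {A : Op (TotalIdx d N)}
    {y' y : Site d N} {C : ℝ} (h : ∀ n, ‖kern A (y', n) (y, n)‖ ≤ C) : ‖thermalElem β A y' y‖ ≤ C := by
  have h1 := (hasSum_gibbsWeight (d := d) hβ hN).mul_right C
  rw [one_mul] at h1
  refine tsum_of_norm_bounded h1 fun n => ?_
  rw [norm_mul, Complex.norm_real, Real.norm_of_nonneg (gibbsWeight_nonneg β n)]
  exact mul_le_mul_of_nonneg_left (h n) (gibbsWeight_nonneg β n)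

theorem norm_thermalElem_le {β : ℝ} (hβ : 0 < β) (hN : 0 < N) (A : Op (TotalIdx d N))
    (y' y : Site d N) : ‖thermalElem β A y' y‖ ≤ ‖A‖ :=
  norm_thermalElem_le_of_kern hβ hN fun _ => norm_kern_le A _ _

variable {φ : EuclideanSpace ℝ (Fin d) → ℂ} (lam : ℝ) (χ : Fin d → ℝ)
  (hφ : Summable fun k : ZLat d => ‖finForm φ N k‖ ^ 2)

theorem thermalElem_wordOp {β : ℝ} (hβ : 0 < β) (hN : 0 < N) (c : List (ZLat d × ℝ))
    (hc : ∀ p ∈ c, p.1 ∈ box d N) (hc0 : wordTime c = 0) (b a : Site d N) :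
    thermalElem β (wordOp (freeEvolution lam χ φ N) c b.1 a.1) b a =
      Complex.exp (wordPhase lam χ hφ c -
        ((∑' p, ‖wordDisp lam hφ c p‖ ^ 2 * thermalOcc β p : ℝ) : ℂ)) := by
  rw [thermalElem, sub_eq_add_neg, Complex.exp_add, ← Complex.ofReal_neg, ← Complex.ofReal_exp,
    ← tsum_gibbsWeight_mul_laguerre hβ hN, Complex.ofReal_tsum, ← tsum_mul_left]
  refine tsum_congr fun n => ?_
  rw [kern_wordOp_self lam χ hφ hN c hc hc0, mul_left_comm, Finsupp.prod, Finsupp.prod]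
  push_cast
  rfl

theorem kern_wordOp_of_ne (U : ℝ → Op (TotalIdx d N)) (c : List (ZLat d × ℝ)) (b a : ZLat d)
    {i j : TotalIdx d N} (h : ¬ (i.1.1 = b ∧ j.1.1 = a)) : kern (wordOp U c b a) i j = 0 := by
  classical
  by_cases hb : b ∈ box d N
  · by_cases ha : a ∈ box d N
    · rw [← latHop_mul_wordOp U c b hb a]
      by_cases h1 : i.1.1 = b
      · rw [← wordOp_mul_latHop U c b ha a, ← mul_assoc]
        refine (hasSum_kern_mul _ _ i j).unique ?_
        convert hasSum_zero with k
        rw [kern_latHop, if_neg fun h2 => h ⟨h1, h2.2.1⟩, mul_zero]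
      · refine (hasSum_kern_mul _ _ i j).unique ?_
        convert hasSum_zero with k
        rw [kern_latHop, if_neg fun h2 => h1 h2.1, zero_mul]
    · rw [wordOp_of_notMem_right _ _ _ ha]; rfl
  · rw [wordOp_of_notMem_left _ _ hb]; rfl

theorem thermalElem_wordOp_of_ne (β : ℝ) (U : ℝ → Op (TotalIdx d N)) (c : List (ZLat d × ℝ))
    (b a : ZLat d) {y' y : Site d N} (h : ¬ (y'.1 = b ∧ y.1 = a)) :
    thermalElem β (wordOp U c b a) y' y = 0 := by
  rw [thermalElem]
  convert tsum_zero with n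
  rw [kern_wordOp_of_ne U c b a h, mul_zero]

end Thermal

/-! ### The memory function of the reservoir -/

section Memory

/-- The function `∫₀ᵗ (t - u) C(u) du`, through which a reservoir with the correlation function `C`
enters the thermal expectations of words. -/
def memoryFn (C : ℝ → ℂ) (t : ℝ) : ℂ := ∫ u in (0 : ℝ)..t, ((t - u : ℝ) : ℂ) * C u

theorem memoryFn_exp {w : ℂ} (hw : w ≠ 0) (t : ℝ) :
    memoryFn (fun u => Complex.exp (w * u)) t = (Complex.exp (w * t) - 1 - w * t) / w ^ 2 := by
  have h : ∀ u : ℝ, HasDerivAt (fun u : ℝ => ((t - u : ℝ) : ℂ) * Complex.exp (w * u) / w +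
      Complex.exp (w * u) / w ^ 2) (((t - u : ℝ) : ℂ) * Complex.exp (w * u)) u := by
    intro u
    have h1 : HasDerivAt (fun u : ℝ => Complex.exp (w * u)) (Complex.exp (w * u) * (w * 1)) u :=
      ((hasDerivAt_id u).ofReal_comp.const_mul w).cexp
    have h2 : HasDerivAt (fun u : ℝ => ((t - u : ℝ) : ℂ)) ((-1 : ℝ) : ℂ) u :=
      ((hasDerivAt_id u).const_sub t).ofReal_comp
    refine (((h2.mul h1).div_const w).add (h1.div_const (w ^ 2))).congr_deriv ?_
    push_cast
    field_simp
    ring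
  rw [memoryFn, intervalIntegral.integral_eq_sub_of_hasDerivAt (fun u _ => h u)]
  · simp only [sub_self, Complex.ofReal_zero, zero_mul, zero_div, zero_add, mul_zero,
      Complex.exp_zero, sub_zero]
    field_simp
    ring
  · refine Continuous.intervalIntegrable ?_ _ _
    fun_prop

variable {d N : ℕ}

theorem thermalFactor_eq {β : ℝ} (hβ : 0 < β) (hN : 0 < N) (p : Mode d N) (u : ℝ) :
    thermalFactor β (modeEnergy p) u = thermalOcc β p * Complex.exp (-(Complex.I * modeEnergy p) * u) +
      (1 + thermalOcc β p) * Complex.exp (Complex.I * modeEnergy p * u) := by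
  rw [thermalFactor, div_eq_inv_mul, div_eq_inv_mul, ← Complex.ofReal_inv, ← Complex.ofReal_inv,
    one_div_one_sub_exp_neg hβ hN]
  rw [show -(Complex.I * (u : ℂ) * modeEnergy p) = -(Complex.I * modeEnergy p) * u by ring,
    show Complex.I * (u : ℂ) * modeEnergy p = Complex.I * modeEnergy p * u by ring]
  rw [Complex.ofReal_add, Complex.ofReal_one]
  rfl

theorem norm_thermalFactor_le {β : ℝ} (hβ : 0 < β) (hN : 0 < N) {C : ℝ}
    (hC : ∀ p : Mode d N, ‖(thermalOcc β p : ℂ)‖ ≤ C) (p : Mode d N) (u : ℝ) :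
    ‖thermalFactor β (modeEnergy p) u‖ ≤ 1 + 2 * C := by
  rw [thermalFactor_eq hβ hN]
  have h1 : ‖Complex.exp (-(Complex.I * modeEnergy p) * u)‖ = 1 := by
    rw [Complex.norm_exp]; simp
  have h2 : ‖Complex.exp (Complex.I * modeEnergy p * u)‖ = 1 := by
    rw [Complex.norm_exp]; simp
  refine (norm_add_le _ _).trans ?_
  rw [norm_mul, norm_mul, h1, h2, mul_one, mul_one]
  have h3 := hC p
  have h4 : ‖(1 : ℂ) + thermalOcc β p‖ ≤ 1 + C := (norm_add_le _ _).trans (by simpa using h3)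
  linarith

variable {φ : EuclideanSpace ℝ (Fin d) → ℂ} (lam : ℝ) (χ : Fin d → ℝ)
  (hφ : Summable fun k : ZLat d => ‖finForm φ N k‖ ^ 2)

theorem zero_mem_box : (0 : ZLat d) ∈ box d N := by
  simp [box]

theorem finCorr_eq {β : ℝ} (x : Site d N) (u : ℝ) : finCorr β φ N u =
    ∑' k, ((‖finForm φ N k‖ ^ 2 : ℝ) : ℂ) * thermalFactor β (modeEnergy ((x, k) : Mode d N)) u := rfl

theorem continuous_thermalFactor (β ω : ℝ) : Continuous fun u : ℝ => thermalFactor β ω u := by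
  unfold thermalFactor
  fun_prop

theorem continuous_finCorr (hφ : Summable fun k : ZLat d => ‖finForm φ N k‖ ^ 2) {β : ℝ}
    (hβ : 0 < β) (hN : 0 < N) : Continuous fun u : ℝ => finCorr β φ N u := by
  obtain ⟨C, hC0, hC⟩ := exists_norm_thermalOcc_le (d := d) hβ hN
  refine continuous_tsum (fun k => (continuous_thermalFactor β _).const_mul _)
    (hφ.mul_right (1 + 2 * C)) fun k u => ?_
  rw [norm_mul, Complex.norm_real, Real.norm_of_nonneg (by positivity)]
  exact mul_le_mul_of_nonneg_left (norm_thermalFactor_le hβ hN hC (⟨0, zero_mem_box⟩, k) u)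
    (by positivity)

/-- The contribution of each mode to the memory function. -/
theorem hasSum_memoryFn_finCorr (hφ : Summable fun k : ZLat d => ‖finForm φ N k‖ ^ 2) {β : ℝ}
    (hβ : 0 < β) (hN : 0 < N) (x : Site d N) (t : ℝ) :
    HasSum (fun k : ZLat d => ((‖finForm φ N k‖ ^ 2 : ℝ) : ℂ) *
      (thermalOcc β ((x, k) : Mode d N) *
        ((1 - Complex.I * modeEnergy ((x, k) : Mode d N) * t -
          Complex.exp (-(Complex.I * modeEnergy ((x, k) : Mode d N)) * t)) /
            (modeEnergy ((x, k) : Mode d N) : ℂ) ^ 2) +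
        (1 + thermalOcc β ((x, k) : Mode d N)) *
        ((1 + Complex.I * modeEnergy ((x, k) : Mode d N) * t -
          Complex.exp (Complex.I * modeEnergy ((x, k) : Mode d N) * t)) /
            (modeEnergy ((x, k) : Mode d N) : ℂ) ^ 2)))
      (memoryFn (fun u => finCorr β φ N u) t) := by
  obtain ⟨C, hC0, hC⟩ := exists_norm_thermalOcc_le (d := d) hβ hN
  have hterm : ∀ k u, ‖((‖finForm φ N k‖ ^ 2 : ℝ) : ℂ) *
      thermalFactor β (modeEnergy ((x, k) : Mode d N)) (u : ℝ)‖ ≤ ‖finForm φ N k‖ ^ 2 * (1 + 2 * C) := by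
    intro k u
    rw [norm_mul, Complex.norm_real, Real.norm_of_nonneg (by positivity)]
    exact mul_le_mul_of_nonneg_left (norm_thermalFactor_le hβ hN hC (x, k) u) (by positivity)
  have hcont : ∀ k : ZLat d, Continuous fun u : ℝ => ((t - u : ℝ) : ℂ) * (((‖finForm φ N k‖ ^ 2 : ℝ) : ℂ) *
      thermalFactor β (modeEnergy ((x, k) : Mode d N)) u) := fun k =>
    (Complex.continuous_ofReal.comp (continuous_const.sub continuous_id)).mul
      ((continuous_thermalFactor β _).const_mul _)
  have h1 := intervalIntegral.hasSum_integral_of_dominated_convergence (μ := volume) (a := 0) (b := t)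
    (F := fun (k : ZLat d) (u : ℝ) => ((t - u : ℝ) : ℂ) * (((‖finForm φ N k‖ ^ 2 : ℝ) : ℂ) *
      thermalFactor β (modeEnergy ((x, k) : Mode d N)) u))
    (f := fun u => ((t - u : ℝ) : ℂ) * finCorr β φ N u)
    (fun k _ => |t| * (‖finForm φ N k‖ ^ 2 * (1 + 2 * C)))
    (fun k => (hcont k).aestronglyMeasurable)
    (fun k => ae_of_all _ fun u hu => by
      rw [norm_mul]
      refine mul_le_mul ?_ (hterm k u) (norm_nonneg _) (abs_nonneg _)
      rw [Complex.norm_real, Real.norm_eq_abs, Set.mem_uIoc] at *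
      rcases hu with hu | hu
      · rw [abs_of_nonneg (by linarith), abs_of_pos (by linarith)]; linarith
      · rw [abs_of_neg (by linarith), abs_of_nonpos (by linarith)]; linarith)
    (ae_of_all _ fun u _ => (hφ.mul_right _).mul_left _)
    intervalIntegrable_const
    (ae_of_all _ fun u _ => by
      rw [finCorr_eq x]
      refine HasSum.mul_left _ (Summable.hasSum (Summable.of_norm ?_))
      exact Summable.of_nonneg_of_le (fun _ => norm_nonneg _) (fun k => hterm k u)
        (hφ.mul_right (1 + 2 * C)))
  refine h1.congr_fun fun k => ?_
  have hω : (modeEnergy ((x, k) : Mode d N) : ℂ) ≠ 0 := by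
    exact_mod_cast (modeEnergy_pos hN ((x, k) : Mode d N)).ne'
  set ω : ℂ := (modeEnergy ((x, k) : Mode d N) : ℂ) with hωdef
  have e1 := memoryFn_exp (w := -(Complex.I * ω)) (neg_ne_zero.2 (mul_ne_zero Complex.I_ne_zero hω)) t
  have e2 := memoryFn_exp (w := Complex.I * ω) (mul_ne_zero Complex.I_ne_zero hω) t
  rw [memoryFn] at e1 e2
  have e3 : ∀ u : ℝ, ((t - u : ℝ) : ℂ) * (((‖finForm φ N k‖ ^ 2 : ℝ) : ℂ) *
      thermalFactor β (modeEnergy ((x, k) : Mode d N)) u) =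
      ((‖finForm φ N k‖ ^ 2 : ℝ) : ℂ) * thermalOcc β ((x, k) : Mode d N) *
        (((t - u : ℝ) : ℂ) * Complex.exp (-(Complex.I * ω) * u)) +
      ((‖finForm φ N k‖ ^ 2 : ℝ) : ℂ) * (1 + thermalOcc β ((x, k) : Mode d N)) *
        (((t - u : ℝ) : ℂ) * Complex.exp (Complex.I * ω * u)) := by
    intro u
    rw [thermalFactor_eq hβ hN]
    ring
  simp only [e3]
  rw [intervalIntegral.integral_add, intervalIntegral.integral_const_mul,
    intervalIntegral.integral_const_mul, e1, e2]
  · have hI : Complex.I ^ 2 = -1 := Complex.I_sq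
    rw [neg_sq, mul_pow, hI]
    field_simp
    ring
  · exact Continuous.intervalIntegrable (by fun_prop) _ _
  · exact Continuous.intervalIntegrable (by fun_prop) _ _

theorem tendsto_memoryFn {β : ℝ} (hβ : 0 < β) (h : ReservoirAssumption β φ) (t : ℝ) :
    Tendsto (fun N => memoryFn (fun u => finCorr β φ N u) t) atTop
      (𝓝 (memoryFn (fun u => infCorr β φ u) t)) := by
  obtain ⟨C, hC⟩ := h.bounded
  have hstrip : ∀ u : ℝ, (u : ℂ) ∈ kmsStrip β := fun u => by simp [kmsStrip, hβ.le]
  refine intervalIntegral.tendsto_integral_filter_of_dominated_convergence (fun _ => |t| * C) ?_ ?_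
    intervalIntegrable_const ?_
  · filter_upwards [eventually_gt_atTop 0] with N hN
    exact ((Complex.continuous_ofReal.comp (continuous_const.sub continuous_id)).mul
      (continuous_finCorr (h.finForm_l2 N hN) hβ hN)).aestronglyMeasurable
  · filter_upwards [eventually_gt_atTop 0] with N hN
    refine ae_of_all _ fun u hu => ?_
    rw [norm_mul]
    refine mul_le_mul ?_ ((hC u (hstrip u)).2 N hN) (norm_nonneg _) (abs_nonneg _)
    rw [Complex.norm_real, Real.norm_eq_abs, Set.mem_uIoc] at *
    rcases hu with hu | hu
    · rw [abs_of_nonneg (by linarith), abs_of_pos (by linarith)]; linarith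
    · rw [abs_of_neg (by linarith), abs_of_nonpos (by linarith)]; linarith
  · refine ae_of_all _ fun u _ => Tendsto.const_mul _ ?_
    exact (h.converges {(u : ℂ)} (by simpa using hstrip u) isCompact_singleton).tendsto_at
      (Set.mem_singleton _)

end Memory

/-! ### The exponent of a word in terms of the memory function -/

section WordExponent

variable {d N : ℕ} {φ : EuclideanSpace ℝ (Fin d) → ℂ} (lam : ℝ) (χ : Fin d → ℝ)
  (hφ : Summable fun k : ZLat d => ‖finForm φ N k‖ ^ 2)

theorem displacement_apply_of_ne (x : ZLat d) {p : Mode d N} (h : p.1.1 ≠ x) :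
    displacement lam hφ x p = 0 := by
  change (lam : ℂ) * ((((modeEnergy p)⁻¹ : ℝ) : ℂ) * formVec hφ x p) = 0
  rw [formVec_apply, if_neg h, mul_zero, mul_zero]

theorem displacement_apply_self (x : Site d N) (k : ZLat d) :
    displacement lam hφ x.1 (x, k) =
      lam * ((modeEnergy (x, k) : ℂ)⁻¹ * (starRingEnd ℂ) (finForm φ N k)) := by
  change (lam : ℂ) * ((((modeEnergy (x, k))⁻¹ : ℝ) : ℂ) * formVec hφ x.1 (x, k)) = _
  rw [formVec_apply, if_pos rfl, Complex.ofReal_inv]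

theorem hasSum_inner_displacement (x : Site d N) (v : Hl2 (Mode d N)) :
    HasSum (fun k => (starRingEnd ℂ) (displacement lam hφ x.1 (x, k)) * v (x, k))
      (inner ℂ (displacement lam hφ x.1) v) := by
  have h := hasSum_inner (displacement lam hφ x.1) v
  rw [← (mode_injective x).hasSum_iff] at h
  · exact h
  · rintro ⟨z, k⟩ hz
    rw [displacement_apply_of_ne, map_zero, zero_mul]
    intro h'
    exact hz ⟨k, by rw [Prod.mk.injEq]; exact ⟨(Subtype.ext h').symm, rfl⟩⟩

theorem inner_displacement_of_support {x y : ZLat d} (hxy : x ≠ y) {v : Hl2 (Mode d N)}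
    (hv : ∀ p : Mode d N, p.1.1 ≠ y → v p = 0) : inner ℂ (displacement lam hφ x) v = 0 := by
  refine (hasSum_inner _ _).unique ?_
  convert hasSum_zero with p
  by_cases hp : p.1.1 = x
  · rw [hv p (hp ▸ hxy), mul_zero]
  · rw [displacement_apply_of_ne lam hφ x hp, map_zero, zero_mul]

theorem modeRotation_apply (t : ℝ) (v : Hl2 (Mode d N)) (p : Mode d N) :
    modeRotation t v p = Complex.exp (-(Complex.I * t * modeEnergy p)) * v p := rfl

variable {β C : ℝ} (hC : ∀ p : Mode d N, ‖(thermalOcc β p : ℂ)‖ ≤ C)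

/-- The sesquilinear form `⟨v, w⟩ + ⟨v, n w⟩ + ⟨w, n v⟩`, with `n` the thermal occupation number;
it governs the thermal expectation of a product of two displacements. -/
def thermalForm (v w : Hl2 (Mode d N)) : ℂ :=
  inner ℂ v w + inner ℂ v (diagOp _ hC w) + inner ℂ w (diagOp _ hC v)

/-- The correlation function `⟨h, e^{iωt} h⟩ + ⟨h, n e^{iωt} h⟩ + ⟨h, n e^{-iωt} h⟩` of the
displacement `h` at the site `x`. -/
def displacementCorr (x : ZLat d) (t : ℝ) : ℂ :=
  inner ℂ (displacement lam hφ x) (modeRotation (-t) (displacement lam hφ x)) +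
    inner ℂ (displacement lam hφ x) (diagOp _ hC (modeRotation (-t) (displacement lam hφ x))) +
    inner ℂ (displacement lam hφ x) (diagOp _ hC (modeRotation t (displacement lam hφ x)))

theorem modeRotation_diagOp (t : ℝ) (v : Hl2 (Mode d N)) :
    modeRotation t (diagOp _ hC v) = diagOp _ hC (modeRotation t v) := by
  ext p
  rw [diagOp_apply, modeRotation_apply, modeRotation_apply, diagOp_apply]
  ring

theorem modeRotation_modeRotation (s t : ℝ) (v : Hl2 (Mode d N)) :
    modeRotation s (modeRotation t v) = modeRotation (s + t) v := by
  rw [modeRotation_isUnitaryGroup.add]; rfl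

theorem inner_modeRotation (s s' : ℝ) (v w : Hl2 (Mode d N)) :
    inner ℂ (modeRotation (-s) v) (modeRotation (-s') w) = inner ℂ v (modeRotation (s - s') w) := by
  rw [modeRotation_isUnitaryGroup.inner_left, neg_neg, modeRotation_modeRotation, sub_eq_add_neg]

theorem inner_modeRotation_diagOp (s s' : ℝ) (v w : Hl2 (Mode d N)) :
    inner ℂ (modeRotation (-s) v) (diagOp _ hC (modeRotation (-s') w)) =
      inner ℂ v (diagOp _ hC (modeRotation (s - s') w)) := by
  rw [modeRotation_isUnitaryGroup.inner_left, neg_neg, modeRotation_diagOp,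
    modeRotation_modeRotation, sub_eq_add_neg]

theorem thermalForm_modeRotation_same (x : ZLat d) (s s' : ℝ) :
    thermalForm hC (modeRotation (-s) (displacement lam hφ x))
      (modeRotation (-s') (displacement lam hφ x)) = displacementCorr lam hφ hC x (s' - s) := by
  rw [thermalForm, displacementCorr, inner_modeRotation, inner_modeRotation_diagOp,
    inner_modeRotation_diagOp, neg_sub]

theorem thermalForm_modeRotation_of_ne {x y : ZLat d} (hxy : x ≠ y) (s s' : ℝ) :
    thermalForm hC (modeRotation (-s) (displacement lam hφ x))
      (modeRotation (-s') (displacement lam hφ y)) = 0 := by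
  have hs : ∀ (y : ZLat d) (t : ℝ) (p : Mode d N), p.1.1 ≠ y →
      modeRotation t (displacement lam hφ y) p = 0 := fun y t p hp => by
    rw [modeRotation_apply, displacement_apply_of_ne lam hφ y hp, mul_zero]
  rw [thermalForm, inner_modeRotation, inner_modeRotation_diagOp, inner_modeRotation_diagOp,
    inner_displacement_of_support lam hφ hxy (hs y _),
    inner_displacement_of_support lam hφ hxy, inner_displacement_of_support lam hφ hxy.symm]
  · simp
  · intro p hp; rw [diagOp_apply, hs x _ p hp, mul_zero]
  · intro p hp; rw [diagOp_apply, hs y _ p hp, mul_zero]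

theorem thermalForm_add_right (v w w' : Hl2 (Mode d N)) :
    thermalForm hC v (w + w') = thermalForm hC v w + thermalForm hC v w' := by
  simp only [thermalForm, map_add, inner_add_left, inner_add_right]; ring

theorem thermalForm_sub_right (v w w' : Hl2 (Mode d N)) :
    thermalForm hC v (w - w') = thermalForm hC v w - thermalForm hC v w' := by
  simp only [thermalForm, map_sub, inner_sub_left, inner_sub_right]; ring

theorem thermalForm_sub_left (v v' w : Hl2 (Mode d N)) :
    thermalForm hC (v - v') w = thermalForm hC v w - thermalForm hC v' w := by
  simp only [thermalForm, map_sub, inner_sub_left, inner_sub_right]; ring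

theorem thermalForm_zero_right (v : Hl2 (Mode d N)) : thermalForm hC v 0 = 0 := by
  simp [thermalForm]

/-- The displacement correlation function is, up to its value at `0` and a linear term, the
memory function of the reservoir. -/
theorem sq_mul_memoryFn (hβ : 0 < β) (hN : 0 < N) (x : Site d N) (t : ℝ) :
    (lam : ℂ) ^ 2 * memoryFn (fun u => finCorr β φ N u) t =
      displacementCorr lam hφ hC x 0 - displacementCorr lam hφ hC x t +
        Complex.I * t * energyShift lam hφ x := by
  set h := displacement lam hφ x.1
  have key := fun v => hasSum_inner_displacement lam hφ x v
  have h1 := ((key (modeRotation (-0) h)).add (key (diagOp _ hC (modeRotation (-0) h)))).add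
    (key (diagOp _ hC (modeRotation 0 h)))
  have h2 := ((key (modeRotation (-t) h)).add (key (diagOp _ hC (modeRotation (-t) h)))).add
    (key (diagOp _ hC (modeRotation t h)))
  have h3 := (((hasSum_inner_formVec hφ x h).mul_left (lam : ℂ)).mul_left (Complex.I * t))
  rw [← ofReal_energyShift] at h3
  have h4 := (h1.sub h2).add h3
  have h5 := (hasSum_memoryFn_finCorr hφ hβ hN x t).mul_left ((lam : ℂ) ^ 2)
  refine h5.unique (h4.congr_fun fun k => ?_)
  have hω : (modeEnergy ((x, k) : Mode d N) : ℂ) ≠ 0 := by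
    exact_mod_cast (modeEnergy_pos hN ((x, k) : Mode d N)).ne'
  have hn : ((‖finForm φ N k‖ ^ 2 : ℝ) : ℂ) =
      finForm φ N k * (starRingEnd ℂ) (finForm φ N k) := by
    rw [Complex.mul_conj, Complex.normSq_eq_norm_sq]
  simp only [diagOp_apply, modeRotation_apply]
  rw [displacement_apply_self, hn]
  simp only [map_mul, map_inv₀, Complex.conj_ofReal, Complex.conj_conj, Complex.ofReal_neg,
    Complex.ofReal_zero, neg_zero, mul_zero, zero_mul, Complex.exp_zero, one_mul]
  rw [show -(Complex.I * -(t : ℂ) * modeEnergy ((x, k) : Mode d N)) =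
      Complex.I * modeEnergy ((x, k) : Mode d N) * t by ring,
    show -(Complex.I * (t : ℂ) * modeEnergy ((x, k) : Mode d N)) =
      -(Complex.I * modeEnergy ((x, k) : Mode d N)) * t by ring]
  field_simp
  ring

open Classical in
/-- The interaction, through the memory function, of a stay at `x` between the times `a` and `b`
with the stays of the word `c`. -/
def crossMemory (Γ : ℝ → ℂ) (x : ZLat d) (a b : ℝ) : List (ZLat d × ℝ) → ℂ
  | [] => 0
  | p :: c => (if x = p.1 then Γ (wordTime c + p.2 - a) - Γ (wordTime c + p.2 - b) -
      Γ (wordTime c - a) + Γ (wordTime c - b) else 0) + crossMemory Γ x a b c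

/-- The logarithm of the thermal expectation of a word, for the memory function `Γ`. -/
def wordExponent (Γ : ℝ → ℂ) : List (ZLat d × ℝ) → ℂ
  | [] => 0
  | p :: c => wordExponent Γ c + (-(Complex.I * p.2 * siteEnergy lam χ p.1) - lam ^ 2 * Γ (-p.2)) -
      lam ^ 2 * crossMemory Γ p.1 (wordTime c) (wordTime c + p.2) c

theorem thermalForm_wordDisp (hβ : 0 < β) (hN : 0 < N) (x : Site d N) (a b : ℝ)
    (c : List (ZLat d × ℝ)) : thermalForm hC (segmentDisp lam hφ x a b) (wordDisp lam hφ c) =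
      lam ^ 2 * crossMemory (memoryFn fun u => finCorr β φ N u) x.1 a b c := by
  induction c with
  | nil => rw [wordDisp, thermalForm_zero_right, crossMemory, mul_zero]
  | cons p c ih =>
    rw [wordDisp, thermalForm_add_right, ih, crossMemory, mul_add, add_comm]
    congr 1
    rw [segmentDisp, segmentDisp, thermalForm_sub_right, thermalForm_sub_left, thermalForm_sub_left]
    split_ifs with hx
    · rw [← hx]
      simp only [thermalForm_modeRotation_same]
      rw [mul_add, mul_sub, mul_sub]
      simp only [sq_mul_memoryFn lam hφ hC hβ hN x]
      push_cast
      ring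
    · simp only [thermalForm_modeRotation_of_ne lam hφ hC hx]
      simp

theorem wordTime_cons (p : ZLat d × ℝ) (c : List (ZLat d × ℝ)) :
    wordTime (p :: c) = p.2 + wordTime c := rfl

theorem wordPhase_sub_eq (hβ : 0 < β) (hN : 0 < N) (c : List (ZLat d × ℝ))
    (hc : ∀ p ∈ c, p.1 ∈ box d N) :
    wordPhase lam χ hφ c - inner ℂ (wordDisp lam hφ c) (diagOp _ hC (wordDisp lam hφ c)) =
      wordExponent lam χ (memoryFn fun u => finCorr β φ N u) c := by
  induction c with
  | nil => simp [wordPhase, wordDisp, wordExponent]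
  | cons p c ih =>
    have hp := hc p List.mem_cons_self
    have h1 := ih fun q hq => hc q (List.mem_cons_of_mem _ hq)
    have h2 := thermalForm_wordDisp lam hφ hC hβ hN ⟨p.1, hp⟩ (wordTime c) (wordTime c + p.2) c
    have h3 := sq_mul_memoryFn lam hφ hC hβ hN ⟨p.1, hp⟩ (-p.2)
    rw [wordPhase, wordDisp, wordExponent, ← h1, ← h2]
    have h4 : inner ℂ (segmentDisp lam hφ p.1 (wordTime c) (wordTime c + p.2))
        (diagOp _ hC (segmentDisp lam hφ p.1 (wordTime c) (wordTime c + p.2))) =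
        2 * inner ℂ (displacement lam hφ p.1) (diagOp _ hC (displacement lam hφ p.1)) -
        inner ℂ (displacement lam hφ p.1) (diagOp _ hC (modeRotation p.2 (displacement lam hφ p.1))) -
        inner ℂ (displacement lam hφ p.1)
          (diagOp _ hC (modeRotation (-p.2) (displacement lam hφ p.1))) := by
      rw [segmentDisp, map_sub, inner_sub_left, inner_sub_right, inner_sub_right]
      simp only [inner_modeRotation_diagOp, sub_self, modeRotation_isUnitaryGroup.zero,
        add_sub_cancel_left, sub_add_cancel_left]
      change inner ℂ _ (diagOp _ hC _) - _ - (_ - inner ℂ _ (diagOp _ hC _)) = _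
      simp only [one_apply_eq_self]
      ring
    simp only at h3
    rw [h3, freePhase, displacementCorr, displacementCorr, neg_neg, neg_zero]
    simp only [modeRotation_isUnitaryGroup.zero, one_apply_eq_self]
    rw [map_add, inner_add_left, inner_add_right, inner_add_right, h4, thermalForm]
    push_cast
    ring

/-- The thermal expectation of a word depends on the reservoir only through its memory
function. -/
theorem thermalElem_wordOp_eq (hφ : Summable fun k : ZLat d => ‖finForm φ N k‖ ^ 2) (hβ : 0 < β)
    (hN : 0 < N) (c : List (ZLat d × ℝ)) (hc : ∀ p ∈ c, p.1 ∈ box d N) (hc0 : wordTime c = 0)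
    (b a : Site d N) :
    thermalElem β (wordOp (freeEvolution lam χ φ N) c b.1 a.1) b a =
      Complex.exp (wordExponent lam χ (memoryFn fun u => finCorr β φ N u) c) := by
  obtain ⟨C, -, hC⟩ := exists_norm_thermalOcc_le (d := d) hβ hN
  rw [thermalElem_wordOp lam χ hφ hβ hN c hc hc0, ← wordPhase_sub_eq lam χ hφ hC hβ hN c hc]
  congr 2
  rw [Complex.ofReal_tsum]
  refine ((hasSum_inner _ _).congr_fun fun p => ?_).tsum_eq
  rw [diagOp_apply, Complex.ofReal_mul, ← Complex.normSq_eq_norm_sq, Complex.normSq_eq_conj_mul_self]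
  ring

theorem tendsto_crossMemory {ι : Type*} {l : Filter ι} {Γ : ι → ℝ → ℂ} {Γ' : ℝ → ℂ}
    (h : ∀ t, Tendsto (fun i => Γ i t) l (𝓝 (Γ' t))) (x : ZLat d) (a b : ℝ)
    (c : List (ZLat d × ℝ)) :
    Tendsto (fun i => crossMemory (Γ i) x a b c) l (𝓝 (crossMemory Γ' x a b c)) := by
  induction c with
  | nil => exact tendsto_const_nhds
  | cons p c ih =>
    simp only [crossMemory]
    refine Tendsto.add ?_ ih
    split_ifs
    · exact (((h _).sub (h _)).sub (h _)).add (h _)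
    · exact tendsto_const_nhds

theorem tendsto_wordExponent {ι : Type*} {l : Filter ι} {Γ : ι → ℝ → ℂ} {Γ' : ℝ → ℂ}
    (h : ∀ t, Tendsto (fun i => Γ i t) l (𝓝 (Γ' t))) (c : List (ZLat d × ℝ)) :
    Tendsto (fun i => wordExponent lam χ (Γ i) c) l (𝓝 (wordExponent lam χ Γ' c)) := by
  induction c with
  | nil => exact tendsto_const_nhds
  | cons p c ih =>
    simp only [wordExponent]
    exact (ih.add (tendsto_const_nhds.sub ((h _).const_mul _))).sub
      ((tendsto_crossMemory h _ _ _ _).const_mul _)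

/-- The translate of a word. -/
def shiftWord (y : ZLat d) (c : List (ZLat d × ℝ)) : List (ZLat d × ℝ) :=
  c.map fun p => (p.1 + y, p.2)

theorem wordTime_shiftWord (y : ZLat d) (c : List (ZLat d × ℝ)) :
    wordTime (shiftWord y c) = wordTime c := by
  rw [wordTime, wordTime, shiftWord, List.map_map]
  rfl

theorem crossMemory_shiftWord (Γ : ℝ → ℂ) (x y : ZLat d) (a b : ℝ) (c : List (ZLat d × ℝ)) :
    crossMemory Γ (x + y) a b (shiftWord y c) = crossMemory Γ x a b c := by
  induction c with
  | nil => rfl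
  | cons p c ih =>
    have : shiftWord y (p :: c) = (p.1 + y, p.2) :: shiftWord y c := rfl
    rw [this, crossMemory, crossMemory, ih]
    simp only [wordTime_shiftWord, add_left_inj]

theorem siteEnergy_add (x y : ZLat d) :
    siteEnergy lam χ (x + y) = siteEnergy lam χ x + siteEnergy lam χ y := by
  simp only [siteEnergy, Pi.add_apply, Int.cast_add, mul_add, Finset.sum_add_distrib]
  ring

theorem wordExponent_shiftWord (Γ : ℝ → ℂ) (y : ZLat d) (c : List (ZLat d × ℝ)) :
    wordExponent lam χ Γ (shiftWord y c) =
      wordExponent lam χ Γ c - Complex.I * wordTime c * siteEnergy lam χ y := by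
  induction c with
  | nil => simp [shiftWord, wordExponent, wordTime]
  | cons p c ih =>
    have : shiftWord y (p :: c) = (p.1 + y, p.2) :: shiftWord y c := rfl
    rw [this, wordExponent, wordExponent, ih]
    simp only [wordTime_shiftWord, crossMemory_shiftWord, siteEnergy_add, wordTime_cons]
    push_cast
    ring

end WordExponent

/-! ### Duhamel's formula for the hopping -/

section Duhamel

section Abstract

variable {ι : Type*} {U₀ U : ℝ → Op ι} {B : Op ι}

theorem kern_interaction (hU₀ : IsUnitaryGroup U₀) (hU : IsUnitaryGroup U) (hB : star B = B)
    (X : Op ι) (s : ℝ) (i j : ι) :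
    kern (U (-s) * (B * (U₀ s * X * U₀ (-s)) - U₀ s * X * U₀ (-s) * B) * U s) i j =
      inner ℂ (U₀ (-s) (B (U s (ket i)))) (X (U₀ (-s) (U s (ket j)))) -
        inner ℂ (U₀ (-s) (U s (ket i))) (X (U₀ (-s) (B (U s (ket j))))) := by
  have hBinner : ∀ v w, inner ℂ (B v) w = inner ℂ v (B w) := fun v w => by
    conv_lhs => rw [← hB, ContinuousLinearMap.star_eq_adjoint,
      ContinuousLinearMap.adjoint_inner_left]
  rw [kern_eq_inner, hU₀.inner_left, neg_neg, hU₀.inner_left, neg_neg, hBinner, hU.inner_left,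
    hU.inner_left, ← inner_sub_right, ← map_sub]
  rfl

/-- Duhamel's formula for the matrix elements of an observable that moves with the free
evolution. -/
theorem kern_duhamel (hU₀ : IsUnitaryGroup U₀) (hU : IsUnitaryGroup U) (hB : star B = B)
    (hd : ∀ v t, HasDerivAt (fun t => U₀ (-t) (U t v)) (-(Complex.I • U₀ (-t) (B (U t v)))) t)
    (X : Op ι) (i j : ι) :
    (Continuous fun s => kern (U (-s) * (B * (U₀ s * X * U₀ (-s)) - U₀ s * X * U₀ (-s) * B) * U s)
      i j) ∧ ∀ t, kern (U (-t) * (U₀ t * X * U₀ (-t)) * U t) i j = kern X i j + Complex.I *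
        ∫ s in (0 : ℝ)..t,
          kern (U (-s) * (B * (U₀ s * X * U₀ (-s)) - U₀ s * X * U₀ (-s) * B) * U s) i j := by
  have hc0 : ∀ f : ℝ → Hl2 ι, Continuous f → Continuous fun s => U₀ (-s) (f s) := fun f hf =>
    continuous_apply_of_strong (K := 1) (fun v => (hU₀.strongly_continuous v).comp continuous_neg)
      (fun s => hU₀.norm_le_one _) hf
  have hcont : Continuous fun s =>
      kern (U (-s) * (B * (U₀ s * X * U₀ (-s)) - U₀ s * X * U₀ (-s) * B) * U s) i j := by
    simp only [kern_interaction hU₀ hU hB]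
    have h1 := fun k : ι => hU.strongly_continuous (ket k)
    exact ((hc0 _ (B.continuous.comp (h1 i))).inner (X.continuous.comp (hc0 _ (h1 j)))).sub
      ((hc0 _ (h1 i)).inner (X.continuous.comp (hc0 _ (B.continuous.comp (h1 j)))))
  refine ⟨hcont, fun t => ?_⟩
  have hg : ∀ s, HasDerivAt
      (fun s => inner ℂ (U₀ (-s) (U s (ket i))) (X (U₀ (-s) (U s (ket j)))))
      (Complex.I * kern (U (-s) * (B * (U₀ s * X * U₀ (-s)) - U₀ s * X * U₀ (-s) * B) * U s) i j)
      s := by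
    intro s
    have h2 : HasDerivAt (fun s => X (U₀ (-s) (U s (ket j))))
        (X (-(Complex.I • U₀ (-s) (B (U s (ket j)))))) s := by
      have h1 := ((X.restrictScalars ℝ).hasFDerivAt
        (x := U₀ (-s) (U s (ket j)))).comp_hasDerivAt s (hd (ket j) s)
      exact h1
    refine ((hd (ket i) s).inner ℂ h2).congr_deriv ?_
    rw [kern_interaction hU₀ hU hB, map_neg, map_smul, inner_neg_right, inner_neg_left,
      inner_smul_right, inner_smul_left, Complex.conj_I]
    ring
  have h3 := intervalIntegral.integral_eq_sub_of_hasDerivAt (a := 0) (b := t) (fun s _ => hg s)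
    ((hcont.const_mul Complex.I).intervalIntegrable _ _)
  rw [intervalIntegral.integral_const_mul] at h3
  have h4 : kern (U (-t) * (U₀ t * X * U₀ (-t)) * U t) i j =
      inner ℂ (U₀ (-t) (U t (ket i))) (X (U₀ (-t) (U t (ket j)))) := by
    rw [kern_eq_inner, hU₀.inner_left, neg_neg, hU.inner_left]
    rfl
  rw [h4, h3]
  simp only [neg_zero, hU₀.zero, hU.zero, one_apply_eq_self]
  rw [kern_eq_inner]
  ring

end Abstract

variable {d N : ℕ}

theorem continuous_thermalElem {β : ℝ} (hβ : 0 < β) (hN : 0 < N) {A : ℝ → Op (TotalIdx d N)}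
    {y' y : Site d N} {K : ℝ} (hc : ∀ n, Continuous fun s => kern (A s) (y', n) (y, n))
    (hA : ∀ s, ‖A s‖ ≤ K) : Continuous fun s => thermalElem β (A s) y' y := by
  refine continuous_tsum (fun n => (hc n).const_mul _)
    ((hasSum_gibbsWeight (d := d) hβ hN).summable.mul_right K) fun n s => ?_
  rw [norm_mul, Complex.norm_real, Real.norm_of_nonneg (gibbsWeight_nonneg β n)]
  exact mul_le_mul_of_nonneg_left ((norm_kern_le _ _ _).trans (hA s)) (gibbsWeight_nonneg β n)

theorem hasSum_thermalElem {β : ℝ} (hβ : 0 < β) (hN : 0 < N) (A : Op (TotalIdx d N))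
    (y' y : Site d N) : HasSum (fun n : Occ d N => (gibbsWeight β n : ℂ) * kern A (y', n) (y, n))
      (thermalElem β A y' y) := (summable_thermalElem hβ hN A y' y).hasSum

theorem thermalElem_duhamel {β : ℝ} (hβ : 0 < β) (hN : 0 < N) {U₀ U : ℝ → Op (TotalIdx d N)}
    {B : Op (TotalIdx d N)} (hU₀ : IsUnitaryGroup U₀) (hU : IsUnitaryGroup U) (hB : star B = B)
    (hd : ∀ v t, HasDerivAt (fun t => U₀ (-t) (U t v)) (-(Complex.I • U₀ (-t) (B (U t v)))) t)
    (X : Op (TotalIdx d N)) (y' y : Site d N) :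
    (Continuous fun s => thermalElem β
      (U (-s) * (B * (U₀ s * X * U₀ (-s)) - U₀ s * X * U₀ (-s) * B) * U s) y' y) ∧
    ∀ t, thermalElem β (U (-t) * (U₀ t * X * U₀ (-t)) * U t) y' y = thermalElem β X y' y +
      Complex.I * ∫ s in (0 : ℝ)..t, thermalElem β
        (U (-s) * (B * (U₀ s * X * U₀ (-s)) - U₀ s * X * U₀ (-s) * B) * U s) y' y := by
  have key := fun n : Occ d N => kern_duhamel hU₀ hU hB hd X (y', n) (y, n)
  set A : ℝ → Op (TotalIdx d N) := fun s =>
    U (-s) * (B * (U₀ s * X * U₀ (-s)) - U₀ s * X * U₀ (-s) * B) * U s with hA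
  set K := ‖B‖ * ‖X‖ + ‖X‖ * ‖B‖ with hK
  have hAK : ∀ s, ‖A s‖ ≤ K := by
    intro s
    have h1 : ‖U₀ s * X * U₀ (-s)‖ ≤ ‖X‖ := by
      refine (norm_mul_le _ _).trans ((mul_le_of_le_one_right (norm_nonneg _)
        (hU₀.norm_le_one _)).trans ((norm_mul_le _ _).trans
        (mul_le_of_le_one_left (norm_nonneg _) (hU₀.norm_le_one _))))
    refine (norm_mul_le _ _).trans ((mul_le_of_le_one_right (norm_nonneg _)
      (hU.norm_le_one _)).trans ((norm_mul_le _ _).trans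
      ((mul_le_of_le_one_left (norm_nonneg _) (hU.norm_le_one _)).trans ?_)))
    refine (norm_sub_le _ _).trans (add_le_add ((norm_mul_le _ _).trans ?_)
      ((norm_mul_le _ _).trans ?_))
    · exact mul_le_mul_of_nonneg_left h1 (norm_nonneg _)
    · exact mul_le_mul_of_nonneg_right h1 (norm_nonneg _)
  have hcn : ∀ n, Continuous fun s => kern (A s) (y', n) (y, n) := fun n => (key n).1
  refine ⟨continuous_thermalElem hβ hN hcn hAK, fun t => ?_⟩
  have h1 := intervalIntegral.hasSum_integral_of_dominated_convergence (μ := volume) (a := 0) (b := t)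
    (F := fun (n : Occ d N) (s : ℝ) => (gibbsWeight β n : ℂ) * kern (A s) (y', n) (y, n))
    (f := fun s => thermalElem β (A s) y' y)
    (fun n _ => gibbsWeight β n * K)
    (fun n => ((hcn n).const_mul _).aestronglyMeasurable)
    (fun n => ae_of_all _ fun s _ => by
      rw [norm_mul, Complex.norm_real, Real.norm_of_nonneg (gibbsWeight_nonneg β n)]
      exact mul_le_mul_of_nonneg_left ((norm_kern_le _ _ _).trans (hAK s)) (gibbsWeight_nonneg β n))
    (ae_of_all _ fun s _ => (hasSum_gibbsWeight (d := d) hβ hN).summable.mul_right K)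
    intervalIntegrable_const
    (ae_of_all _ fun s _ => hasSum_thermalElem hβ hN _ _ _)
  have h2 := (hasSum_thermalElem hβ hN X y' y).add (h1.mul_left Complex.I)
  refine (hasSum_thermalElem hβ hN _ y' y).unique (h2.congr_fun fun n => ?_)
  rw [intervalIntegral.integral_const_mul, (key n).2 t]
  ring

variable {φ : EuclideanSpace ℝ (Fin d) → ℂ} (lam : ℝ) (χ : Fin d → ℝ) (ε : (Fin d → ℝ) → ℝ)

/-- The unitary group of the coupled system. -/
def fullEvolution (lam : ℝ) (χ : Fin d → ℝ) (ε : (Fin d → ℝ) → ℝ)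
    (φ : EuclideanSpace ℝ (Fin d) → ℂ) (N : ℕ) : ℝ → Op (TotalIdx d N) :=
  evolution (hamiltonian lam χ ε φ N)

theorem fullEvolution_isUnitaryGroup (hφ : Summable fun k : ZLat d => ‖finForm φ N k‖ ^ 2) :
    IsUnitaryGroup (fullEvolution lam χ ε φ N) := (isEvolution_evolution lam χ ε hφ).isUnitaryGroup

theorem freeEvolution_isUnitaryGroup (hφ : Summable fun k : ZLat d => ‖finForm φ N k‖ ^ 2) :
    IsUnitaryGroup (freeEvolution lam χ φ N) := (isEvolution_evolution lam χ _ hφ).isUnitaryGroup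

theorem hasDerivAt_fullEvolution (hφ : Summable fun k : ZLat d => ‖finForm φ N k‖ ^ 2)
    (v : Hl2 (TotalIdx d N)) (t : ℝ) :
    HasDerivAt (fun t => freeEvolution lam χ φ N (-t) (fullEvolution lam χ ε φ N t v))
      (-(Complex.I • freeEvolution lam χ φ N (-t)
        (boxHopping ε (fullEvolution lam χ ε φ N t v)))) t := by
  classical
  refine (gradedHamiltonian lam χ ε hφ).hasDerivAt_interaction
    (isEvolution_freeEvolution lam χ hφ) ?_ (star_boxHopping ε) (fun j => ?_) v t
  · have h := isEvolution_evolution lam χ ε hφ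
    rw [fullEvolution]
    convert h using 1
    exact (hamiltonian_eq_row lam χ _ hφ).symm
  · ext i
    have h1 : (boxHopping ε (ket j) : Hl2 (TotalIdx d N)) i = kern (boxHopping ε) i j := rfl
    rw [lp.coeFn_add, Pi.add_apply, gradedHamiltonian_row, gradedHamiltonian_row, h1, boxHopping,
      kern_siteOp, hamiltonian, hamiltonian, hopping_zero, ite_self]
    ring_nf

/-- The word conjugated by the free evolution for the time `r`. -/
def conjWord (c : List (ZLat d × ℝ)) (b a : ZLat d) (r : ℝ) : List (ZLat d × ℝ) :=
  (b, -r) :: (c ++ [(a, r)])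

theorem wordOp_conjWord (hφ : Summable fun k : ZLat d => ‖finForm φ N k‖ ^ 2)
    (c : List (ZLat d × ℝ)) (b a : ZLat d) (r : ℝ) :
    wordOp (freeEvolution lam χ φ N) (conjWord c b a r) b a =
      freeEvolution lam χ φ N (-r) * wordOp (freeEvolution lam χ φ N) c b a *
        freeEvolution lam χ φ N r := by
  rw [conjWord, ← freeEvolution_mul_wordOp lam χ hφ, ← wordOp_mul_freeEvolution lam χ hφ, mul_assoc]

theorem wordTime_conjWord (c : List (ZLat d × ℝ)) (b a : ZLat d) (r : ℝ) :
    wordTime (conjWord c b a r) = wordTime c := by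
  simp [wordTime, conjWord]

theorem boxHopping_mul_latHop (b : Site d N) (a : ZLat d) :
    (boxHopping ε * latHop b.1 a : Op (TotalIdx d N)) =
      ∑ x : Site d N, hopping ε (x.1 - b.1) • latHop x.1 a := by
  classical
  rw [boxHopping, siteOp, Finset.sum_mul]
  refine Finset.sum_congr rfl fun x _ => ?_
  rw [Finset.sum_mul, Finset.sum_eq_single b]
  · rw [smul_mul_assoc, ← latHop_coe, latHop_mul_same _ b.2]
  · intro z _ hz
    by_cases ha : a ∈ box d N
    · rw [smul_mul_assoc, latHop_coe b ⟨a, ha⟩, hopOp_mul_of_ne hz, smul_zero]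
    · rw [latHop_of_notMem_right ha, mul_zero]
  · simp

theorem boxHopping_mul_wordOp (U : ℝ → Op (TotalIdx d N)) (c : List (ZLat d × ℝ)) (b : Site d N)
    (a : ZLat d) : boxHopping ε * wordOp U c b.1 a =
      ∑ x : Site d N, hopping ε (x.1 - b.1) • wordOp U c x.1 a := by
  rw [← latHop_mul_wordOp U c b.1 b.2, ← mul_assoc, boxHopping_mul_latHop, Finset.sum_mul]
  refine Finset.sum_congr rfl fun x _ => ?_
  rw [smul_mul_assoc, latHop_mul_wordOp U c x.1 b.2]

theorem latHop_mul_boxHopping (b : ZLat d) (a : Site d N) :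
    (latHop b a.1 * boxHopping ε : Op (TotalIdx d N)) =
      ∑ z : Site d N, hopping ε (a.1 - z.1) • latHop b z.1 := by
  have h := congrArg star (boxHopping_mul_latHop ε a b)
  rw [star_mul, star_boxHopping, star_latHop, star_sum] at h
  rw [h]
  refine Finset.sum_congr rfl fun z _ => ?_
  rw [star_smul, star_latHop]
  congr 1
  rw [← neg_sub z.1 a.1]
  exact conj_hopping ε _

theorem wordOp_mul_boxHopping (U : ℝ → Op (TotalIdx d N)) (c : List (ZLat d × ℝ)) (b : ZLat d)
    (a : Site d N) : wordOp U c b a.1 * boxHopping ε =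
      ∑ z : Site d N, hopping ε (a.1 - z.1) • wordOp U c b z.1 := by
  rw [← wordOp_mul_latHop U c b a.2, mul_assoc, latHop_mul_boxHopping, Finset.mul_sum]
  refine Finset.sum_congr rfl fun x _ => ?_
  rw [mul_smul_comm, wordOp_mul_latHop U c b a.2]

/-- The thermal matrix element `⟨y'| ⋅ |y⟩` of a word in the Heisenberg picture; it vanishes unless
`y'` and `y` belong to the cube. -/
def heisWord (β lam : ℝ) (χ : Fin d → ℝ) (ε : (Fin d → ℝ) → ℝ) (φ : EuclideanSpace ℝ (Fin d) → ℂ)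
    (N : ℕ) (t : ℝ) (c : List (ZLat d × ℝ)) (b a y' y : ZLat d) : ℂ :=
  if h : y' ∈ box d N ∧ y ∈ box d N then
    thermalElem β (fullEvolution lam χ ε φ N (-t) * wordOp (freeEvolution lam χ φ N) c b a *
      fullEvolution lam χ ε φ N t) ⟨y', h.1⟩ ⟨y, h.2⟩
  else 0

theorem heisWord_of_notMem_left (β lam : ℝ) (χ : Fin d → ℝ) (ε : (Fin d → ℝ) → ℝ)
    (φ : EuclideanSpace ℝ (Fin d) → ℂ) (t : ℝ) (c : List (ZLat d × ℝ)) {b : ZLat d}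
    (hb : b ∉ box d N) (a y' y : ZLat d) : heisWord β lam χ ε φ N t c b a y' y = 0 := by
  rw [heisWord]
  split_ifs
  · rw [wordOp_of_notMem_left _ _ hb, mul_zero, zero_mul, thermalElem]
    simp
  · rfl

theorem heisWord_of_notMem_right (β lam : ℝ) (χ : Fin d → ℝ) (ε : (Fin d → ℝ) → ℝ)
    (φ : EuclideanSpace ℝ (Fin d) → ℂ) (t : ℝ) (c : List (ZLat d × ℝ)) (b : ZLat d) {a : ZLat d}
    (ha : a ∉ box d N) (y' y : ZLat d) : heisWord β lam χ ε φ N t c b a y' y = 0 := by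
  rw [heisWord]
  split_ifs
  · rw [wordOp_of_notMem_right _ _ _ ha, mul_zero, zero_mul, thermalElem]
    simp
  · rfl

theorem norm_heisWord_le {β : ℝ} (hβ : 0 < β) (hN : 0 < N)
    (hφ : Summable fun k : ZLat d => ‖finForm φ N k‖ ^ 2) (t : ℝ) (c : List (ZLat d × ℝ))
    (b a y' y : ZLat d) : ‖heisWord β lam χ ε φ N t c b a y' y‖ ≤ 1 := by
  rw [heisWord]
  split_ifs
  · have hU := fullEvolution_isUnitaryGroup lam χ ε hφ
    refine (norm_thermalElem_le hβ hN _ _ _).trans ((norm_mul_le _ _).trans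
      (mul_le_one₀ ((norm_mul_le _ _).trans (mul_le_one₀ (hU.norm_le_one _) (norm_nonneg _) ?_))
        (norm_nonneg _) (hU.norm_le_one _)))
    exact norm_wordOp_le (freeEvolution_isUnitaryGroup lam χ hφ) _ _ _
  · simp

theorem thermalElem_sum {β : ℝ} (hβ : 0 < β) (hN : 0 < N) {κ : Type*} (s : Finset κ) (r : κ → ℂ)
    (A : κ → Op (TotalIdx d N)) (y' y : Site d N) :
    thermalElem β (∑ k ∈ s, r k • A k) y' y = ∑ k ∈ s, r k * thermalElem β (A k) y' y := by
  refine (hasSum_thermalElem hβ hN _ y' y).unique ((hasSum_sum fun k (_ : k ∈ s) =>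
    (hasSum_thermalElem hβ hN (A k) y' y).mul_left (r k)).congr_fun fun n => ?_)
  rw [kern_sum, Finset.mul_sum]
  refine Finset.sum_congr rfl fun k _ => ?_
  rw [kern_smul]
  ring

theorem thermalElem_sub {β : ℝ} (hβ : 0 < β) (hN : 0 < N) (A A' : Op (TotalIdx d N))
    (y' y : Site d N) :
    thermalElem β (A - A') y' y = thermalElem β A y' y - thermalElem β A' y' y := by
  refine (hasSum_thermalElem hβ hN _ y' y).unique (((hasSum_thermalElem hβ hN A y' y).sub
    (hasSum_thermalElem hβ hN A' y' y)).congr_fun fun n => ?_)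
  rw [kern_sub]
  ring

/-- The integrand of the Duhamel expansion. -/
def hopWord (β lam : ℝ) (χ : Fin d → ℝ) (ε : (Fin d → ℝ) → ℝ) (φ : EuclideanSpace ℝ (Fin d) → ℂ)
    (N : ℕ) (t : ℝ) (c : List (ZLat d × ℝ)) (b a y' y : ZLat d) : ℂ :=
  ∑' x, hopping ε (x - b) * heisWord β lam χ ε φ N t c x a y' y -
    ∑' z, hopping ε (a - z) * heisWord β lam χ ε φ N t c b z y' y

/-- Duhamel's formula for the thermal matrix elements of words: the expansion in the hopping only
involves longer words. -/
theorem heisWord_duhamel {β : ℝ} (hβ : 0 < β) (hN : 0 < N)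
    (hφ : Summable fun k : ZLat d => ‖finForm φ N k‖ ^ 2) (t : ℝ) (c : List (ZLat d × ℝ))
    (b a y' y : Site d N) :
    (Continuous fun s => hopWord β lam χ ε φ N s (conjWord c b.1 a.1 (t - s)) b.1 a.1 y'.1 y.1) ∧
    heisWord β lam χ ε φ N t c b.1 a.1 y'.1 y.1 =
      thermalElem β (wordOp (freeEvolution lam χ φ N) (conjWord c b.1 a.1 t) b.1 a.1) y' y +
      Complex.I * ∫ s in (0 : ℝ)..t,
        hopWord β lam χ ε φ N s (conjWord c b.1 a.1 (t - s)) b.1 a.1 y'.1 y.1 := by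
  set U₀ := freeEvolution lam χ φ N with hU₀
  set U := fullEvolution lam χ ε φ N with hU
  have hG₀ : IsUnitaryGroup U₀ := freeEvolution_isUnitaryGroup lam χ hφ
  have hG : IsUnitaryGroup U := fullEvolution_isUnitaryGroup lam χ ε hφ
  set X := wordOp U₀ (conjWord c b.1 a.1 t) b.1 a.1 with hX
  obtain ⟨h1, h2⟩ := thermalElem_duhamel hβ hN hG₀ hG (star_boxHopping ε)
    (hasDerivAt_fullEvolution lam χ ε hφ) X y' y
  have hY : ∀ s, U₀ s * X * U₀ (-s) = wordOp U₀ (conjWord c b.1 a.1 (t - s)) b.1 a.1 := by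
    intro s
    rw [hX, wordOp_conjWord lam χ hφ, wordOp_conjWord lam χ hφ, ← hU₀, neg_sub, sub_eq_add_neg,
      sub_eq_add_neg, hG₀.add, hG₀.add]
    simp only [mul_assoc]
  have hmem : ∀ s, hopWord β lam χ ε φ N s (conjWord c b.1 a.1 (t - s)) b.1 a.1 y'.1 y.1 =
      thermalElem β (U (-s) * (boxHopping ε * (U₀ s * X * U₀ (-s)) -
        U₀ s * X * U₀ (-s) * boxHopping ε) * U s) y' y := by
    intro s
    set w := conjWord c b.1 a.1 (t - s)
    have hsum : ∀ f : ZLat d → ℂ, (∀ x ∉ box d N, f x = 0) → ∑' x, f x = ∑ x : Site d N, f x.1 := by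
      intro f hf
      rw [tsum_eq_sum hf]
      exact (Finset.sum_coe_sort (box d N) f).symm
    rw [hY, boxHopping_mul_wordOp, wordOp_mul_boxHopping, mul_sub, sub_mul,
      thermalElem_sub hβ hN, Finset.mul_sum, Finset.mul_sum, Finset.sum_mul, Finset.sum_mul]
    simp only [mul_smul_comm, smul_mul_assoc]
    rw [thermalElem_sum hβ hN, thermalElem_sum hβ hN, hopWord, hsum, hsum]
    · congr 1
      · refine Finset.sum_congr rfl fun x _ => ?_
        rw [heisWord, dif_pos ⟨y'.2, y.2⟩]
      · refine Finset.sum_congr rfl fun x _ => ?_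
        rw [heisWord, dif_pos ⟨y'.2, y.2⟩]
    · intro x hx
      rw [heisWord_of_notMem_right β lam χ ε φ _ _ _ hx, mul_zero]
    · intro x hx
      rw [heisWord_of_notMem_left β lam χ ε φ _ _ hx, mul_zero]
  simp only [hmem]
  refine ⟨h1, ?_⟩
  rw [← h2 t, heisWord, dif_pos ⟨y'.2, y.2⟩, hY, sub_self]
  congr 3
  have h3 := wordOp_conjWord lam χ hφ c b.1 a.1 0
  rw [← hU₀, neg_zero, hG₀.zero, one_mul, mul_one] at h3
  exact h3.symm

end Duhamel

/-! ### Comparison of different volumes -/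

section Comparison

variable {d : ℕ} {φ : EuclideanSpace ℝ (Fin d) → ℂ} (lam : ℝ) (χ : Fin d → ℝ)
  (ε : (Fin d → ℝ) → ℝ)

theorem eventually_mem_box (x : ZLat d) : ∀ᶠ N : ℕ in atTop, x ∈ box d N := by
  have h : ∀ᶠ N : ℕ in atTop, ∀ i, |x i| ≤ (N : ℤ) :=
    eventually_all.2 fun i => by
      filter_upwards [eventually_ge_atTop (x i).natAbs] with N hN
      rw [Int.abs_eq_natAbs]
      exact_mod_cast hN
  filter_upwards [h] with N hN
  rw [box, Fintype.mem_piFinset]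
  exact fun i => Finset.mem_Icc.2 (abs_le.1 (hN i))

theorem heisWord_zero {N : ℕ} (β : ℝ) (hφ : Summable fun k : ZLat d => ‖finForm φ N k‖ ^ 2)
    (c : List (ZLat d × ℝ)) (b a : ZLat d) (y' y : Site d N) :
    heisWord β lam χ ε φ N 0 c b a y'.1 y.1 =
      thermalElem β (wordOp (freeEvolution lam χ φ N) c b a) y' y := by
  rw [heisWord, dif_pos ⟨y'.2, y.2⟩, neg_zero, (fullEvolution_isUnitaryGroup lam χ ε hφ).zero,
    one_mul, mul_one]

open Classical in
theorem tendsto_heisWord_zero {β : ℝ} (hβ : 0 < β) (hφ : ReservoirAssumption β φ)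
    (c : List (ZLat d × ℝ)) (hc : wordTime c = 0) (b a y' y : ZLat d) :
    Tendsto (fun N => heisWord β lam χ ε φ N 0 c b a y' y) atTop
      (𝓝 (if y' = b ∧ y = a then
        Complex.exp (wordExponent lam χ (memoryFn fun u => infCorr β φ u) c) else 0)) := by
  split_ifs with h
  · obtain ⟨rfl, rfl⟩ := h
    have h1 : ∀ᶠ N : ℕ in atTop, ∀ p ∈ c, p.1 ∈ box d N :=
      (eventually_all_finite (List.finite_toSet c)).2 fun p _ => eventually_mem_box p.1
    refine ((Complex.continuous_exp.tendsto _).comp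
      (tendsto_wordExponent lam χ (tendsto_memoryFn hβ hφ) c)).congr' ?_
    filter_upwards [h1, eventually_mem_box y', eventually_mem_box y, eventually_gt_atTop 0]
      with N hN hy' hy hN0
    rw [heisWord_zero lam χ ε β (hφ.finForm_l2 N hN0) c y' y ⟨y', hy'⟩ ⟨y, hy⟩]
    exact (thermalElem_wordOp_eq lam χ (hφ.finForm_l2 N hN0) hβ hN0 c hN hc ⟨y', hy'⟩ ⟨y, hy⟩).symm
  · refine tendsto_const_nhds.congr' ?_
    filter_upwards [eventually_mem_box y', eventually_mem_box y, eventually_gt_atTop 0]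
      with N hy' hy hN0
    rw [heisWord_zero lam χ ε β (hφ.finForm_l2 N hN0) c b a ⟨y', hy'⟩ ⟨y, hy⟩]
    exact (thermalElem_wordOp_of_ne β _ c b a h).symm

/-- The difference of the thermal matrix elements of a word in one volume and of its translate
by `e` in another one. -/
def heisDiff (β lam : ℝ) (χ : Fin d → ℝ) (ε : (Fin d → ℝ) → ℝ) (φ : EuclideanSpace ℝ (Fin d) → ℂ)
    (e y' y : ZLat d) (t : ℝ) (c : List (ZLat d × ℝ)) (b a : ZLat d) (p : ℕ × ℕ) : ℂ :=
  heisWord β lam χ ε φ p.1 t c b a y' y -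
    heisWord β lam χ ε φ p.2 t (shiftWord e c) (b + e) (a + e) (y' + e) (y + e)

theorem norm_heisDiff_le {β : ℝ} (hβ : 0 < β) (hφ : ReservoirAssumption β φ) (e y' y : ZLat d)
    (t : ℝ) (c : List (ZLat d × ℝ)) (b a : ZLat d) {p : ℕ × ℕ} (h1 : 0 < p.1) (h2 : 0 < p.2) :
    ‖heisDiff β lam χ ε φ e y' y t c b a p‖ ≤ 2 := by
  have h3 := norm_heisWord_le lam χ ε hβ h1 (hφ.finForm_l2 _ h1) t c b a y' y
  have h4 := norm_heisWord_le lam χ ε hβ h2 (hφ.finForm_l2 _ h2) t (shiftWord e c) (b + e) (a + e)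
    (y' + e) (y + e)
  exact (norm_sub_le _ _).trans (by linarith)

theorem eventually_pos_prod :
    ∀ᶠ p : ℕ × ℕ in atTop ×ˢ atTop, 0 < p.1 ∧ 0 < p.2 :=
  (eventually_gt_atTop 0).prod_mk (eventually_gt_atTop 0)

theorem tendsto_heisDiff_zero {β : ℝ} (hβ : 0 < β) (hφ : ReservoirAssumption β φ) (e y' y : ZLat d)
    (c : List (ZLat d × ℝ)) (hc : wordTime c = 0) (b a : ZLat d) :
    Tendsto (heisDiff β lam χ ε φ e y' y 0 c b a) (atTop ×ˢ atTop) (𝓝 0) := by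
  classical
  have h1 := (tendsto_heisWord_zero lam χ ε hβ hφ c hc b a y' y).comp
    (tendsto_fst (f := atTop) (g := (atTop : Filter ℕ)))
  have h2 := (tendsto_heisWord_zero lam χ ε hβ hφ (shiftWord e c)
    ((wordTime_shiftWord e c).trans hc) (b + e) (a + e) (y' + e) (y + e)).comp
    (tendsto_snd (f := (atTop : Filter ℕ)) (g := atTop))
  have h3 := h1.sub h2
  simp only [add_left_inj, wordExponent_shiftWord, hc, Complex.ofReal_zero, mul_zero, zero_mul,
    sub_zero, sub_self] at h3
  exact h3

theorem shiftWord_conjWord (e : ZLat d) (c : List (ZLat d × ℝ)) (b a : ZLat d) (r : ℝ) :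
    shiftWord e (conjWord c b a r) = conjWord (shiftWord e c) (b + e) (a + e) r := by
  simp [shiftWord, conjWord]

theorem summable_mul_heisWord {β : ℝ} (hβ : 0 < β) (hφ : ReservoirAssumption β φ) {N : ℕ}
    (hN : 0 < N) {f : ZLat d → ℂ} (hf : Summable fun x => ‖f x‖) {t : ℝ} {c : List (ZLat d × ℝ)}
    {b a : ZLat d → ZLat d} {y' y : ZLat d} :
    Summable fun x => f x * heisWord β lam χ ε φ N t c (b x) (a x) y' y := by
  refine Summable.of_norm (Summable.of_nonneg_of_le (fun _ => norm_nonneg _) (fun x => ?_) hf)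
  rw [norm_mul]
  exact mul_le_of_le_one_right (norm_nonneg _)
    (norm_heisWord_le lam χ ε hβ hN (hφ.finForm_l2 _ hN) _ _ _ _ _ _)

theorem summable_norm_comp {f : ZLat d → ℂ} (hf : Summable fun x => ‖f x‖) (b : ZLat d) :
    (Summable fun x => ‖f (x - b)‖) ∧ (Summable fun x => ‖f (b - x)‖) ∧
    (∑' x, ‖f (x - b)‖ = ∑' x, ‖f x‖) ∧ ∑' x, ‖f (b - x)‖ = ∑' x, ‖f x‖ := by
  set g : ZLat d → ℝ := fun x => ‖f x‖ with hg
  have h1 := hf.hasSum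
  have h2 : HasSum (g ∘ Equiv.subRight b) (∑' x, g x) := (Equiv.hasSum_iff _).2 h1
  have h3 : HasSum (g ∘ Equiv.subLeft b) (∑' x, g x) := (Equiv.hasSum_iff _).2 h1
  exact ⟨h2.summable, h3.summable, h2.tsum_eq, h3.tsum_eq⟩

theorem hopWord_sub_eq {β : ℝ} (hβ : 0 < β) (hφ : ReservoirAssumption β φ)
    (hK : Summable fun x => ‖hopping ε x‖) (e y' y : ZLat d)
    (t : ℝ) (c : List (ZLat d × ℝ)) (b a : ZLat d) {p : ℕ × ℕ} (h1 : 0 < p.1) (h2 : 0 < p.2) :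
    hopWord β lam χ ε φ p.1 t c b a y' y -
      hopWord β lam χ ε φ p.2 t (shiftWord e c) (b + e) (a + e) (y' + e) (y + e) =
    ∑' x, hopping ε (x - b) * heisDiff β lam χ ε φ e y' y t c x a p -
      ∑' z, hopping ε (a - z) * heisDiff β lam χ ε φ e y' y t c b z p := by
  obtain ⟨hb, -, -, -⟩ := summable_norm_comp hK b
  obtain ⟨-, ha, -, -⟩ := summable_norm_comp hK a
  simp only [hopWord, heisDiff, mul_sub]
  rw [(summable_mul_heisWord lam χ ε hβ hφ h1 hb).tsum_sub
      (summable_mul_heisWord lam χ ε hβ hφ h2 hb),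
    (summable_mul_heisWord lam χ ε hβ hφ h1 ha).tsum_sub
      (summable_mul_heisWord lam χ ε hβ hφ h2 ha)]
  rw [← (Equiv.addRight e).tsum_eq fun x => hopping ε (x - (b + e)) * _,
    ← (Equiv.addRight e).tsum_eq fun z => hopping ε (a + e - z) * _]
  simp only [Equiv.coe_addRight, add_sub_add_right_eq_sub]
  ring

/-- The remainder bound of the Duhamel expansion after `n` steps. -/
def duhamelRemainder (K : ℝ) (n : ℕ) (t : ℝ) : ℝ := 2 * ((2 * K * t) ^ n / n.factorial)

theorem continuous_duhamelRemainder (K : ℝ) (n : ℕ) : Continuous (duhamelRemainder K n) := by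
  unfold duhamelRemainder
  fun_prop

theorem integral_duhamelRemainder (K : ℝ) (n : ℕ) (t : ℝ) :
    ∫ s in (0 : ℝ)..t, 2 * K * duhamelRemainder K n s = duhamelRemainder K (n + 1) t := by
  have h : ∀ s, HasDerivAt (duhamelRemainder K (n + 1)) (2 * K * duhamelRemainder K n s) s := by
    intro s
    have h1 : HasDerivAt (fun s : ℝ => 2 * K * s) (2 * K * 1) s := (hasDerivAt_id s).const_mul _
    refine (((h1.pow (n + 1)).div_const _).const_mul 2).congr_deriv ?_
    rw [duhamelRemainder, Nat.factorial_succ]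
    push_cast
    field_simp
  rw [intervalIntegral.integral_eq_sub_of_hasDerivAt (fun s _ => h s)
    (((continuous_duhamelRemainder K n).const_mul _).intervalIntegrable _ _)]
  simp [duhamelRemainder]

theorem duhamelRemainder_nonneg {K : ℝ} (hK : 0 ≤ K) (n : ℕ) {t : ℝ} (ht : 0 ≤ t) :
    0 ≤ duhamelRemainder K n t := by
  unfold duhamelRemainder; positivity

theorem norm_tsum_mul_le {f g : ZLat d → ℂ} {E : ZLat d → ℝ} {r : ℝ} (hf : Summable fun x => ‖f x‖)
    (hg : ∀ x, ‖g x‖ ≤ r + E x) {M : ℝ} (hE : ∀ x, |E x| ≤ M) :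
    ‖∑' x, f x * g x‖ ≤ (∑' x, ‖f x‖) * r + ∑' x, ‖f x‖ * E x := by
  have h1 : Summable fun x => ‖f x‖ * E x := by
    refine Summable.of_norm (Summable.of_nonneg_of_le (fun _ => norm_nonneg _) (fun x => ?_)
      (hf.mul_right M))
    rw [norm_mul, norm_norm]
    exact mul_le_mul_of_nonneg_left (hE x) (norm_nonneg _)
  refine tsum_of_norm_bounded ((hf.hasSum.mul_right r).add h1.hasSum) fun x => ?_
  rw [norm_mul, ← mul_add]
  exact mul_le_mul_of_nonneg_left (hg x) (norm_nonneg _)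

/-- Words in different volumes have asymptotically the same thermal matrix elements, up to the
remainder of the Duhamel expansion after `n` steps. -/
theorem tendsto_max_heisDiff {β : ℝ} (hβ : 0 < β) (hφ : ReservoirAssumption β φ)
    (hK : Summable fun x => ‖hopping ε x‖) (e y' y : ZLat d) (n : ℕ) :
    ∀ (t : ℝ), 0 ≤ t → ∀ (c : List (ZLat d × ℝ)), wordTime c = 0 → ∀ b a : ZLat d,
      Tendsto (fun p => max (‖heisDiff β lam χ ε φ e y' y t c b a p‖ -
        duhamelRemainder (∑' x, ‖hopping ε x‖) n t) 0) (atTop ×ˢ atTop) (𝓝 0) := by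
  set K := ∑' x, ‖hopping ε x‖ with hKdef
  have hK0 : 0 ≤ K := tsum_nonneg fun _ => norm_nonneg _
  induction n with
  | zero =>
    intro t _ c _ b a
    refine tendsto_const_nhds.congr' ?_
    filter_upwards [eventually_pos_prod] with p hp
    have := norm_heisDiff_le lam χ ε hβ hφ e y' y t c b a hp.1 hp.2
    rw [max_eq_right]
    simpa [duhamelRemainder] using this
  | succ n ih =>
    intro t ht c hc b a
    set Δ := fun (s : ℝ) (x z : ZLat d) (p : ℕ × ℕ) =>
      heisDiff β lam χ ε φ e y' y s (conjWord c b a (t - s)) x z p with hΔ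
    set E := fun (s : ℝ) (x z : ZLat d) (p : ℕ × ℕ) =>
      max (‖Δ s x z p‖ - duhamelRemainder K n s) 0 with hE
    set H := fun (p : ℕ × ℕ) (s : ℝ) =>
      hopWord β lam χ ε φ p.1 s (conjWord c b a (t - s)) b a y' y -
      hopWord β lam χ ε φ p.2 s (shiftWord e (conjWord c b a (t - s))) (b + e) (a + e) (y' + e)
        (y + e) with hH
    set G := fun (p : ℕ × ℕ) (s : ℝ) => max (‖H p s‖ - 2 * K * duhamelRemainder K n s) 0 with hG
    obtain ⟨hb, -, hbK, -⟩ := summable_norm_comp hK b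
    obtain ⟨-, ha, -, haK⟩ := summable_norm_comp hK a
    have hE2 : ∀ s, 0 ≤ s → ∀ x z p, 0 < p.1 → 0 < p.2 → |E s x z p| ≤ 2 := by
      intro s hs x z p h1 h2
      rw [abs_of_nonneg (le_max_right _ _)]
      refine max_le ?_ zero_le_two
      have h3 := norm_heisDiff_le lam χ ε hβ hφ e y' y s (conjWord c b a (t - s)) x z h1 h2
      have h4 := duhamelRemainder_nonneg hK0 n hs
      linarith
    have hHle : ∀ s, 0 ≤ s → ∀ p, 0 < p.1 → 0 < p.2 → ‖H p s‖ ≤ 2 * K * duhamelRemainder K n s +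
        (∑' x, ‖hopping ε (x - b)‖ * E s x a p + ∑' z, ‖hopping ε (a - z)‖ * E s b z p) := by
      intro s hs p h1 h2
      have h3 : ∀ x z, ‖Δ s x z p‖ ≤ duhamelRemainder K n s + E s x z p := fun x z => by
        have := le_max_left (‖Δ s x z p‖ - duhamelRemainder K n s) 0
        simp only [hE]
        linarith
      have h4 := norm_tsum_mul_le hb (fun x => h3 x a) fun x => hE2 s hs x a p h1 h2
      have h5 := norm_tsum_mul_le ha (fun z => h3 b z) fun z => hE2 s hs b z p h1 h2
      rw [hbK] at h4
      rw [haK] at h5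
      have h6 : H p s = ∑' x, hopping ε (x - b) * Δ s x a p - ∑' z, hopping ε (a - z) * Δ s b z p :=
        hopWord_sub_eq lam χ ε hβ hφ hK e y' y s _ b a h1 h2
      rw [h6]
      refine (norm_sub_le _ _).trans ((add_le_add h4 h5).trans (le_of_eq ?_))
      ring
    have hGlim : ∀ s, 0 ≤ s → Tendsto (fun p => G p s) (atTop ×ˢ atTop) (𝓝 0) := by
      intro s hs
      have hw : wordTime (conjWord c b a (t - s)) = 0 := (wordTime_conjWord _ _ _ _).trans hc
      have hl : ∀ (f : ZLat d → ℂ) (g h : ZLat d → ZLat d), (Summable fun x => ‖f x‖) →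
          Tendsto (fun p => ∑' x, ‖f x‖ * E s (g x) (h x) p) (atTop ×ˢ atTop) (𝓝 0) := by
        intro f g h hf
        have h1 := tendsto_tsum_of_dominated_convergence (𝓕 := (atTop ×ˢ atTop : Filter (ℕ × ℕ)))
          (f := fun p x => ‖f x‖ * E s (g x) (h x) p) (g := fun _ => (0 : ℝ)) (hf.mul_right 2)
          (fun x => by simpa using (ih s hs _ hw (g x) (h x)).const_mul ‖f x‖)
          (by
            filter_upwards [eventually_pos_prod] with p hp x
            rw [norm_mul, norm_norm]
            exact mul_le_mul_of_nonneg_left (hE2 s hs _ _ p hp.1 hp.2) (norm_nonneg _))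
        simpa using h1
      have h1 := (hl _ (fun x => x) (fun _ => a) hb).add (hl _ (fun _ => b) (fun z => z) ha)
      rw [add_zero] at h1
      refine squeeze_zero' (Eventually.of_forall fun p => le_max_right _ _) ?_ h1
      filter_upwards [eventually_pos_prod] with p hp
      refine max_le ?_ ?_
      · have := hHle s hs p hp.1 hp.2
        linarith
      · exact add_nonneg (tsum_nonneg fun x => mul_nonneg (norm_nonneg _) (le_max_right _ _))
          (tsum_nonneg fun x => mul_nonneg (norm_nonneg _) (le_max_right _ _))
    have hsites : ∀ᶠ p : ℕ × ℕ in atTop ×ˢ atTop, (b ∈ box d p.1 ∧ a ∈ box d p.1 ∧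
        y' ∈ box d p.1 ∧ y ∈ box d p.1) ∧ (b + e ∈ box d p.2 ∧ a + e ∈ box d p.2 ∧
        y' + e ∈ box d p.2 ∧ y + e ∈ box d p.2) :=
      ((eventually_mem_box _).and ((eventually_mem_box _).and ((eventually_mem_box _).and
        (eventually_mem_box _)))).prod_mk ((eventually_mem_box _).and ((eventually_mem_box _).and
        ((eventually_mem_box _).and (eventually_mem_box _))))
    have hduh : ∀ᶠ p : ℕ × ℕ in atTop ×ˢ atTop, Continuous (H p) ∧
        heisDiff β lam χ ε φ e y' y t c b a p = heisDiff β lam χ ε φ e y' y 0 (conjWord c b a t) b a p +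
          Complex.I * ∫ s in (0 : ℝ)..t, H p s := by
      filter_upwards [hsites, eventually_pos_prod] with p hp hp0
      obtain ⟨⟨hb1, ha1, hy1', hy1⟩, ⟨hb2, ha2, hy2', hy2⟩⟩ := hp
      have f1 := hφ.finForm_l2 _ hp0.1
      have f2 := hφ.finForm_l2 _ hp0.2
      obtain ⟨c1, d1⟩ := heisWord_duhamel lam χ ε hβ hp0.1 f1 t c ⟨b, hb1⟩ ⟨a, ha1⟩ ⟨y', hy1'⟩
        ⟨y, hy1⟩
      obtain ⟨c2, d2⟩ := heisWord_duhamel lam χ ε hβ hp0.2 f2 t (shiftWord e c) ⟨b + e, hb2⟩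
        ⟨a + e, ha2⟩ ⟨y' + e, hy2'⟩ ⟨y + e, hy2⟩
      rw [← heisWord_zero lam χ ε β f1] at d1
      rw [← heisWord_zero lam χ ε β f2] at d2
      simp only [← shiftWord_conjWord] at c2 d2
      refine ⟨c1.sub c2, ?_⟩
      rw [heisDiff, d1, d2, heisDiff, hH]
      simp only
      rw [intervalIntegral.integral_sub (c1.intervalIntegrable _ _) (c2.intervalIntegrable _ _)]
      ring
    have hGint : Tendsto (fun p => ∫ s in (0 : ℝ)..t, G p s) (atTop ×ˢ atTop) (𝓝 0) := by
      have hKd : ∀ s, 0 ≤ s → 0 ≤ 2 * K * duhamelRemainder K n s := fun s hs =>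
        mul_nonneg (by positivity) (duhamelRemainder_nonneg hK0 n hs)
      have h1 := intervalIntegral.tendsto_integral_filter_of_dominated_convergence (μ := volume)
        (a := 0) (b := t) (F := G) (f := fun _ => (0 : ℝ)) (l := (atTop ×ˢ atTop : Filter (ℕ × ℕ)))
        (fun _ => 4 * K) ?_ ?_ intervalIntegrable_const ?_
      · simpa using h1
      · filter_upwards [hduh] with p hp
        exact ((hp.1.norm.sub ((continuous_duhamelRemainder K n).const_mul _)).max
          continuous_const).aestronglyMeasurable
      · filter_upwards [eventually_pos_prod] with p hp
        refine ae_of_all _ fun s hs => ?_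
        rw [Set.uIoc_of_le ht] at hs
        rw [Real.norm_of_nonneg (le_max_right _ _)]
        refine max_le ?_ (by positivity)
        have h3 : ∀ x z, ‖Δ s x z p‖ ≤ 2 + 0 := fun x z => by
          rw [add_zero]
          exact norm_heisDiff_le lam χ ε hβ hφ e y' y s (conjWord c b a (t - s)) x z hp.1 hp.2
        have h4 := norm_tsum_mul_le hb (E := fun _ => 0) (fun x => h3 x a) (M := 0) (by simp)
        have h5 := norm_tsum_mul_le ha (E := fun _ => 0) (fun z => h3 b z) (M := 0) (by simp)
        rw [hbK] at h4
        rw [haK] at h5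
        have h6 : H p s = ∑' x, hopping ε (x - b) * Δ s x a p -
            ∑' z, hopping ε (a - z) * Δ s b z p :=
          hopWord_sub_eq lam χ ε hβ hφ hK e y' y s _ b a hp.1 hp.2
        have h7 : ‖H p s‖ ≤ 4 * K := by
          rw [h6]
          refine (norm_sub_le _ _).trans ((add_le_add h4 h5).trans (le_of_eq ?_))
          simp only [mul_zero, tsum_zero]
          ring
        have := hKd s hs.1.le
        linarith
      · refine ae_of_all _ fun s hs => ?_
        rw [Set.uIoc_of_le ht] at hs
        exact hGlim s hs.1.le
    have h0 := (tendsto_heisDiff_zero lam χ ε hβ hφ e y' y (conjWord c b a t)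
      ((wordTime_conjWord _ _ _ _).trans hc) b a).norm.add hGint
    rw [norm_zero, add_zero] at h0
    refine squeeze_zero' (Eventually.of_forall fun p => le_max_right _ _) ?_ h0
    filter_upwards [hduh] with p hp
    have hG0 : 0 ≤ ∫ s in (0 : ℝ)..t, G p s :=
      intervalIntegral.integral_nonneg ht fun s _ => le_max_right _ _
    refine max_le ?_ (add_nonneg (norm_nonneg _) hG0)
    have hGc : Continuous (G p) :=
      (hp.1.norm.sub ((continuous_duhamelRemainder K n).const_mul _)).max continuous_const
    have h1 : ‖∫ s in (0 : ℝ)..t, H p s‖ ≤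
        (∫ s in (0 : ℝ)..t, G p s) + duhamelRemainder K (n + 1) t := by
      refine (intervalIntegral.norm_integral_le_integral_norm ht).trans ?_
      rw [← integral_duhamelRemainder, ← intervalIntegral.integral_add
        (hGc.intervalIntegrable _ _)
        (((continuous_duhamelRemainder K n).const_mul _).intervalIntegrable _ _)]
      refine intervalIntegral.integral_mono_on ht (hp.1.norm.intervalIntegrable _ _)
        ((hGc.add ((continuous_duhamelRemainder K n).const_mul _)).intervalIntegrable _ _)
        fun s _ => ?_
      have := le_max_left (‖H p s‖ - 2 * K * duhamelRemainder K n s) 0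
      simp only [hG]
      linarith
    have h2 : ‖heisDiff β lam χ ε φ e y' y t c b a p‖ ≤
        ‖heisDiff β lam χ ε φ e y' y 0 (conjWord c b a t) b a p‖ + ‖∫ s in (0 : ℝ)..t, H p s‖ := by
      rw [hp.2]
      refine (norm_add_le _ _).trans (le_of_eq ?_)
      rw [norm_mul, Complex.norm_I, one_mul]
    linarith

theorem tendsto_heisDiff {β : ℝ} (hβ : 0 < β) (hφ : ReservoirAssumption β φ)
    (hK : Summable fun x => ‖hopping ε x‖) (e y' y : ZLat d) {t : ℝ} (ht : 0 ≤ t)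
    (c : List (ZLat d × ℝ)) (hc : wordTime c = 0) (b a : ZLat d) :
    Tendsto (heisDiff β lam χ ε φ e y' y t c b a) (atTop ×ˢ atTop) (𝓝 0) := by
  rw [tendsto_zero_iff_norm_tendsto_zero, Metric.tendsto_nhds]
  intro r hr
  have h1 : Tendsto (fun n => duhamelRemainder (∑' x, ‖hopping ε x‖) n t) atTop (𝓝 0) := by
    have := (FloorSemiring.tendsto_pow_div_factorial_atTop
      (2 * (∑' x, ‖hopping ε x‖) * t)).const_mul 2
    simpa [duhamelRemainder] using this
  obtain ⟨n, hn⟩ := (h1.eventually (gt_mem_nhds (half_pos hr))).exists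
  have h2 := tendsto_max_heisDiff lam χ ε hβ hφ hK e y' y n t ht c hc b a
  filter_upwards [h2.eventually (gt_mem_nhds (half_pos hr))] with p hp
  have := (le_max_left _ _).trans_lt hp
  rw [Real.dist_eq, sub_zero, abs_of_nonneg (norm_nonneg _)]
  linarith

end Comparison

/-! ### Exponential bounds on the propagator and its thermodynamic limit -/

section Propagator

variable {d N : ℕ} {φ : EuclideanSpace ℝ (Fin d) → ℂ} (lam : ℝ) (χ : Fin d → ℝ)
  (ε : (Fin d → ℝ) → ℝ)

theorem norm_latHop_apply_le (x z : ZLat d) (v : Hl2 (TotalIdx d N)) :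
    ‖latHop x z v‖ ≤ ‖latHop z z v‖ := by
  by_cases hz : z ∈ box d N
  · rw [← latHop_mul_same x hz z]
    exact ((latHop x z).le_opNorm _).trans (mul_le_of_le_one_left (norm_nonneg _) (norm_latHop_le x z))
  · rw [latHop_of_notMem_right hz]
    simp

theorem latHop_self_freeEvolution (hφ : Summable fun k : ZLat d => ‖finForm φ N k‖ ^ 2)
    (x : ZLat d) (t : ℝ) (v : Hl2 (TotalIdx d N)) :
    latHop x x (freeEvolution lam χ φ N t v) = freeEvolution lam χ φ N t (latHop x x v) :=
  congrArg (fun A : Op (TotalIdx d N) => A v) (latHop_mul_freeEvolution lam χ hφ x t)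

theorem norm_latHop_boxHopping_le (x : Site d N) (v : Hl2 (TotalIdx d N)) :
    ‖latHop x.1 x.1 (boxHopping ε v)‖ ≤
      ∑ z : Site d N, ‖hopping ε (x.1 - z.1)‖ * ‖latHop z.1 z.1 v‖ := by
  have h : latHop x.1 x.1 (boxHopping ε v) =
      ∑ z : Site d N, hopping ε (x.1 - z.1) • latHop x.1 z.1 v := by
    have := congrArg (fun A : Op (TotalIdx d N) => A v) (latHop_mul_boxHopping ε x.1 x)
    simpa [_root_.sum_apply] using this
  rw [h]
  refine (norm_sum_le _ _).trans (Finset.sum_le_sum fun z _ => ?_)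
  rw [norm_smul]
  exact mul_le_mul_of_nonneg_left (norm_latHop_apply_le _ _ _) (norm_nonneg _)

/-- In finite time the particle moves over distances with exponentially decaying amplitude,
uniformly in the volume and in the state of the reservoirs. -/
theorem norm_latHop_fullEvolution_le (hφ : Summable fun k : ZLat d => ‖finForm φ N k‖ ^ 2)
    {ν : ℝ} (hν : 0 ≤ ν) (hK : Summable fun x : ZLat d => ‖hopping ε x‖ * Real.exp (ν * latNorm x))
    (x y : Site d N) (n : Occ d N) {t : ℝ} (ht : 0 ≤ t) :
    ‖latHop x.1 x.1 (fullEvolution lam χ ε φ N t (ket (y, n)))‖ ≤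
      Real.exp ((∑' x : ZLat d, ‖hopping ε x‖ * Real.exp (ν * latNorm x)) * t) *
        Real.exp (-ν * latNorm (x.1 - y.1)) := by
  classical
  set K := ∑' x : ZLat d, ‖hopping ε x‖ * Real.exp (ν * latNorm x) with hKdef
  set U₀ := freeEvolution lam χ φ N
  set U := fullEvolution lam χ ε φ N
  have hG₀ : IsUnitaryGroup U₀ := freeEvolution_isUnitaryGroup lam χ hφ
  have hG : IsUnitaryGroup U := fullEvolution_isUnitaryGroup lam χ ε hφ
  set v : Hl2 (TotalIdx d N) := ket (y, n) with hv
  -- the components at the sites `x`, in the interaction picture and with the weight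
  -- `e^{ν|x - y|}`; Gronwall's inequality is applied to their maximum, whose growth rate is `K`
  set Z : ℝ → Site d N → Hl2 (TotalIdx d N) := fun t x =>
    Real.exp (ν * latNorm (x.1 - y.1)) • latHop x.1 x.1 (U₀ (-t) (U t v)) with hZ
  set Z' : ℝ → Site d N → Hl2 (TotalIdx d N) := fun t x =>
    Real.exp (ν * latNorm (x.1 - y.1)) •
      latHop x.1 x.1 (-(Complex.I • U₀ (-t) (boxHopping ε (U t v)))) with hZ'
  have hd : ∀ t, HasDerivAt Z (Z' t) t := by
    intro t
    refine hasDerivAt_pi.2 fun x => ?_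
    have h1 := (((latHop x.1 x.1 : Op (TotalIdx d N)).restrictScalars ℝ).hasFDerivAt
      (x := U₀ (-t) (U t v))).comp_hasDerivAt t (hasDerivAt_fullEvolution lam χ ε hφ v t)
    exact h1.const_smul (Real.exp (ν * latNorm (x.1 - y.1)))
  have hPU : ∀ t (z : Site d N), ‖latHop z.1 z.1 (U t v)‖ =
      ‖latHop z.1 z.1 (U₀ (-t) (U t v))‖ := by
    intro t z
    rw [latHop_self_freeEvolution lam χ hφ, hG₀.norm_apply]
  have hZn : ∀ t (z : Site d N), Real.exp (ν * latNorm (z.1 - y.1)) * ‖latHop z.1 z.1 (U t v)‖ ≤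
      ‖Z t‖ := by
    intro t z
    refine le_trans (le_of_eq ?_) (norm_le_pi_norm (Z t) z)
    rw [hZ, norm_smul, Real.norm_of_nonneg (Real.exp_pos _).le, hPU]
  have hK0 : 0 ≤ K := tsum_nonneg fun _ => by positivity
  have hbound : ∀ t, ‖Z' t‖ ≤ K * ‖Z t‖ + 0 := by
    intro t
    rw [add_zero]
    refine (pi_norm_le_iff_of_nonneg (mul_nonneg hK0 (norm_nonneg _))).2 fun x => ?_
    have h1 : ‖Z' t x‖ =
        Real.exp (ν * latNorm (x.1 - y.1)) * ‖latHop x.1 x.1 (boxHopping ε (U t v))‖ := by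
      rw [hZ']
      simp only
      rw [norm_smul, Real.norm_of_nonneg (Real.exp_pos _).le, map_neg, map_smul, norm_neg,
        norm_smul, Complex.norm_I, one_mul, latHop_self_freeEvolution lam χ hφ, hG₀.norm_apply]
    rw [h1]
    have h2 : ∀ z : Site d N, Real.exp (ν * latNorm (x.1 - y.1)) *
        (‖hopping ε (x.1 - z.1)‖ * ‖latHop z.1 z.1 (U t v)‖) ≤
        ‖hopping ε (x.1 - z.1)‖ * Real.exp (ν * latNorm (x.1 - z.1)) * ‖Z t‖ := by
      intro z
      have h3 : Real.exp (ν * latNorm (x.1 - y.1)) ≤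
          Real.exp (ν * latNorm (x.1 - z.1)) * Real.exp (ν * latNorm (z.1 - y.1)) := by
        rw [← Real.exp_add, Real.exp_le_exp, ← mul_add]
        refine mul_le_mul_of_nonneg_left ?_ hν
        have := latNorm_add_le (x.1 - z.1) (z.1 - y.1)
        rwa [sub_add_sub_cancel] at this
      calc _ ≤ Real.exp (ν * latNorm (x.1 - z.1)) * Real.exp (ν * latNorm (z.1 - y.1)) *
            (‖hopping ε (x.1 - z.1)‖ * ‖latHop z.1 z.1 (U t v)‖) :=
            mul_le_mul_of_nonneg_right h3 (by positivity)
        _ = ‖hopping ε (x.1 - z.1)‖ * Real.exp (ν * latNorm (x.1 - z.1)) *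
            (Real.exp (ν * latNorm (z.1 - y.1)) * ‖latHop z.1 z.1 (U t v)‖) := by ring
        _ ≤ _ := mul_le_mul_of_nonneg_left (hZn t z) (by positivity)
    refine (mul_le_mul_of_nonneg_left (norm_latHop_boxHopping_le ε x _)
      (Real.exp_pos _).le).trans ?_
    rw [Finset.mul_sum]
    refine (Finset.sum_le_sum fun z _ => h2 z).trans ?_
    rw [← Finset.sum_mul]
    refine mul_le_mul_of_nonneg_right ?_ (norm_nonneg _)
    have hinj : Function.Injective fun z : Site d N => x.1 - z.1 := fun z z' h =>
      Subtype.ext (sub_right_injective h)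
    have h4 := (hK.comp_injective hinj).sum_le_tsum Finset.univ fun z _ => by
      rw [Function.comp_apply]; positivity
    refine h4.trans ?_
    exact tsum_comp_le_tsum_of_inj hK (fun _ => by positivity) hinj
  have h0 : ‖Z 0‖ ≤ 1 := by
    refine (pi_norm_le_iff_of_nonneg zero_le_one).2 fun z => ?_
    rw [hZ]
    simp only [neg_zero, hG₀.zero, hG.zero, one_apply_eq_self]
    by_cases hz : z = y
    · rw [hz, sub_self, latNorm, norm_smul]
      simp only [Pi.zero_apply, Int.cast_zero, ne_eq, OfNat.ofNat_ne_zero, not_false_eq_true,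
        zero_pow, Finset.sum_const_zero, Real.sqrt_zero, mul_zero, Real.exp_zero, norm_one, one_mul]
      refine ((latHop y.1 y.1).le_opNorm _).trans (mul_le_one₀ (norm_latHop_le _ _) (norm_nonneg _)
        (norm_ket _).le)
    · have : latHop z.1 z.1 v = 0 := by
        ext a
        rw [latHop_self_apply]
        split_ifs with ha
        · rw [hv, ket_apply, if_neg]
          · rfl
          · intro h
            exact hz (by rw [h] at ha; exact Subtype.ext ha.symm)
        · rfl
      rw [this, smul_zero, norm_zero]
      exact zero_le_one
  have hgr := norm_le_gronwallBound_of_norm_deriv_right_le (f := Z) (f' := Z') (δ := 1) (K := K)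
    (ε := 0) (a := 0) (b := t) (fun s _ => (hd s).continuousAt.continuousWithinAt)
    (fun s _ => (hd s).hasDerivWithinAt) h0 (fun s _ => hbound s) t ⟨ht, le_rfl⟩
  rw [gronwallBound_ε0, one_mul, sub_zero] at hgr
  have h1 := (hZn t x).trans hgr
  rw [neg_mul, Real.exp_neg, ← div_eq_mul_inv, le_div_iff₀ (Real.exp_pos _), mul_comm]
  exact h1

theorem norm_heisWord_nil_le {β : ℝ} (hβ : 0 < β) (hN : 0 < N)
    (hφ : Summable fun k : ZLat d => ‖finForm φ N k‖ ^ 2) {ν : ℝ} (hν : 0 ≤ ν)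
    (hK : Summable fun x : ZLat d => ‖hopping ε x‖ * Real.exp (ν * latNorm x))
    (x' x y' y : ZLat d) {t : ℝ} (ht : 0 ≤ t) :
    ‖heisWord β lam χ ε φ N t [] x' x y' y‖ ≤
      Real.exp ((∑' x : ZLat d, ‖hopping ε x‖ * Real.exp (ν * latNorm x)) * t) ^ 2 *
        (Real.exp (-ν * latNorm (x - y)) * Real.exp (-ν * latNorm (x' - y'))) := by
  set M := Real.exp ((∑' x : ZLat d, ‖hopping ε x‖ * Real.exp (ν * latNorm x)) * t) with hM
  have h0 : 0 ≤ M ^ 2 * (Real.exp (-ν * latNorm (x - y)) * Real.exp (-ν * latNorm (x' - y'))) := by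
    positivity
  by_cases hx' : x' ∈ box d N
  swap
  · rwa [heisWord_of_notMem_left _ _ _ _ _ _ _ hx', norm_zero]
  by_cases hx : x ∈ box d N
  swap
  · rwa [heisWord_of_notMem_right _ _ _ _ _ _ _ _ hx, norm_zero]
  rw [heisWord]
  split_ifs with h
  swap
  · rwa [norm_zero]
  have hG := fullEvolution_isUnitaryGroup lam χ ε hφ
  refine norm_thermalElem_le_of_kern hβ hN fun n => ?_
  rw [kern_eq_inner]
  set U := fullEvolution lam χ ε φ N
  have h1 : inner ℂ (ket ((⟨y', h.1⟩, n) : TotalIdx d N))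
      ((U (-t) * wordOp (freeEvolution lam χ φ N) [] x' x * U t) (ket (⟨y, h.2⟩, n))) =
      inner ℂ (latHop x' x' (U t (ket ((⟨y', h.1⟩, n) : TotalIdx d N))))
        (latHop x' x (U t (ket (⟨y, h.2⟩, n)))) := by
    conv_rhs => rw [← star_latHop, ContinuousLinearMap.star_eq_adjoint,
      ContinuousLinearMap.adjoint_inner_left, hG.inner_left]
    have h2 := latHop_mul_same (N := N) x' hx' x
    have h3 : ∀ w : Hl2 (TotalIdx d N), latHop x' x' (latHop x' x w) = latHop x' x w := fun w =>
      congrArg (fun A : Op (TotalIdx d N) => A w) h2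
    rw [h3]
    rfl
  rw [h1]
  refine (norm_inner_le_norm _ _).trans ?_
  have h4 := norm_latHop_fullEvolution_le lam χ ε hφ hν hK ⟨x', hx'⟩ ⟨y', h.1⟩ n ht
  have h5 := (norm_latHop_apply_le x' x _).trans
    (norm_latHop_fullEvolution_le lam χ ε hφ hν hK ⟨x, hx⟩ ⟨y, h.2⟩ n ht)
  refine (mul_le_mul h4 h5 (norm_nonneg _) (by positivity)).trans (le_of_eq ?_)
  ring

/-- The propagator `⟨x| 𝓩(|y⟩⟨y'|) |x'⟩` of the reduced dynamics converges in the thermodynamic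
limit, and its limit is translation invariant. -/
theorem exists_tendsto_heisWord_nil {β : ℝ} (hβ : 0 < β) (hφ : ReservoirAssumption β φ)
    (hK : Summable fun x => ‖hopping ε x‖) {t : ℝ} (ht : 0 ≤ t) :
    ∃ P : ZLat d → ZLat d → ZLat d → ZLat d → ℂ,
      (∀ x y x' y', Tendsto (fun N => heisWord β lam χ ε φ N t [] x' x y' y) atTop
        (𝓝 (P x y x' y'))) ∧
      ∀ e x y x' y', P (x + e) (y + e) (x' + e) (y' + e) = P x y x' y' := by
  have hcauchy : ∀ x y x' y', ∃ p : ℂ,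
      Tendsto (fun N => heisWord β lam χ ε φ N t [] x' x y' y) atTop (𝓝 p) := by
    intro x y x' y'
    refine cauchySeq_tendsto_of_complete (Metric.cauchySeq_iff.2 fun r hr => ?_)
    have h1 := tendsto_heisDiff lam χ ε hβ hφ hK 0 y' y ht [] rfl x' x
    have h2 := (tendsto_zero_iff_norm_tendsto_zero.1 h1).eventually (gt_mem_nhds hr)
    rw [prod_atTop_atTop_eq] at h2
    obtain ⟨⟨n, m⟩, hnm⟩ := eventually_atTop.1 h2
    refine ⟨max n m, fun k hk l hl => ?_⟩
    have h3 := hnm (k, l) ⟨(le_max_left _ _).trans hk, (le_max_right _ _).trans hl⟩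
    simpa [heisDiff, shiftWord, dist_eq_norm] using h3
  choose P hP using hcauchy
  refine ⟨P, hP, fun e x y x' y' => ?_⟩
  have h1 := tendsto_heisDiff lam χ ε hβ hφ hK e y' y ht [] rfl x' x
  have h2 := ((hP x y x' y').comp (tendsto_fst (f := atTop) (g := (atTop : Filter ℕ)))).sub
    ((hP (x + e) (y + e) (x' + e) (y' + e)).comp
      (tendsto_snd (f := (atTop : Filter ℕ)) (g := atTop)))
  have h3 := tendsto_nhds_unique h2 h1
  exact (sub_eq_zero.1 h3).symm

end Propagator

/-! ### The reduced dynamics in finite volume -/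

section FiniteVolume

variable {d N : ℕ}

/-- The Cauchy-Schwarz inequality for series. -/
theorem summable_mul_of_hasSum_sq {κ : Type*} {a b : κ → ℝ} {A B : ℝ} (ha : ∀ k, 0 ≤ a k)
    (hb : ∀ k, 0 ≤ b k) (hA : 0 ≤ A) (hB : 0 ≤ B) (h1 : HasSum (fun k => a k ^ 2) (A ^ 2))
    (h2 : HasSum (fun k => b k ^ 2) (B ^ 2)) :
    Summable (fun k => a k * b k) ∧ ∑' k, a k * b k ≤ A * B := by
  have h : ∀ F : Finset κ, ∑ k ∈ F, a k * b k ≤ A * B := by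
    intro F
    refine (Real.sum_mul_le_sqrt_mul_sqrt F a b).trans (mul_le_mul ?_ ?_ (Real.sqrt_nonneg _) hA)
    · rw [← Real.sqrt_sq hA]
      exact Real.sqrt_le_sqrt (sum_le_hasSum F (fun _ _ => sq_nonneg _) h1)
    · rw [← Real.sqrt_sq hB]
      exact Real.sqrt_le_sqrt (sum_le_hasSum F (fun _ _ => sq_nonneg _) h2)
  have hs := summable_of_sum_le (fun k => mul_nonneg (ha k) (hb k)) h
  exact ⟨hs, hs.tsum_le_of_sum_le h⟩

theorem embedBox_apply (M : Matrix (Site d N) (Site d N) ℂ) (v : Hl2 (ZLat d)) (x : ZLat d) :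
    embedBox M v x = if h : x ∈ box d N then ∑ y : Site d N, M ⟨x, h⟩ y * v y.1 else 0 := by
  classical
  have h1 : embedBox M v = ∑ z : Site d N, ∑ y : Site d N, (M z y * v y.1) • ket z.1 := by
    rw [embedBox, _root_.sum_apply]
    refine Finset.sum_congr rfl fun z _ => ?_
    rw [_root_.sum_apply]
    refine Finset.sum_congr rfl fun y _ => ?_
    rw [smul_apply, ketbra, InnerProductSpace.rankOne_apply, inner_ket, smul_smul]
  rw [h1, ← inner_ket, inner_sum]
  simp only [inner_sum, inner_smul_right, inner_ket, ket_apply, mul_ite, mul_one, mul_zero]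
  split_ifs with h
  · rw [Finset.sum_eq_single ⟨x, h⟩]
    · simp
    · intro z _ hz
      refine Finset.sum_eq_zero fun y _ => if_neg fun e => hz (Subtype.ext e.symm)
    · simp
  · refine Finset.sum_eq_zero fun z _ => Finset.sum_eq_zero fun y _ => if_neg fun e : x = z.1 => h (e ▸ z.2)

theorem kern_embedBox (M : Matrix (Site d N) (Site d N) ℂ) (x x' : ZLat d) :
    kern (embedBox M) x x' =
      if h : x ∈ box d N ∧ x' ∈ box d N then M ⟨x, h.1⟩ ⟨x', h.2⟩ else 0 := by
  classical
  rw [kern, embedBox_apply]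
  simp only [ket_apply, mul_ite, mul_one, mul_zero]
  by_cases h : x ∈ box d N
  · rw [dif_pos h]
    by_cases h' : x' ∈ box d N
    · rw [dif_pos ⟨h, h'⟩, Finset.sum_eq_single ⟨x', h'⟩]
      · simp
      · intro z _ hz
        exact if_neg fun e => hz (Subtype.ext e)
      · simp
    · rw [dif_neg fun e => h' e.2]
      exact Finset.sum_eq_zero fun z _ => if_neg fun e : z.1 = x' => h' (e ▸ z.2)
  · rw [dif_neg h, dif_neg fun e => h e.1]

/-- The vector `1_Λ u ⊗ |m⟩`. -/
def boxTensor (m : Occ d N) (u : Hl2 (ZLat d)) : Hl2 (TotalIdx d N) :=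
  ∑ y : Site d N, u y.1 • ket (y, m)

theorem apply_boxTensor (A : Op (TotalIdx d N)) (m : Occ d N) (u : Hl2 (ZLat d))
    (a : TotalIdx d N) : A (boxTensor m u) a = ∑ y : Site d N, u y.1 * kern A a (y, m) := by
  rw [boxTensor, map_sum, ← inner_ket, inner_sum]
  refine Finset.sum_congr rfl fun y _ => ?_
  rw [map_smul, inner_smul_right, kern_eq_inner]

theorem norm_boxTensor_le (m : Occ d N) (u : Hl2 (ZLat d)) : ‖boxTensor m u‖ ≤ ‖u‖ := by
  classical
  have h1 : ‖boxTensor m u‖ ^ 2 = ∑ y : Site d N, ‖u y.1‖ ^ 2 := by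
    have hinj : Function.Injective fun y : Site d N => ((y, m) : TotalIdx d N) :=
      fun y y' h => congrArg Prod.fst h
    have ho := ((ketBasis (TotalIdx d N)).orthonormal.comp _ hinj).inner_sum
      (fun y => u y.1) (fun y => u y.1) Finset.univ
    simp only [Function.comp_apply, ketBasis_apply] at ho
    have h3 := inner_self_eq_norm_sq_to_K (𝕜 := ℂ) (boxTensor m u)
    rw [boxTensor, ho] at h3
    have h4 : ((‖boxTensor m u‖ ^ 2 : ℝ) : ℂ) = ((∑ y : Site d N, ‖u y.1‖ ^ 2 : ℝ) : ℂ) := by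
      push_cast
      refine h3.symm.trans (Finset.sum_congr rfl fun y _ => ?_)
      rw [← Complex.normSq_eq_conj_mul_self, Complex.normSq_eq_norm_sq, Complex.ofReal_pow]
    exact_mod_cast h4
  have h2 : ∑ y : Site d N, ‖u y.1‖ ^ 2 ≤ ‖u‖ ^ 2 := by
    rw [Finset.sum_coe_sort (box d N) fun y => ‖u y‖ ^ 2]
    exact sum_le_hasSum _ (fun _ _ => sq_nonneg _) (hasSum_norm_sq u)
  exact le_of_sq_le_sq (h1.trans_le h2) (norm_nonneg _)

variable {φ : EuclideanSpace ℝ (Fin d) → ℂ} (lam : ℝ) (χ : Fin d → ℝ) (ε : (Fin d → ℝ) → ℝ)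

/-- The reduced dynamics in the cube as a map of operators on `ℓ²(ℤ^d)`. -/
def finDyn (β lam : ℝ) (χ : Fin d → ℝ) (ε : (Fin d → ℝ) → ℝ)
    (φ : EuclideanSpace ℝ (Fin d) → ℂ) (t : ℝ) (N : ℕ) (ρ : Op (ZLat d)) : Op (ZLat d) :=
  embedBox (reducedDynamics β lam χ ε φ N t (restrictBox N ρ))

/-- The Kraus operators `√p_m ⟨n| U |m⟩` of the reduced dynamics. -/
def krausOp (β : ℝ) (U : Op (TotalIdx d N)) (n m : Occ d N) : Op (ZLat d) :=
  embedBox fun x y => (√(gibbsWeight β m) : ℂ) * kern U (x, n) (y, m)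

theorem krausOp_apply (β : ℝ) (U : Op (TotalIdx d N)) (n m : Occ d N) (u : Hl2 (ZLat d))
    (x : ZLat d) : krausOp β U n m u x =
      if h : x ∈ box d N then (√(gibbsWeight β m) : ℂ) * U (boxTensor m u) (⟨x, h⟩, n) else 0 := by
  refine (embedBox_apply _ u x).trans ?_
  split_ifs with h
  · rw [apply_boxTensor, Finset.mul_sum]
    exact Finset.sum_congr rfl fun y _ => by ring
  · rfl

theorem hasSum_norm_krausOp_sq (β : ℝ) (U : Op (TotalIdx d N)) (m : Occ d N) (u : Hl2 (ZLat d)) :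
    HasSum (fun n => ‖krausOp β U n m u‖ ^ 2) (gibbsWeight β m * ‖U (boxTensor m u)‖ ^ 2) := by
  have h1 := ((Equiv.prodComm (Occ d N) (Site d N)).hasSum_iff.2
    (hasSum_norm_sq (U (boxTensor m u)))).prod_fiberwise
    (g := fun n => ∑ x : Site d N, ‖U (boxTensor m u) (x, n)‖ ^ 2) fun n => hasSum_fintype _
  refine (h1.mul_left (gibbsWeight β m)).congr_fun fun n => ?_
  refine (hasSum_norm_sq _).unique ?_
  have h2 : ∑ x : Site d N, ‖U (boxTensor m u) (x, n)‖ ^ 2 * gibbsWeight β m =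
      ∑ x ∈ box d N, ‖krausOp β U n m u x‖ ^ 2 := by
    rw [← Finset.sum_coe_sort (box d N) fun x => ‖krausOp β U n m u x‖ ^ 2]
    refine Finset.sum_congr rfl fun x _ => ?_
    rw [krausOp_apply, dif_pos x.2, norm_mul, mul_pow, Complex.norm_real, Real.norm_eq_abs, sq_abs,
      Real.sq_sqrt (gibbsWeight_nonneg β m), mul_comm]
  rw [mul_comm, Finset.sum_mul, h2]
  refine hasSum_sum_of_ne_finset_zero fun x hx => ?_
  rw [krausOp_apply, dif_neg hx, norm_zero, zero_pow two_ne_zero]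

theorem summable_norm_krausOp (β : ℝ) {U : Op (TotalIdx d N)} (hU : ∀ v, ‖U v‖ = ‖v‖)
    (m : Occ d N) (u v : Hl2 (ZLat d)) :
    (Summable fun n => ‖krausOp β U n m u‖ * ‖krausOp β U n m v‖) ∧
      ∑' n, ‖krausOp β U n m u‖ * ‖krausOp β U n m v‖ ≤ gibbsWeight β m * (‖u‖ * ‖v‖) := by
  have h : ∀ u, HasSum (fun n => ‖krausOp β U n m u‖ ^ 2)
      ((√(gibbsWeight β m) * ‖boxTensor m u‖) ^ 2) := fun u => by
    rw [mul_pow, Real.sq_sqrt (gibbsWeight_nonneg β m), ← hU]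
    exact hasSum_norm_krausOp_sq β U m u
  obtain ⟨h1, h2⟩ := summable_mul_of_hasSum_sq (fun _ => norm_nonneg _) (fun _ => norm_nonneg _)
    (by positivity) (by positivity) (h u) (h v)
  refine ⟨h1, h2.trans ?_⟩
  rw [mul_mul_mul_comm, Real.mul_self_sqrt (gibbsWeight_nonneg β m)]
  exact mul_le_mul_of_nonneg_left (mul_le_mul (norm_boxTensor_le m u) (norm_boxTensor_le m v)
    (norm_nonneg _) (norm_nonneg _)) (gibbsWeight_nonneg β m)

theorem kern_mul_ketbra_mul (A B : Op (TotalIdx d N)) (a b i j : TotalIdx d N) :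
    kern (A * ketbra a b * B) i j = kern A i a * kern B b j := by
  rw [kern, mul_apply_eq_comp, mul_apply_eq_comp, ketbra, InnerProductSpace.rankOne_apply,
    inner_ket, map_smul]
  exact mul_comm _ _

/-- The matrix elements of `U (M ⊗ ρ_R) V`. -/
theorem hasSum_kern_tensorGibbs {β : ℝ} (hβ : 0 < β) (hN : 0 < N) (U V : Op (TotalIdx d N))
    (M : Matrix (Site d N) (Site d N) ℂ) (i j : TotalIdx d N) :
    HasSum (fun m : Occ d N => ∑ y : Site d N, ∑ y' : Site d N,
      M y y' * gibbsWeight β m * (kern U i (y, m) * kern V (y', m) j))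
      (kern (U * tensorGibbs β M * V) i j) := by
  have hs : Summable fun m : Occ d N => ∑ y : Site d N, ∑ y' : Site d N,
      (M y y' * (gibbsWeight β m : ℂ)) • (ketbra (y, m) (y', m) : Op (TotalIdx d N)) := by
    refine summable_sum fun y _ => summable_sum fun y' _ => ?_
    refine Summable.of_norm_bounded
      ((hasSum_gibbsWeight (d := d) hβ hN).summable.mul_left ‖M y y'‖) fun m => ?_
    rw [norm_smul, norm_mul, Complex.norm_real, Real.norm_of_nonneg (gibbsWeight_nonneg β m), ketbra,
      InnerProductSpace.norm_rankOne, norm_ket, norm_ket, mul_one, mul_one]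
  have h1 : HasSum _ (tensorGibbs β M) := hs.hasSum
  have h2 := (((h1.mul_left U).mul_right V).mapL
    (ContinuousLinearMap.apply ℂ (Hl2 (TotalIdx d N)) (ket j))).mapL (innerSL ℂ (ket i))
  simp only [innerSL_apply_apply, ContinuousLinearMap.apply_apply] at h2
  rw [← kern_eq_inner] at h2
  refine h2.congr_fun fun m => ?_
  rw [← kern_eq_inner, Finset.mul_sum, Finset.sum_mul, kern_sum]
  refine Finset.sum_congr rfl fun y _ => ?_
  rw [Finset.mul_sum, Finset.sum_mul, kern_sum]
  refine Finset.sum_congr rfl fun y' _ => ?_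
  rw [mul_smul_comm, smul_mul_assoc, kern_smul, kern_mul_ketbra_mul]

end FiniteVolume

section ReducedDynamics

variable {d N : ℕ} {φ : EuclideanSpace ℝ (Fin d) → ℂ} (lam : ℝ) (χ : Fin d → ℝ)
  (ε : (Fin d → ℝ) → ℝ)

theorem kern_finDyn (β t : ℝ) (ρ : Op (ZLat d)) (x x' : ZLat d) :
    kern (finDyn β lam χ ε φ t N ρ) x x' = if h : x ∈ box d N ∧ x' ∈ box d N then
      ∑' n : Occ d N, kern (fullEvolution lam χ ε φ N t * tensorGibbs β (restrictBox N ρ) *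
        fullEvolution lam χ ε φ N (-t)) (⟨x, h.1⟩, n) (⟨x', h.2⟩, n) else 0 :=
  kern_embedBox _ x x'

theorem summable_iterated {α κ γ : Type*} {p : α → ℝ} {b : κ → ℝ} {F : (α × κ) × γ → ℝ}
    (hF0 : ∀ q, 0 ≤ F q) (hp0 : ∀ m, 0 ≤ p m) (hb0 : ∀ k, 0 ≤ b k) (hp : HasSum p 1)
    (hb : Summable b)
    (hF : ∀ q : α × κ, (Summable fun n => F (q, n)) ∧ ∑' n, F (q, n) ≤ p q.1 * b q.2) :
    Summable F ∧ ∑' q, F q ≤ ∑' k, b k := by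
  have h1 : Summable fun q : α × κ => p q.1 * b q.2 := hp.summable.mul_of_nonneg hb hp0 hb0
  have h2 : Summable F := (summable_prod_of_nonneg hF0).2 ⟨fun q => (hF q).1,
    Summable.of_nonneg_of_le (fun q => tsum_nonneg fun _ => hF0 _) (fun q => (hF q).2) h1⟩
  refine ⟨h2, ?_⟩
  rw [h2.tsum_prod]
  refine (h2.prod.tsum_le_tsum (fun q => (hF q).2) h1).trans (le_of_eq ?_)
  rw [h1.tsum_prod]
  simp only [tsum_mul_left, tsum_mul_right]
  rw [hp.tsum_eq, one_mul]

theorem summable_kraus_family {β : ℝ} (hβ : 0 < β) (hN : 0 < N) {U : Op (TotalIdx d N)}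
    (hU : ∀ v, ‖U v‖ = ‖v‖) {κ : Type} {A : Op (ZLat d)} {u v : κ → Hl2 (ZLat d)} {c : ℝ}
    (h : IsNuclearSum A u v c) :
    (Summable fun q : (Occ d N × κ) × Occ d N =>
      ‖krausOp β U q.2 q.1.1 (u q.1.2)‖ * ‖krausOp β U q.2 q.1.1 (v q.1.2)‖) ∧
    ∑' q : (Occ d N × κ) × Occ d N,
      ‖krausOp β U q.2 q.1.1 (u q.1.2)‖ * ‖krausOp β U q.2 q.1.1 (v q.1.2)‖ ≤ c := by
  obtain ⟨h1, h2⟩ := summable_iterated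
    (F := fun q : (Occ d N × κ) × Occ d N =>
      ‖krausOp β U q.2 q.1.1 (u q.1.2)‖ * ‖krausOp β U q.2 q.1.1 (v q.1.2)‖)
    (b := fun k => ‖u k‖ * ‖v k‖) (fun _ => by positivity) (gibbsWeight_nonneg β)
    (fun _ => by positivity) (hasSum_gibbsWeight hβ hN) h.summable
    fun p => summable_norm_krausOp β hU p.1 (u p.2) (v p.2)
  exact ⟨h1, h2.trans h.tsum_le⟩

set_option maxHeartbeats 1000000 in
/-- The kernel of the reduced dynamics, on the one hand as a sum over the Kraus operators and on the
other hand through the propagator, the thermal matrix elements of the empty word. -/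
theorem IsNuclearSum.finDyn_and_hasSum {β : ℝ} (hβ : 0 < β) (hN : 0 < N)
    (hφ : Summable fun k : ZLat d => ‖finForm φ N k‖ ^ 2) (t : ℝ) {κ : Type} {ρ : Op (ZLat d)}
    {u v : κ → Hl2 (ZLat d)} {c : ℝ} (h : IsNuclearSum ρ u v c) (x x' : ZLat d) :
    HasSum (fun q : (Occ d N × κ) × Occ d N =>
      krausOp β (fullEvolution lam χ ε φ N t) q.2 q.1.1 (u q.1.2) x *
        (starRingEnd ℂ) (krausOp β (fullEvolution lam χ ε φ N t) q.2 q.1.1 (v q.1.2) x'))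
      (kern (finDyn β lam χ ε φ t N ρ) x x') ∧
    kern (finDyn β lam χ ε φ t N ρ) x x' = ∑ y : Site d N, ∑ y' : Site d N,
      kern ρ y.1 y'.1 * heisWord β lam χ ε φ N t [] x' x y'.1 y.1 := by
  classical
  set U := fullEvolution lam χ ε φ N t with hUdef
  have hG := fullEvolution_isUnitaryGroup lam χ ε hφ
  have hU : ∀ v, ‖U v‖ = ‖v‖ := hG.norm_apply t
  rw [kern_finDyn]
  by_cases hx : x ∈ box d N ∧ x' ∈ box d N
  swap
  · rw [dif_neg hx]
    constructor
    · convert hasSum_zero with q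
      rw [krausOp_apply, krausOp_apply]
      by_cases h1 : x ∈ box d N
      · rw [dif_neg fun h2 => hx ⟨h1, h2⟩, map_zero, mul_zero]
      · rw [dif_neg h1, zero_mul]
    · refine (Finset.sum_eq_zero fun y _ => Finset.sum_eq_zero fun y' _ => ?_).symm
      by_cases h1 : x ∈ box d N
      · rw [heisWord_of_notMem_left _ _ _ _ _ _ _ fun h2 => hx ⟨h1, h2⟩, mul_zero]
      · rw [heisWord_of_notMem_right _ _ _ _ _ _ _ _ h1, mul_zero]
  rw [dif_pos hx]
  set a : Site d N := ⟨x, hx.1⟩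
  set a' : Site d N := ⟨x', hx.2⟩
  obtain ⟨hs, -⟩ := summable_kraus_family hβ hN hU h
  set f : (Occ d N × κ) × Occ d N → ℂ := fun q => krausOp β U q.2 q.1.1 (u q.1.2) x *
    (starRingEnd ℂ) (krausOp β U q.2 q.1.1 (v q.1.2) x') with hf
  have hfs : Summable f := by
    refine Summable.of_norm_bounded hs fun q => ?_
    rw [hf, norm_mul, RCLike.norm_conj]
    exact mul_le_mul (norm_apply_le _ _) (norm_apply_le _ _) (norm_nonneg _) (norm_nonneg _)
  have hft := hfs.hasSum
  have hsq : ∀ m : Occ d N, (√(gibbsWeight β m) : ℂ) * (√(gibbsWeight β m) : ℂ) = gibbsWeight β m :=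
    fun m => by rw [← Complex.ofReal_mul, Real.mul_self_sqrt (gibbsWeight_nonneg β m)]
  have hfU : ∀ q, f q = gibbsWeight β q.1.1 * (U (boxTensor q.1.1 (u q.1.2)) (a, q.2) *
      (starRingEnd ℂ) (U (boxTensor q.1.1 (v q.1.2)) (a', q.2))) := by
    intro q
    rw [hf]
    simp only
    rw [krausOp_apply, krausOp_apply, dif_pos hx.1, dif_pos hx.2, map_mul, Complex.conj_ofReal,
      ← hsq]
    ring
  have hfk : ∀ n m k, f ((m, k), n) = ∑ y : Site d N, ∑ y' : Site d N,
      (gibbsWeight β m * (kern U (a, n) (y, m) * (starRingEnd ℂ) (kern U (a', n) (y', m)))) *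
        (u k y.1 * (starRingEnd ℂ) (v k y'.1)) := by
    intro n m k
    rw [hfU]
    simp only
    rw [apply_boxTensor, apply_boxTensor, map_sum, Finset.sum_mul_sum, Finset.mul_sum]
    refine Finset.sum_congr rfl fun y _ => ?_
    rw [Finset.mul_sum]
    refine Finset.sum_congr rfl fun y' _ => ?_
    rw [map_mul]
    ring
  have hkstar : ∀ i j, (starRingEnd ℂ) (kern U i j) = kern (fullEvolution lam χ ε φ N (-t)) j i := by
    intro i j
    rw [← kern_star, hG.star_eq]
  -- for fixed `n`, summation over `k` and `m`
  have h1 : ∀ n, HasSum (fun p : Occ d N × κ => f (p, n)) (kern (U * tensorGibbs β (restrictBox N ρ) *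
      fullEvolution lam χ ε φ N (-t)) (a, n) (a', n)) := by
    intro n
    have hsn : Summable fun p : Occ d N × κ => f (p, n) :=
      hfs.comp_injective (i := fun p => (p, n)) fun p p' e => congrArg Prod.fst e
    have h2 := hsn.hasSum.prod_fiberwise (g := fun m => ∑ y : Site d N, ∑ y' : Site d N,
      (gibbsWeight β m * (kern U (a, n) (y, m) * (starRingEnd ℂ) (kern U (a', n) (y', m)))) *
        kern ρ y.1 y'.1) fun m => by
      simp only [hfk]
      exact hasSum_sum fun y _ => hasSum_sum fun y' _ => (h.hasSum y.1 y'.1).mul_left _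
    have h3 := hasSum_kern_tensorGibbs hβ hN U (fullEvolution lam χ ε φ N (-t)) (restrictBox N ρ)
      (a, n) (a', n)
    rw [← h2.unique (h3.congr_fun fun m => ?_)]
    · exact hsn.hasSum
    · refine Finset.sum_congr rfl fun y _ => Finset.sum_congr rfl fun y' _ => ?_
      rw [hkstar, restrictBox]
      ring
  have h4 := ((Equiv.prodComm (Occ d N) (Occ d N × κ)).hasSum_iff.2 hft).prod_fiberwise h1
  -- for fixed `m` and `k`, summation over `n`
  have h5 : ∀ p : Occ d N × κ, HasSum (fun n => f (p, n)) (∑ y : Site d N, ∑ y' : Site d N,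
      (gibbsWeight β p.1 * kern (fullEvolution lam χ ε φ N (-t) * latHop x' x * U)
        (y', p.1) (y, p.1)) * (u p.2 y.1 * (starRingEnd ℂ) (v p.2 y'.1))) := by
    intro p
    simp only [hfk]
    refine hasSum_sum fun y _ => hasSum_sum fun y' _ => HasSum.mul_right _ (HasSum.mul_left _ ?_)
    have h6 := hasSum_kern_mul (fullEvolution lam χ ε φ N (-t)) (latHop x' x * U) (y', p.1) (y, p.1)
    rw [← mul_assoc] at h6
    have hinj : Function.Injective fun n : Occ d N => ((a', n) : TotalIdx d N) :=
      fun n n' e => congrArg Prod.snd e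
    have hk : ∀ i : TotalIdx d N, kern (latHop x' x * U) i (y, p.1) =
        if i.1.1 = x' ∧ x ∈ box d N then kern U (a, i.2) (y, p.1) else 0 := by
      intro i
      have : kern (latHop x' x * U) i (y, p.1) = latHop x' x (U (ket (y, p.1))) i := rfl
      rw [this, latHop_apply]
      by_cases hi : i.1.1 = x' ∧ x ∈ box d N
      · rw [dif_pos hi, if_pos hi]; rfl
      · rw [dif_neg hi, if_neg hi]
    rw [← hinj.hasSum_iff] at h6
    · refine h6.congr_fun fun n => ?_
      rw [Function.comp_apply, hk, if_pos ⟨rfl, hx.1⟩, hkstar]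
      exact mul_comm _ _
    · rintro ⟨z, n⟩ hz
      rw [hk, if_neg, mul_zero]
      rintro ⟨e, -⟩
      exact hz ⟨n, Prod.ext (Subtype.ext e.symm) rfl⟩
  have h6 := hft.prod_fiberwise h5
  have h7 := h6.prod_fiberwise (g := fun m => ∑ y : Site d N, ∑ y' : Site d N,
      (gibbsWeight β m * kern (fullEvolution lam χ ε φ N (-t) * latHop x' x * U)
        (y', m) (y, m)) * kern ρ y.1 y'.1) fun m =>
    hasSum_sum fun y _ => hasSum_sum fun y' _ => (h.hasSum y.1 y'.1).mul_left _
  have h8 : HasSum (fun m : Occ d N => ∑ y : Site d N, ∑ y' : Site d N,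
      (gibbsWeight β m * kern (fullEvolution lam χ ε φ N (-t) * latHop x' x * U)
        (y', m) (y, m)) * kern ρ y.1 y'.1) (∑ y : Site d N, ∑ y' : Site d N,
      kern ρ y.1 y'.1 * heisWord β lam χ ε φ N t [] x' x y'.1 y.1) := by
    refine hasSum_sum fun y _ => hasSum_sum fun y' _ => ?_
    rw [mul_comm, heisWord, dif_pos ⟨y'.2, y.2⟩]
    exact (hasSum_thermalElem hβ hN _ y' y).mul_right _
  rw [h4.tsum_eq]
  exact ⟨hft, h7.unique h8⟩

/-- The reduced dynamics in Kraus form: it maps a sum of rank-one operators to a sum of rank-one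
operators, with the same bound on the nuclear norm. -/
theorem IsNuclearSum.finDyn {β : ℝ} (hβ : 0 < β) (hN : 0 < N)
    (hφ : Summable fun k : ZLat d => ‖finForm φ N k‖ ^ 2) (t : ℝ) {κ : Type} {ρ : Op (ZLat d)}
    {u v : κ → Hl2 (ZLat d)} {c : ℝ} (h : IsNuclearSum ρ u v c) :
    IsNuclearSum (finDyn β lam χ ε φ t N ρ)
      (fun q : (Occ d N × κ) × Occ d N => krausOp β (fullEvolution lam χ ε φ N t) q.2 q.1.1 (u q.1.2))
      (fun q => krausOp β (fullEvolution lam χ ε φ N t) q.2 q.1.1 (v q.1.2)) c := by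
  obtain ⟨h1, h2⟩ := summable_kraus_family hβ hN
    ((fullEvolution_isUnitaryGroup lam χ ε hφ).norm_apply t) h
  exact ⟨h1, h2, fun x x' => (h.finDyn_and_hasSum lam χ ε hβ hN hφ t x x').1⟩

theorem NuclearLE.finDyn {β : ℝ} (hβ : 0 < β) (hN : 0 < N)
    (hφ : Summable fun k : ZLat d => ‖finForm φ N k‖ ^ 2) (t : ℝ) {ρ : Op (ZLat d)} {c : ℝ}
    (h : NuclearLE ρ c) : NuclearLE (finDyn β lam χ ε φ t N ρ) c := by
  obtain ⟨κ, u, v, hh⟩ := h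
  exact ⟨_, _, _, hh.finDyn lam χ ε hβ hN hφ t⟩

theorem isPositive_finDyn {β : ℝ} (hβ : 0 < β) (hN : 0 < N)
    (hφ : Summable fun k : ZLat d => ‖finForm φ N k‖ ^ 2) (t : ℝ) {ρ : Op (ZLat d)}
    (h : IsTraceClass ρ) (hp : ρ.IsPositive) : (finDyn β lam χ ε φ t N ρ).IsPositive := by
  obtain ⟨u, hu⟩ := h.exists_isNuclearSum_of_isPositive hp
  exact isPositive_of_hasSum (hu.finDyn lam χ ε hβ hN hφ t)

theorem IsTraceClass.kern_finDyn {β : ℝ} (hβ : 0 < β) (hN : 0 < N)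
    (hφ : Summable fun k : ZLat d => ‖finForm φ N k‖ ^ 2) (t : ℝ) {ρ : Op (ZLat d)}
    (h : IsTraceClass ρ) (x x' : ZLat d) :
    kern (finDyn β lam χ ε φ t N ρ) x x' = ∑ y : Site d N, ∑ y' : Site d N,
      kern ρ y.1 y'.1 * heisWord β lam χ ε φ N t [] x' x y'.1 y.1 := by
  obtain ⟨u, v, hu⟩ := h.exists_isNuclearSum
  exact (hu.finDyn_and_hasSum lam χ ε hβ hN hφ t x x').2

theorem heisWord_nil_of_notMem (β t : ℝ) {y' y : ZLat d} (h : ¬ (y' ∈ box d N ∧ y ∈ box d N))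
    (b a : ZLat d) : heisWord β lam χ ε φ N t [] b a y' y = 0 := dif_neg h

theorem IsTraceClass.hasSum_kern_finDyn {β : ℝ} (hβ : 0 < β) (hN : 0 < N)
    (hφ : Summable fun k : ZLat d => ‖finForm φ N k‖ ^ 2) (t : ℝ) {ρ : Op (ZLat d)}
    (h : IsTraceClass ρ) (x x' : ZLat d) :
    HasSum (fun p : ZLat d × ZLat d => kern ρ p.1 p.2 * heisWord β lam χ ε φ N t [] x' x p.2 p.1)
      (kern (_root_.finDyn β lam χ ε φ t N ρ) x x') := by
  rw [h.kern_finDyn lam χ ε hβ hN hφ t x x']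
  have h1 : ∑ y : Site d N, ∑ y' : Site d N,
      kern ρ y.1 y'.1 * heisWord β lam χ ε φ N t [] x' x y'.1 y.1 =
      ∑ p ∈ box d N ×ˢ box d N, kern ρ p.1 p.2 * heisWord β lam χ ε φ N t [] x' x p.2 p.1 := by
    rw [Finset.sum_product, ← Finset.sum_coe_sort (box d N)]
    refine Finset.sum_congr rfl fun y _ => ?_
    rw [← Finset.sum_coe_sort (box d N)]
  rw [h1]
  refine hasSum_sum_of_ne_finset_zero fun p hp => ?_
  rw [heisWord_nil_of_notMem lam χ ε β t fun h => hp (Finset.mem_product.2 ⟨h.2, h.1⟩), mul_zero]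

/-- The reduced dynamics preserves the trace. -/
theorem opTrace_finDyn {β : ℝ} (hβ : 0 < β) (hN : 0 < N)
    (hφ : Summable fun k : ZLat d => ‖finForm φ N k‖ ^ 2) (t : ℝ) {ρ : Op (ZLat d)}
    (h : IsTraceClass ρ) : opTrace (finDyn β lam χ ε φ t N ρ) = ∑ y ∈ box d N, kern ρ y y := by
  classical
  have hG := fullEvolution_isUnitaryGroup lam χ ε hφ
  have h0 : ∀ x ∉ box d N, kern (finDyn β lam χ ε φ t N ρ) x x = 0 := fun x hx => by
    rw [_root_.kern_finDyn, dif_neg fun e => hx e.1]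
  have h1 : ∀ y' y : Site d N, ∑ x : Site d N, heisWord β lam χ ε φ N t [] x.1 x.1 y'.1 y.1 =
      if y' = y then 1 else 0 := by
    intro y' y
    have h2 := thermalElem_sum hβ hN (Finset.univ : Finset (Site d N)) (fun _ => 1)
      (fun x => fullEvolution lam χ ε φ N (-t) * hopOp x x * fullEvolution lam χ ε φ N t) y' y
    simp only [one_mul, one_smul] at h2
    rw [← Finset.sum_mul, ← Finset.mul_sum, sum_hopOp_self, mul_one, hG.neg_mul_self] at h2
    have h3 : thermalElem β (1 : Op (TotalIdx d N)) y' y = if y' = y then 1 else 0 := by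
      rw [thermalElem]
      have h4 : ∀ n : Occ d N, kern (1 : Op (TotalIdx d N)) (y', n) (y, n) =
          if y' = y then 1 else 0 := by
        intro n
        have : kern (1 : Op (TotalIdx d N)) (y', n) (y, n) = (ket (y, n) : Hl2 _) (y', n) := rfl
        rw [this, ket_apply]
        simp
      simp only [h4]
      rw [tsum_mul_right, ← Complex.ofReal_tsum, (hasSum_gibbsWeight hβ hN).tsum_eq]
      simp
    rw [← h3, h2]
    refine Finset.sum_congr rfl fun x _ => ?_
    rw [heisWord, dif_pos ⟨y'.2, y.2⟩, wordOp, latHop_coe]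
  rw [opTrace, tsum_eq_sum h0, ← Finset.sum_coe_sort (box d N)]
  simp only [h.kern_finDyn lam χ ε hβ hN hφ t]
  rw [Finset.sum_comm]
  rw [← Finset.sum_coe_sort (box d N) fun y => kern ρ y y]
  refine Finset.sum_congr rfl fun y _ => ?_
  rw [Finset.sum_comm]
  simp only [← Finset.mul_sum, h1]
  simp

end ReducedDynamics

/-! ### The thermodynamic limit -/

section Limit

variable {d : ℕ} {φ : EuclideanSpace ℝ (Fin d) → ℂ} (lam : ℝ) (χ : Fin d → ℝ)
  (ε : (Fin d → ℝ) → ℝ)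

theorem summable_exp_latNorm_sub {ν : ℝ} (hν : 0 < ν) (x : ZLat d) :
    Summable fun y : ZLat d => Real.exp (-ν * latNorm (x - y)) := by
  have h : HasSum ((fun y : ZLat d => Real.exp (-ν * latNorm y)) ∘ Equiv.subLeft x) _ :=
    (Equiv.hasSum_iff _).2 (summable_exp_latNorm d hν).hasSum
  exact h.summable

theorem tsum_exp_latNorm_sub {ν : ℝ} (hν : 0 < ν) (y : ZLat d) :
    HasSum (fun x : ZLat d => Real.exp (-ν * latNorm (x - y)))
      (∑' x : ZLat d, Real.exp (-ν * latNorm x)) := by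
  have h : HasSum ((fun y : ZLat d => Real.exp (-ν * latNorm y)) ∘ Equiv.subRight y) _ :=
    (Equiv.hasSum_iff _).2 (summable_exp_latNorm d hν).hasSum
  exact h

theorem summable_norm_hopping_mul_exp {C μ : ℝ} (hμ : 0 < μ)
    (h : ∀ x : ZLat d, ‖hopping ε x‖ ≤ C * Real.exp (-μ * latNorm x)) :
    Summable fun x : ZLat d => ‖hopping ε x‖ * Real.exp (μ / 2 * latNorm x) := by
  refine Summable.of_nonneg_of_le (fun x => by positivity) (fun x => ?_)
    ((summable_exp_latNorm d (half_pos hμ)).mul_left C)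
  refine (mul_le_mul_of_nonneg_right (h x) (Real.exp_pos _).le).trans (le_of_eq ?_)
  rw [mul_assoc, ← Real.exp_add]
  congr 2
  ring

/-- Exponential bounds, convergence and translation invariance of the propagator. -/
theorem exists_propagator (hd : 1 ≤ d) {β : ℝ} (hβ : 0 < β) (hε : AnalyticDispersion ε)
    (hφ : ReservoirAssumption β φ) {t : ℝ} (ht : 0 ≤ t) :
    ∃ C ν : ℝ, 0 < ν ∧ (∀ N : ℕ, 0 < N → ∀ x y x' y', ‖heisWord β lam χ ε φ N t [] x' x y' y‖ ≤
        C * (Real.exp (-ν * latNorm (x - y)) * Real.exp (-ν * latNorm (x' - y')))) ∧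
      ∃ P : ZLat d → ZLat d → ZLat d → ZLat d → ℂ,
        (∀ x y x' y', Tendsto (fun N => heisWord β lam χ ε φ N t [] x' x y' y) atTop
          (𝓝 (P x y x' y'))) ∧
        ∀ e x y x' y', P (x + e) (y + e) (x' + e) (y' + e) = P x y x' y' := by
  obtain ⟨C, μ, hμ, hC⟩ := exists_norm_hopping_le hd hε
  have hK := summable_norm_hopping_mul_exp ε hμ hC
  refine ⟨_, μ / 2, half_pos hμ, fun N hN x y x' y' => norm_heisWord_nil_le lam χ ε hβ hN
    (hφ.finForm_l2 N hN) (half_pos hμ).le hK x' x y' y ht, ?_⟩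
  refine exists_tendsto_heisWord_nil lam χ ε hβ hφ ?_ ht
  refine Summable.of_nonneg_of_le (fun _ => norm_nonneg _) (fun x => ?_) hK
  exact le_mul_of_one_le_right (norm_nonneg _)
    (Real.one_le_exp (mul_nonneg (half_pos hμ).le (latNorm_nonneg x)))

theorem summable_exp_mul_exp {ν : ℝ} (hν : 0 < ν) (x x' : ZLat d) :
    Summable fun p : ZLat d × ZLat d =>
      Real.exp (-ν * latNorm (x - p.1)) * Real.exp (-ν * latNorm (x' - p.2)) :=
  (summable_exp_latNorm_sub hν x).mul_of_nonneg (summable_exp_latNorm_sub hν x')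
    (fun _ => (Real.exp_pos _).le) fun _ => (Real.exp_pos _).le

variable {β t C ν : ℝ}

theorem tendsto_kern_finDyn (hβ : 0 < β) (hφ : ReservoirAssumption β φ) (hν : 0 < ν)
    (hC : ∀ N : ℕ, 0 < N → ∀ x y x' y', ‖heisWord β lam χ ε φ N t [] x' x y' y‖ ≤
      C * (Real.exp (-ν * latNorm (x - y)) * Real.exp (-ν * latNorm (x' - y'))))
    {P : ZLat d → ZLat d → ZLat d → ZLat d → ℂ}
    (hP : ∀ x y x' y', Tendsto (fun N => heisWord β lam χ ε φ N t [] x' x y' y) atTop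
      (𝓝 (P x y x' y'))) {ρ : Op (ZLat d)} (h : IsTraceClass ρ) (x x' : ZLat d) :
    Tendsto (fun N => kern (finDyn β lam χ ε φ t N ρ) x x') atTop
      (𝓝 (∑' p : ZLat d × ZLat d, kern ρ p.1 p.2 * P x p.1 x' p.2)) := by
  have h1 := tendsto_tsum_of_dominated_convergence (𝓕 := (atTop : Filter ℕ))
    (f := fun N (p : ZLat d × ZLat d) => kern ρ p.1 p.2 * heisWord β lam χ ε φ N t [] x' x p.2 p.1)
    (g := fun p => kern ρ p.1 p.2 * P x p.1 x' p.2)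
    (((summable_exp_mul_exp hν x x').mul_left C).mul_left ‖ρ‖)
    (fun p => (hP x p.1 x' p.2).const_mul _)
    (by
      filter_upwards [eventually_gt_atTop 0] with N hN p
      rw [norm_mul]
      exact mul_le_mul (norm_kern_le _ _ _) (hC N hN _ _ _ _) (norm_nonneg _) (norm_nonneg _))
  refine h1.congr' ?_
  filter_upwards [eventually_gt_atTop 0] with N hN
  exact (h.hasSum_kern_finDyn lam χ ε hβ hN (hφ.finForm_l2 N hN) t x x').tsum_eq

theorem finDyn_add_smul {N : ℕ} (hβ : 0 < β) (hN : 0 < N)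
    (hφ : Summable fun k : ZLat d => ‖finForm φ N k‖ ^ 2) {ρ σ : Op (ZLat d)} (h : IsTraceClass ρ)
    (h' : IsTraceClass σ) (a b : ℂ) : finDyn β lam χ ε φ t N (a • ρ + b • σ) =
      a • finDyn β lam χ ε φ t N ρ + b • finDyn β lam χ ε φ t N σ := by
  have h2 : IsTraceClass (a • ρ + b • σ) := ((h.nuclearLE.smul a).add (h'.nuclearLE.smul b)).isTraceClass
  refine op_ext fun x x' => ?_
  rw [kern_add, kern_smul, kern_smul, h.kern_finDyn lam χ ε hβ hN hφ,
    h'.kern_finDyn lam χ ε hβ hN hφ, h2.kern_finDyn lam χ ε hβ hN hφ]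
  simp only [Finset.mul_sum, ← Finset.sum_add_distrib, kern_add, kern_smul]
  exact Finset.sum_congr rfl fun y _ => Finset.sum_congr rfl fun y' _ => by ring

theorem summable_mul_kernel {ι : Type*} {a : ι × ι → ℝ} (ha0 : ∀ p, 0 ≤ a p) (ha : Summable a)
    {e : ι → ι → ℝ} (he0 : ∀ x y, 0 ≤ e x y) {S : ℝ} (he : ∀ y, HasSum (fun x => e x y) S) :
    Summable fun q : (ι × ι) × (ι × ι) => a q.2 * (e q.1.1 q.2.1 * e q.1.2 q.2.2) := by
  have h2 : ∀ p : ι × ι, HasSum (fun q : ι × ι => a p * (e q.1 p.1 * e q.2 p.2)) (a p * (S * S)) :=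
    fun p => ((he p.1).mul (he p.2) ((he p.1).summable.mul_of_nonneg (he p.2).summable
      (fun _ => he0 _ _) fun _ => he0 _ _)).mul_left _
  have h3 : Summable fun q : (ι × ι) × (ι × ι) => a q.1 * (e q.2.1 q.1.1 * e q.2.2 q.1.2) := by
    refine (summable_prod_of_nonneg fun q => mul_nonneg (ha0 _) (mul_nonneg (he0 _ _) (he0 _ _))).2
      ⟨fun p => (h2 p).summable, (ha.mul_right (S * S)).congr fun p => (h2 p).tsum_eq.symm⟩
  exact (Equiv.prodComm (ι × ι) (ι × ι)).summable_iff.2 h3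

theorem summable_norm_kern_mul_exp (hν : 0 < ν) {ρ : Op (ZLat d)}
    (hρ : Summable fun p : ZLat d × ZLat d => ‖kern ρ p.1 p.2‖) :
    Summable fun q : (ZLat d × ZLat d) × (ZLat d × ZLat d) => ‖kern ρ q.2.1 q.2.2‖ *
      (C * (Real.exp (-ν * latNorm (q.1.1 - q.2.1)) * Real.exp (-ν * latNorm (q.1.2 - q.2.2)))) := by
  refine ((summable_mul_kernel (fun p => norm_nonneg _) hρ
    (e := fun x y : ZLat d => Real.exp (-ν * latNorm (x - y))) (fun _ _ => (Real.exp_pos _).le)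
    (tsum_exp_latNorm_sub hν)).mul_left C).congr fun q => ?_
  ring

/-- The reduced dynamics of operators with summable kernel is a Cauchy sequence in nuclear norm. -/
theorem exists_nuclearLE_finDyn_sub_of_summable (hβ : 0 < β) (hφ : ReservoirAssumption β φ)
    (hν : 0 < ν)
    (hC : ∀ N : ℕ, 0 < N → ∀ x y x' y', ‖heisWord β lam χ ε φ N t [] x' x y' y‖ ≤
      C * (Real.exp (-ν * latNorm (x - y)) * Real.exp (-ν * latNorm (x' - y'))))
    {P : ZLat d → ZLat d → ZLat d → ZLat d → ℂ}
    (hP : ∀ x y x' y', Tendsto (fun N => heisWord β lam χ ε φ N t [] x' x y' y) atTop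
      (𝓝 (P x y x' y'))) {ρ : Op (ZLat d)}
    (hρ : Summable fun p : ZLat d × ZLat d => ‖kern ρ p.1 p.2‖) {r : ℝ} (hr : 0 < r) :
    ∃ n, ∀ N ≥ n, ∀ M ≥ n, NuclearLE (finDyn β lam χ ε φ t N ρ - finDyn β lam χ ε φ t M ρ) r := by
  have h : IsTraceClass ρ := (nuclearLE_of_summable_kern hρ).isTraceClass
  -- a summable bound on the kernel of the reduced dynamics, uniform in the volume
  set D : ZLat d × ZLat d → ℝ := fun q => ∑' p : ZLat d × ZLat d, ‖kern ρ p.1 p.2‖ *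
    (C * (Real.exp (-ν * latNorm (q.1 - p.1)) * Real.exp (-ν * latNorm (q.2 - p.2)))) with hD
  have hs := summable_norm_kern_mul_exp (C := C) hν hρ
  have hDs : Summable D := hs.prod
  have hbound : ∀ N, 0 < N → ∀ q : ZLat d × ZLat d,
      ‖kern (finDyn β lam χ ε φ t N ρ) q.1 q.2‖ ≤ D q := by
    intro N hN q
    rw [← (h.hasSum_kern_finDyn lam χ ε hβ hN (hφ.finForm_l2 N hN) t q.1 q.2).tsum_eq]
    refine tsum_of_norm_bounded (hs.prod_factor q).hasSum fun p => ?_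
    rw [norm_mul]
    exact mul_le_mul_of_nonneg_left (hC N hN _ _ _ _) (norm_nonneg _)
  have hbound2 : ∀ p : ℕ × ℕ, 0 < p.1 ∧ 0 < p.2 → ∀ q : ZLat d × ZLat d,
      ‖kern (finDyn β lam χ ε φ t p.1 ρ - finDyn β lam χ ε φ t p.2 ρ) q.1 q.2‖ ≤ 2 * D q := by
    intro p hp q
    have h1 := hbound p.1 hp.1 q
    have h2 := hbound p.2 hp.2 q
    rw [kern_sub]
    exact (norm_sub_le _ _).trans (by linarith)
  have h1 := tendsto_tsum_of_dominated_convergence (𝓕 := (atTop ×ˢ atTop : Filter (ℕ × ℕ)))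
    (f := fun (p : ℕ × ℕ) (q : ZLat d × ZLat d) =>
      ‖kern (finDyn β lam χ ε φ t p.1 ρ - finDyn β lam χ ε φ t p.2 ρ) q.1 q.2‖)
    (g := fun _ => (0 : ℝ)) (hDs.mul_left 2)
    (fun q => by
      have h2 := tendsto_kern_finDyn lam χ ε hβ hφ hν hC hP h q.1 q.2
      have h3 := ((h2.comp (tendsto_fst (f := atTop) (g := (atTop : Filter ℕ)))).sub
        (h2.comp (tendsto_snd (f := (atTop : Filter ℕ)) (g := atTop)))).norm
      rw [sub_self, norm_zero] at h3
      exact h3)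
    (by
      filter_upwards [eventually_pos_prod] with p hp q
      rw [norm_norm]
      exact hbound2 p hp q)
  rw [tsum_zero] at h1
  have h2 := (h1.eventually (gt_mem_nhds hr)).and eventually_pos_prod
  rw [prod_atTop_atTop_eq] at h2
  obtain ⟨⟨n, m⟩, hnm⟩ := eventually_atTop.1 h2
  refine ⟨max n m, fun k hk l hl => ?_⟩
  obtain ⟨h3, h4⟩ := hnm (k, l) ⟨(le_max_left _ _).trans hk, (le_max_right _ _).trans hl⟩
  refine (nuclearLE_of_summable_kern ?_).mono h3.le
  exact Summable.of_nonneg_of_le (fun _ => norm_nonneg _) (hbound2 (k, l) h4) (hDs.mul_left 2)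

open Classical in
theorem norm_indicator_le {ι : Type*} (F : Finset ι) (i : ι) :
    ‖(if i ∈ F then (1 : ℂ) else 0)‖ ≤ 1 := by
  split_ifs <;> simp

open Classical in
/-- The projection onto the span of finitely many basis vectors. -/
def finProj {ι : Type*} (F : Finset ι) : Op ι := diagOp _ (norm_indicator_le F)

theorem norm_finProj_le {ι : Type*} (F : Finset ι) : ‖finProj F‖ ≤ 1 :=
  norm_diagOp_le _ zero_le_one _

theorem norm_finProj_apply_le {ι : Type*} (F : Finset ι) (u : Hl2 ι) : ‖finProj F u‖ ≤ ‖u‖ :=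
  ((finProj F).le_opNorm u).trans (mul_le_of_le_one_left (norm_nonneg _) (norm_finProj_le F))

theorem tendsto_finProj {ι : Type*} (u : Hl2 ι) :
    Tendsto (fun F : Finset ι => ‖u - finProj F u‖) atTop (𝓝 0) := by
  classical
  have h : ∀ F : Finset ι, finProj F u = ∑ i ∈ F, u i • ket i := by
    intro F
    ext i
    rw [finProj, diagOp_apply, ← inner_ket i (∑ i ∈ F, u i • ket i), inner_sum]
    simp only [inner_smul_right, inner_ket, ket_apply, mul_ite, mul_one, mul_zero]
    rw [Finset.sum_ite_eq]
    split_ifs <;> simp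
  have h1 := (tendsto_const_nhds (x := u)).sub (hasSum_ket u)
  rw [sub_self] at h1
  simp only [h]
  exact tendsto_zero_iff_norm_tendsto_zero.1 h1

/-- Trace class operators are approximated in nuclear norm by operators with finitely many matrix
elements. -/
theorem IsTraceClass.exists_finite_approx {ι : Type} {ρ : Op ι} (h : IsTraceClass ρ) {r : ℝ}
    (hr : 0 < r) : ∃ σ : Op ι, (Summable fun p : ι × ι => ‖kern σ p.1 p.2‖) ∧
      NuclearLE (ρ - σ) r := by
  classical
  obtain ⟨u, v, hu⟩ := h.exists_isNuclearSum
  set g : Finset ι → ι → ℝ := fun F k => ‖u k - finProj F (u k)‖ * ‖v k‖ +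
    ‖finProj F (u k)‖ * ‖v k - finProj F (v k)‖ with hg
  have h2 : ∀ (F : Finset ι) (w : Hl2 ι), ‖w - finProj F w‖ ≤ 2 * ‖w‖ := fun F w =>
    (norm_sub_le _ _).trans (by linarith [norm_finProj_apply_le F w])
  have hgb : ∀ F k, ‖g F k‖ ≤ 4 * (‖u k‖ * ‖v k‖) := by
    intro F k
    rw [Real.norm_of_nonneg (by positivity)]
    have h3 := mul_le_mul_of_nonneg_right (h2 F (u k)) (norm_nonneg (v k))
    have h4 := mul_le_mul (norm_finProj_apply_le F (u k)) (h2 F (v k)) (norm_nonneg _)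
      (norm_nonneg _)
    simp only [hg]
    linarith
  have hg0 : Tendsto (fun F => ∑' k, g F k) atTop (𝓝 0) := by
    have h3 := tendsto_tsum_of_dominated_convergence (𝓕 := (atTop : Filter (Finset ι)))
      (f := g) (g := fun _ => (0 : ℝ)) (hu.summable.mul_left 4) (fun k => by
        have h4 := ((tendsto_finProj (u k)).mul_const ‖v k‖)
        have h5 := squeeze_zero (fun F => by positivity)
          (fun F => mul_le_mul_of_nonneg_right (norm_finProj_apply_le F (u k))
            (norm_nonneg (v k - finProj F (v k)))) (by
              simpa using (tendsto_finProj (v k)).const_mul ‖u k‖)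
        simpa using h4.add h5)
      (Eventually.of_forall fun F k => hgb F k)
    simpa using h3
  obtain ⟨F, hF⟩ := (hg0.eventually (gt_mem_nhds hr)).exists
  have hstar : star (finProj F : Op ι) = finProj F := by
    refine op_ext fun i j => ?_
    rw [kern_star]
    simp only [finProj, kern, diagOp_apply, ket_apply]
    by_cases hij : i = j
    · subst hij; split_ifs <;> simp
    · rw [if_neg hij, if_neg (Ne.symm hij)]; simp
  have hk : ∀ i j, kern (finProj F * ρ * finProj F) i j =
      (if i ∈ F then 1 else 0) * kern ρ i j * (if j ∈ F then 1 else 0) := by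
    intro i j
    rw [mul_assoc, finProj, kern_diagOp_mul, kern_mul_diagOp]
    ring
  refine ⟨finProj F * ρ * finProj F, ?_, ?_⟩
  · refine summable_of_ne_finset_zero (s := F ×ˢ F) fun p hp => ?_
    rw [hk, norm_eq_zero]
    by_cases h1 : p.1 ∈ F
    · rw [if_neg fun h3 : p.2 ∈ F => hp (Finset.mem_product.2 ⟨h1, h3⟩), mul_zero]
    · rw [if_neg h1, zero_mul, zero_mul]
  · have hgs : Summable (g F) := Summable.of_norm_bounded (hu.summable.mul_left 4) (hgb F)
    have hs1 : Summable fun k => ‖u k - finProj F (u k)‖ * ‖v k‖ :=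
      Summable.of_nonneg_of_le (fun k => by positivity)
        (fun k => le_add_of_nonneg_right (by positivity)) hgs
    have hs2 : Summable fun k => ‖finProj F (u k)‖ * ‖v k - finProj F (v k)‖ :=
      Summable.of_nonneg_of_le (fun k => by positivity)
        (fun k => le_add_of_nonneg_left (by positivity)) hgs
    have n1 : NuclearLE (ρ - finProj F * ρ) (∑' k, ‖u k - finProj F (u k)‖ * ‖v k‖) := by
      refine ⟨ι, fun k => u k - finProj F (u k), v, hs1, le_rfl, fun i j => ?_⟩
      refine ((hu.hasSum i j).sub ((hu.mul_left (finProj F)).hasSum i j)).congr_fun fun k => ?_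
      exact sub_mul _ _ _
    have n2 : NuclearLE (finProj F * ρ - finProj F * ρ * finProj F)
        (∑' k, ‖finProj F (u k)‖ * ‖v k - finProj F (v k)‖) := by
      refine ⟨ι, fun k => finProj F (u k), fun k => v k - finProj F (v k), hs2, le_rfl,
        fun i j => ?_⟩
      have h3 := (hu.mul_left (finProj F)).hasSum i j
      have h4 := h3.mul_right (1 - if j ∈ F then (1 : ℂ) else 0)
      have h5 : kern (finProj F * ρ - finProj F * ρ * finProj F) i j =
          kern (finProj F * ρ) i j * (1 - if j ∈ F then (1 : ℂ) else 0) := by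
        rw [kern_sub, hk, finProj, kern_diagOp_mul]
        ring
      rw [h5]
      refine h4.congr_fun fun k => ?_
      have h6 : (starRingEnd ℂ) ((v k - finProj F (v k)) j) =
          (starRingEnd ℂ) (v k j) * (1 - if j ∈ F then (1 : ℂ) else 0) := by
        change (starRingEnd ℂ) (v k j - finProj F (v k) j) = _
        rw [finProj, diagOp_apply, map_sub, map_mul]
        split_ifs <;> simp
      rw [h6]
      ring
    have n3 := n1.add n2
    rw [sub_add_sub_cancel, ← hs1.tsum_add hs2] at n3
    exact n3.mono hF.le

end Limit

/-! ### Properties of the limiting dynamics -/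

section LimitProperties

variable {d : ℕ} {φ : EuclideanSpace ℝ (Fin d) → ℂ} (lam : ℝ) (χ : Fin d → ℝ)
  (ε : (Fin d → ℝ) → ℝ)

/-- The reduced dynamics in infinite volume, the limit in operator norm of the finite-volume
ones. It exists for trace class `ρ`; other operators get a junk value. -/
def infDyn (β lam : ℝ) (χ : Fin d → ℝ) (ε : (Fin d → ℝ) → ℝ)
    (φ : EuclideanSpace ℝ (Fin d) → ℂ) (t : ℝ) (ρ : Op (ZLat d)) : Op (ZLat d) :=
  limUnder atTop fun N => finDyn β lam χ ε φ t N ρ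

theorem tendsto_box : Tendsto (fun N => box d N) atTop atTop := by
  refine tendsto_atTop_finset_of_monotone (fun N M h x hx => ?_) fun x =>
    (eventually_mem_box x).exists
  rw [box, Fintype.mem_piFinset] at hx ⊢
  intro i
  have h1 := Finset.mem_Icc.1 (hx i)
  have h2 : (N : ℤ) ≤ M := by exact_mod_cast h
  exact Finset.mem_Icc.2 ⟨by linarith, by linarith⟩

theorem IsTraceClass.tendsto_sum_box {ρ : Op (ZLat d)} (h : IsTraceClass ρ) :
    Tendsto (fun N => ∑ y ∈ box d N, kern ρ y y) atTop (𝓝 (opTrace ρ)) :=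
  h.nuclearLE.hasSum_opTrace.1.comp tendsto_box

variable {β t : ℝ} {ρ : Op (ZLat d)}

theorem exists_nuclearLE_finDyn_sub (hd : 1 ≤ d) (hβ : 0 < β) (hε : AnalyticDispersion ε)
    (hφ : ReservoirAssumption β φ) (ht : 0 ≤ t) (h : IsTraceClass ρ) {r : ℝ} (hr : 0 < r) :
    ∃ n, ∀ N ≥ n, ∀ M ≥ n, NuclearLE (finDyn β lam χ ε φ t N ρ - finDyn β lam χ ε φ t M ρ) r := by
  obtain ⟨C, ν, hν, hC, P, hP, -⟩ := exists_propagator lam χ ε hd hβ hε hφ ht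
  obtain ⟨σ, hσ, hρσ⟩ := h.exists_finite_approx (show 0 < r / 3 by positivity)
  obtain ⟨n, hn⟩ := exists_nuclearLE_finDyn_sub_of_summable lam χ ε hβ hφ hν hC hP hσ
    (show 0 < r / 3 by positivity)
  have hσt : IsTraceClass σ := (nuclearLE_of_summable_kern hσ).isTraceClass
  have hsub : ∀ N, 0 < N → finDyn β lam χ ε φ t N (ρ - σ) =
      finDyn β lam χ ε φ t N ρ - finDyn β lam χ ε φ t N σ := by
    intro N hN
    have h1 := finDyn_add_smul lam χ ε (t := t) hβ hN (hφ.finForm_l2 N hN) h hσt 1 (-1)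
    simpa [sub_eq_add_neg] using h1
  refine ⟨max n 1, fun N hN M hM => ?_⟩
  have hN0 : 0 < N := (le_max_right n 1).trans hN
  have hM0 : 0 < M := (le_max_right n 1).trans hM
  have h1 := hρσ.finDyn lam χ ε hβ hN0 (hφ.finForm_l2 N hN0) t
  have h2 := hρσ.finDyn lam χ ε hβ hM0 (hφ.finForm_l2 M hM0) t
  have h3 := (h1.add (hn N ((le_max_left _ _).trans hN) M ((le_max_left _ _).trans hM))).sub h2
  rw [hsub N hN0, hsub M hM0] at h3
  have h4 : finDyn β lam χ ε φ t N ρ - finDyn β lam χ ε φ t M ρ =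
      finDyn β lam χ ε φ t N ρ - finDyn β lam χ ε φ t N σ +
        (finDyn β lam χ ε φ t N σ - finDyn β lam χ ε φ t M σ) -
        (finDyn β lam χ ε φ t M ρ - finDyn β lam χ ε φ t M σ) := by abel
  rw [h4]
  exact h3.mono (by linarith)

theorem tendsto_finDyn (hd : 1 ≤ d) (hβ : 0 < β) (hε : AnalyticDispersion ε)
    (hφ : ReservoirAssumption β φ) (ht : 0 ≤ t) (h : IsTraceClass ρ)
    : Tendsto (fun N => finDyn β lam χ ε φ t N ρ) atTop
    (𝓝 (infDyn β lam χ ε φ t ρ)) := by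
  refine CauchySeq.tendsto_limUnder (Metric.cauchySeq_iff.2 fun r hr => ?_)
  obtain ⟨n, hn⟩ := exists_nuclearLE_finDyn_sub lam χ ε hd hβ hε hφ ht h (half_pos hr)
  refine ⟨n, fun N hN M hM => ?_⟩
  rw [dist_eq_norm]
  exact (norm_le_of_nuclearLE (hn N hN M hM)).trans_lt (half_lt_self hr)

theorem tendsto_traceNorm_finDyn (hd : 1 ≤ d) (hβ : 0 < β) (hε : AnalyticDispersion ε)
    (hφ : ReservoirAssumption β φ) (ht : 0 ≤ t) (h : IsTraceClass ρ)
    : Tendsto (fun N => traceNorm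
    (finDyn β lam χ ε φ t N ρ - infDyn β lam χ ε φ t ρ)) atTop (𝓝 0) := by
  refine ENNReal.tendsto_nhds_zero.2 fun r hr => ?_
  by_cases hr' : r = ∞
  · rw [hr']; exact Eventually.of_forall fun _ => le_top
  obtain ⟨n, hn⟩ := exists_nuclearLE_finDyn_sub lam χ ε hd hβ hε hφ ht h
    (ENNReal.toReal_pos hr.ne' hr')
  filter_upwards [eventually_ge_atTop n] with N hN
  rw [← ENNReal.ofReal_toReal hr']
  refine traceNorm_le_of_tendsto
    ((tendsto_finDyn lam χ ε hd hβ hε hφ ht h).const_sub (finDyn β lam χ ε φ t N ρ)) ?_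
  filter_upwards [eventually_ge_atTop n] with M hM
  exact hn N hN M hM

theorem isTraceClass_infDyn (hd : 1 ≤ d) (hβ : 0 < β) (hε : AnalyticDispersion ε)
    (hφ : ReservoirAssumption β φ) (ht : 0 ≤ t) (h : IsTraceClass ρ)
    : IsTraceClass (infDyn β lam χ ε φ t ρ) := by
  refine (traceNorm_le_of_tendsto (tendsto_finDyn lam χ ε hd hβ hε hφ ht h) ?_).trans_lt
    (ENNReal.ofReal_lt_top (r := (traceNorm ρ).toReal))
  filter_upwards [eventually_gt_atTop 0] with N hN
  exact h.nuclearLE.finDyn lam χ ε hβ hN (hφ.finForm_l2 N hN) t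

theorem infDyn_add_smul (hd : 1 ≤ d) (hβ : 0 < β) (hε : AnalyticDispersion ε)
    (hφ : ReservoirAssumption β φ) (ht : 0 ≤ t) (h : IsTraceClass ρ)
    {σ : Op (ZLat d)} (h' : IsTraceClass σ) (a b : ℂ) :
    infDyn β lam χ ε φ t (a • ρ + b • σ) =
      a • infDyn β lam χ ε φ t ρ + b • infDyn β lam χ ε φ t σ := by
  have h2 : IsTraceClass (a • ρ + b • σ) := ((h.nuclearLE.smul a).add (h'.nuclearLE.smul b)).isTraceClass
  refine tendsto_nhds_unique (tendsto_finDyn lam χ ε hd hβ hε hφ ht h2) ?_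
  refine (((tendsto_finDyn lam χ ε hd hβ hε hφ ht h).const_smul a).add
    ((tendsto_finDyn lam χ ε hd hβ hε hφ ht h').const_smul b)).congr' ?_
  filter_upwards [eventually_gt_atTop 0] with N hN
  exact (finDyn_add_smul lam χ ε hβ hN (hφ.finForm_l2 N hN) h h' a b).symm

theorem opTrace_infDyn (hd : 1 ≤ d) (hβ : 0 < β) (hε : AnalyticDispersion ε)
    (hφ : ReservoirAssumption β φ) (ht : 0 ≤ t) (h : IsTraceClass ρ)
    : opTrace (infDyn β lam χ ε φ t ρ) = opTrace ρ := by
  have hZ := isTraceClass_infDyn lam χ ε hd hβ hε hφ ht h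
  refine tendsto_nhds_unique ?_ h.tendsto_sum_box
  rw [tendsto_iff_norm_sub_tendsto_zero]
  have h1 := (ENNReal.tendsto_toReal ENNReal.zero_ne_top).comp
    (tendsto_traceNorm_finDyn lam χ ε hd hβ hε hφ ht h)
  rw [ENNReal.toReal_zero] at h1
  refine squeeze_zero' (Eventually.of_forall fun _ => norm_nonneg _) ?_ h1
  filter_upwards [eventually_gt_atTop 0] with N hN
  have hN' := hφ.finForm_l2 N hN
  have h2 := h.nuclearLE.finDyn lam χ ε hβ hN hN' t
  have h3 := (h2.sub hZ.nuclearLE).isTraceClass.nuclearLE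
  have h4 : opTrace (finDyn β lam χ ε φ t N ρ - infDyn β lam χ ε φ t ρ) =
      opTrace (finDyn β lam χ ε φ t N ρ) - opTrace (infDyn β lam χ ε φ t ρ) :=
    h3.hasSum_opTrace.1.unique ((h2.hasSum_opTrace.1.sub hZ.nuclearLE.hasSum_opTrace.1))
  rw [← opTrace_finDyn lam χ ε hβ hN hN' t h, ← h4]
  exact h3.hasSum_opTrace.2

theorem isPositive_infDyn (hd : 1 ≤ d) (hβ : 0 < β) (hε : AnalyticDispersion ε)
    (hφ : ReservoirAssumption β φ) (ht : 0 ≤ t) (h : IsTraceClass ρ)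
    (hp : ρ.IsPositive) : (infDyn β lam χ ε φ t ρ).IsPositive := by
  rw [← ContinuousLinearMap.nonneg_iff_isPositive]
  refine ge_of_tendsto (tendsto_finDyn lam χ ε hd hβ hε hφ ht h) ?_
  filter_upwards [eventually_gt_atTop 0] with N hN
  rw [ContinuousLinearMap.nonneg_iff_isPositive]
  exact isPositive_finDyn lam χ ε hβ hN (hφ.finForm_l2 N hN) t h hp

theorem expLocalized_infDyn (hd : 1 ≤ d) (hβ : 0 < β) (hε : AnalyticDispersion ε)
    (hφ : ReservoirAssumption β φ) (ht : 0 ≤ t) (h : IsTraceClass ρ)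
    (hρ : ExpLocalized ρ) : ExpLocalized (infDyn β lam χ ε φ t ρ) := by
  obtain ⟨C, ν, hν, hC, -⟩ := exists_propagator lam χ ε hd hβ hε hφ ht
  obtain ⟨K, μ, hμ, hK⟩ := hρ
  set η := min ν μ / 2 with hη
  have hη0 : 0 < η := half_pos (lt_min hν hμ)
  have hC0 : 0 ≤ C := by
    have h1 := (norm_nonneg _).trans (hC 1 one_pos 0 0 0 0)
    exact nonneg_of_mul_nonneg_left h1 (by positivity)
  have hK0 : 0 ≤ K := nonneg_of_mul_nonneg_left ((norm_nonneg _).trans (hK 0 0)) (Real.exp_pos _)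
  have key : ∀ x y : ZLat d, Real.exp (-μ * latNorm y) * Real.exp (-ν * latNorm (x - y)) ≤
      Real.exp (-η * latNorm x) * Real.exp (-η * latNorm y) := by
    intro x y
    rw [← Real.exp_add, ← Real.exp_add, Real.exp_le_exp]
    have h1 := latNorm_le_add_sub x y
    have h2 := latNorm_nonneg y
    have h3 := latNorm_nonneg (x - y)
    have h4 : 2 * η ≤ ν := by rw [hη]; linarith [min_le_left ν μ]
    have h5 : 2 * η ≤ μ := by rw [hη]; linarith [min_le_right ν μ]
    nlinarith [mul_le_mul_of_nonneg_right h4 h3, mul_le_mul_of_nonneg_right h5 h2,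
      mul_le_mul_of_nonneg_left h1 hη0.le]
  have hS := (summable_exp_latNorm d hη0).hasSum
  set S := ∑' x : ZLat d, Real.exp (-η * latNorm x)
  have hSS := (hS.mul hS ((summable_exp_latNorm d hη0).mul_of_nonneg (summable_exp_latNorm d hη0)
    (fun _ => (Real.exp_pos _).le) fun _ => (Real.exp_pos _).le))
  refine ⟨K * C * (S * S), η, hη0, fun x x' => ?_⟩
  refine le_of_tendsto (tendsto_kern (tendsto_finDyn lam χ ε hd hβ hε hφ ht h) x x').norm ?_
  filter_upwards [eventually_gt_atTop 0] with N hN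
  rw [← (h.hasSum_kern_finDyn lam χ ε hβ hN (hφ.finForm_l2 N hN) t x x').tsum_eq]
  have h2 := hSS.mul_left (K * C * (Real.exp (-η * latNorm x) * Real.exp (-η * latNorm x')))
  have h3 : K * C * (S * S) * Real.exp (-η * (latNorm x + latNorm x')) =
      K * C * (Real.exp (-η * latNorm x) * Real.exp (-η * latNorm x')) * (S * S) := by
    rw [mul_add, Real.exp_add]; ring
  rw [h3]
  refine tsum_of_norm_bounded h2 fun p => ?_
  rw [norm_mul]
  refine (mul_le_mul (hK p.1 p.2) (hC N hN x p.1 x' p.2) (norm_nonneg _) (by positivity)).trans ?_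
  rw [mul_add, Real.exp_add]
  calc _ = K * C * ((Real.exp (-μ * latNorm p.1) * Real.exp (-ν * latNorm (x - p.1))) *
        (Real.exp (-μ * latNorm p.2) * Real.exp (-ν * latNorm (x' - p.2)))) := by ring
    _ ≤ K * C * ((Real.exp (-η * latNorm x) * Real.exp (-η * latNorm p.1)) *
        (Real.exp (-η * latNorm x') * Real.exp (-η * latNorm p.2))) := by
      refine mul_le_mul_of_nonneg_left (mul_le_mul (key _ _) (key _ _) (by positivity)
        (by positivity)) (by positivity)
    _ = _ := by ring

theorem IsTraceClass.transl {ρ : Op (ZLat d)} (h : IsTraceClass ρ) (y : ZLat d) :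
    IsTraceClass (transl y ρ) := by
  obtain ⟨u, v, hu⟩ := h.exists_isNuclearSum
  have hn : ∀ w : Hl2 (ZLat d), ‖shift (-y) w‖ ≤ ‖w‖ := fun w => by
    refine ((shift (-y)).le_opNorm w).trans (mul_le_of_le_one_left (norm_nonneg _) ?_)
    exact LinearMap.mkContinuous_norm_le _ zero_le_one _
  have hb : ∀ k, ‖shift (-y) (u k)‖ * ‖shift (-y) (v k)‖ ≤ ‖u k‖ * ‖v k‖ := fun k =>
    mul_le_mul (hn _) (hn _) (norm_nonneg _) (norm_nonneg _)
  have hs := Summable.of_nonneg_of_le (fun k => by positivity) hb hu.summable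
  refine NuclearLE.isTraceClass (c := (traceNorm ρ).toReal)
    ⟨_, fun k => shift (-y) (u k), fun k => shift (-y) (v k), hs,
      (hs.tsum_le_tsum hb hu.summable).trans hu.tsum_le, fun i j => ?_⟩
  rw [kern_transl]
  refine (hu.hasSum (i + y) (j + y)).congr_fun fun k => ?_
  rw [shift_apply, shift_apply, sub_neg_eq_add, sub_neg_eq_add]

/-- Translation invariance of the limiting dynamics. -/
theorem transl_infDyn (hd : 1 ≤ d) (hβ : 0 < β) (hε : AnalyticDispersion ε)
    (hφ : ReservoirAssumption β φ) (ht : 0 ≤ t) (h : IsTraceClass ρ)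
    (y : ZLat d) :
    transl (-y) (infDyn β lam χ ε φ t (transl y ρ)) = infDyn β lam χ ε φ t ρ := by
  obtain ⟨C, ν, hν, hC, P, hP, hPt⟩ := exists_propagator lam χ ε hd hβ hε hφ ht
  have hk : ∀ {σ : Op (ZLat d)}, IsTraceClass σ → ∀ x x', kern (infDyn β lam χ ε φ t σ) x x' =
      ∑' p : ZLat d × ZLat d, kern σ p.1 p.2 * P x p.1 x' p.2 := fun hσ x x' =>
    tendsto_nhds_unique (tendsto_kern (tendsto_finDyn lam χ ε hd hβ hε hφ ht hσ) x x')
      (tendsto_kern_finDyn lam χ ε hβ hφ hν hC hP hσ x x')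
  refine op_ext fun x x' => ?_
  rw [kern_transl, hk (h.transl y), hk h]
  rw [← ((Equiv.addRight y).prodCongr (Equiv.addRight y)).tsum_eq
    fun p : ZLat d × ZLat d => kern ρ p.1 p.2 * P x p.1 x' p.2]
  refine tsum_congr fun p => ?_
  rw [kern_transl, ← hPt y (x + -y), neg_add_cancel_right, neg_add_cancel_right]
  rfl

/-- Convergence for the normalized restrictions of a density matrix. -/
theorem tendsto_traceNorm_finDensity (hd : 1 ≤ d) (hβ : 0 < β) (hε : AnalyticDispersion ε)
    (hφ : ReservoirAssumption β φ) (ht : 0 ≤ t)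
    (hρ : IsDensityMatrix ρ) : Tendsto (fun N : ℕ => traceNorm
    (embedBox (reducedDynamics β lam χ ε φ N t (finDensity N ρ)) - infDyn β lam χ ε φ t ρ)) atTop
    (𝓝 0) := by
  have h := hρ.traceClass
  set c : ℕ → ℂ := fun N => (restrictBox N ρ).trace⁻¹ with hc
  have hc1 : Tendsto c atTop (𝓝 1) := by
    have h1 := h.tendsto_sum_box.inv₀ (by rw [hρ.trace_one]; exact one_ne_zero)
    rw [hρ.trace_one, inv_one] at h1
    refine h1.congr fun N => ?_
    change (∑ y ∈ box d N, kern ρ y y)⁻¹ = (∑ y : Site d N, kern ρ y.1 y.1)⁻¹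
    rw [Finset.sum_coe_sort (box d N) fun y => kern ρ y y]
  have hZ := isTraceClass_infDyn lam χ ε hd hβ hε hφ ht h
  have h2 : Tendsto (fun N => ENNReal.ofReal (‖c N - 1‖ * (traceNorm ρ).toReal) +
      traceNorm (finDyn β lam χ ε φ t N ρ - infDyn β lam χ ε φ t ρ)) atTop (𝓝 0) := by
    have h3 : Tendsto (fun N => ‖c N - 1‖ * (traceNorm ρ).toReal) atTop (𝓝 0) := by
      have := (hc1.sub_const 1).norm.mul_const (traceNorm ρ).toReal
      simpa using this
    have h4 := (ENNReal.tendsto_ofReal h3).add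
      (tendsto_traceNorm_finDyn lam χ ε hd hβ hε hφ ht h)
    simpa using h4
  refine tendsto_of_tendsto_of_tendsto_of_le_of_le' tendsto_const_nhds h2
    (Eventually.of_forall fun _ => zero_le) ?_
  filter_upwards [eventually_gt_atTop 0] with N hN
  have hN' := hφ.finForm_l2 N hN
  have hf := h.nuclearLE.finDyn lam χ ε hβ hN hN' t
  have e1 : embedBox (reducedDynamics β lam χ ε φ N t (finDensity N ρ)) =
      c N • finDyn β lam χ ε φ t N ρ := by
    have e2 : finDensity N ρ = restrictBox N (c N • ρ + (0 : ℂ) • ρ) := by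
      funext x y
      change c N * kern ρ x.1 y.1 = kern (c N • ρ + (0 : ℂ) • ρ) x.1 y.1
      rw [kern_add, kern_smul, kern_smul, zero_mul, add_zero]
    rw [e2]
    refine (finDyn_add_smul lam χ ε hβ hN hN' h h (c N) 0).trans ?_
    rw [zero_smul, add_zero]
  have e3 : embedBox (reducedDynamics β lam χ ε φ N t (finDensity N ρ)) - infDyn β lam χ ε φ t ρ =
      (c N - 1) • finDyn β lam χ ε φ t N ρ +
        (finDyn β lam χ ε φ t N ρ - infDyn β lam χ ε φ t ρ) := by
    rw [e1, sub_smul, one_smul]; abel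
  rw [e3]
  refine (traceNorm_add_le (hf.smul _).isTraceClass (hf.sub hZ.nuclearLE).isTraceClass).trans ?_
  exact add_le_add_left ((hf.smul _).traceNorm_le) _

/-- Polynomials grow slower than exponentials. -/
theorem exists_norm_eval_le (f : MvPolynomial (Fin d) ℂ) {ν : ℝ} (hν : 0 < ν) :
    ∃ C, ∀ x : ZLat d, ‖MvPolynomial.eval (fun i => ((x i : ℤ) : ℂ)) f‖ ≤
      C * Real.exp (ν * latNorm x) := by
  induction f using MvPolynomial.induction_on generalizing ν with
  | C a =>
    refine ⟨‖a‖, fun x => ?_⟩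
    rw [MvPolynomial.eval_C]
    exact le_mul_of_one_le_right (norm_nonneg _)
      (Real.one_le_exp (mul_nonneg hν.le (latNorm_nonneg x)))
  | add p q hp hq =>
    obtain ⟨C, hC⟩ := hp hν
    obtain ⟨D, hD⟩ := hq hν
    refine ⟨C + D, fun x => ?_⟩
    rw [map_add, add_mul]
    exact (norm_add_le _ _).trans (add_le_add (hC x) (hD x))
  | mul_X p i hp =>
    obtain ⟨C, hC⟩ := hp (half_pos hν)
    refine ⟨C * (2 / ν), fun x => ?_⟩
    rw [map_mul, MvPolynomial.eval_X, norm_mul]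
    have h1 : ‖((x i : ℤ) : ℂ)‖ ≤ 2 / ν * Real.exp (ν / 2 * latNorm x) := by
      have h2 := abs_le_latNorm x i
      have h3 := (le_add_of_nonneg_right zero_le_one).trans (Real.add_one_le_exp (ν / 2 * latNorm x))
      have h4 : ‖((x i : ℤ) : ℂ)‖ = |(x i : ℝ)| := by
        rw [Complex.norm_intCast]
      rw [h4]
      have h5 : latNorm x = 2 / ν * (ν / 2 * latNorm x) := by field_simp
      exact h2.trans (h5.le.trans (mul_le_mul_of_nonneg_left h3 (by positivity)))
    refine (mul_le_mul (hC x) h1 (norm_nonneg _) ((norm_nonneg _).trans (hC x))).trans (le_of_eq ?_)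
    have h6 : Real.exp (ν * latNorm x) =
        Real.exp (ν / 2 * latNorm x) * Real.exp (ν / 2 * latNorm x) := by
      rw [← Real.exp_add]; congr 1; ring
    rw [h6]; ring

theorem ExpLocalized.exists_eval_mul {A : Op (ZLat d)} (hA : ExpLocalized A)
    (f : MvPolynomial (Fin d) ℂ) : ∃ B : Op (ZLat d), IsTraceClass B ∧
      ∀ v x, (B v) x = MvPolynomial.eval (fun i => ((x i : ℤ) : ℂ)) f * (A v x) := by
  obtain ⟨K, ν, hν, hK⟩ := hA
  obtain ⟨C, hC⟩ := exists_norm_eval_le f (half_pos hν)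
  have hs : Summable fun p : ZLat d × ZLat d =>
      ‖MvPolynomial.eval (fun i => ((p.1 i : ℤ) : ℂ)) f * kern A p.1 p.2‖ := by
    refine Summable.of_nonneg_of_le (fun _ => norm_nonneg _) (fun p => ?_)
      (((summable_exp_latNorm d (half_pos hν)).mul_of_nonneg (summable_exp_latNorm d hν)
        (fun _ => (Real.exp_pos _).le) fun _ => (Real.exp_pos _).le).mul_left (C * K))
    rw [norm_mul]
    refine (mul_le_mul (hC p.1) (hK p.1 p.2) (norm_nonneg _)
      ((norm_nonneg _).trans (hC p.1))).trans (le_of_eq ?_)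
    have h1 : Real.exp (-ν * (latNorm p.1 + latNorm p.2)) = Real.exp (-(ν / 2) * latNorm p.1) *
        Real.exp (-(ν / 2) * latNorm p.1) * Real.exp (-ν * latNorm p.2) := by
      rw [← Real.exp_add, ← Real.exp_add]; congr 1; ring
    have h2 : Real.exp (ν / 2 * latNorm p.1) * Real.exp (-(ν / 2) * latNorm p.1) = 1 := by
      rw [← Real.exp_add, neg_mul, add_neg_cancel, Real.exp_zero]
    rw [h1]
    linear_combination (C * K * Real.exp (-(ν / 2) * latNorm p.1) * Real.exp (-ν * latNorm p.2)) * h2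
  obtain ⟨B, hB, hn⟩ := exists_op_of_summable (a := fun x x' : ZLat d =>
    MvPolynomial.eval (fun i => ((x i : ℤ) : ℂ)) f * kern A x x') hs
  refine ⟨B, hn.isTraceClass, fun v x => ?_⟩
  refine (hasSum_kern_apply B v x).unique (((hasSum_kern_apply A v x).mul_left _).congr_fun
    fun y => ?_)
  rw [hB]
  ring

end LimitProperties

end

theorem lemma3p1 (d : ℕ) (hd : 1 ≤ d) (β : ℝ) (hβ : 0 < β) (lam : ℝ) (χ : Fin d → ℝ)
    (ε : (Fin d → ℝ) → ℝ) (hε : AnalyticDispersion ε)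
    (φ : EuclideanSpace ℝ (Fin d) → ℂ) (hφ : ReservoirAssumption β φ) :
    -- in every finite volume the Hamiltonian generates a unique unitary group
    (∀ N : ℕ, 0 < N → ∃! U, IsEvolution (hamiltonian lam χ ε φ N) U) ∧
    ∀ t : ℝ, 0 ≤ t → ∃ Z : Op (ZLat d) → Op (ZLat d),
      -- `Z` is a linear map of the trace class into itself
      (∀ ρ, IsTraceClass ρ → IsTraceClass (Z ρ)) ∧
      (∀ ρ σ, IsTraceClass ρ → IsTraceClass σ → ∀ a b : ℂ,
        Z (a • ρ + b • σ) = a • Z ρ + b • Z σ) ∧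
      -- it is the thermodynamic limit, in trace norm, of the reduced dynamics
      (∀ ρ, IsDensityMatrix ρ → Tendsto (fun N : ℕ => traceNorm
        (embedBox (reducedDynamics β lam χ ε φ N t (finDensity N ρ)) - Z ρ)) atTop (𝓝 0)) ∧
      (∀ ρ, IsTraceClass ρ → Tendsto (fun N : ℕ => traceNorm
        (embedBox (reducedDynamics β lam χ ε φ N t (restrictBox N ρ)) - Z ρ)) atTop (𝓝 0)) ∧
      -- it preserves the trace, positivity and exponential localization
      (∀ ρ, IsTraceClass ρ → opTrace (Z ρ) = opTrace ρ) ∧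
      (∀ ρ, IsTraceClass ρ → ρ.IsPositive → (Z ρ).IsPositive) ∧
      (∀ ρ, IsTraceClass ρ → ExpLocalized ρ → ExpLocalized (Z ρ)) ∧
      -- it is translation-invariant
      (∀ y : ZLat d, ∀ ρ, IsTraceClass ρ → transl (-y) (Z (transl y ρ)) = Z ρ) ∧
      -- `Tr[O Z ρ]` is well-defined for `O` in `𝔄` or a polynomial in the position operators
      (∀ ρ, IsTraceClass ρ → ExpLocalized ρ →
        (∀ O ∈ quasiDiagonalClosure d, IsTraceClass (O * Z ρ)) ∧
        (∀ f : MvPolynomial (Fin d) ℂ, ∃ B : Op (ZLat d), IsTraceClass B ∧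
          ∀ v x, (B v) x = MvPolynomial.eval (fun i => ((x i : ℤ) : ℂ)) f * (Z ρ v) x)) := by
  refine ⟨fun N hN => existsUnique_evolution lam χ ε (hφ.finForm_l2 N hN), fun t ht =>
    ⟨infDyn β lam χ ε φ t, fun ρ h => isTraceClass_infDyn lam χ ε hd hβ hε hφ ht h,
    fun ρ σ h h' a b => infDyn_add_smul lam χ ε hd hβ hε hφ ht h h' a b,
    fun ρ h => tendsto_traceNorm_finDensity lam χ ε hd hβ hε hφ ht h,
    fun ρ h => tendsto_traceNorm_finDyn lam χ ε hd hβ hε hφ ht h,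
    fun ρ h => opTrace_infDyn lam χ ε hd hβ hε hφ ht h,
    fun ρ h hp => isPositive_infDyn lam χ ε hd hβ hε hφ ht h hp,
    fun ρ h hl => expLocalized_infDyn lam χ ε hd hβ hε hφ ht h hl,
    fun y ρ h => transl_infDyn lam χ ε hd hβ hε hφ ht h y,
    fun ρ h hl => ⟨fun O _ => ?_, fun f => ?_⟩⟩⟩
  · exact ((isTraceClass_infDyn lam χ ε hd hβ hε hφ ht h).nuclearLE.mul_left O).isTraceClass
  · exact (expLocalized_infDyn lam χ ε hd hβ hε hφ ht h hl).exists_eval_mul f
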